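/- **Setting.** Fix a bond dimension $D$ and finitely many site types $t$; each has a degree $\deg(t)$, a code dimension $d_t$ and a projection map $\mathcal P_t:(\mathbb C^D)^{\otimes\deg(t)}\to\mathbb C^{d_t}$ (one type is the translation-invariant case). The maps are isometric: $\mathcal P_t\mathcal P_t^\dagger=1$. A PEPS built from these tensors is given by a finite multigraph $\Lambda$ whose sites $s$ carry types, the ends of the edges being identified with the legs (virtual qudits) of the sites. Put $\mathcal P_\Lambda=\bigotimes_s\mathcal P_s$, $P_s=\mathcal P_s^\dagger\mathcal P_s$, $P_R=\prod_{s\in R}P_s$, $P_0=P_\Lambda$, let $M_e$ be the orthogonal projection onto $|\Phi_D(e)\rangle=\sum_k|k\rangle|k\rangle$ on the two virtual qudits of $e$, and let $|\psi\rangle_c=\mathcal P_\Lambda\prod_e|\Phi_D(e)\rangle$ and $|\psi\rangle_v=\mathcal P_\Lambda^\dagger|\psi\rangle_c$ be the PEPS and the encoded PEPS; assume $|\psi\rangle_c\neq0$. *Quasi-injective*: for every finite sequence of regions $(R_{P_i},R_{E_i})_i$ (sets of sites, sets of edges) with union $U$, the vector $|\psi\rangle_v$ is an eigenvector of $\Upsilon=\tfrac12P_U\big(\prod_iP_{R_{P_i}}\prod_{e\in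 R_{E_i}}M_e\big)P_U+\mathrm{h.c.}$ for the largest eigenvalue of $\Upsilon$. *Gapped canonical parent Hamiltonian of range $r$ and gap $\gamma$*: $H_{\rm can}=-\sum_{R\in\mathcal R}\varpi_R$ on the code space, where $\varpi_R$ is the projection onto the support of the reduced state of $|\psi\rangle_c$ on $R$ and $\mathcal R$ is a set of connected sets of sites such that (i) each $R\in\mathcal R$ contains at most $r$ edges; (ii) for $R\in\mathcal R$, $\mathcal P_\Lambda\big(\prod_{e\in R}M_e\big)\mathcal P_\Lambda^\dagger=\kappa_R\,\varpi_R$ with some $\kappa_R>0$; (iii) $\mathcal R$ is large enough to fix the ground space: every ground state $\varphi$ of $H_{\rm can}$ satisfies $\varpi_{R'}\varphi=\varphi$ for all connected $R'$ with at most $r+1$ sites; (iv) the lowest eigenvalue of $H_{\rm can}$ is separated from its other eigenvalues by at least $\gamma$. *Effective Hamiltonian.* For the model $H=H_0+\varepsilon V$, $H_0=\sum_sQ_s$, $Q_s=1-P_s$, $V=-\sum_eM_e$, on the virtual qudits, put $Q_0=1-P_0$, $V_{\rm d}=P_0VP_0+Q_0VQ_0$, $V_{\rm od}=V-V_{\rm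 d}$, $\mathcal L(X)=\frac{Q_0}{H_0}XP_0-P_0X\frac{Q_0}{H_0}$, $W^{(k)}_m=\sum_{j_1,\dots,j_m\ge1,\ \sum j_i=k}[S_{j_1},[\cdots,[S_{j_m},V_{\rm od}]\cdots]]$, $S_1=\mathcal L(V)$, and, for $j>1$, $S_j=\mathcal L([S_{j-1},V_{\rm d}])+\sum_{i=1}^{\lfloor(j-1)/2\rfloor}\frac{2^{2i}B_{2i}}{(2i)!}\mathcal L(W^{(j-1)}_{2i})$, where $B_i$ are the Bernoulli numbers. The global Schrieffer–Wolff effective Hamiltonian of order $n$ is $H_{\rm eff}^{\langle n\rangle}=P_0H_0P_0+\sum_{j=1}^n\varepsilon^jP_0V^{(j-1)}P_0$ with $V^{(0)}=V$ and $V^{(j-1)}=\sum_{i=1}^{\lfloor j/2\rfloor}\frac{2(2^{2i}-1)B_{2i}}{(2i)!}W^{(j-1)}_{2i-1}$ for $j>1$. **Theorem.** Given isometric tensors as above, $r\ge1$ and $\gamma>0$, there are $n_*,\ell\in\mathbb N$ and $c,\varepsilon_0>0$ such that for every quasi-injective PEPS built from these tensors (on a finite multigraph of any size) that has a gapped canonical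 parent Hamiltonian $H_{\rm can}$ of range $r$ and gap $\gamma$, and for every $0<\varepsilon<\varepsilon_0$, the Hermitian operator $H_{\rm eff}^{\langle n_*\rangle}$ is a frustration-free parent Hamiltonian for the encoded PEPS, with gap of order at least $\varepsilon^{n_*}$. That is: 1. $|\psi\rangle_v$ is a ground state of $H_{\rm eff}^{\langle n_*\rangle}$, and the ground states of $H_{\rm eff}^{\langle n_*\rangle}$ are exactly the vectors $\mathcal P_\Lambda^\dagger\varphi$ with $\varphi$ a ground state of $H_{\rm can}$; 2. $H_{\rm eff}^{\langle n_*\rangle}=\mathcal P_\Lambda^\dagger\big(\sum_Xh_X\big)\mathcal P_\Lambda$ with Hermitian operators $h_X$ on the code space, each nonzero one supported on a connected set $X$ of at most $\ell$ sites, such that for every ground state $x$ of $H_{\rm eff}^{\langle n_*\rangle}$ and every $X$ the vector $\mathcal P_\Lambda x$ is a ground state of $h_X$; 3. the lowest eigenvalue of $H_{\rm eff}^{\langle n_*\rangle}$ is separated from its other eigenvalues by at least $c\,\varepsilon^{n_*}$. -/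

import Mathlib

/-! ### Spectra of finite-dimensional Hamiltonians -/

/-- The real eigenvalues of a complex matrix (all of its eigenvalues, if it is Hermitian). -/
def realEigenvalues {n : Type} [Fintype n] (A : Matrix n n ℂ) : Set ℝ :=
  {μ | ∃ x : n → ℂ, x ≠ 0 ∧ A.mulVec x = (μ : ℂ) • x}

/-- `x` is a ground state of `A`: an eigenvector for the least eigenvalue. -/
def IsGroundState {n : Type} [Fintype n] (A : Matrix n n ℂ) (x : n → ℂ) : Prop :=
  x ≠ 0 ∧ ∃ E : ℝ, IsLeast (realEigenvalues A) E ∧ A.mulVec x = (E : ℂ) • x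

/-- The least eigenvalue of `A` is separated from all other eigenvalues by at least `Δ`. -/
def HasGap {n : Type} [Fintype n] (A : Matrix n n ℂ) (Δ : ℝ) : Prop :=
  ∃ E : ℝ, IsLeast (realEigenvalues A) E ∧ ∀ μ ∈ realEigenvalues A, μ ≠ E → E + Δ ≤ μ

/-- The orthogonal projection onto the range (the support, for a positive matrix) of `A`. -/
noncomputable def supportProj {n : Type} [Fintype n] [DecidableEq n] (A : Matrix n n ℂ) :
    Matrix n n ℂ :=
  (Matrix.toEuclideanCLM (n := n) (𝕜 := ℂ)).symm
    (LinearMap.range (Matrix.toEuclideanCLM (n := n) (𝕜 := ℂ) A).toLinearMap).starProjection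

/-! ### Composite systems: site `s` carries the Hilbert space with orthonormal basis `ι s` -/

/-- `B ⊗ 1`: the operator on the whole system that acts as `B` on the sites of `R`. -/
def extendOp {S : Type} [Fintype S] [DecidableEq S] {ι : S → Type} [∀ s, DecidableEq (ι s)]
    (R : Finset S) (B : Matrix (∀ s : R, ι s) (∀ s : R, ι s) ℂ) :
    Matrix (∀ s, ι s) (∀ s, ι s) ℂ :=
  fun x y => if ∀ s, s ∉ R → x s = y s then B (fun s => x s) (fun s => y s) else 0

/-- The operator `A` is supported on the set of sites `R`. -/
def SupportedOn {S : Type} [Fintype S] [DecidableEq S] {ι : S → Type} [∀ s, DecidableEq (ι s)]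
    (A : Matrix (∀ s, ι s) (∀ s, ι s) ℂ) (R : Finset S) : Prop :=
  ∃ B, A = extendOp R B

/-- The reduced operator `Tr_{∖R} |ψ⟩⟨ψ|` on the sites of `R`. -/
def reducedState {S : Type} [Fintype S] [DecidableEq S] {ι : S → Type}
    [∀ s, Fintype (ι s)] [∀ s, DecidableEq (ι s)] (ψ : (∀ s, ι s) → ℂ) (R : Finset S) :
    Matrix (∀ s : R, ι s) (∀ s : R, ι s) ℂ :=
  fun a b => ∑ x : ∀ s, ι s, ∑ y : ∀ s, ι s,
    if (∀ s : R, x s = a s) ∧ (∀ s : R, y s = b s) ∧ (∀ s, s ∉ R → x s = y s)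
    then ψ x * star (ψ y) else 0

/-! ### The global Schrieffer–Wolff expansion

`P` is the projection onto the unperturbed ground space, `G = Q/H₀` the reduced resolvent
(`Q = 1 - P`, and `G` vanishes on the range of `P`), and `V` the perturbation. -/

namespace SchriefferWolff

variable {n : Type} [Fintype n] [DecidableEq n]

/-- `𝓛(X) = (Q/H₀) X P - P X (Q/H₀)`. -/
def L (P G X : Matrix n n ℂ) : Matrix n n ℂ := G * X * P - P * X * G

/-- The block-diagonal part. -/
def diagPart (P X : Matrix n n ℂ) : Matrix n n ℂ := P * X * P + (1 - P) * X * (1 - P)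

/-- The block-off-diagonal part. -/
def offDiagPart (P X : Matrix n n ℂ) : Matrix n n ℂ := P * X * (1 - P) + (1 - P) * X * P

/-- `[S_{j₁}, [S_{j₂}, [⋯, [S_{jₘ}, X] ⋯ ]]]` for the list `j₁, …, jₘ`. -/
def nestedComm (S : ℕ → Matrix n n ℂ) (X : Matrix n n ℂ) : List ℕ → Matrix n n ℂ
  | [] => X
  | j :: l => S j * nestedComm S X l - nestedComm S X l * S j

/-- `W^{(k)}_m`: the sum of the `m`-fold nested commutators of `S_{j₁}, …, S_{jₘ}` with `V_od`
over all `j₁, …, jₘ ≥ 1` with `j₁ + ⋯ + jₘ = k`. -/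
def W (P V : Matrix n n ℂ) (S : ℕ → Matrix n n ℂ) (k m : ℕ) : Matrix n n ℂ :=
  ∑ j ∈ (Finset.Nat.antidiagonalTuple m k).filter (fun j => ∀ i, 1 ≤ j i),
    nestedComm S (offDiagPart P V) (List.ofFn j)

/-- `a_i = 2^i B_i / i!`. -/
def a (i : ℕ) : ℚ := 2 ^ i * bernoulli i / (i.factorial : ℚ)

/-- `b_{2i-1} = 2 (2^{2i} - 1) B_{2i} / (2i)!`, as a function of `i`. -/
def b (i : ℕ) : ℚ := 2 * (2 ^ (2 * i) - 1) * bernoulli (2 * i) / ((2 * i).factorial : ℚ)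

/-- The right-hand side of the recursion for `S_j`, in terms of the earlier coefficients. -/
def genStep (P G V : Matrix n n ℂ) (S : ℕ → Matrix n n ℂ) (j : ℕ) : Matrix n n ℂ :=
  if j = 1 then L P G V
  else L P G (S (j - 1) * diagPart P V - diagPart P V * S (j - 1))
    + ∑ i ∈ Finset.Icc 1 ((j - 1) / 2), (a (2 * i) : ℂ) • L P G (W P V S (j - 1) (2 * i))

/-- The sequence of the coefficients `S_1, …, S_k` (and zero at all other places). -/
def genUpTo (P G V : Matrix n n ℂ) : ℕ → ℕ → Matrix n n ℂ
  | 0 => fun _ => 0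
  | k + 1 => Function.update (genUpTo P G V k) (k + 1) (genStep P G V (genUpTo P G V k) (k + 1))

/-- The coefficient `S_j` of the generator `S = ∑_{j ≥ 1} ε^j S_j`. -/
def gen (P G V : Matrix n n ℂ) (j : ℕ) : Matrix n n ℂ := genUpTo P G V j j

/-- The coefficient `V^{(j-1)}` of order `j ≥ 1`. -/
def Vcoeff (P G V : Matrix n n ℂ) (j : ℕ) : Matrix n n ℂ :=
  if j = 1 then V
  else ∑ i ∈ Finset.Icc 1 (j / 2), (b i : ℂ) • W P V (gen P G V) (j - 1) (2 * i - 1)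

/-- The effective Hamiltonian `P H₀ P + ∑_{j=1}^{m} ε^j P V^{(j-1)} P` of order `m`. -/
def effectiveHamiltonian (H₀ P G V : Matrix n n ℂ) (ε : ℝ) (m : ℕ) : Matrix n n ℂ :=
  P * H₀ * P + ∑ j ∈ Finset.Icc 1 m, ((ε : ℂ) ^ j) • (P * Vcoeff P G V j * P)

end SchriefferWolff

/-! ### Projected entangled pair states -/

/-- The local data of a PEPS: the bond dimension `D`, finitely many types of sites, and for each
type its degree, the dimension of its code qudit, and its projection map. One type is the
translation-invariant case. -/
structure SiteTensors where
  D : ℕ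
  T : Type
  fintypeT : Fintype T
  deg : T → ℕ
  d : T → ℕ
  map : ∀ t, Matrix (Fin (d t)) (Fin (deg t) → Fin D) ℂ

/-- The projection maps are isometries, in the sense that each adjoint embeds the code qudit
isometrically into the virtual qudits. -/
def SiteTensors.IsIsometric (𝒯 : SiteTensors) : Prop :=
  ∀ t, 𝒯.map t * (𝒯.map t).conjTranspose = 1

/-- A finite PEPS built from the given tensors: a finite (multi)graph with site set `S` and edge
set `E`. The two ends `(e, false)`, `(e, true)` of the edges are identified with the virtual
qudits, which are the pairs of a site and one of its legs. -/
structure PEPS (𝒯 : SiteTensors) where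
  S : Type
  E : Type
  fintypeS : Fintype S
  fintypeE : Fintype E
  decEqS : DecidableEq S
  decEqE : DecidableEq E
  type : S → 𝒯.T
  ends : E × Bool ≃ Σ s : S, Fin (𝒯.deg (type s))

attribute [instance] PEPS.fintypeS PEPS.fintypeE PEPS.decEqS PEPS.decEqE

namespace PEPS

variable {𝒯 : SiteTensors} (Λ : PEPS 𝒯)

/-- Basis labels of the virtual qudits at a site. -/
abbrev SiteCfg (s : Λ.S) : Type := Fin (𝒯.deg (Λ.type s)) → Fin 𝒯.D

/-- Basis labels of the virtual Hilbert space. -/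
abbrev VirtCfg : Type := ∀ s, Λ.SiteCfg s

/-- Basis labels of the code qudit at a site. -/
abbrev CodeSite (s : Λ.S) : Type := Fin (𝒯.d (Λ.type s))

/-- Basis labels of the code Hilbert space. -/
abbrev CodeCfg : Type := ∀ s, Λ.CodeSite s

/-- The label of the virtual qudit at one end of an edge. -/
def endVal (x : Λ.VirtCfg) (e : Λ.E) (i : Bool) : Fin 𝒯.D := x (Λ.ends (e, i)).1 (Λ.ends (e, i)).2

/-- The site at one end of an edge. -/
def endSite (e : Λ.E) (i : Bool) : Λ.S := (Λ.ends (e, i)).1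

/-- `∏_e |Φ_D(e)⟩` with `|Φ_D(e)⟩ = ∑_k |k⟩|k⟩`. -/
def bondState : Λ.VirtCfg → ℂ :=
  fun x => ∏ e, if Λ.endVal x e false = Λ.endVal x e true then 1 else 0

/-- `𝒫_Λ = ∏_s 𝒫_s`, from the virtual space to the code space. -/
def codeMap : Matrix Λ.CodeCfg Λ.VirtCfg ℂ := fun c x => ∏ s, 𝒯.map (Λ.type s) (c s) (x s)

/-- The PEPS on the code qudits. -/
def codeState : Λ.CodeCfg → ℂ := Λ.codeMap.mulVec Λ.bondState

/-- The one-site operator `𝒫_s† 𝒫_s` on the virtual qudits of the site `s`. -/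
def localProj (s : Λ.S) : Matrix (Λ.SiteCfg s) (Λ.SiteCfg s) ℂ :=
  (𝒯.map (Λ.type s)).conjTranspose * 𝒯.map (Λ.type s)

/-- The tensor product of one-site operators. -/
def tensorOp (A : ∀ s, Matrix (Λ.SiteCfg s) (Λ.SiteCfg s) ℂ) : Matrix Λ.VirtCfg Λ.VirtCfg ℂ :=
  fun x y => ∏ s, A s (x s) (y s)

/-- `P_R = ∏_{s ∈ R} 𝒫_s† 𝒫_s`. -/
def siteProj (R : Finset Λ.S) : Matrix Λ.VirtCfg Λ.VirtCfg ℂ :=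
  Λ.tensorOp (fun s => if s ∈ R then Λ.localProj s else 1)

/-- The projection onto the unperturbed ground space, `P_0 = ∏_s P_s`. -/
def P₀ : Matrix Λ.VirtCfg Λ.VirtCfg ℂ := Λ.siteProj Finset.univ

/-- The encoded PEPS, on the virtual qudits. -/
def virtState : Λ.VirtCfg → ℂ := Λ.P₀.mulVec Λ.bondState

/-- `∏_{e ∈ F} M_e`, with `M_e` the orthogonal projection onto the line of `|Φ_D(e)⟩`. -/
noncomputable def bondProj (F : Finset Λ.E) : Matrix Λ.VirtCfg Λ.VirtCfg ℂ := fun x y =>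
  (∏ e ∈ F, if Λ.endVal x e false = Λ.endVal x e true ∧ Λ.endVal y e false = Λ.endVal y e true
    then (𝒯.D : ℂ)⁻¹ else 0) *
  ∏ e ∈ Fᶜ, if Λ.endVal x e false = Λ.endVal y e false ∧ Λ.endVal x e true = Λ.endVal y e true
    then 1 else 0

/-! #### Regions -/

/-- The simple graph of adjacency of distinct sites. -/
def siteGraph : SimpleGraph Λ.S where
  Adj s t := s ≠ t ∧ ∃ e i, Λ.endSite e i = s ∧ Λ.endSite e (!i) = t
  symm := ⟨by
    rintro s t ⟨hst, e, i, h₁, h₂⟩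
    exact ⟨hst.symm, e, !i, h₂, by simpa using h₁⟩⟩
  loopless := ⟨fun _ h => h.1 rfl⟩

/-- A (nonempty) connected set of sites. -/
def IsConnectedRegion (R : Finset Λ.S) : Prop := (Λ.siteGraph.induce (R : Set Λ.S)).Connected

/-- The edges with both ends in the region. -/
def edgesIn (R : Finset Λ.S) : Finset Λ.E :=
  Finset.univ.filter (fun e => ∀ i, Λ.endSite e i ∈ R)

/-- The sites at the ends of a set of edges. -/
def sitesOf (F : Finset Λ.E) : Finset Λ.S :=
  F.biUnion (fun e => {Λ.endSite e false, Λ.endSite e true})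

/-! #### Quasi-injectivity -/

/-- The union of the regions in a list of pairs `(R_{P_i}, R_{E_i})`. -/
def wordSites (w : List (Finset Λ.S × Finset Λ.E)) : Finset Λ.S :=
  w.foldr (fun p U => p.1 ∪ Λ.sitesOf p.2 ∪ U) ∅

/-- `½ P_U (∏_i P_{R_{P_i}} ∏_{e ∈ R_{E_i}} M_e) P_U + h.c.`, with `U` the union of all the regions.
Single sites, single edges and the empty set are connected regions, and `P_R` and `∏_{e ∈ R} M_e`
are products of such factors; so the operators are the same whether or not the regions are
required to be connected. -/
noncomputable def Upsilon (w : List (Finset Λ.S × Finset Λ.E)) : Matrix Λ.VirtCfg Λ.VirtCfg ℂ :=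
  let Y := Λ.siteProj (Λ.wordSites w) *
    (w.map (fun p => Λ.siteProj p.1 * Λ.bondProj p.2)).prod * Λ.siteProj (Λ.wordSites w)
  (1 / 2 : ℂ) • (Y + Y.conjTranspose)

/-- The PEPS is an eigenvector of every `Υ`, for the largest eigenvalue of that operator. -/
def IsQuasiInjective : Prop :=
  ∀ w : List (Finset Λ.S × Finset Λ.E), ∃ η : ℝ,
    IsGreatest (realEigenvalues (Λ.Upsilon w)) η ∧
    (Λ.Upsilon w).mulVec Λ.virtState = (η : ℂ) • Λ.virtState

/-! #### Canonical parent Hamiltonians -/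

/-- `ϖ_R ⊗ 1`, with `ϖ_R` the projection onto the support of the reduced state of the PEPS. -/
noncomputable def regionProj (R : Finset Λ.S) : Matrix Λ.CodeCfg Λ.CodeCfg ℂ :=
  extendOp R (supportProj (reducedState Λ.codeState R))

/-- `H_can = - ∑_R ϖ_R`. -/
noncomputable def canonicalHamiltonian (ℛ : Finset (Finset Λ.S)) : Matrix Λ.CodeCfg Λ.CodeCfg ℂ :=
  -∑ R ∈ ℛ, Λ.regionProj R

/-- The set of regions `ℛ` defines a canonical parent Hamiltonian of range `r` and gap `γ`. -/
structure IsGappedCanonical (ℛ : Finset (Finset Λ.S)) (r : ℕ) (γ : ℝ) : Prop where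
  connected : ∀ R ∈ ℛ, Λ.IsConnectedRegion R
  /-- The regions have bounded size. -/
  card_le : ∀ R ∈ ℛ, (Λ.edgesIn R).card ≤ r
  /-- `ϖ_R = 𝒫_R (∏_{e ∈ R} M_e) 𝒫_R†` up to normalization. -/
  form : ∀ R ∈ ℛ, ∃ κ : ℝ, 0 < κ ∧
    Λ.codeMap * Λ.bondProj (Λ.edgesIn R) * Λ.codeMap.conjTranspose = (κ : ℂ) • Λ.regionProj R
  /-- The regions are large enough to fix the ground space: further regions of this size (a
  connected region with `r` bonds has at most `r + 1` sites) impose no further constraint. -/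
  saturated : ∀ φ, IsGroundState (Λ.canonicalHamiltonian ℛ) φ →
    ∀ R, Λ.IsConnectedRegion R → R.card ≤ r + 1 → (Λ.regionProj R).mulVec φ = φ
  gap : HasGap (Λ.canonicalHamiltonian ℛ) γ

/-! #### The two-body model `H = ∑_s Q_s - ε ∑_e M_e` -/

/-- `H₀ = ∑_s Q_s`, with `Q_s = 1 - P_s`. -/
def H₀ : Matrix Λ.VirtCfg Λ.VirtCfg ℂ := ∑ s, (1 - Λ.siteProj {s})

/-- `V = - ∑_e M_e`. -/
noncomputable def V : Matrix Λ.VirtCfg Λ.VirtCfg ℂ := -∑ e, Λ.bondProj {e}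

/-- `Q_0 / H₀`. The projection onto the states that are excited exactly at the sites of `A` is
`∏_{s ∈ A} Q_s ∏_{s ∉ A} P_s`, and `H₀` has the value `|A|` there; the term `A = ∅` vanishes since
`0⁻¹ = 0`. -/
noncomputable def resolvent : Matrix Λ.VirtCfg Λ.VirtCfg ℂ :=
  ∑ A : Finset Λ.S, ((A.card : ℂ)⁻¹) •
    Λ.tensorOp (fun s => if s ∈ A then 1 - Λ.localProj s else Λ.localProj s)

/-- The global Schrieffer–Wolff effective Hamiltonian of order `n` of the model. -/
noncomputable def Heff (ε : ℝ) (n : ℕ) : Matrix Λ.VirtCfg Λ.VirtCfg ℂ :=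
  SchriefferWolff.effectiveHamiltonian Λ.H₀ Λ.P₀ Λ.resolvent Λ.V ε n

/-- On the code space, `H` is a sum of terms on connected regions of at most `ℓ` sites, each of
which is minimized by every ground state of `H`. (`H = 𝒫† (∑_X h_X) 𝒫` also says that `H` vanishes
on the orthogonal complement of the code space.) -/
def IsLocalFrustrationFree (H : Matrix Λ.VirtCfg Λ.VirtCfg ℂ) (ℓ : ℕ) : Prop :=
  ∃ h : Finset Λ.S → Matrix Λ.CodeCfg Λ.CodeCfg ℂ,
    (∀ X, (h X).IsHermitian ∧ SupportedOn (h X) X) ∧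
    (∀ X, h X ≠ 0 → Λ.IsConnectedRegion X ∧ X.card ≤ ℓ) ∧
    H = Λ.codeMap.conjTranspose * (∑ X, h X) * Λ.codeMap ∧
    ∀ x, IsGroundState H x → ∀ X, IsGroundState (h X) (Λ.codeMap.mulVec x)

end PEPS

/-! The order r already works, with terms on at most r + 1 sites. Four facts carry the proof.

Locality. The coefficients of the Schrieffer–Wolff series are the upper block of a
block-diagonalization of H₀ + εV over formal power series (`IsGenerator.conj_eq`,
`isGenerator_genSeries`). That block depends only on the Hamiltonian (`IsBlockDiag.compress_eq`), so
it is additive over independent systems (`Vcoeff_add`). Restrict V to the edges of F and invert over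
subsets: the resulting coefficient of a cluster F vanishes unless F is connected with at most as
many edges as the order (`exists_clusters`), and it can be computed from the sites of F alone
(`Vcoeff_pert_local`). Hence all constants are independent of the size of the system.

Sign. Up to products x P y with x and y of positive degree in V, the compressed coefficient of order
j is (-1)^(j-1) P V (G V)^(j-1) P (`Vcoeff_lead`). On finitely many sites U, the reduced resolvent
is a combination with positive weights of P_B - P_U over proper subsets B of U
(`siteHam_mul_siteRes`), and the P_U again only produce passages through the code space. Since V =
-∑ M_e, every order contributes minus a nonnegative combination of words in the P_B and M_e, plus
terms through the code space (`exists_local_clusters`).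

Quasi-injectivity. Compress a word to the code space. Words are closed under products and adjoints,
and squaring an operator doubles the "angle" between its expectation value and its norm; as all the
expectation values are nonnegative, the angle is zero. So the encoded PEPS is an eigenvector of
every compressed word and of its adjoint, with the operator norm as eigenvalue
(`maximizes_of_maximizesRe`, `exists_maximizes`). Consequently the defect of a word x in φ,
mean(x)‖φ‖² - Re⟨φ, xφ⟩, is nonnegative, and the defect of x P₀ y is at most twice the sum of those
of x and y (`defect_mul_P₀_mul_le`). A term through the code space has factors of lower degree, so
that a power of ε is left over: its defect is at most O(ε) times the defects of the leading parts of
the subclusters (`mono_defect_le`, `thru_defect_le`). Each cluster has boundedly many connected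
superclusters, so these small multiples can be moved between clusters without changing the sum;
afterwards every local term is minimized by the PEPS, with at least half of the defect of its
leading part to spare (`exists_frustrationFree`).

Gap. For a region R of the canonical Hamiltonian, the product of its at most r bond projections is
itself a word in a leading part, at order at most r. Its defect is its mean times the energy of the
term 1 - ϖ_R, and the means are bounded below because they dominate positive matrix elements taken
from a finite list (`exists_pos_le_mean_bondProj`). Thus on the code space the effective Hamiltonian
minus its ground energy dominates a multiple of ε^r times the canonical one minus its ground energy
(`IsGappedCanonical.energy_le`). Conversely, each local term has the PEPS as an eigenvector, hence
is a scalar on the support of the reduced state, and saturation puts all canonical ground states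
there (`mulVec_of_regionProj`). Off the code space the effective Hamiltonian is zero, while the
energy of the PEPS is at most -const · ε times the number of edges (`sum_mean_leadSum_ge`); so the
complement causes no low-lying states. `parent_of_local_terms` combines these facts. -/

set_option linter.unusedSectionVars false

/-! ### Power series at nilpotent elements -/

namespace SchriefferWolff

section PowerSeriesEval

open PowerSeries

variable {B : Type*} [Ring B] [Algebra ℚ B]

/-- The value of a rational power series at a nilpotent element. -/
noncomputable def psEval (x : B) (f : ℚ⟦X⟧) : B :=
  ∑ i ∈ Finset.range (nilpotencyClass x), coeff i f • x ^ i

theorem psEval_eq_sum {x : B} {k : ℕ} (h : x ^ k = 0) (f : ℚ⟦X⟧) :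
    psEval x f = ∑ i ∈ Finset.range k, coeff i f • x ^ i := by
  have hle : nilpotencyClass x ≤ k := csInf_le' h
  rw [psEval, ← Finset.sum_range_add_sum_Ico _ hle, left_eq_add]
  refine Finset.sum_eq_zero fun i hi => ?_
  rw [pow_eq_zero_of_le (Finset.mem_Ico.1 hi).1 (pow_nilpotencyClass ⟨k, h⟩), smul_zero]

theorem psEval_eq_aeval {x : B} {k : ℕ} (h : x ^ k = 0) (f : ℚ⟦X⟧) :
    psEval x f = Polynomial.aeval x (trunc k f) := by
  rw [psEval_eq_sum h, Polynomial.aeval_def, eval₂_trunc_eq_sum_range]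
  exact Finset.sum_congr rfl fun i _ => Algebra.smul_def _ _

/-- The degree of `p` may exceed `k`; both sides agree with the sum up to the larger bound, since
the extra powers of `x` vanish. -/
theorem aeval_trunc {x : B} {k : ℕ} (h : x ^ k = 0) (p : Polynomial ℚ) :
    Polynomial.aeval x (trunc k (p : ℚ⟦X⟧)) = Polynomial.aeval x p := by
  rw [← psEval_eq_aeval h, psEval_eq_sum (pow_eq_zero_of_le (le_max_left k (p.natDegree + 1)) h),
    Polynomial.aeval_eq_sum_range' (lt_of_lt_of_le (Nat.lt_succ_self _)
      (le_max_right k (p.natDegree + 1)))]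
  simp

/-- The coefficients of a product below `k` depend only on the truncated factors, and evaluation of
polynomials is multiplicative. This lets identities between generating functions be applied to the
nilpotent operator `adj S`. -/
theorem psEval_mul {x : B} (hx : IsNilpotent x) (f g : ℚ⟦X⟧) :
    psEval x (f * g) = psEval x f * psEval x g := by
  obtain ⟨k, h⟩ := hx
  rw [psEval_eq_aeval h, psEval_eq_aeval h, psEval_eq_aeval h, ← trunc_trunc_mul_trunc,
    ← Polynomial.coe_mul, aeval_trunc h, map_mul]

theorem psEval_add (x : B) (f g : ℚ⟦X⟧) : psEval x (f + g) = psEval x f + psEval x g := by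
  simp [psEval, add_smul, Finset.sum_add_distrib]

theorem psEval_sub (x : B) (f g : ℚ⟦X⟧) : psEval x (f - g) = psEval x f - psEval x g := by
  simp [psEval, sub_smul, Finset.sum_sub_distrib]

theorem psEval_X {x : B} (hx : IsNilpotent x) : psEval x X = x := by
  obtain ⟨k, h⟩ := hx
  rw [psEval_eq_sum (pow_eq_zero_of_le (Nat.le_add_right k 2) h),
    Finset.sum_eq_single_of_mem 1 (by simp)]
  · simp
  · intro i _ hi
    simp [coeff_X, hi]

theorem psEval_one {x : B} (hx : IsNilpotent x) : psEval x 1 = 1 := by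
  obtain ⟨k, h⟩ := hx
  rw [psEval_eq_sum (pow_eq_zero_of_le (Nat.le_add_right k 2) h),
    Finset.sum_eq_single_of_mem 0 (by simp)]
  · simp
  · intro i _ hi
    simp [coeff_one, hi]

theorem psEval_exp {x : B} (hx : IsNilpotent x) : psEval x (exp ℚ) = IsNilpotent.exp x := by
  obtain ⟨k, h⟩ := hx
  rw [psEval_eq_sum h, IsNilpotent.exp_eq_sum h]
  simp [coeff_exp]

/-! ### The series `x coth x` and `tanh (x / 2)` -/

/-- `x coth x`. -/
noncomputable def cothSeries : ℚ⟦X⟧ := mk fun n => if Even n then a n else 0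

/-- `tanh (x / 2)`. -/
noncomputable def tanhSeries : ℚ⟦X⟧ := mk fun n => if Odd n then b ((n + 1) / 2) else 0

/-- `(exp x - 1) / x`. -/
noncomputable def expDivSeries : ℚ⟦X⟧ := mk fun n => ((n + 1).factorial : ℚ)⁻¹

theorem X_mul_expDivSeries : X * expDivSeries = exp ℚ - 1 := by
  ext n
  cases n with
  | zero => simp
  | succ n => simp [expDivSeries, coeff_succ_X_mul, coeff_exp, coeff_one]

/-- x coth x = 2x/(exp(2x) - 1) + x: the summand `X` removes the only odd coefficient of the
Bernoulli series, which comes from B₁ = -1/2. -/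
theorem cothSeries_eq : cothSeries = rescale 2 (bernoulliPowerSeries ℚ) + X := by
  ext n
  simp only [cothSeries, coeff_mk, map_add, coeff_rescale, bernoulliPowerSeries, coeff_X, a]
  rcases Nat.even_or_odd n with h | h
  · have : n ≠ 1 := by rintro rfl; simp at h
    simp [h, this]
    ring
  · rw [if_neg (Nat.not_even_iff_odd.2 h)]
    by_cases h1 : n = 1
    · subst h1; norm_num [bernoulli_one]
    · have : 1 < n := by rcases h with ⟨m, rfl⟩; omega
      simp [bernoulli_eq_zero_of_odd h this, h1]

/-- The half-angle formula tanh(x/2) = 2 coth x - coth(x/2), in which x coth(x/2) = x + 2x/(exp x -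
1). -/
theorem X_mul_tanhSeries :
    X * tanhSeries = 2 * cothSeries - 2 * bernoulliPowerSeries ℚ - X := by
  have two : (2 : ℚ⟦X⟧) = C (2 : ℚ) := (map_ofNat (C (R := ℚ)) 2).symm
  ext n
  rw [two]
  simp only [map_sub, coeff_C_mul, cothSeries, coeff_mk, bernoulliPowerSeries, coeff_X, a]
  cases n with
  | zero => simp [bernoulli_zero]
  | succ n =>
    rw [coeff_succ_X_mul, tanhSeries, coeff_mk]
    rcases Nat.even_or_odd (n + 1) with h | h
    · have h1 : Odd n := by rcases h with ⟨m, hm⟩; exact ⟨m - 1, by omega⟩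
      have h2 : 2 * ((n + 1) / 2) = n + 1 := Nat.two_mul_div_two_of_even h
      have h3 : n ≠ 0 := by rintro rfl; simp at h1
      simp only [h, h1, if_true, b, h2]
      simp [h3]
      ring
    · have h1 : ¬ Odd n := by rcases h with ⟨m, hm⟩; simp; exact ⟨m, by omega⟩
      rw [if_neg h1, if_neg (Nat.not_even_iff_odd.2 h)]
      by_cases h3 : n = 0
      · subst h3; norm_num [bernoulli_one]
      · simp [bernoulli_eq_zero_of_odd h (by omega), h3]

theorem cothSeries_mul : cothSeries * (exp ℚ ^ 2 - 1) = X * (exp ℚ ^ 2 + 1) := by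
  have h := congrArg (rescale (2 : ℚ)) (bernoulliPowerSeries_mul_exp_sub_one ℚ)
  have h2 : rescale (2 : ℚ) (exp ℚ) = exp ℚ ^ 2 := by
    have := exp_pow_eq_rescale_exp (A := ℚ) 2
    simpa using this.symm
  have h3 : rescale (2 : ℚ) (X : ℚ⟦X⟧) = 2 * X := by
    have two : (2 : ℚ⟦X⟧) = C (2 : ℚ) := (map_ofNat (C (R := ℚ)) 2).symm
    rw [rescale_X, two]
  rw [map_mul, map_sub, map_one, h2, h3] at h
  rw [cothSeries_eq, add_mul, h]
  ring

theorem exp_sub_one_ne_zero : (exp ℚ - 1 : ℚ⟦X⟧) ≠ 0 := by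
  intro h
  have := congrArg (coeff 1) h
  simp [coeff_exp, coeff_one] at this

theorem exp_add_one_ne_zero : (exp ℚ + 1 : ℚ⟦X⟧) ≠ 0 := by
  intro h
  have := congrArg (coeff 0) h
  norm_num at this

/-- This identity is why tanh(x/2) appears in the effective Hamiltonian: the off-diagonal part of V
is acted on by exp(ad S), and the commutator of S with the diagonal part of the Hamiltonian
contributes the subtracted product. It is checked after multiplication by x(exp x - 1)(exp x + 1),
in an integral domain. -/
theorem exp_sub_expDivSeries_mul_cothSeries :
    exp ℚ - expDivSeries * cothSeries = tanhSeries := by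
  have hX : (X : ℚ⟦X⟧) ≠ 0 := X_ne_zero
  apply mul_left_cancel₀ hX
  apply mul_right_cancel₀ (mul_ne_zero exp_sub_one_ne_zero exp_add_one_ne_zero)
  rw [X_mul_tanhSeries, mul_sub, ← mul_assoc X, X_mul_expDivSeries]
  have h1 := cothSeries_mul
  have h2 := bernoulliPowerSeries_mul_exp_sub_one ℚ
  linear_combination (-(exp ℚ - 1) - 2) * h1 + 2 * (exp ℚ + 1) * h2

end PowerSeriesEval

end SchriefferWolff

namespace SchriefferWolff

/-! ### The exact transformation in a `ℚ`-algebra -/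

section Exact

variable {R : Type*} [Ring R]

/-- Block off-diagonal elements with respect to `P`. -/
def IsOff (P X : R) : Prop := P * X + X * P = X

/-- Commuting with `P` and being off-diagonal form the even and odd parts of a ℤ/2-grading; this and
the next two lemmas are its multiplication table. -/
theorem IsOff.mul {P X Y : R} (hX : IsOff P X) (hY : IsOff P Y) : Commute P (X * Y) := by
  unfold IsOff at hX hY
  have h1 : P * X = X - X * P := eq_sub_of_add_eq hX
  have h2 : P * Y = Y - Y * P := eq_sub_of_add_eq hY
  rw [Commute, SemiconjBy, ← mul_assoc, h1, sub_mul, mul_assoc X P, h2, mul_sub, mul_assoc]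
  abel

theorem IsOff.mul_commute {P X Y : R} (hX : IsOff P X) (hY : Commute P Y) : IsOff P (X * Y) := by
  unfold IsOff at *
  rw [mul_assoc, ← hY.eq, ← mul_assoc, ← mul_assoc, ← add_mul, hX]

theorem IsOff.commute_mul {P X Y : R} (hX : IsOff P X) (hY : Commute P Y) : IsOff P (Y * X) := by
  unfold IsOff at *
  rw [← mul_assoc, hY.eq, mul_assoc, mul_assoc, ← mul_add, hX]

theorem IsOff.add {P X Y : R} (hX : IsOff P X) (hY : IsOff P Y) : IsOff P (X + Y) := by
  unfold IsOff at *
  rw [mul_add, add_mul, add_add_add_comm, hX, hY]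

theorem IsOff.sub {P X Y : R} (hX : IsOff P X) (hY : IsOff P Y) : IsOff P (X - Y) := by
  unfold IsOff at *
  rw [mul_sub, sub_mul, sub_add_sub_comm, hX, hY]

theorem IsOff.sum {ι : Type*} {P : R} {s : Finset ι} {f : ι → R} (h : ∀ i ∈ s, IsOff P (f i)) :
    IsOff P (∑ i ∈ s, f i) := by
  classical
  induction s using Finset.induction_on with
  | empty => simp [IsOff]
  | insert i s hi ih =>
    rw [Finset.sum_insert hi]
    exact (h i (by simp)).add (ih fun j hj => h j (by simp [hj]))

variable [Algebra ℚ R]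

/-- The commutator with `S`. -/
def adj (S : R) : Module.End ℚ R := LinearMap.mulLeft ℚ S - LinearMap.mulRight ℚ S

theorem adj_apply (S X : R) : adj S X = S * X - X * S := rfl

theorem commute_mulLeft_mulRight (x y : R) :
    Commute (LinearMap.mulLeft ℚ x) (LinearMap.mulRight ℚ y) :=
  LinearMap.ext fun z => by simp [mul_assoc]

theorem isNilpotent_adj {S : R} (hS : IsNilpotent S) : IsNilpotent (adj S) := by
  refine Commute.isNilpotent_sub (commute_mulLeft_mulRight S S) ?_ ?_
  · exact (LinearMap.isNilpotent_mulLeft_iff ℚ S).2 hS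
  · exact (LinearMap.isNilpotent_mulRight_iff ℚ S).2 hS

/-- Left and right multiplication commute, so the exponential of their difference factors. -/
theorem exp_adj {S : R} (hS : IsNilpotent S) (X : R) :
    IsNilpotent.exp (adj S) X = IsNilpotent.exp S * X * IsNilpotent.exp (-S) := by
  have hl : IsNilpotent (LinearMap.mulLeft ℚ S) := (LinearMap.isNilpotent_mulLeft_iff ℚ S).2 hS
  have hr : IsNilpotent (LinearMap.mulRight ℚ (-S)) :=
    (LinearMap.isNilpotent_mulRight_iff ℚ (-S)).2 hS.neg
  have hadj : adj S = LinearMap.mulLeft ℚ S + LinearMap.mulRight ℚ (-S) := by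
    ext x; simp [adj_apply, sub_eq_add_neg]
  rw [hadj, IsNilpotent.exp_add_of_commute (commute_mulLeft_mulRight S (-S)) hl hr]
  obtain ⟨k, hk⟩ := hS
  have hk' : (-S) ^ k = 0 := by rw [neg_pow, hk, mul_zero]
  have hkl : (LinearMap.mulLeft ℚ S) ^ k = 0 := by rw [LinearMap.pow_mulLeft, hk]; ext; simp
  have hkr : (LinearMap.mulRight ℚ (-S)) ^ k = 0 := by
    rw [LinearMap.pow_mulRight, hk']; ext; simp
  rw [IsNilpotent.exp_eq_sum hkl, IsNilpotent.exp_eq_sum hkr, IsNilpotent.exp_eq_sum hk,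
    IsNilpotent.exp_eq_sum hk', Module.End.mul_apply]
  simp only [LinearMap.sum_apply, LinearMap.smul_apply, LinearMap.pow_mulRight,
    LinearMap.pow_mulLeft, LinearMap.mulLeft_apply, LinearMap.mulRight_apply, Finset.sum_mul,
    Finset.mul_sum, smul_mul_assoc, mul_smul_comm, Finset.smul_sum, mul_assoc]
  rw [Finset.sum_comm]
  exact Finset.sum_congr rfl fun i _ => Finset.sum_congr rfl fun j _ => smul_comm _ _ _

theorem IsOff.smul {P X : R} (hX : IsOff P X) (q : ℚ) : IsOff P (q • X) := by
  unfold IsOff at *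
  rw [mul_smul_comm, smul_mul_assoc, ← smul_add, hX]

/-- Each commutator with the odd element `S` flips the parity. Hence the even series x coth x keeps
off-diagonal elements off-diagonal and the odd series tanh(x/2) makes them block diagonal. -/
theorem adj_pow_isOff {P S X : R} (hS : IsOff P S) (hX : IsOff P X) (i : ℕ) :
    (Even i → IsOff P ((adj S ^ i) X)) ∧ (Odd i → Commute P ((adj S ^ i) X)) := by
  induction i with
  | zero => exact ⟨fun _ => by simpa using hX, fun h => by simp at h⟩
  | succ i ih =>
    have hstep : (adj S ^ (i + 1)) X = S * (adj S ^ i) X - (adj S ^ i) X * S := by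
      rw [pow_succ', Module.End.mul_apply, adj_apply]
    rw [hstep]
    constructor
    · intro h
      have h' := ih.2 (by rcases h with ⟨m, hm⟩; exact ⟨m - 1, by omega⟩)
      exact (hS.mul_commute h').sub (hS.commute_mul h')
    · intro h
      have h' := ih.1 (by rcases h with ⟨m, hm⟩; exact ⟨m, by omega⟩)
      exact (hS.mul h').sub_right (h'.mul hS)

theorem psEval_cothSeries_isOff {P S X : R} (hS : IsOff P S) (hX : IsOff P X) :
    IsOff P (psEval (adj S) cothSeries X) := by
  rw [psEval, LinearMap.sum_apply]
  refine IsOff.sum fun i _ => ?_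
  rw [LinearMap.smul_apply, cothSeries, PowerSeries.coeff_mk]
  split_ifs with h
  · exact ((adj_pow_isOff hS hX i).1 h).smul _
  · simp [IsOff]

theorem psEval_tanhSeries_commute {P S X : R} (hS : IsOff P S) (hX : IsOff P X) :
    Commute P (psEval (adj S) tanhSeries X) := by
  rw [psEval, LinearMap.sum_apply]
  refine Commute.sum_right _ _ _ fun i _ => ?_
  rw [LinearMap.smul_apply, tanhSeries, PowerSeries.coeff_mk]
  split_ifs with h
  · exact ((adj_pow_isOff hS hX i).2 h).smul_right _
  · simp

/-- The equation for the generator `S`, with block diagonal and off-diagonal parts `Vd`, `Vo`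
of the perturbation. -/
structure IsGenerator (P H₀ G Vd Vo S : R) : Prop where
  idem : P * P = P
  PG : P * G = 0
  GP : G * P = 0
  HP : H₀ * P = 0
  PH : P * H₀ = 0
  HG : H₀ * G = 1 - P
  GH : G * H₀ = 1 - P
  comm : Commute P Vd
  off : IsOff P Vo
  nil : IsNilpotent S
  eq : ∃ Y, Y = S * Vd - Vd * S + psEval (adj S) cothSeries Vo ∧ S = G * Y * P - P * Y * G

namespace IsGenerator

variable {P H₀ G Vd Vo S : R}

theorem isOff (h : IsGenerator P H₀ G Vd Vo S) : IsOff P S := by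
  obtain ⟨Y, -, hS⟩ := h.eq
  have h1 : P * S = -(P * Y * G) := by
    rw [hS, mul_sub, ← mul_assoc, ← mul_assoc, h.PG, ← mul_assoc, ← mul_assoc, h.idem]; simp
  have h2 : S * P = G * Y * P := by
    rw [hS, sub_mul, mul_assoc _ P, h.idem, mul_assoc _ G, h.GP]; simp
  rw [IsOff, h1, h2, hS]; abel

/-- The map Y ↦ GYP - PYG inverts the commutator with `H₀` on off-diagonal elements, so [H₀, S] = Y
for the Y in the equation of the generator. Subtracting this from [S, Vd] leaves only the series in
`Vo`. -/
theorem commutator (h : IsGenerator P H₀ G Vd Vo S) :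
    adj S (H₀ + Vd) = - psEval (adj S) cothSeries Vo := by
  have hoff := h.isOff
  obtain ⟨Y, hY, hS⟩ := h.eq
  have hYoff : IsOff P Y := by
    rw [hY]
    exact ((hoff.mul_commute h.comm).sub (hoff.commute_mul h.comm)).add
      (psEval_cothSeries_isOff hoff h.off)
  have hPYP : P * Y * P = 0 := by
    have := congrArg (P * ·) hYoff
    simp only [mul_add, ← mul_assoc, h.idem] at this
    simpa using this
  have h1 : H₀ * S = Y * P := by
    rw [hS, mul_sub, ← mul_assoc, ← mul_assoc, h.HG, ← mul_assoc, ← mul_assoc, h.HP, sub_mul,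
      sub_mul, hPYP]; simp
  have h2 : S * H₀ = -(P * Y) := by
    rw [hS, sub_mul, mul_assoc _ P, h.PH, mul_assoc _ G, h.GH, mul_sub, hPYP]; simp
  have h3 : H₀ * S - S * H₀ = Y := by
    rw [h1, h2, sub_neg_eq_add, add_comm]; exact hYoff
  have h4 : adj S (H₀ + Vd) = (S * Vd - Vd * S) - (H₀ * S - S * H₀) := by
    rw [adj_apply]; noncomm_ring
  rw [h4, h3, hY]; abel

/-- The generator block-diagonalizes the Hamiltonian. -/
theorem conj_eq (h : IsGenerator P H₀ G Vd Vo S) :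
    IsNilpotent.exp S * (H₀ + Vd + Vo) * IsNilpotent.exp (-S) =
      H₀ + Vd + psEval (adj S) tanhSeries Vo := by
  have hn := isNilpotent_adj h.nil
  -- On `H₀ + Vd` the exponential of ad S is written as 1 plus a series applied to one commutator,
  -- which `commutator` expresses through `Vo`; on `Vo` it is kept whole. The two series in `Vo`
  -- then combine to tanh(x/2).
  have hexp : psEval (adj S) (PowerSeries.exp ℚ) =
      1 + psEval (adj S) expDivSeries * adj S := by
    have h1 : PowerSeries.exp ℚ = 1 + expDivSeries * PowerSeries.X := by
      rw [mul_comm, X_mul_expDivSeries]; ring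
    conv_lhs => rw [h1]
    rw [psEval_add, psEval_one hn, psEval_mul hn, psEval_X hn]
  rw [← exp_adj h.nil, map_add, ← psEval_exp hn, ← exp_sub_expDivSeries_mul_cothSeries, psEval_sub,
    psEval_mul hn]
  conv_lhs => enter [1]; rw [hexp]
  rw [LinearMap.add_apply, Module.End.mul_apply, h.commutator, LinearMap.sub_apply,
    Module.End.mul_apply, map_neg, Module.End.one_apply]
  abel

theorem commute_conj (h : IsGenerator P H₀ G Vd Vo S) :
    Commute P (H₀ + Vd + psEval (adj S) tanhSeries Vo) := by
  refine Commute.add_right (Commute.add_right ?_ h.comm)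
    (psEval_tanhSeries_commute h.isOff h.off)
  rw [Commute, SemiconjBy, h.PH, h.HP]

/-- Odd powers of `S` are off-diagonal and vanish between two factors `P`; even powers do not see
the sign. This normalization is what singles out one block-diagonalizing transformation. -/
theorem exp_compress (h : IsGenerator P H₀ G Vd Vo S) :
    P * IsNilpotent.exp (-S) * P = P * IsNilpotent.exp S * P := by
  have hoff := h.isOff
  obtain ⟨k, hk⟩ := h.nil
  have hk' : (-S) ^ k = 0 := by rw [neg_pow, hk, mul_zero]
  have hpow : ∀ i, (Even i → Commute P (S ^ i)) ∧ (Odd i → IsOff P (S ^ i)) := by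
    intro i
    induction i with
    | zero => exact ⟨fun _ => by simp, fun h => by simp at h⟩
    | succ i ih =>
      rw [pow_succ']
      constructor
      · intro hi
        exact hoff.mul (ih.2 (by rcases hi with ⟨m, hm⟩; exact ⟨m - 1, by omega⟩))
      · intro hi
        exact hoff.mul_commute (ih.1 (by rcases hi with ⟨m, hm⟩; exact ⟨m, by omega⟩))
  rw [IsNilpotent.exp_eq_sum hk, IsNilpotent.exp_eq_sum hk', Finset.mul_sum, Finset.mul_sum,
    Finset.sum_mul, Finset.sum_mul]
  refine Finset.sum_congr rfl fun i _ => ?_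
  rcases Nat.even_or_odd i with hi | hi
  · rw [hi.neg_pow]
  · have hz : P * S ^ i * P = 0 := by
      have := congrArg (P * ·) ((hpow i).2 hi)
      simp only [mul_add, ← mul_assoc, h.idem] at this
      simpa using this
    rw [hi.neg_pow]
    simp only [mul_smul_comm, smul_mul_assoc, mul_neg, neg_mul, hz, neg_zero]

end IsGenerator

end Exact

end SchriefferWolff

namespace SchriefferWolff

/-! ### Uniqueness of the effective Hamiltonian -/

section Uniqueness

variable {R : Type*} [Ring R]

/-- Iterating the equation puts arbitrarily high powers of `ε` in front of `X`. It is the formal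
substitute for a contraction argument in the uniqueness proofs below. -/
theorem eq_zero_of_eq_mul_nilpotent {ε : R} (hε : IsNilpotent ε) (φ : R → R)
    (hφ : ∀ x, φ (ε * x) = ε * φ x) {X : R} (hX : X = ε * φ X) : X = 0 := by
  have hpow : ∀ k x, φ (ε ^ k * x) = ε ^ k * φ x := by
    intro k
    induction k with
    | zero => simp
    | succ k ih => intro x; rw [pow_succ', mul_assoc, hφ, ih, mul_assoc]
  have h : ∀ k : ℕ, ∃ Y, X = ε ^ k * Y := by
    intro k
    induction k with
    | zero => exact ⟨X, by simp⟩
    | succ k ih =>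
      obtain ⟨Y, hY⟩ := ih
      refine ⟨φ Y, ?_⟩
      rw [pow_succ', mul_assoc, ← hpow, ← hY]
      exact hX
  obtain ⟨N, hN⟩ := hε
  obtain ⟨Y, hY⟩ := h N
  rw [hY, hN, zero_mul]

/-- `U` conjugates `H = H₀ + O(ε)` to the block-diagonal operator `K`, and `U = 1 + O(ε)`. -/
structure IsBlockDiag (ε P H K U U' : R) : Prop where
  mul_inv : U * U' = 1
  inv_mul : U' * U = 1
  conj : U * H * U' = K
  comm : Commute P K
  compress : P * U' * P = P * U * P
  near : ∃ u, U = 1 + ε * u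
  near' : ∃ u, U' = 1 + ε * u

variable {ε P H K U U' : R}

namespace IsBlockDiag

theorem proj_idem (h : IsBlockDiag ε P H K U U') (hP : P * P = P) :
    U' * P * U * (U' * P * U) = U' * P * U := by
  calc U' * P * U * (U' * P * U) = U' * P * (U * U') * P * U := by simp only [mul_assoc]
    _ = U' * (P * P) * U := by rw [h.mul_inv, mul_one, mul_assoc U' P P]
    _ = _ := by rw [hP]

theorem proj_comm (h : IsBlockDiag ε P H K U U') : Commute (U' * P * U) H := by
  have h1 : U * H = K * U := by
    rw [← h.conj, mul_assoc, h.inv_mul, mul_one]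
  have h2 : H * U' = U' * K := by
    rw [← h.conj, ← mul_assoc, ← mul_assoc, h.inv_mul, one_mul]
  rw [Commute, SemiconjBy, mul_assoc, h1, ← mul_assoc, ← mul_assoc, ← mul_assoc, h2,
    mul_assoc U' P K, h.comm.eq, mul_assoc U' K P]

theorem proj_near (h : IsBlockDiag ε P H K U U') (hc : ∀ x, Commute ε x) :
    ∃ p, U' * P * U = P + ε * p := by
  obtain ⟨u, hu⟩ := h.near
  obtain ⟨u', hu'⟩ := h.near'
  refine ⟨u' * P + P * u + ε * (u' * P * u), ?_⟩
  have h1 : P * (ε * u) = ε * (P * u) := by rw [← mul_assoc, ← (hc P).eq, mul_assoc]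
  have h2 : ε * u' * P * (ε * u) = ε * (ε * (u' * P * u)) := by
    rw [mul_assoc, mul_assoc, ← mul_assoc P, ← (hc P).eq, mul_assoc ε P u, ← mul_assoc u',
      ← (hc u').eq, mul_assoc ε u', mul_assoc u']
  rw [hu, hu']
  calc (1 + ε * u') * P * (1 + ε * u)
      = P + ε * u' * P + P * (ε * u) + ε * u' * P * (ε * u) := by noncomm_ring
    _ = _ := by rw [h1, h2]; noncomm_ring

end IsBlockDiag

/-- Uniqueness of the perturbed spectral projection. The element X = (1 - Z) Z' commutes with `H`,
so its block from the range of `P` to that of 1 - P is O(ε) by the gap of `H₀`. Since X = (1 - Z) X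
Z' and both projections are P + O(ε), all of X is ε times a linear expression in X. -/
theorem proj_unique {H₀ G v Z Z' : R} (hε : IsNilpotent ε) (hc : ∀ x, Commute ε x)
    (hHP : H₀ * P = 0) (hGH : G * H₀ = 1 - P) (hH : H = H₀ + ε * v)
    (h : Commute Z H) (hi : Z * Z = Z) (hn : ∃ p, Z = P + ε * p)
    (h' : Commute Z' H) (hi' : Z' * Z' = Z') (hn' : ∃ p, Z' = P + ε * p) :
    Z' = Z * Z' := by
  obtain ⟨p, hp⟩ := hn
  obtain ⟨p', hp'⟩ := hn'
  set X := Z' - Z * Z' with hX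
  suffices X = 0 from sub_eq_zero.1 this
  have hXH : X * H = H * X := by
    rw [hX, sub_mul, mul_sub, mul_assoc, h'.eq, ← mul_assoc, h.eq, mul_assoc]
  have hX1 : X = X - Z * X := by
    rw [hX, mul_sub, ← mul_assoc, hi]; simp
  have hX2 : X = X * Z' := by
    rw [hX, sub_mul, mul_assoc, hi']
  clear_value X
  have hcc : ∀ x y, x * (ε * y) = ε * (x * y) := fun x y => by
    rw [← mul_assoc, ← (hc x).eq, mul_assoc]
  -- From XH = HX the commutator of `H₀` with X is ε[X, v]; applying `G` from the left and `P` from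
  -- the right divides by the energy, as `H₀ * P = 0`.
  have hQ : X * P - P * X * P = ε * (G * (X * v - v * X) * P) := by
    have h0 : H₀ * X = X * H₀ + ε * (X * v - v * X) := by
      have e1 : X * (ε * v) = ε * (X * v) := hcc _ _
      have := hXH
      rw [hH, mul_add, add_mul, e1] at this
      rw [mul_sub, ← add_sub_assoc, this]
      simp [mul_assoc]
    calc X * P - P * X * P = (1 - P) * X * P := by noncomm_ring
      _ = G * (H₀ * X) * P := by rw [← hGH]; simp only [mul_assoc]
      _ = G * X * (H₀ * P) + G * (ε * (X * v - v * X)) * P := by rw [h0]; noncomm_ring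
      _ = _ := by rw [hHP, mul_zero, zero_add, hcc, mul_assoc ε]
  refine eq_zero_of_eq_mul_nilpotent hε
    (fun X => G * (X * v - v * X) * P + (X * p' - P * X * p') - p * X * P - ε * (p * X * p'))
    ?_ ?_
  · intro x
    have e1 : ε * x * v = ε * (x * v) := mul_assoc _ _ _
    simp only [hcc, mul_assoc, ← mul_sub, ← mul_add]
  · calc X = (X - Z * X) * Z' := by rw [← hX1]; exact hX2
      _ = (X * P - P * X * P) + (X * (ε * p') - P * (X * (ε * p')))
          - ε * p * X * P - ε * p * (X * (ε * p')) := by rw [hp, hp']; noncomm_ring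
      _ = _ := by
        rw [hQ, hcc X, hcc P, hcc (ε * p)]; noncomm_ring

/-- Two block-diagonalizations of the same Hamiltonian have the same upper block. -/
theorem IsBlockDiag.compress_eq [Algebra ℚ R] {H₀ G v K₂ W W' : R} (hε : IsNilpotent ε)
    (hc : ∀ x, Commute ε x)
    (hP : P * P = P) (hHP : H₀ * P = 0) (hPH : P * H₀ = 0) (hGH : G * H₀ = 1 - P)
    (hHG : H₀ * G = 1 - P) (hH : H = H₀ + ε * v)
    (h : IsBlockDiag ε P H K U U') (h₂ : IsBlockDiag ε P H K₂ W W') :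
    P * K * P = P * K₂ * P := by
  have hcc : ∀ x y, x * (ε * y) = ε * (x * y) := fun x y => by
    rw [← mul_assoc, ← (hc x).eq, mul_assoc]
  -- Both sides are spectral projections of `H`. Uniqueness gives Z' = Z Z'; the same statement in
  -- the opposite ring gives the mirrored equation, hence equality.
  have hZ : W' * P * W = U' * P * U := by
    have a1 := proj_unique hε hc hHP hGH hH h₂.proj_comm (h₂.proj_idem hP) (h₂.proj_near hc)
      h.proj_comm (h.proj_idem hP) (h.proj_near hc)
    have near_op : ∀ {Z : R}, (∃ p, Z = P + ε * p) →
        ∃ p, MulOpposite.op Z = MulOpposite.op P + MulOpposite.op ε * p := by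
      rintro Z ⟨p, rfl⟩
      exact ⟨MulOpposite.op p, by rw [(hc p).eq]; simp⟩
    have a2 := proj_unique (R := Rᵐᵒᵖ) (ε := MulOpposite.op ε) (P := MulOpposite.op P)
      (H := MulOpposite.op H) (H₀ := MulOpposite.op H₀) (G := MulOpposite.op G)
      (v := MulOpposite.op v) (Z := MulOpposite.op (U' * P * U))
      (Z' := MulOpposite.op (W' * P * W))
      (by obtain ⟨N, hN⟩ := hε; exact ⟨N, by rw [← MulOpposite.op_pow, hN, MulOpposite.op_zero]⟩)
      (fun x => by
        rw [Commute, SemiconjBy]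
        apply MulOpposite.unop_injective
        exact (hc x.unop).symm.eq)
      (by rw [← MulOpposite.op_mul, hPH, MulOpposite.op_zero])
      (by rw [← MulOpposite.op_mul, hHG, MulOpposite.op_sub, MulOpposite.op_one])
      (by rw [hH, (hc v).eq, MulOpposite.op_add, MulOpposite.op_mul])
      h.proj_comm.op (by rw [← MulOpposite.op_mul, h.proj_idem hP]) (near_op (h.proj_near hc))
      h₂.proj_comm.op (by rw [← MulOpposite.op_mul, h₂.proj_idem hP]) (near_op (h₂.proj_near hc))
    rw [← MulOpposite.op_mul] at a2
    exact (MulOpposite.op_injective a2).trans a1.symm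
  obtain ⟨u, hu⟩ := h.near
  obtain ⟨w, hw⟩ := h₂.near
  have hcu : P * U * P = P + ε * (P * u * P) := by
    rw [hu, mul_add, hcc, add_mul, mul_one, hP, mul_assoc ε]
  have hcw : P * W * P = P + ε * (P * w * P) := by
    rw [hw, mul_add, hcc, add_mul, mul_one, hP, mul_assoc ε]
  have sq : ∀ {A A' : R}, P * A' * P = P * A * P →
      P * (A' * P * A) * P = P * A * P * (P * A * P) := by
    intro A A' hA
    calc P * (A' * P * A) * P = P * A' * (P * P) * A * P := by rw [hP]; simp only [mul_assoc]
      _ = P * A' * P * (P * A * P) := by simp only [mul_assoc]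
      _ = _ := by rw [hA]
  -- By the normalization in `compress`, P U P is a square root of the compressed spectral
  -- projection. It is P + O(ε), and such a square root is unique; this is `hd` below.
  have hsq : P * U * P * (P * U * P) = P * W * P * (P * W * P) := by
    rw [← sq h.compress, ← sq h₂.compress, hZ]
  have hd : P * U * P - P * W * P = 0 := by
    refine eq_zero_of_eq_mul_nilpotent hε
      (fun x => (-(1 / 2) : ℚ) • (P * u * P * x + x * (P * w * P))) ?_ ?_
    · intro x
      simp only [hcc, mul_assoc, ← mul_add, mul_smul_comm]
    · set d := P * U * P - P * W * P with hd
      have h1 : P * d = d := by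
        rw [hd, mul_sub]; simp only [← mul_assoc, hP]
      have h2 : d * P = d := by
        rw [hd, sub_mul]; simp only [mul_assoc, hP]
      have h3 : P * U * P * d + d * (P * W * P) = 0 := by
        rw [hd]
        calc P * U * P * (P * U * P - P * W * P) + (P * U * P - P * W * P) * (P * W * P)
            = P * U * P * (P * U * P) - P * W * P * (P * W * P) := by noncomm_ring
          _ = 0 := by rw [hsq, sub_self]
      rw [hcu, hcw, add_mul, mul_add, h1, h2, hcc d, mul_assoc ε] at h3
      have h4 : d + d = -(ε * (P * u * P * d + d * (P * w * P))) := by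
        rw [mul_add, eq_neg_iff_add_eq_zero, ← h3]; abel
      have h5 : d = (1 / 2 : ℚ) • (d + d) := by
        rw [smul_add, ← add_smul]; norm_num
      rw [mul_smul_comm, neg_smul, ← smul_neg, ← h4]
      exact h5
  have hc2 : P * U * P = P * W * P := sub_eq_zero.1 hd
  -- P U P is invertible on the range of `P` up to O(ε) corrections, so the products (P U P)(P U) =
  -- P Z, and likewise (U' P)(P U P) = Z P, determine P U and U' P.
  have hl : P * U - P * W = 0 := by
    refine eq_zero_of_eq_mul_nilpotent hε (fun x => -(P * u * P * x)) ?_ ?_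
    · intro x
      rw [hcc, mul_neg]
    · have h1 : ∀ {A A' : R}, P * A' * P = P * A * P →
          P * A * P * (P * A) = P * (A' * P * A) := by
        intro A A' hA
        rw [← hA]
        calc P * A' * P * (P * A) = P * A' * (P * P) * A := by simp only [mul_assoc]
          _ = _ := by rw [hP]; simp only [mul_assoc]
      have h2 : P * U * P * (P * U - P * W) = 0 := by
        rw [mul_sub, h1 h.compress, hc2, h1 h₂.compress, hZ, sub_self]
      have h3 : P * (P * U - P * W) = P * U - P * W := by
        rw [mul_sub, ← mul_assoc, ← mul_assoc, hP]
      rw [hcu, add_mul, h3, mul_assoc ε] at h2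
      rw [mul_neg]
      exact eq_neg_of_add_eq_zero_left h2
  have hr : U' * P - W' * P = 0 := by
    refine eq_zero_of_eq_mul_nilpotent hε (fun x => -(x * (P * u * P))) ?_ ?_
    · intro x
      rw [mul_assoc, mul_neg]
    · have h1 : ∀ {A A' : R}, A' * P * (P * A * P) = A' * P * A * P := by
        intro A A'
        calc A' * P * (P * A * P) = A' * (P * P) * A * P := by simp only [mul_assoc]
          _ = _ := by rw [hP]
      have h2 : (U' * P - W' * P) * (P * U * P) = 0 := by
        rw [sub_mul, h1, hc2, h1, hZ, sub_self]
      have h3 : (U' * P - W' * P) * P = U' * P - W' * P := by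
        rw [sub_mul, mul_assoc, mul_assoc, hP]
      rw [hcu, mul_add, h3, hcc] at h2
      rw [mul_neg]
      exact eq_neg_of_add_eq_zero_left h2
  rw [← h.conj, ← h₂.conj]
  calc P * (U * H * U') * P = P * U * H * (U' * P) := by simp only [mul_assoc]
    _ = P * W * H * (W' * P) := by rw [sub_eq_zero.1 hl, sub_eq_zero.1 hr]
    _ = _ := by simp only [mul_assoc]

/-- Block-diagonalizations of two independent systems combine. -/
theorem IsBlockDiag.prod {P₁ P₂ H₁ H₂ K₁ K₂ U₁ U₁' U₂ U₂' : R}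
    (h₁ : IsBlockDiag ε P₁ H₁ K₁ U₁ U₁') (h₂ : IsBlockDiag ε P₂ H₂ K₂ U₂ U₂')
    (hP : ∀ y ∈ ({P₂, H₂, U₂, U₂'} : Set R), Commute P₁ y)
    (hHc : Commute H₁ U₂)
    (hU : ∀ y ∈ ({P₂, H₂, U₂, U₂'} : Set R), Commute U₁ y)
    (hU' : ∀ y ∈ ({P₂, H₂, U₂, U₂'} : Set R), Commute U₁' y)
    (hPH : Commute P₂ H₁) :
    IsBlockDiag ε (P₁ * P₂) (H₁ + H₂) (K₁ + K₂) (U₁ * U₂) (U₁' * U₂') := by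
  have PP := hP P₂ (by simp)
  have PH := hP H₂ (by simp)
  have PU := hP U₂ (by simp)
  have PU' := hP U₂' (by simp)
  have UP := hU P₂ (by simp)
  have UH := hU H₂ (by simp)
  have UU := hU U₂ (by simp)
  have UU' := hU U₂' (by simp)
  have U'P := hU' P₂ (by simp)
  have U'H := hU' H₂ (by simp)
  have U'U := hU' U₂ (by simp)
  refine ⟨?_, ?_, ?_, ?_, ?_, ?_, ?_⟩
  · rw [mul_assoc, ← mul_assoc U₂, ← U'U.eq, mul_assoc, h₂.mul_inv, mul_one, h₁.mul_inv]
  · rw [mul_assoc, ← mul_assoc U₂', ← UU'.eq, mul_assoc, h₂.inv_mul, mul_one, h₁.inv_mul]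
  · have e1 : U₁ * U₂ * H₁ * (U₁' * U₂') = K₁ := by
      calc U₁ * U₂ * H₁ * (U₁' * U₂') = U₁ * (U₂ * (H₁ * U₁')) * U₂' := by simp only [mul_assoc]
        _ = U₁ * (H₁ * U₁') * (U₂ * U₂') := by
          rw [← (hHc.mul_left U'U).eq]; simp only [mul_assoc]
        _ = K₁ := by rw [h₂.mul_inv, mul_one, ← mul_assoc, h₁.conj]
    have e2 : U₁ * U₂ * H₂ * (U₁' * U₂') = K₂ := by
      have : Commute U₁' (U₂ * H₂) := U'U.mul_right U'H
      rw [mul_assoc U₁, ← mul_assoc _ U₁', mul_assoc U₁, ← this.eq, ← mul_assoc U₁, h₁.mul_inv,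
        one_mul, h₂.conj]
    rw [mul_add, add_mul, e1, e2]
  · have c1 : Commute P₁ K₂ := by rw [← h₂.conj]; exact (PU.mul_right PH).mul_right PU'
    have c2 : Commute P₂ K₁ := by
      rw [← h₁.conj]; exact (UP.symm.mul_right hPH).mul_right U'P.symm
    exact (h₁.comm.mul_left c2).add_right (c1.mul_left h₂.comm)
  · have e1 : P₁ * P₂ * (U₁' * U₂') * (P₁ * P₂) = (P₁ * U₁' * P₁) * (P₂ * U₂' * P₂) := by
      rw [mul_assoc P₁ P₂, ← mul_assoc P₂, ← U'P.eq, mul_assoc U₁', ← mul_assoc P₁ U₁',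
        mul_assoc (P₁ * U₁'), ← mul_assoc _ P₁ P₂, ← (PP.mul_right PU').eq]
      simp only [mul_assoc]
    have e2 : P₁ * P₂ * (U₁ * U₂) * (P₁ * P₂) = (P₁ * U₁ * P₁) * (P₂ * U₂ * P₂) := by
      rw [mul_assoc P₁ P₂, ← mul_assoc P₂, ← UP.eq, mul_assoc U₁, ← mul_assoc P₁ U₁,
        mul_assoc (P₁ * U₁), ← mul_assoc _ P₁ P₂, ← (PP.mul_right PU).eq]
      simp only [mul_assoc]
    rw [e1, e2, h₁.compress, h₂.compress]
  · obtain ⟨u₁, rfl⟩ := h₁.near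
    obtain ⟨u₂, rfl⟩ := h₂.near
    exact ⟨u₁ + u₂ + u₁ * (ε * u₂), by noncomm_ring⟩
  · obtain ⟨u₁, rfl⟩ := h₁.near'
    obtain ⟨u₂, rfl⟩ := h₂.near'
    exact ⟨u₁ + u₂ + u₁ * (ε * u₂), by noncomm_ring⟩

end Uniqueness

end SchriefferWolff

namespace SchriefferWolff

/-! ### Noncommutative polynomials in `P`, `G`, `V` -/

/-- An expression in three matrices. -/
abbrev NCFamily : Type 1 :=
  ∀ (n : Type) [Fintype n] [DecidableEq n], Matrix n n ℂ → Matrix n n ℂ → Matrix n n ℂ →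
    Matrix n n ℂ

/-- Real noncommutative polynomials in `P`, `G`, `V`, homogeneous of degree `k` in `V`. -/
inductive IsNCPoly : ℕ → NCFamily → Prop
  | proj : IsNCPoly 0 (fun _ _ _ P _ _ => P)
  | res : IsNCPoly 0 (fun _ _ _ _ G _ => G)
  | pert : IsNCPoly 1 (fun _ _ _ _ _ V => V)
  | one : IsNCPoly 0 (fun _ _ _ _ _ _ => 1)
  | zero (k : ℕ) : IsNCPoly k (fun _ _ _ _ _ _ => 0)
  | add {k : ℕ} {X Y : NCFamily} : IsNCPoly k X → IsNCPoly k Y →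
      IsNCPoly k (fun n _ _ P G V => X n P G V + Y n P G V)
  | smul {k : ℕ} {X : NCFamily} (c : ℝ) : IsNCPoly k X →
      IsNCPoly k (fun n _ _ P G V => (c : ℂ) • X n P G V)
  | mul {k l : ℕ} {X Y : NCFamily} : IsNCPoly k X → IsNCPoly l Y →
      IsNCPoly (k + l) (fun n _ _ P G V => X n P G V * Y n P G V)

/-- Linear combinations of products `x * P * y` with `x`, `y` of positive degree in `V`. -/
inductive IsThru : ℕ → NCFamily → Prop
  | zero (k : ℕ) : IsThru k (fun _ _ _ _ _ _ => 0)
  | mk {k l : ℕ} {X Y : NCFamily} : IsNCPoly k X → IsNCPoly l Y → 1 ≤ k → 1 ≤ l →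
      IsThru (k + l) (fun n _ _ P G V => X n P G V * P * Y n P G V)
  | add {k : ℕ} {X Y : NCFamily} : IsThru k X → IsThru k Y →
      IsThru k (fun n _ _ P G V => X n P G V + Y n P G V)
  | smul {k : ℕ} {X : NCFamily} (c : ℝ) : IsThru k X →
      IsThru k (fun n _ _ P G V => (c : ℂ) • X n P G V)

/-- Linear combinations of products `x * P` and `P * x` with `x` of positive degree in `V`. -/
inductive IsEnd : ℕ → NCFamily → Prop
  | right {k : ℕ} {X : NCFamily} : IsNCPoly k X → 1 ≤ k →
      IsEnd k (fun n _ _ P G V => X n P G V * P)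
  | left {k : ℕ} {X : NCFamily} : IsNCPoly k X → 1 ≤ k →
      IsEnd k (fun n _ _ P G V => P * X n P G V)
  | add {k : ℕ} {X Y : NCFamily} : IsEnd k X → IsEnd k Y →
      IsEnd k (fun n _ _ P G V => X n P G V + Y n P G V)
  | smul {k : ℕ} {X : NCFamily} (c : ℝ) : IsEnd k X →
      IsEnd k (fun n _ _ P G V => (c : ℂ) • X n P G V)

namespace IsNCPoly

variable {k l : ℕ} {X Y : NCFamily}

theorem neg (h : IsNCPoly k X) : IsNCPoly k (fun n _ _ P G V => -X n P G V) := by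
  simpa using h.smul (-1)

theorem sub (h : IsNCPoly k X) (h' : IsNCPoly k Y) :
    IsNCPoly k (fun n _ _ P G V => X n P G V - Y n P G V) := by
  simpa [sub_eq_add_neg] using h.add h'.neg

theorem sum {ι : Type*} (s : Finset ι) {f : ι → NCFamily} (h : ∀ i ∈ s, IsNCPoly k (f i)) :
    IsNCPoly k (fun n _ _ P G V => ∑ i ∈ s, f i n P G V) := by
  classical
  induction s using Finset.induction_on with
  | empty => simpa using IsNCPoly.zero k
  | insert i s hi ih =>
    simpa only [Finset.sum_insert hi] using
      (h i (by simp)).add (ih fun j hj => h j (by simp [hj]))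

theorem ratSmul (q : ℚ) (h : IsNCPoly k X) :
    IsNCPoly k (fun n _ _ P G V => (q : ℂ) • X n P G V) := by
  simpa using h.smul (q : ℝ)

theorem commute (h : IsNCPoly k X) {n : Type} [Fintype n] [DecidableEq n]
    {P G V Z : Matrix n n ℂ} (hP : Commute Z P) (hG : Commute Z G) (hV : Commute Z V) :
    Commute Z (X n P G V) := by
  induction h with
  | proj => exact hP
  | res => exact hG
  | pert => exact hV
  | one => exact Commute.one_right _
  | zero => exact Commute.zero_right _
  | add _ _ h₁ h₂ => exact h₁.add_right h₂
  | smul c _ h => exact h.smul_right _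
  | mul _ _ h₁ h₂ => exact h₁.mul_right h₂

theorem offDiag : IsNCPoly 1 (fun _ _ _ P _ V => offDiagPart P V) := by
  have hQ := IsNCPoly.one.sub IsNCPoly.proj
  exact ((IsNCPoly.proj.mul IsNCPoly.pert).mul hQ).add ((hQ.mul IsNCPoly.pert).mul IsNCPoly.proj)

theorem diag : IsNCPoly 1 (fun _ _ _ P _ V => diagPart P V) := by
  have hQ := IsNCPoly.one.sub IsNCPoly.proj
  exact ((IsNCPoly.proj.mul IsNCPoly.pert).mul IsNCPoly.proj).add ((hQ.mul IsNCPoly.pert).mul hQ)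

theorem applyL (h : IsNCPoly k X) : IsNCPoly k (fun n _ _ P G V => L P G (X n P G V)) := by
  have h1 := (IsNCPoly.res.mul h).mul IsNCPoly.proj
  have h2 := (IsNCPoly.proj.mul h).mul IsNCPoly.res
  rw [zero_add, add_zero] at h1 h2
  exact h1.sub h2

end IsNCPoly

namespace IsThru

variable {k l : ℕ} {X Y : NCFamily}

theorem neg (h : IsThru k X) : IsThru k (fun n _ _ P G V => -X n P G V) := by
  simpa using h.smul (-1)

theorem sub (h : IsThru k X) (h' : IsThru k Y) :
    IsThru k (fun n _ _ P G V => X n P G V - Y n P G V) := by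
  simpa [sub_eq_add_neg] using h.add h'.neg

theorem sum {ι : Type*} (s : Finset ι) {f : ι → NCFamily} (h : ∀ i ∈ s, IsThru k (f i)) :
    IsThru k (fun n _ _ P G V => ∑ i ∈ s, f i n P G V) := by
  classical
  induction s using Finset.induction_on with
  | empty => simpa using IsThru.zero k
  | insert i s hi ih =>
    simpa only [Finset.sum_insert hi] using
      (h i (by simp)).add (ih fun j hj => h j (by simp [hj]))

theorem ratSmul (q : ℚ) (h : IsThru k X) :
    IsThru k (fun n _ _ P G V => (q : ℂ) • X n P G V) := by
  simpa using h.smul (q : ℝ)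

theorem mul_left (h : IsThru k X) (hY : IsNCPoly l Y) :
    IsThru (l + k) (fun n _ _ P G V => Y n P G V * X n P G V) := by
  induction h with
  | zero k => simpa using IsThru.zero (l + k)
  | mk h₁ h₂ hk hl =>
    simpa only [add_assoc, mul_assoc] using IsThru.mk (hY.mul h₁) h₂ (by omega) hl
  | add _ _ h₁ h₂ => simpa only [mul_add] using h₁.add h₂
  | smul c _ h => simpa only [Matrix.mul_smul] using h.smul c

theorem mul_right (h : IsThru k X) (hY : IsNCPoly l Y) :
    IsThru (k + l) (fun n _ _ P G V => X n P G V * Y n P G V) := by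
  induction h with
  | zero k => simpa using IsThru.zero (k + l)
  | mk h₁ h₂ hk hl =>
    simpa only [add_assoc, mul_assoc] using IsThru.mk h₁ (h₂.mul hY) hk (by omega)
  | add _ _ h₁ h₂ => simpa only [add_mul] using h₁.add h₂
  | smul c _ h => simpa only [Matrix.smul_mul] using h.smul c

theorem applyL (h : IsThru k X) : IsThru k (fun n _ _ P G V => L P G (X n P G V)) := by
  have h1 := (h.mul_left IsNCPoly.res).mul_right IsNCPoly.proj
  have h2 := (h.mul_left IsNCPoly.proj).mul_right IsNCPoly.res
  rw [zero_add, add_zero] at h1 h2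
  exact h1.sub h2

end IsThru

namespace IsEnd

variable {k l m : ℕ} {X Y Z : NCFamily}

theorem sub (h : IsEnd k X) (h' : IsEnd k Y) :
    IsEnd k (fun n _ _ P G V => X n P G V - Y n P G V) := by
  simpa [sub_eq_add_neg] using h.add (h'.smul (-1))

theorem isNCPoly (h : IsEnd k X) : IsNCPoly k X ∧ 1 ≤ k := by
  induction h with
  | right h hk => exact ⟨by simpa using h.mul IsNCPoly.proj, hk⟩
  | left h hk => exact ⟨by simpa using IsNCPoly.proj.mul h, hk⟩
  | add _ _ h₁ h₂ => exact ⟨h₁.1.add h₂.1, h₁.2⟩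
  | smul c _ h => exact ⟨h.1.smul c, h.2⟩

/-- A product of three block off-diagonal terms passes through `P`. -/
theorem isThru_mul (hX : IsEnd k X) (hY : IsEnd l Y) (hZ : IsNCPoly m Z) (hm : 1 ≤ m) :
    IsThru (k + l + m) (fun n _ _ P G V => X n P G V * (Y n P G V * Z n P G V)) := by
  induction hX with
  | right h hk =>
    simpa only [add_assoc, mul_assoc] using
      IsThru.mk h (hY.isNCPoly.1.mul hZ) hk (by omega)
  | add _ _ h₁ h₂ => simpa only [add_mul] using h₁.add h₂
  | smul c _ h => simpa only [Matrix.smul_mul] using h.smul c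
  | left hX hk =>
    induction hY with
    | right hY hl =>
      simpa only [zero_add, add_assoc, mul_assoc] using
        IsThru.mk ((IsNCPoly.proj.mul hX).mul hY) hZ (by omega) hm
    | left hY hl =>
      simpa only [zero_add, add_assoc, mul_assoc] using
        IsThru.mk (IsNCPoly.proj.mul hX) (hY.mul hZ) (by omega) (by omega)
    | add _ _ h₁ h₂ => simpa only [add_mul, mul_add] using h₁.add h₂
    | smul c _ h => simpa only [Matrix.smul_mul, Matrix.mul_smul] using h.smul c

/-- The off-diagonal part is PV + VP - 2PVP, and PVP has the form P * x with x = VP. -/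
theorem offDiag : IsEnd 1 (fun _ _ _ P _ V => offDiagPart P V) := by
  have h1 := IsEnd.left IsNCPoly.pert le_rfl
  have h2 := IsEnd.right IsNCPoly.pert le_rfl
  have h3 := IsEnd.left (k := 1) (by simpa using IsNCPoly.pert.mul IsNCPoly.proj) le_rfl
  have := (h1.add h2).sub (h3.smul 2)
  convert this using 7 with n _ _ P G V
  rw [offDiagPart]
  push_cast
  rw [two_smul]
  noncomm_ring

theorem applyL (h : IsNCPoly k X) (hk : 1 ≤ k) :
    IsEnd k (fun n _ _ P G V => L P G (X n P G V)) := by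
  have h1 := IsEnd.right (by simpa only [zero_add] using IsNCPoly.res.mul h) hk
  have h2 := IsEnd.left (by simpa only [add_zero] using h.mul IsNCPoly.res) hk
  simpa only [L, mul_assoc] using h1.sub h2

end IsEnd

/-! ### Structure of the coefficients -/

theorem nestedComm_congr {n : Type} [Fintype n] {S S' : ℕ → Matrix n n ℂ} (X : Matrix n n ℂ) {l : List ℕ}
    (h : ∀ i ∈ l, S i = S' i) : nestedComm S X l = nestedComm S' X l := by
  induction l with
  | nil => rfl
  | cons j l ih =>
    rw [nestedComm, nestedComm, ih fun i hi => h i (by simp [hi]), h j (by simp)]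

section Generator

variable {n : Type} [Fintype n] [DecidableEq n] (P G V : Matrix n n ℂ)

theorem genUpTo_eq_gen {k j : ℕ} (h : j ≤ k) : genUpTo P G V k j = gen P G V j := by
  induction k with
  | zero => rw [Nat.le_zero.1 h]; rfl
  | succ k ih =>
    rcases Nat.lt_or_ge j (k + 1) with h1 | h1
    · rw [genUpTo, Function.update_of_ne h1.ne, ih (by omega)]
    · rw [le_antisymm h h1]; rfl

theorem gen_zero : gen P G V 0 = 0 := rfl

theorem W_congr {S S' : ℕ → Matrix n n ℂ} {k : ℕ} (h : ∀ i ≤ k, S i = S' i) (m : ℕ) :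
    W P V S k m = W P V S' k m := by
  refine Finset.sum_congr rfl fun j hj => nestedComm_congr _ fun i hi => h i ?_
  rw [Finset.mem_filter, Finset.Nat.mem_antidiagonalTuple] at hj
  obtain ⟨x, rfl⟩ := (List.mem_ofFn' _ _).1 hi
  rw [← hj.1]
  exact Finset.single_le_sum (fun _ _ => Nat.zero_le _) (Finset.mem_univ x)

theorem gen_one : gen P G V 1 = L P G V := by
  simp [gen, genUpTo, genStep]

theorem gen_succ {j : ℕ} (hj : 1 ≤ j) :
    gen P G V (j + 1) = L P G (gen P G V j * diagPart P V - diagPart P V * gen P G V j)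
      + ∑ i ∈ Finset.Icc 1 (j / 2), (a (2 * i) : ℂ) • L P G (W P V (gen P G V) j (2 * i)) := by
  conv_lhs => rw [gen, genUpTo, Function.update_self, genStep, if_neg (by omega)]
  simp only [Nat.add_sub_cancel, genUpTo_eq_gen P G V le_rfl]
  congr 1
  refine Finset.sum_congr rfl fun i _ => ?_
  rw [W_congr P V (fun i hi => genUpTo_eq_gen P G V hi)]

end Generator

theorem isNCPoly_nestedComm {S : ℕ → NCFamily} (l : List ℕ)
    (hS : ∀ i ∈ l, IsNCPoly i (S i)) :
    IsNCPoly (l.sum + 1)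
      (fun n _ _ P G V => nestedComm (fun i => S i n P G V) (offDiagPart P V) l) := by
  induction l with
  | nil => simpa [nestedComm] using IsNCPoly.offDiag
  | cons j l ih =>
    have h1 := hS j (by simp)
    have h2 := ih fun i hi => hS i (by simp [hi])
    have h3 := h1.mul h2
    have h4 := h2.mul h1
    rw [show l.sum + 1 + j = j + (l.sum + 1) by ring] at h4
    rw [List.sum_cons, add_assoc]
    exact h3.sub h4

theorem isNCPoly_W {S : ℕ → NCFamily} {k : ℕ} (hS : ∀ i ≤ k, IsNCPoly i (S i)) (m : ℕ) :
    IsNCPoly (k + 1) (fun n _ _ P G V => W P V (fun i => S i n P G V) k m) := by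
  refine IsNCPoly.sum _ fun j hj => ?_
  rw [Finset.mem_filter, Finset.Nat.mem_antidiagonalTuple] at hj
  have := isNCPoly_nestedComm (S := S) (List.ofFn j) fun i hi => hS i (by
    obtain ⟨x, rfl⟩ := (List.mem_ofFn' _ _).1 hi
    rw [← hj.1]
    exact Finset.single_le_sum (fun _ _ => Nat.zero_le _) (Finset.mem_univ x))
  rwa [List.sum_ofFn, hj.1] at this

theorem isNCPoly_gen (j : ℕ) : IsNCPoly j (fun _ _ _ P G V => gen P G V j) := by
  induction j using Nat.strong_induction_on with
  | _ j ih =>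
    rcases j with _ | _ | j
    · simpa only [gen_zero] using IsNCPoly.zero 0
    · simpa only [zero_add, gen_one] using IsNCPoly.pert.applyL
    · simp only [gen_succ _ _ _ (Nat.le_add_left 1 j)]
      have h1 := ih (j + 1) (by omega)
      have h2 := h1.mul IsNCPoly.diag
      have h3 := IsNCPoly.diag.mul h1
      rw [add_comm 1] at h3
      refine (h2.sub h3).applyL.add (IsNCPoly.sum _ fun i _ => ?_)
      exact (isNCPoly_W (S := fun i _ _ _ P G V => gen P G V i)
        (fun i hi => ih i (by omega)) (2 * i)).applyL.ratSmul _

/-- Every term of the recursion is of the form 𝓛(X) = (GX)P - P(XG). So a nested commutator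
multiplies at least three such factors once it has length two, and some `P` must end up between two
powers of V. -/
theorem isEnd_gen {j : ℕ} (hj : 1 ≤ j) : IsEnd j (fun _ _ _ P G V => gen P G V j) := by
  obtain ⟨j, rfl⟩ : ∃ i, j = i + 1 := ⟨j - 1, by omega⟩
  rcases j with _ | j
  · simpa only [zero_add, gen_one] using IsEnd.applyL IsNCPoly.pert le_rfl
  · simp only [gen_succ _ _ _ (Nat.le_add_left 1 j)]
    have h1 := isNCPoly_gen (j + 1)
    have h2 := h1.mul IsNCPoly.diag
    have h3 := IsNCPoly.diag.mul h1
    rw [add_comm 1] at h3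
    have h4 := IsNCPoly.sum (Finset.Icc 1 ((j + 1) / 2)) (k := j + 1 + 1)
      (f := fun i _ _ _ P G V => (a (2 * i) : ℂ) • W P V (gen P G V) (j + 1) (2 * i))
      fun i _ => (isNCPoly_W (S := fun i _ _ _ P G V => gen P G V i)
        (fun i _ => isNCPoly_gen i) (2 * i)).ratSmul _
    have h5 := IsEnd.applyL ((h2.sub h3).add h4) (by omega)
    convert h5 using 7 with n _ _ P G V
    simp only [L, mul_add, add_mul, Finset.mul_sum, Finset.sum_mul, Matrix.mul_smul,
      Matrix.smul_mul, smul_sub, Finset.sum_sub_distrib]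
    abel

theorem isNCPoly_Vcoeff {j : ℕ} (hj : 1 ≤ j) : IsNCPoly j (fun _ _ _ P G V => Vcoeff P G V j) := by
  unfold Vcoeff
  by_cases h : j = 1
  · subst h; simpa using IsNCPoly.pert
  · simp only [h, if_false]
    refine IsNCPoly.sum _ fun i _ => IsNCPoly.ratSmul _ ?_
    have := isNCPoly_W (S := fun i _ _ _ P G V => gen P G V i) (k := j - 1)
      (fun i _ => isNCPoly_gen i) (2 * i - 1)
    rwa [Nat.sub_add_cancel hj] at this

/-- Nested commutators of length at least two pass through `P`. -/
theorem isThru_nestedComm : ∀ (l : List ℕ), 2 ≤ l.length → (∀ i ∈ l, 1 ≤ i) →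
    IsThru (l.sum + 1)
      (fun _ _ _ P G V => nestedComm (gen P G V) (offDiagPart P V) l)
  | [], h, _ => by simp at h
  | [_], h, _ => by simp at h
  | [i, j], _, h => by
    have hi := isEnd_gen (h i (by simp))
    have hj := isEnd_gen (h j (by simp))
    have hV := IsEnd.offDiag
    have h1 := hi.isThru_mul hj hV.isNCPoly.1 le_rfl
    have h2 := hi.isThru_mul hV hj.isNCPoly.1 hj.isNCPoly.2
    have h3 := hj.isThru_mul hV hi.isNCPoly.1 hi.isNCPoly.2
    have h4 := hV.isThru_mul hj hi.isNCPoly.1 hi.isNCPoly.2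
    rw [show i + 1 + j = i + j + 1 by ring] at h2
    rw [show j + 1 + i = i + j + 1 by ring] at h3
    rw [show 1 + j + i = i + j + 1 by ring] at h4
    have := (h1.sub h2).sub (h3.sub h4)
    simp only [List.sum_cons, List.sum_nil, add_zero]
    convert this using 7 with n _ _ P G V
    simp only [nestedComm]
    noncomm_ring
  | i :: j :: j' :: l, _, h => by
    have ih := isThru_nestedComm (j :: j' :: l) (by simp) fun x hx => h x (by simp [hx])
    have hi := isNCPoly_gen i
    have h1 := ih.mul_left hi
    have h2 := ih.mul_right hi
    rw [add_comm _ i] at h2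
    have := h1.sub h2
    rw [List.sum_cons, add_assoc]
    exact this

theorem isThru_W (k : ℕ) {m : ℕ} (hm : 2 ≤ m) :
    IsThru (k + 1) (fun _ _ _ P G V => W P V (gen P G V) k m) := by
  refine IsThru.sum _ fun j hj => ?_
  rw [Finset.mem_filter, Finset.Nat.mem_antidiagonalTuple] at hj
  have := isThru_nestedComm (List.ofFn j) (by simpa using hm) fun i hi => by
    obtain ⟨x, rfl⟩ := (List.mem_ofFn' _ _).1 hi
    exact hj.2 x
  rwa [List.sum_ofFn, hj.1] at this

end SchriefferWolff

namespace SchriefferWolff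

/-! ### The leading terms -/

section Leading

variable {n : Type} [Fintype n] [DecidableEq n] {P G V : Matrix n n ℂ}

theorem diagPart_mul_proj (hP : P * P = P) (V : Matrix n n ℂ) : diagPart P V * P = P * V * P := by
  have h : (1 - P) * P = 0 := by rw [sub_mul, one_mul, hP, sub_self]
  rw [diagPart, add_mul, mul_assoc _ P P, hP, mul_assoc _ (1 - P) P, h, mul_zero, add_zero]

theorem proj_mul_diagPart (hP : P * P = P) (V : Matrix n n ℂ) : P * diagPart P V = P * V * P := by
  have h : P * (1 - P) = 0 := by rw [mul_sub, mul_one, hP, sub_self]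
  rw [diagPart, mul_add, ← mul_assoc, ← mul_assoc, hP, ← mul_assoc, ← mul_assoc, h, zero_mul,
    zero_mul, add_zero]

theorem commute_diagPart (hP : P * P = P) (V : Matrix n n ℂ) : Commute P (diagPart P V) := by
  rw [Commute, SemiconjBy, diagPart_mul_proj hP, proj_mul_diagPart hP]

theorem res_mul_diagPart (hGP : G * P = 0) (V : Matrix n n ℂ) :
    G * diagPart P V = G * V - G * V * P := by
  have h : G * (1 - P) = G := by rw [mul_sub, hGP]; simp
  rw [diagPart, mul_add, ← mul_assoc, ← mul_assoc, hGP, ← mul_assoc, ← mul_assoc, h]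
  noncomm_ring

theorem diagPart_mul_res (hPG : P * G = 0) (V : Matrix n n ℂ) :
    diagPart P V * G = V * G - P * V * G := by
  rw [diagPart, add_mul, mul_assoc, hPG, mul_assoc _ _ G, sub_mul 1 P G, hPG]
  noncomm_ring

/-- One step of the recursion, on the leading terms. -/
theorem L_commutator_lead (hP : P * P = P) (hPG : P * G = 0) (hGP : G * P = 0) {j : ℕ}
    (hj : 1 ≤ j) :
    L P G (((G * V) ^ j * P - P * (V * G) ^ j) * diagPart P V -
        diagPart P V * ((G * V) ^ j * P - P * (V * G) ^ j)) =
      -((G * V) ^ (j + 1) * P - P * (V * G) ^ (j + 1)) +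
        (G * (G * V) ^ j * P * (V * P) - P * V * P * ((V * G) ^ j * G)) := by
  have hA : P * (G * V) ^ j = 0 := by
    obtain ⟨i, rfl⟩ : ∃ i, j = i + 1 := ⟨j - 1, by omega⟩
    rw [pow_succ', ← mul_assoc, ← mul_assoc, hPG]; simp
  have hB : (V * G) ^ j * P = 0 := by
    obtain ⟨i, rfl⟩ : ∃ i, j = i + 1 := ⟨j - 1, by omega⟩
    rw [pow_succ, mul_assoc, mul_assoc, hGP]; simp
  have d1 := diagPart_mul_proj hP V
  have d2 := proj_mul_diagPart hP V
  have d3 := res_mul_diagPart hGP V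
  have d4 := diagPart_mul_res hPG V
  set D := diagPart P V
  set A := (G * V) ^ j
  set B := (V * G) ^ j
  have t1 : G * (A * P * D) * P = G * A * P * (V * P) := by
    rw [mul_assoc A, d2]
    simp only [mul_assoc, hP]
  have t2 : G * (P * B * D) * P = 0 := by
    rw [← mul_assoc, ← mul_assoc, hGP]; simp
  have t3 : G * (D * (A * P)) * P = (G * V) ^ (j + 1) * P := by
    calc G * (D * (A * P)) * P = G * D * A * (P * P) := by simp only [mul_assoc]
      _ = G * V * A * P - G * V * (P * A) * P := by rw [hP, d3, sub_mul, sub_mul]; simp only [mul_assoc]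
      _ = _ := by rw [hA, pow_succ']; simp [A]
  have t4 : G * (D * (P * B)) * P = 0 := by
    calc G * (D * (P * B)) * P = G * D * P * (B * P) := by simp only [mul_assoc]
      _ = 0 := by rw [hB, mul_zero]
  have t5 : P * (A * P * D) * G = 0 := by
    rw [← mul_assoc, ← mul_assoc, hA]; simp
  have t6 : P * (P * B * D) * G = P * (V * G) ^ (j + 1) := by
    calc P * (P * B * D) * G = P * P * B * (D * G) := by simp only [mul_assoc]
      _ = P * (B * (V * G)) - P * (B * P) * V * G := by
        rw [hP, d4, mul_sub]; simp only [mul_assoc]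
      _ = _ := by rw [hB, pow_succ]; simp [B]
  have t7 : P * (D * (A * P)) * G = 0 := by
    calc P * (D * (A * P)) * G = P * D * A * (P * G) := by simp only [mul_assoc]
      _ = 0 := by rw [hPG, mul_zero]
  have t8 : P * (D * (P * B)) * G = P * V * P * (B * G) := by
    calc P * (D * (P * B)) * G = P * (D * P) * (B * G) := by simp only [mul_assoc]
      _ = _ := by rw [d1]; simp only [← mul_assoc, hP]
  rw [L]
  have e1 : G * ((A * P - P * B) * D - D * (A * P - P * B)) * P =
      G * (A * P * D) * P - G * (P * B * D) * P - G * (D * (A * P)) * P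
        + G * (D * (P * B)) * P := by noncomm_ring
  have e2 : P * ((A * P - P * B) * D - D * (A * P - P * B)) * G =
      P * (A * P * D) * G - P * (P * B * D) * G - P * (D * (A * P)) * G
        + P * (D * (P * B)) * G := by noncomm_ring
  rw [e1, e2, t1, t2, t3, t4, t5, t6, t7, t8]
  abel

end Leading

theorem isNCPoly_pow_res_pert (j : ℕ) : IsNCPoly j (fun _ _ _ _ G V => (G * V) ^ j) := by
  induction j with
  | zero => simpa using IsNCPoly.one
  | succ j ih =>
    simp only [pow_succ]
    simpa only [zero_add] using ih.mul (IsNCPoly.res.mul IsNCPoly.pert)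

theorem isNCPoly_pow_pert_res (j : ℕ) : IsNCPoly j (fun _ _ _ _ G V => (V * G) ^ j) := by
  induction j with
  | zero => simpa using IsNCPoly.one
  | succ j ih =>
    simp only [pow_succ]
    simpa only [add_zero] using ih.mul (IsNCPoly.pert.mul IsNCPoly.res)

/-- In the recursion, [S_j, V_d] contributes the unbroken chains G V ⋯ G V P, because next to a
resolvent V_d acts as V up to an insertion of `P`, which is either annihilated by the chain or gives
a term through `P`. The nested commutators all pass through `P` by `isThru_W`. Each step changes the
sign. -/
theorem gen_lead {j : ℕ} (hj : 1 ≤ j) : ∃ T : NCFamily, IsThru j T ∧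
    ∀ (n : Type) [Fintype n] [DecidableEq n] (P G V : Matrix n n ℂ), P * P = P → P * G = 0 →
      G * P = 0 → gen P G V j =
        (-1 : ℂ) ^ (j - 1) • ((G * V) ^ j * P - P * (V * G) ^ j) + T n P G V := by
  induction j, hj using Nat.le_induction with
  | base =>
    refine ⟨_, IsThru.zero 1, fun n _ _ P G V _ _ _ => ?_⟩
    simp [gen_one, L, mul_assoc]
  | succ j hj ih =>
    obtain ⟨T, hT, h⟩ := ih
    have h1 := (hT.mul_right IsNCPoly.diag)
    have h2 := (hT.mul_left IsNCPoly.diag)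
    rw [add_comm 1] at h2
    have h3 := (h1.sub h2).applyL
    have h4 := IsThru.sum (Finset.Icc 1 (j / 2)) (k := j + 1)
      (f := fun i _ _ _ P G V => (a (2 * i) : ℂ) • L P G (W P V (gen P G V) j (2 * i)))
      fun i hi => (isThru_W j (by have := (Finset.mem_Icc.1 hi).1; omega)).applyL.ratSmul _
    have hx := IsNCPoly.res.mul (isNCPoly_pow_res_pert j)
    rw [zero_add] at hx
    have hy := (isNCPoly_pow_pert_res j).mul IsNCPoly.res
    rw [add_zero] at hy
    have h5 := IsThru.mk hx (by simpa only [add_zero] using IsNCPoly.pert.mul IsNCPoly.proj) hj le_rfl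
    have hpv := IsNCPoly.proj.mul IsNCPoly.pert
    rw [zero_add] at hpv
    have h6 := IsThru.mk hpv hy le_rfl hj
    rw [add_comm 1] at h6
    refine ⟨_, (((h5.sub h6).smul ((-1) ^ (j - 1))).add h3).add h4,
      fun n _ _ P G V hP hPG hGP => ?_⟩
    rw [gen_succ P G V hj, h n P G V hP hPG hGP]
    have e1 : ∀ (c : ℂ) (A T D : Matrix n n ℂ), L P G ((c • A + T) * D - D * (c • A + T)) =
        c • L P G (A * D - D * A) + L P G (T * D - D * T) := by
      intro c A T D
      simp only [L, add_mul, mul_add, Matrix.smul_mul, Matrix.mul_smul, smul_sub, mul_sub, sub_mul]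
      abel
    rw [e1, L_commutator_lead hP hPG hGP hj, smul_add, add_assoc, add_assoc, add_assoc]
    push_cast
    obtain ⟨i, rfl⟩ : ∃ i, j = i + 1 := ⟨j - 1, by omega⟩
    rw [Nat.add_sub_cancel, smul_neg, ← neg_smul, pow_succ (-1 : ℂ) i, mul_neg_one]

/-- The leading term of the coefficient of order `j` is `± P V (G V)^(j-1) P`; all other terms pass
through `P`. -/
theorem Vcoeff_lead {j : ℕ} (hj : 1 ≤ j) : ∃ T : NCFamily, IsThru j T ∧
    ∀ (n : Type) [Fintype n] [DecidableEq n] (P G V : Matrix n n ℂ), P * P = P → P * G = 0 →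
      G * P = 0 → P * Vcoeff P G V j * P =
        (-1 : ℂ) ^ (j - 1) • (P * (V * (G * V) ^ (j - 1)) * P) + T n P G V := by
  by_cases h1 : j = 1
  · subst h1
    exact ⟨_, IsThru.zero 1, fun n _ _ P G V _ _ _ => by simp [Vcoeff]⟩
  obtain ⟨i, rfl⟩ : ∃ i, j = i + 1 := ⟨j - 1, by omega⟩
  have hi : 1 ≤ i := by omega
  obtain ⟨T, hT, h⟩ := gen_lead hi
  have hc : IsThru (i + 1) (fun n _ _ P G V =>
      P * (T n P G V * offDiagPart P V) * P - P * (offDiagPart P V * T n P G V) * P) := by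
    have a1 := ((hT.mul_right IsNCPoly.offDiag).mul_left IsNCPoly.proj).mul_right IsNCPoly.proj
    have a2 := ((hT.mul_left IsNCPoly.offDiag).mul_left IsNCPoly.proj).mul_right IsNCPoly.proj
    rw [zero_add, add_zero] at a1 a2
    rw [add_comm 1] at a2
    exact a1.sub a2
  have hs : IsThru (i + 1) (fun _ _ _ P G V =>
      ∑ x ∈ Finset.Icc 2 ((i + 1) / 2), (b x : ℂ) • (P * W P V (gen P G V) i (2 * x - 1) * P)) := by
    refine IsThru.sum _ fun x hx => IsThru.ratSmul _ ?_
    have := ((isThru_W i (m := 2 * x - 1) (by have := (Finset.mem_Icc.1 hx).1; omega)).mul_left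
      IsNCPoly.proj).mul_right IsNCPoly.proj
    rwa [zero_add, add_zero] at this
  refine ⟨_, (hc.smul (1 / 2)).add hs, fun n _ _ P G V hP hPG hGP => ?_⟩
  have hW : W P V (gen P G V) i 1 =
      gen P G V i * offDiagPart P V - offDiagPart P V * gen P G V i := by
    rw [W, Finset.Nat.antidiagonalTuple_one, Finset.filter_true_of_mem (by simpa using hi)]
    simp [nestedComm]
  -- Only the simple commutator, i = 1, contributes to the leading term; longer ones pass through
  -- `P`. It produces the chain twice with a minus sign, and b₁ = 1/2 compensates the factor two.
  have hb : b 1 = 1 / 2 := by norm_num [b, bernoulli_two, Nat.factorial]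
  have hIcc : Finset.Icc 1 ((i + 1) / 2) = insert 1 (Finset.Icc 2 ((i + 1) / 2)) := by
    ext x; simp only [Finset.mem_Icc, Finset.mem_insert]; omega
  rw [Vcoeff, if_neg (by omega), Nat.add_sub_cancel, hIcc, Finset.sum_insert (by simp), mul_add,
    add_mul, hb, mul_one, show 2 - 1 = 1 from rfl, hW, h n P G V hP hPG hGP, Finset.mul_sum,
    Finset.sum_mul, ← add_assoc]
  simp only [Matrix.mul_smul, Matrix.smul_mul]
  congr 1
  have o1 : P * offDiagPart P V = P * V - P * V * P := by
    have h : P * (1 - P) = 0 := by rw [mul_sub, mul_one, hP, sub_self]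
    rw [offDiagPart, mul_add, ← mul_assoc, ← mul_assoc, hP, ← mul_assoc, ← mul_assoc, h]
    noncomm_ring
  have o2 : offDiagPart P V * P = V * P - P * V * P := by
    have h : (1 - P) * P = 0 := by rw [sub_mul, one_mul, hP, sub_self]
    rw [offDiagPart, add_mul, mul_assoc _ P P, hP, mul_assoc _ (1 - P) P, h]
    noncomm_ring
  have hA : P * (G * V) ^ i = 0 := by
    obtain ⟨i, rfl⟩ : ∃ i', i = i' + 1 := ⟨i - 1, by omega⟩
    rw [pow_succ', ← mul_assoc, ← mul_assoc, hPG]; simp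
  have hB : (V * G) ^ i * P = 0 := by
    obtain ⟨i, rfl⟩ : ∃ i', i = i' + 1 := ⟨i - 1, by omega⟩
    rw [pow_succ, mul_assoc, mul_assoc, hGP]; simp
  have hAB : (V * G) ^ i * V = V * (G * V) ^ i := by
    have : SemiconjBy V (G * V) (V * G) := by rw [SemiconjBy, mul_assoc]
    exact (this.pow_right i).eq.symm
  set D := offDiagPart P V
  set A := (G * V) ^ i
  set B := (V * G) ^ i
  set s := (-1 : ℂ) ^ (i - 1)
  set t := T n P G V
  have e : P * ((s • (A * P - P * B) + t) * D - D * (s • (A * P - P * B) + t)) * P =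
      s • ((P * A) * P * D * P - P * P * B * (D * P) - (P * D) * A * (P * P)
        + P * D * P * (B * P)) + (P * (t * D) * P - P * (D * t) * P) := by
    simp only [add_mul, mul_add, Matrix.smul_mul, Matrix.mul_smul, smul_sub, mul_sub, sub_mul,
      mul_assoc, smul_add]
    abel
  have e2 : P * B * (V * P - P * V * P) = P * (V * A) * P := by
    rw [mul_sub]
    calc P * B * (V * P) - P * B * (P * V * P) = P * (B * V) * P - P * (B * P) * V * P := by
          simp only [mul_assoc]
      _ = _ := by rw [hB, hAB]; simp
  have e3 : (P * V - P * V * P) * A * P = P * (V * A) * P := by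
    rw [sub_mul, sub_mul]
    calc P * V * A * P - P * V * P * A * P = P * (V * A) * P - P * V * (P * A) * P := by
          simp only [mul_assoc]
      _ = _ := by rw [hA]; simp
  rw [e, hA, hB, hP, o1, o2, e2, e3]
  have hs' : (-1 : ℂ) ^ i = -s := by
    simp only [s]
    obtain ⟨i, rfl⟩ : ∃ i', i = i' + 1 := ⟨i - 1, by omega⟩
    rw [pow_succ, Nat.add_sub_cancel, mul_neg_one]
  rw [hs']
  push_cast
  rw [smul_add, smul_smul]
  congr 1
  simp only [zero_mul, mul_zero, zero_sub, add_zero]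
  rw [show -(P * (V * A) * P) - P * (V * A) * P = (-2 : ℂ) • (P * (V * A) * P) by
    rw [neg_smul, two_smul]; abel, smul_smul]
  congr 1
  ring

/-! ### Hermiticity -/

section Hermitian

variable {n : Type} [Fintype n] [DecidableEq n] {P G V : Matrix n n ℂ}

theorem isHermitian_ratSmul {A : Matrix n n ℂ} (q : ℚ) (hA : A.IsHermitian) :
    ((q : ℂ) • A).IsHermitian := by
  rw [Matrix.IsHermitian, Matrix.conjTranspose_smul, hA.eq]
  simp

theorem isHermitian_diagPart (hP : P.IsHermitian) (hV : V.IsHermitian) :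
    (diagPart P V).IsHermitian := by
  rw [Matrix.IsHermitian, diagPart]
  simp [Matrix.conjTranspose_mul, hP.eq, hV.eq, mul_assoc]

theorem isHermitian_offDiagPart (hP : P.IsHermitian) (hV : V.IsHermitian) :
    (offDiagPart P V).IsHermitian := by
  rw [Matrix.IsHermitian, offDiagPart]
  simp [Matrix.conjTranspose_mul, hP.eq, hV.eq, mul_assoc, add_comm]

theorem isHermitian_commutator {S X : Matrix n n ℂ} (hS : S.conjTranspose = -S)
    (hX : X.IsHermitian) : (S * X - X * S).IsHermitian := by
  rw [Matrix.IsHermitian, Matrix.conjTranspose_sub, Matrix.conjTranspose_mul,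
    Matrix.conjTranspose_mul, hX.eq, hS]
  noncomm_ring

theorem isHermitian_nestedComm {S : ℕ → Matrix n n ℂ} {X : Matrix n n ℂ} (hX : X.IsHermitian)
    (l : List ℕ) (hS : ∀ i ∈ l, (S i).conjTranspose = -S i) : (nestedComm S X l).IsHermitian := by
  induction l with
  | nil => exact hX
  | cons j l ih =>
    exact isHermitian_commutator (hS j (by simp)) (ih fun i hi => hS i (by simp [hi]))

theorem isHermitian_sum {ι : Type*} (s : Finset ι) {f : ι → Matrix n n ℂ}
    (h : ∀ i ∈ s, (f i).IsHermitian) : (∑ i ∈ s, f i).IsHermitian := by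
  rw [Matrix.IsHermitian, Matrix.conjTranspose_sum]
  exact Finset.sum_congr rfl fun i hi => (h i hi).eq

theorem isHermitian_W (hP : P.IsHermitian) (hV : V.IsHermitian) {S : ℕ → Matrix n n ℂ} {k : ℕ}
    (hS : ∀ i ≤ k, (S i).conjTranspose = -S i) (m : ℕ) : (W P V S k m).IsHermitian := by
  refine isHermitian_sum _ fun j hj => isHermitian_nestedComm (isHermitian_offDiagPart hP hV) _
    fun i hi => hS i ?_
  rw [Finset.mem_filter, Finset.Nat.mem_antidiagonalTuple] at hj
  obtain ⟨x, rfl⟩ := (List.mem_ofFn' _ _).1 hi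
  rw [← hj.1]
  exact Finset.single_le_sum (fun _ _ => Nat.zero_le _) (Finset.mem_univ x)

theorem conjTranspose_L (hP : P.IsHermitian) (hG : G.IsHermitian) {X : Matrix n n ℂ}
    (hX : X.IsHermitian) : (L P G X).conjTranspose = -L P G X := by
  rw [L, Matrix.conjTranspose_sub]
  simp only [Matrix.conjTranspose_mul, hP.eq, hG.eq, hX.eq, mul_assoc, neg_sub]

theorem conjTranspose_gen (hP : P.IsHermitian) (hG : G.IsHermitian) (hV : V.IsHermitian) (j : ℕ) :
    (gen P G V j).conjTranspose = -gen P G V j := by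
  induction j using Nat.strong_induction_on with
  | _ j ih =>
    rcases j with _ | _ | j
    · simp [gen_zero]
    · rw [zero_add, gen_one]; exact conjTranspose_L hP hG hV
    · rw [gen_succ _ _ _ (Nat.le_add_left 1 j), Matrix.conjTranspose_add, neg_add,
        conjTranspose_L hP hG
          (isHermitian_commutator (ih _ (by omega)) (isHermitian_diagPart hP hV)),
        Matrix.conjTranspose_sum, ← Finset.sum_neg_distrib]
      congr 1
      refine Finset.sum_congr rfl fun i _ => ?_
      rw [Matrix.conjTranspose_smul, conjTranspose_L hP hG
        (isHermitian_W hP hV (fun i hi => ih i (by omega)) _)]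
      simp

theorem isHermitian_Vcoeff (hP : P.IsHermitian) (hG : G.IsHermitian) (hV : V.IsHermitian) (j : ℕ) :
    (Vcoeff P G V j).IsHermitian := by
  rw [Vcoeff]
  split_ifs
  · exact hV
  · exact isHermitian_sum _ fun i _ => isHermitian_ratSmul _
      (isHermitian_W hP hV (fun i _ => conjTranspose_gen hP hG hV i) _)

end Hermitian

end SchriefferWolff

namespace SchriefferWolff

open PowerSeries

/-! ### Additivity of the effective Hamiltonian over independent systems -/

/-- Power series modulo `X ^ N`. -/
def truncCon (A : Type*) [Ring A] (N : ℕ) : RingCon A⟦X⟧ where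
  r f g := ∀ k < N, coeff k f = coeff k g
  iseqv := ⟨fun _ _ _ => rfl, fun h k hk => (h k hk).symm,
    fun h h' k hk => (h k hk).trans (h' k hk)⟩
  add' := fun h h' k hk => by rw [map_add, map_add, h k hk, h' k hk]
  mul' := fun h h' k hk => by
    rw [coeff_mul, coeff_mul]
    refine Finset.sum_congr rfl fun x hx => ?_
    rw [Finset.HasAntidiagonal.mem_antidiagonal] at hx
    rw [h _ (by omega), h' _ (by omega)]

theorem truncCon_eq {A : Type*} [Ring A] {N : ℕ} {f g : A⟦X⟧} :
    (truncCon A N).mk' f = (truncCon A N).mk' g ↔ ∀ k < N, coeff k f = coeff k g :=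
  RingCon.eq (truncCon A N)

/-! ### The recursion for the generator as an equation between power series -/

section Series

variable {n : Type} [Fintype n] [DecidableEq n]

theorem nestedComm_eq_zero {S : ℕ → Matrix n n ℂ} (hS : S 0 = 0) (X : Matrix n n ℂ) {l : List ℕ}
    (h : 0 ∈ l) : nestedComm S X l = 0 := by
  induction l with
  | nil => simp at h
  | cons j l ih =>
    rcases List.mem_cons.1 h with h | h
    · subst h; simp [nestedComm, hS]
    · simp [nestedComm, ih h]

/-- With S₀ = 0 the restriction to indices at least one is automatic, and the sum becomes a
coefficient of a product of power series. -/
theorem W_eq_sum (P V : Matrix n n ℂ) {S : ℕ → Matrix n n ℂ} (hS : S 0 = 0) (k m : ℕ) :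
    W P V S k m = ∑ j ∈ Finset.Nat.antidiagonalTuple m k,
      nestedComm S (offDiagPart P V) (List.ofFn j) := by
  refine Finset.sum_filter_of_ne fun j _ hj i => ?_
  by_contra hi
  refine hj (nestedComm_eq_zero hS _ ?_)
  rw [List.mem_ofFn']
  exact ⟨i, by omega⟩

theorem W_zero (P V : Matrix n n ℂ) (S : ℕ → Matrix n n ℂ) (k : ℕ) :
    W P V S k 0 = if k = 0 then offDiagPart P V else 0 := by
  cases k <;> simp [W, nestedComm]

theorem W_succ (P V : Matrix n n ℂ) {S : ℕ → Matrix n n ℂ} (hS : S 0 = 0) (k m : ℕ) :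
    W P V S k (m + 1) = ∑ x ∈ Finset.HasAntidiagonal.antidiagonal k,
      (S x.1 * W P V S x.2 m - W P V S x.2 m * S x.1) := by
  simp only [W_eq_sum P V hS, Finset.mul_sum, Finset.sum_mul, ← Finset.sum_sub_distrib]
  rw [Finset.sum_sigma']
  refine Finset.sum_bij' (fun j _ => ⟨(j 0, ∑ i, j (Fin.succ i)), Fin.tail j⟩)
    (fun x _ => Fin.cons x.1.1 x.2) ?_ ?_ ?_ ?_ ?_
  · intro j hj
    rw [Finset.Nat.mem_antidiagonalTuple, Fin.sum_univ_succ] at hj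
    simp [Finset.Nat.mem_antidiagonalTuple, hj, Fin.tail]
  · rintro ⟨⟨i, i'⟩, j⟩ hx
    simp only [Finset.mem_sigma, Finset.HasAntidiagonal.mem_antidiagonal, Finset.Nat.mem_antidiagonalTuple] at hx
    simp [Finset.Nat.mem_antidiagonalTuple, Fin.sum_univ_succ, hx]
  · intro j _
    exact Fin.cons_self_tail j
  · rintro ⟨⟨i, i'⟩, j⟩ hx
    simp only [Finset.mem_sigma, Finset.HasAntidiagonal.mem_antidiagonal, Finset.Nat.mem_antidiagonalTuple] at hx
    obtain ⟨-, rfl⟩ := hx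
    simp
  · intro j _
    rw [List.ofFn_succ, nestedComm]
    rfl

theorem W_eq_zero (P V : Matrix n n ℂ) {S : ℕ → Matrix n n ℂ} {k m : ℕ} (h : k < m) :
    W P V S k m = 0 := by
  refine Finset.sum_eq_zero fun j hj => ?_
  rw [Finset.mem_filter, Finset.Nat.mem_antidiagonalTuple] at hj
  exfalso
  have : ∑ _i : Fin m, 1 ≤ ∑ i, j i := Finset.sum_le_sum fun i _ => hj.2 i
  simp at this
  omega

variable (P G V : Matrix n n ℂ)

/-- The generator as a formal power series. -/
noncomputable def genSeries : (Matrix n n ℂ)⟦X⟧ := mk (gen P G V)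

/-- This translates the sums over compositions in the definition of the expansion into powers of the
commutator with a single power series. -/
theorem coeff_adj_pow (m k : ℕ) :
    coeff k ((adj (genSeries P G V) ^ m) (C (offDiagPart P V))) = W P V (gen P G V) k m := by
  induction m generalizing k with
  | zero => rw [W_zero, pow_zero, Module.End.one_apply, coeff_C]
  | succ m ih =>
    rw [pow_succ', Module.End.mul_apply, adj_apply, map_sub, coeff_mul, coeff_mul,
      W_succ P V (gen_zero P G V), Finset.sum_sub_distrib]
    congr 1
    · exact Finset.sum_congr rfl fun x _ => by rw [ih, genSeries, coeff_mk]
    · rw [← Finset.Nat.sum_antidiagonal_swap]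
      exact Finset.sum_congr rfl fun x _ => by
        rw [Prod.fst_swap, Prod.snd_swap, ih, genSeries, coeff_mk]

theorem sum_cothSeries (N j : ℕ) (hj : j < N) (w : ℕ → Matrix n n ℂ) (hw : ∀ i, j < i → w i = 0) :
    ∑ i ∈ Finset.range N, coeff i cothSeries • w i =
      w 0 + ∑ i ∈ Finset.Icc 1 (j / 2), (a (2 * i) : ℂ) • w (2 * i) := by
  have h0 : a 0 = 1 := by simp [a]
  have h1 : ∑ i ∈ Finset.range N, coeff i cothSeries • w i =
      ∑ i ∈ (Finset.range (j / 2 + 1)).image (2 * ·), coeff i cothSeries • w i := by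
    symm
    refine Finset.sum_subset ?_ fun i _ hi => ?_
    · intro i hi
      simp only [Finset.mem_image, Finset.mem_range] at hi ⊢
      obtain ⟨x, hx, rfl⟩ := hi
      omega
    · by_cases hij : j < i
      · rw [hw i hij, smul_zero]
      · rw [cothSeries, coeff_mk, if_neg, zero_smul]
        rintro ⟨x, rfl⟩
        refine hi (Finset.mem_image.2 ⟨x, Finset.mem_range.2 (by omega), by ring⟩)
  rw [h1, Finset.sum_image (fun x _ y _ h => by simpa using h), Finset.range_eq_Ico,
    Finset.sum_eq_sum_Ico_succ_bot (by omega)]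
  congr 1
  · simp [cothSeries, h0]
  · refine Finset.sum_congr rfl fun i _ => ?_
    rw [cothSeries, coeff_mk, if_pos (even_two_mul i), Rat.cast_smul_eq_qsmul]

theorem sum_tanhSeries (N j : ℕ) (hj : j < N) (w : ℕ → Matrix n n ℂ) (hw : ∀ i, j < i → w i = 0) :
    ∑ i ∈ Finset.range N, coeff i tanhSeries • w i =
      ∑ i ∈ Finset.Icc 1 ((j + 1) / 2), (b i : ℂ) • w (2 * i - 1) := by
  have h1 : ∑ i ∈ Finset.range N, coeff i tanhSeries • w i =
      ∑ i ∈ (Finset.Icc 1 ((j + 1) / 2)).image (2 * · - 1), coeff i tanhSeries • w i := by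
    symm
    refine Finset.sum_subset ?_ fun i _ hi => ?_
    · intro i hi
      simp only [Finset.mem_image, Finset.mem_range, Finset.mem_Icc] at hi ⊢
      obtain ⟨x, hx, rfl⟩ := hi
      omega
    · by_cases hij : j < i
      · rw [hw i hij, smul_zero]
      · rw [tanhSeries, coeff_mk, if_neg, zero_smul]
        rintro ⟨x, rfl⟩
        refine hi (Finset.mem_image.2 ⟨x + 1, Finset.mem_Icc.2 (by omega), by omega⟩)
  rw [h1, Finset.sum_image (fun x hx y hy h => by
    have hx := (Finset.mem_Icc.1 hx).1
    have hy := (Finset.mem_Icc.1 hy).1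
    omega)]
  refine Finset.sum_congr rfl fun i hi => ?_
  have hi := (Finset.mem_Icc.1 hi).1
  rw [tanhSeries, coeff_mk, if_pos ⟨i - 1, by omega⟩, Rat.cast_smul_eq_qsmul,
    show (2 * i - 1 + 1) / 2 = i by omega]

variable (N : ℕ)

/-- The ring of matrix-valued power series modulo `X ^ N`. -/
abbrev TruncRing (n : Type) [Fintype n] [DecidableEq n] (N : ℕ) : Type :=
  (truncCon (Matrix n n ℂ) N).Quotient

/-- The projection to the truncated power series. -/
noncomputable def toTrunc : (Matrix n n ℂ)⟦X⟧ →+* TruncRing n N := (truncCon _ N).mk'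

theorem toTrunc_eq {N : ℕ} {f g : (Matrix n n ℂ)⟦X⟧} :
    toTrunc N f = toTrunc N g ↔ ∀ k < N, coeff k f = coeff k g := truncCon_eq

theorem toTrunc_surjective : Function.Surjective (toTrunc (n := n) N) :=
  RingCon.mk'_surjective _

theorem toTrunc_X_pow : (toTrunc (n := n) N X) ^ N = 0 := by
  rw [← map_pow, ← map_zero (toTrunc N), toTrunc_eq]
  intro k hk
  rw [coeff_X_pow, if_neg hk.ne, map_zero]

theorem toTrunc_X_commute (x : TruncRing n N) : Commute (toTrunc N X) x := by
  obtain ⟨f, rfl⟩ := toTrunc_surjective N x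
  exact ((commute_X f).symm).map (toTrunc N)

theorem toTrunc_adj_pow (f g : (Matrix n n ℂ)⟦X⟧) (m : ℕ) :
    (adj (toTrunc N f) ^ m) (toTrunc N g) = toTrunc N ((adj f ^ m) g) := by
  induction m with
  | zero => rfl
  | succ m ih =>
    rw [pow_succ', Module.End.mul_apply, ih, pow_succ', Module.End.mul_apply, adj_apply, adj_apply,
      map_sub, map_mul, map_mul]

theorem genSeries_eq : ∃ s, genSeries P G V = X * s := by
  refine ⟨mk fun k => gen P G V (k + 1), ?_⟩
  ext1 k
  cases k with
  | zero => simp [genSeries, gen_zero]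
  | succ k => rw [coeff_succ_X_mul, genSeries, coeff_mk, coeff_mk]

theorem toTrunc_genSeries_pow : (toTrunc N (genSeries P G V)) ^ N = 0 := by
  obtain ⟨s, hs⟩ := genSeries_eq P G V
  rw [hs, map_mul, (toTrunc_X_commute N _).mul_pow, toTrunc_X_pow, zero_mul]

theorem adj_X_mul (s y : (Matrix n n ℂ)⟦X⟧) (m : ℕ) : (adj s ^ m) (X * y) = X * (adj s ^ m) y := by
  induction m with
  | zero => rfl
  | succ m ih =>
    rw [pow_succ', Module.End.mul_apply, ih, Module.End.mul_apply, adj_apply, adj_apply, mul_sub,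
      mul_assoc, ← mul_assoc s, (commute_X s).eq, mul_assoc]

/-- The generator is divisible by the central variable, so the m-th power of its commutator is
divisible by the m-th power of the variable. -/
theorem toTrunc_genSeries_adj_pow : (adj (toTrunc N (genSeries P G V))) ^ N = 0 := by
  obtain ⟨s, hs⟩ := genSeries_eq P G V
  have key : ∀ m (y : TruncRing n N), (adj (toTrunc N (genSeries P G V)) ^ m) y =
      toTrunc N X ^ m * (adj (toTrunc N s) ^ m) y := by
    intro m
    induction m with
    | zero => simp
    | succ m ih =>
      intro y
      have hx := (toTrunc_X_commute N (toTrunc N s))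
      rw [pow_succ', Module.End.mul_apply, ih, pow_succ' (adj (toTrunc N s)), Module.End.mul_apply,
        adj_apply, adj_apply, hs, map_mul]
      set e := toTrunc (n := n) N X
      have he : ∀ x, Commute e x := toTrunc_X_commute N
      set z := (adj (toTrunc N s) ^ m) y
      have h1 : e * toTrunc N s * (e ^ m * z) = e ^ (m + 1) * (toTrunc N s * z) := by
        rw [mul_assoc, ← mul_assoc _ (e ^ m), ← ((he (toTrunc N s)).pow_left m).eq, pow_succ']
        simp only [mul_assoc]
      have h2 : e ^ m * z * (e * toTrunc N s) = e ^ (m + 1) * (z * toTrunc N s) := by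
        rw [mul_assoc, ← mul_assoc z, ← (he z).eq, pow_succ]
        simp only [mul_assoc]
      rw [h1, h2, mul_sub]
  ext y
  rw [key, toTrunc_X_pow, zero_mul, LinearMap.zero_apply]

theorem psEval_adj_toTrunc (f : ℚ⟦X⟧) :
    psEval (adj (toTrunc N (genSeries P G V))) f
        (toTrunc N X * toTrunc N (C (offDiagPart P V))) =
      toTrunc N (X * ∑ i ∈ Finset.range N,
        coeff i f • (adj (genSeries P G V) ^ i) (C (offDiagPart P V))) := by
  rw [psEval_eq_sum (toTrunc_genSeries_adj_pow P G V N), LinearMap.sum_apply, Finset.mul_sum,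
    map_sum, ← map_mul]
  refine Finset.sum_congr rfl fun i _ => ?_
  rw [LinearMap.smul_apply, toTrunc_adj_pow, adj_X_mul, mul_smul_comm, map_rat_smul]

theorem coeff_sum_adj (f : ℚ⟦X⟧) (j : ℕ) :
    coeff j (∑ i ∈ Finset.range N,
      coeff i f • (adj (genSeries P G V) ^ i) (C (offDiagPart P V))) =
      ∑ i ∈ Finset.range N, coeff i f • W P V (gen P G V) j i := by
  rw [map_sum]
  refine Finset.sum_congr rfl fun i _ => ?_
  rw [← coeff_adj_pow]
  exact map_rat_smul (coeff j) _ _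

end Series

/-- `H` is a Hamiltonian with zero-energy projection `P` and reduced resolvent `G`. -/
structure IsResolvent {A : Type*} [Ring A] (P H G : A) : Prop where
  idem : P * P = P
  PG : P * G = 0
  GP : G * P = 0
  HP : H * P = 0
  PH : P * H = 0
  HG : H * G = 1 - P
  GH : G * H = 1 - P

section Additivity

variable {n : Type} [Fintype n] [DecidableEq n] {P H G V : Matrix n n ℂ}

theorem L_offDiagPart (h : IsResolvent P H G) : L P G (offDiagPart P V) = L P G V := by
  have h1 : (1 - P) * P = 0 := by rw [sub_mul, one_mul, h.idem, sub_self]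
  have h2 : P * (1 - P) = 0 := by rw [mul_sub, mul_one, h.idem, sub_self]
  have h3 : G * (1 - P) = G := by rw [mul_sub, h.GP, mul_one, sub_zero]
  have h4 : (1 - P) * G = G := by rw [sub_mul, h.PG, one_mul, sub_zero]
  have e1 : G * offDiagPart P V * P = G * V * P := by
    calc G * offDiagPart P V * P
        = G * P * V * ((1 - P) * P) + G * (1 - P) * V * (P * P) := by
          rw [offDiagPart]; noncomm_ring
      _ = _ := by rw [h1, h3, h.idem]; simp
  have e2 : P * offDiagPart P V * G = P * V * G := by
    calc P * offDiagPart P V * G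
        = P * P * V * ((1 - P) * G) + P * (1 - P) * V * (P * G) := by
          rw [offDiagPart]; noncomm_ring
      _ = _ := by rw [h2, h4, h.idem]; simp
  rw [L, L, e1, e2]

theorem isOff_offDiagPart (hP : P * P = P) : IsOff P (offDiagPart P V) := by
  have h1 : (1 - P) * P = 0 := by rw [sub_mul, one_mul, hP, sub_self]
  have h2 : P * (1 - P) = 0 := by rw [mul_sub, mul_one, hP, sub_self]
  have e1 : P * offDiagPart P V = P * V * (1 - P) := by
    calc P * offDiagPart P V = P * P * V * (1 - P) + P * (1 - P) * V * P := by
          rw [offDiagPart]; noncomm_ring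
      _ = _ := by rw [hP, h2]; simp
  have e2 : offDiagPart P V * P = (1 - P) * V * P := by
    calc offDiagPart P V * P = P * V * ((1 - P) * P) + (1 - P) * V * (P * P) := by
          rw [offDiagPart]; noncomm_ring
      _ = _ := by rw [hP, h1]; simp
  rw [IsOff, e1, e2, offDiagPart]

/-- Comparing coefficients in S = 𝓛([S, xV_d] + (ad S) coth(ad S)(xV_od)) gives exactly the
recursion for the S_j. Modulo x^N the generator is nilpotent, so the algebra above applies. -/
theorem isGenerator_genSeries (h : IsResolvent P H G) (N : ℕ) :
    IsGenerator (toTrunc N (C P)) (toTrunc N (C H)) (toTrunc N (C G))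
      (toTrunc N X * toTrunc N (C (diagPart P V))) (toTrunc N X * toTrunc N (C (offDiagPart P V)))
      (toTrunc N (genSeries P G V)) := by
  refine ⟨?_, ?_, ?_, ?_, ?_, ?_, ?_, ?_, ?_, ⟨N, toTrunc_genSeries_pow P G V N⟩, ?_⟩
  · rw [← map_mul, ← map_mul, h.idem]
  · rw [← map_mul, ← map_mul, h.PG, map_zero, map_zero]
  · rw [← map_mul, ← map_mul, h.GP, map_zero, map_zero]
  · rw [← map_mul, ← map_mul, h.HP, map_zero, map_zero]
  · rw [← map_mul, ← map_mul, h.PH, map_zero, map_zero]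
  · rw [← map_mul, ← map_mul, h.HG]; simp
  · rw [← map_mul, ← map_mul, h.GH]; simp
  · refine (toTrunc_X_commute N _).symm.mul_right ?_
    exact ((commute_diagPart h.idem V).map C).map (toTrunc N)
  · refine IsOff.commute_mul ?_ (toTrunc_X_commute N _).symm
    have := isOff_offDiagPart (V := V) h.idem
    rw [IsOff] at this ⊢
    simp only [← map_mul, ← map_add, this]
  · refine ⟨_, rfl, ?_⟩
    rw [psEval_adj_toTrunc]
    set Y₀ := ∑ i ∈ Finset.range N,
      coeff i cothSeries • (adj (genSeries P G V) ^ i) (C (offDiagPart P V)) with hY₀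
    set s := genSeries P G V with hs
    set D := diagPart P V with hD
    have hY : toTrunc N s * (toTrunc N X * toTrunc N (C D))
          - toTrunc N X * toTrunc N (C D) * toTrunc N s + toTrunc N (X * Y₀) =
        toTrunc N (X * (s * C D - C D * s + Y₀)) := by
      simp only [← map_mul, ← map_sub, ← map_add]
      congr 1
      rw [← mul_assoc s, (commute_X s).eq, mul_add, mul_sub]
      simp only [mul_assoc]
    have hR : C G * (X * (s * C D - C D * s + Y₀)) * C P - C P * (X * (s * C D - C D * s + Y₀)) * C G
        = X * (C G * (s * C D - C D * s + Y₀) * C P - C P * (s * C D - C D * s + Y₀) * C G) := by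
      rw [← mul_assoc (C G), (commute_X (C G)).eq, ← mul_assoc (C P), (commute_X (C P)).eq, mul_sub]
      simp only [mul_assoc]
    rw [hY]
    simp only [← map_mul, ← map_sub]
    rw [hR, toTrunc_eq]
    intro k hk
    cases k with
    | zero => simp [hs, genSeries, gen_zero]
    | succ j =>
      rw [coeff_succ_X_mul, map_sub, coeff_mul_C, coeff_C_mul, coeff_mul_C, coeff_C_mul, map_add,
        map_sub, coeff_mul_C, coeff_C_mul, hY₀, coeff_sum_adj,
        sum_cothSeries N j (by omega) _ (fun i hi => W_eq_zero P V hi), hs, genSeries, coeff_mk,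
        coeff_mk, W_zero]
      -- At first order the series yields 𝓛(V_od), the recursion 𝓛(V); they agree because 𝓛
      -- annihilates the diagonal part. At higher orders the constant term 1 of x coth x contributes
      -- nothing.
      rcases Nat.eq_zero_or_pos j with rfl | hj
      · have := L_offDiagPart (V := V) h
        simp only [L] at this
        simp [gen_zero, gen_one, this, L]
      · rw [gen_succ P G V hj, if_neg (by omega), zero_add, mul_add, add_mul, mul_add, add_mul, L]
        simp only [L, smul_sub, Finset.sum_sub_distrib, Finset.mul_sum, Finset.sum_mul,
          Matrix.mul_smul, Matrix.smul_mul]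
        abel

/-- The block-diagonal form of the Hamiltonian as a formal power series. -/
noncomputable def conjSeries (P H G V : Matrix n n ℂ) (N : ℕ) : (Matrix n n ℂ)⟦X⟧ :=
  C H + X * C (diagPart P V) + X * ∑ i ∈ Finset.range N,
    coeff i tanhSeries • (adj (genSeries P G V) ^ i) (C (offDiagPart P V))

theorem coeff_conjSeries (h : IsResolvent P H G) {N j : ℕ} (hj : 1 ≤ j) (hN : j < N) :
    P * coeff j (conjSeries P H G V N) * P = P * Vcoeff P G V j * P := by
  obtain ⟨j, rfl⟩ : ∃ i, j = i + 1 := ⟨j - 1, by omega⟩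
  rw [conjSeries, map_add, map_add, coeff_succ_X_mul, coeff_succ_X_mul, coeff_sum_adj,
    sum_tanhSeries N j (by omega) _ (fun i hi => W_eq_zero P V hi), coeff_C, if_neg (by omega),
    zero_add, coeff_C]
  by_cases h0 : j = 0
  · subst h0
    have := diagPart_mul_proj h.idem V
    simp [Vcoeff, mul_assoc, this]
    simp only [← mul_assoc, h.idem]
  · rw [if_neg h0, zero_add, Vcoeff, if_neg (by omega), Nat.add_sub_cancel]

theorem commute_exp_right {A : Type*} [Ring A] [Algebra ℚ A] {x y : A} (h : Commute x y) :
    Commute x (IsNilpotent.exp y) := by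
  rw [IsNilpotent.exp]
  exact Commute.sum_right _ _ _ fun i _ => (h.pow_right i).smul_right _

theorem exp_near {A : Type*} [Ring A] [Algebra ℚ A] {ε s x : A} (hx : IsNilpotent x)
    (h : x = ε * s) : ∃ u, IsNilpotent.exp x = 1 + ε * u := by
  refine ⟨s * psEval x expDivSeries, ?_⟩
  have h1 : PowerSeries.exp ℚ = 1 + X * expDivSeries := by rw [X_mul_expDivSeries]; ring
  rw [← psEval_exp hx, h1, psEval_add, psEval_one hx, psEval_mul hx, psEval_X hx, ← mul_assoc, ← h]

theorem isBlockDiag_genSeries (h : IsResolvent P H G) (N : ℕ) :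
    IsBlockDiag (toTrunc N X) (toTrunc N (C P)) (toTrunc N (C H) + toTrunc N X * toTrunc N (C V))
      (toTrunc N (conjSeries P H G V N)) (IsNilpotent.exp (toTrunc N (genSeries P G V)))
      (IsNilpotent.exp (-toTrunc N (genSeries P G V))) := by
  have hg := isGenerator_genSeries (V := V) h N
  have hV : toTrunc N (C H) + toTrunc N X * toTrunc N (C V) =
      toTrunc N (C H) + toTrunc N X * toTrunc N (C (diagPart P V))
        + toTrunc N X * toTrunc N (C (offDiagPart P V)) := by
    rw [add_assoc, ← mul_add, ← map_add, ← map_add]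
    congr 4
    rw [diagPart, offDiagPart]; noncomm_ring
  have hK : toTrunc N (conjSeries P H G V N) =
      toTrunc N (C H) + toTrunc N X * toTrunc N (C (diagPart P V))
      + psEval (adj (toTrunc N (genSeries P G V))) tanhSeries
        (toTrunc N X * toTrunc N (C (offDiagPart P V))) := by
    rw [psEval_adj_toTrunc, conjSeries, map_add, map_add, map_mul]
  obtain ⟨s, hs⟩ := genSeries_eq P G V
  refine ⟨IsNilpotent.exp_mul_exp_neg_self hg.nil, IsNilpotent.exp_neg_mul_exp_self hg.nil,
    ?_, ?_, hg.exp_compress, ?_, ?_⟩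
  · rw [hV, hK]; exact hg.conj_eq
  · rw [hK]; exact hg.commute_conj
  · exact exp_near hg.nil (s := toTrunc N s) (by rw [hs, map_mul])
  · exact exp_near hg.nil.neg (s := toTrunc N (-s)) (by rw [hs, ← map_neg, ← mul_neg, map_mul])

/-- The effective Hamiltonian of two independent systems is the sum of those of the systems. -/
theorem Vcoeff_add {P₁ H₁ G₁ V₁ P₂ H₂ G₂ V₂ G : Matrix n n ℂ} (h₁ : IsResolvent P₁ H₁ G₁)
    (h₂ : IsResolvent P₂ H₂ G₂) (h : IsResolvent (P₁ * P₂) (H₁ + H₂) G)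
    (hc : ∀ x ∈ ({P₁, H₁, G₁, V₁} : Set (Matrix n n ℂ)),
      ∀ y ∈ ({P₂, H₂, G₂, V₂} : Set (Matrix n n ℂ)), Commute x y) {j : ℕ} (hj : 1 ≤ j) :
    P₁ * P₂ * Vcoeff (P₁ * P₂) G (V₁ + V₂) j * (P₁ * P₂) =
      P₁ * P₂ * Vcoeff P₁ G₁ V₁ j * (P₁ * P₂) + P₁ * P₂ * Vcoeff P₂ G₂ V₂ j * (P₁ * P₂) := by
  set N := j + 1 with hN
  have hgen₁ : ∀ {z}, (Commute z P₁ ∧ Commute z G₁ ∧ Commute z V₁) →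
      ∀ i, Commute z (gen P₁ G₁ V₁ i) := fun hz i => (isNCPoly_gen i).commute hz.1 hz.2.1 hz.2.2
  have hgen₂ : ∀ {z}, (Commute z P₂ ∧ Commute z G₂ ∧ Commute z V₂) →
      ∀ i, Commute z (gen P₂ G₂ V₂ i) := fun hz i => (isNCPoly_gen i).commute hz.1 hz.2.1 hz.2.2
  have hC : ∀ {x y : Matrix n n ℂ}, Commute x y →
      Commute (toTrunc N (C x)) (toTrunc N (C y)) := fun h => (h.map C).map (toTrunc N)
  have hser : ∀ {x : Matrix n n ℂ} {f : ℕ → Matrix n n ℂ}, (∀ i, Commute x (f i)) →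
      Commute (toTrunc N (C x)) (toTrunc N (mk f)) := by
    intro x f hf
    refine Commute.map ?_ (toTrunc N)
    ext1 k
    rw [coeff_C_mul, coeff_mul_C, coeff_mk, (hf k).eq]
  have hss : Commute (toTrunc N (genSeries P₁ G₁ V₁)) (toTrunc N (genSeries P₂ G₂ V₂)) := by
    refine Commute.map ?_ (toTrunc N)
    ext1 k
    rw [coeff_mul, coeff_mul, ← Finset.Nat.sum_antidiagonal_swap]
    refine Finset.sum_congr rfl fun x _ => ?_
    simp only [Prod.fst_swap, Prod.snd_swap, genSeries, coeff_mk]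
    refine (hgen₂ ?_ _).eq
    refine ⟨?_, ?_, ?_⟩ <;>
      exact (hgen₁ ⟨(hc _ (by simp) _ (by simp)).symm, (hc _ (by simp) _ (by simp)).symm,
        (hc _ (by simp) _ (by simp)).symm⟩ _).symm
  have x₁ : ∀ x ∈ ({P₁, H₁, G₁, V₁} : Set (Matrix n n ℂ)),
      Commute (toTrunc N (C x)) (toTrunc N (genSeries P₂ G₂ V₂)) := fun x hx =>
    hser (hgen₂ ⟨hc _ hx _ (by simp), hc _ hx _ (by simp), hc _ hx _ (by simp)⟩)
  have x₂ : ∀ x ∈ ({P₂, H₂, G₂, V₂} : Set (Matrix n n ℂ)),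
      Commute (toTrunc N (C x)) (toTrunc N (genSeries P₁ G₁ V₁)) := fun x hx =>
    hser (hgen₁ ⟨(hc _ (by simp) _ hx).symm, (hc _ (by simp) _ hx).symm,
      (hc _ (by simp) _ hx).symm⟩)
  have hX := toTrunc_X_commute (n := n) N
  have b₁ := isBlockDiag_genSeries (V := V₁) h₁ N
  have b₂ := isBlockDiag_genSeries (V := V₂) h₂ N
  have b := isBlockDiag_genSeries (V := V₁ + V₂) h N
  -- Everything built from one system commutes with everything built from the other, so the product
  -- of the two transformations block-diagonalizes the joint Hamiltonian.
  have bp := b₁.prod b₂ (by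
      rintro y (rfl | rfl | rfl | rfl)
      · exact hC (hc _ (by simp) _ (by simp))
      · exact (hC (hc _ (by simp) _ (by simp))).add_right
          ((hX _).symm.mul_right (hC (hc _ (by simp) _ (by simp))))
      · exact commute_exp_right (x₁ _ (by simp))
      · exact commute_exp_right (x₁ _ (by simp)).neg_right)
    (commute_exp_right ((x₁ _ (by simp)).add_left ((hX _).mul_left (x₁ _ (by simp)))))
    (by
      rintro y (rfl | rfl | rfl | rfl)
      · exact (commute_exp_right (x₂ _ (by simp))).symm
      · exact (commute_exp_right ((x₂ _ (by simp)).add_left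
          ((hX _).mul_left (x₂ _ (by simp))))).symm
      · exact commute_exp_right (commute_exp_right hss.symm).symm
      · exact commute_exp_right (commute_exp_right hss.symm.neg_left).symm)
    (by
      rintro y (rfl | rfl | rfl | rfl)
      · exact (commute_exp_right (x₂ _ (by simp)).neg_right).symm
      · exact (commute_exp_right (((x₂ _ (by simp)).add_left
          ((hX _).mul_left (x₂ _ (by simp)))).neg_right)).symm
      · exact commute_exp_right (commute_exp_right hss.symm.neg_right).symm
      · exact commute_exp_right (commute_exp_right hss.symm.neg_left.neg_right).symm)
    ((hC (hc _ (by simp) _ (by simp)).symm).add_right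
      ((hX _).symm.mul_right (hC (hc _ (by simp) _ (by simp)).symm)))
  have hHH : toTrunc N (C H₁) + toTrunc N X * toTrunc N (C V₁) +
      (toTrunc N (C H₂) + toTrunc N X * toTrunc N (C V₂)) =
      toTrunc N (C (H₁ + H₂)) + toTrunc N X * toTrunc N (C (V₁ + V₂)) := by
    simp only [map_add, mul_add]; abel
  rw [hHH, ← map_mul, ← map_mul] at bp
  -- The product transformation need not be the one generated by the joint recursion, since it may
  -- fail to be off-diagonal with respect to P₁P₂. Uniqueness of the upper block makes the
  -- comparison nevertheless.
  have key := b.compress_eq (H₀ := toTrunc N (C (H₁ + H₂))) (G := toTrunc N (C G))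
    (v := toTrunc N (C (V₁ + V₂))) ⟨N, toTrunc_X_pow N⟩ hX
    (by rw [← map_mul, ← map_mul, h.idem])
    (by rw [← map_mul, ← map_mul, h.HP, map_zero, map_zero])
    (by rw [← map_mul, ← map_mul, h.PH, map_zero, map_zero])
    (by rw [← map_mul, ← map_mul, h.GH]; simp)
    (by rw [← map_mul, ← map_mul, h.HG]; simp) rfl bp
  rw [← map_add] at key
  simp only [← map_mul (toTrunc N)] at key
  have key := toTrunc_eq.1 key j (by omega)
  rw [coeff_mul_C, coeff_C_mul, coeff_mul_C, coeff_C_mul, coeff_conjSeries h hj (by omega), map_add,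
    mul_add, add_mul] at key
  have hPP : Commute P₁ P₂ := hc _ (by simp) _ (by simp)
  have r₁ : ∀ A, P₁ * P₂ * A * (P₁ * P₂) = P₂ * (P₁ * A * P₁) * P₂ := by
    intro A
    rw [hPP.eq]; nth_rw 2 [← hPP.eq]; simp only [mul_assoc]
  have r₂ : ∀ A, P₁ * P₂ * A * (P₁ * P₂) = P₁ * (P₂ * A * P₂) * P₁ := by
    intro A
    nth_rw 2 [hPP.eq]; simp only [mul_assoc]
  rw [key, r₁, coeff_conjSeries h₁ hj (by omega), ← r₁, r₂ (coeff j _),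
    coeff_conjSeries h₂ hj (by omega), ← r₂]

end Additivity

end SchriefferWolff

/-! ### Product operators and local operators -/

section ProductOperators

variable {I : Type} [Fintype I] [DecidableEq I] {κ ι μ : I → Type}

/-- The tensor product of a family of rectangular matrices. -/
def piMap (A : ∀ i, Matrix (κ i) (ι i) ℂ) : Matrix (∀ i, κ i) (∀ i, ι i) ℂ :=
  fun x y => ∏ i, A i (x i) (y i)

theorem piMap_mul [∀ i, Fintype (ι i)] (A : ∀ i, Matrix (κ i) (ι i) ℂ)
    (B : ∀ i, Matrix (ι i) (μ i) ℂ) : piMap A * piMap B = piMap fun i => A i * B i := by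
  ext x y
  simp only [piMap, Matrix.mul_apply]
  rw [Finset.prod_univ_sum, Fintype.piFinset_univ]
  simp only [Finset.prod_mul_distrib]

theorem piMap_mulVec [∀ i, Fintype (ι i)] (A : ∀ i, Matrix (κ i) (ι i) ℂ) (v : ∀ i, ι i → ℂ) :
    (piMap A).mulVec (fun x => ∏ i, v i (x i)) = fun x => ∏ i, (A i).mulVec (v i) (x i) := by
  ext x
  simp only [piMap, Matrix.mulVec, dotProduct]
  rw [Finset.prod_univ_sum, Fintype.piFinset_univ]
  simp only [Finset.prod_mul_distrib]

theorem piMap_conjTranspose (A : ∀ i, Matrix (κ i) (ι i) ℂ) :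
    (piMap A).conjTranspose = piMap fun i => (A i).conjTranspose := by
  ext x y
  simp [piMap, Matrix.conjTranspose_apply]

theorem piMap_one [∀ i, DecidableEq (ι i)] :
    piMap (fun i => (1 : Matrix (ι i) (ι i) ℂ)) = 1 := by
  ext x y
  simp only [piMap, Matrix.one_apply]
  by_cases h : x = y
  · subst h; simp
  · rw [if_neg h]
    obtain ⟨i, hi⟩ := Function.ne_iff.1 h
    exact Finset.prod_eq_zero (Finset.mem_univ i) (if_neg hi)

theorem piMap_eq_zero {A : ∀ i, Matrix (κ i) (ι i) ℂ} {i : I} (h : A i = 0) : piMap A = 0 := by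
  ext x y
  exact Finset.prod_eq_zero (Finset.mem_univ i) (by rw [h]; rfl)

end ProductOperators

section LocalOperators

variable {S : Type} [Fintype S] [DecidableEq S] {ι : S → Type} [∀ s, Fintype (ι s)]
  [∀ s, DecidableEq (ι s)]

/-- `A` is the identity off `R`, in terms of matrix elements. -/
structure ActsOn (A : Matrix (∀ s, ι s) (∀ s, ι s) ℂ) (R : Finset S) : Prop where
  zero : ∀ x y, (∃ s, s ∉ R ∧ x s ≠ y s) → A x y = 0
  eq : ∀ x y x' y', (∀ s ∈ R, x s = x' s) → (∀ s ∈ R, y s = y' s) → (∀ s, s ∉ R → x s = y s) →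
    (∀ s, s ∉ R → x' s = y' s) → A x y = A x' y'

namespace ActsOn

variable {A A' : Matrix (∀ s, ι s) (∀ s, ι s) ℂ} {R R' : Finset S}

theorem supportedOn (h : ActsOn A R) : SupportedOn A R := by
  rcases isEmpty_or_nonempty (∀ s, ι s) with he | ⟨⟨z⟩⟩
  · exact ⟨0, by ext x; exact he.elim x⟩
  · refine ⟨fun c d => A (fun s => if hs : s ∈ R then c ⟨s, hs⟩ else z s)
      (fun s => if hs : s ∈ R then d ⟨s, hs⟩ else z s), ?_⟩
    ext x y
    simp only [extendOp]
    split_ifs with hxy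
    · refine h.eq _ _ _ _ ?_ ?_ hxy ?_
      · intro s hs; simp [hs]
      · intro s hs; simp [hs]
      · intro s hs; simp [hs]
    · push Not at hxy
      exact h.zero _ _ hxy

theorem mono (h : ActsOn A R) (hR : R ⊆ R') : ActsOn A R' := by
  constructor
  · rintro x y ⟨s, hs, hxy⟩
    exact h.zero x y ⟨s, fun h => hs (hR h), hxy⟩
  · intro x y x' y' h1 h2 h3 h4
    by_cases hxy : ∀ s, s ∉ R → x s = y s
    · refine h.eq _ _ _ _ (fun s hs => h1 s (hR hs)) (fun s hs => h2 s (hR hs)) hxy fun s hs => ?_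
      by_cases hs' : s ∈ R'
      · rw [← h1 s hs', ← h2 s hs', hxy s hs]
      · exact h4 s hs'
    · push Not at hxy
      obtain ⟨s, hs, hne⟩ := hxy
      have hs' : s ∈ R' := by by_contra hs'; exact hne (h3 s hs')
      rw [h.zero x y ⟨s, hs, hne⟩, h.zero x' y' ⟨s, hs, by rwa [← h1 s hs', ← h2 s hs']⟩]

theorem add (h : ActsOn A R) (h' : ActsOn A' R) : ActsOn (A + A') R :=
  ⟨fun x y hxy => by rw [Matrix.add_apply, h.zero x y hxy, h'.zero x y hxy, add_zero],
    fun x y x' y' h1 h2 h3 h4 => by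
      rw [Matrix.add_apply, Matrix.add_apply, h.eq x y x' y' h1 h2 h3 h4,
        h'.eq x y x' y' h1 h2 h3 h4]⟩

theorem smul (h : ActsOn A R) (c : ℂ) : ActsOn (c • A) R :=
  ⟨fun x y hxy => by rw [Matrix.smul_apply, h.zero x y hxy, smul_zero],
    fun x y x' y' h1 h2 h3 h4 => by
      rw [Matrix.smul_apply, Matrix.smul_apply, h.eq x y x' y' h1 h2 h3 h4]⟩

theorem of_zero (R : Finset S) : ActsOn (0 : Matrix (∀ s, ι s) (∀ s, ι s) ℂ) R :=
  ⟨fun _ _ _ => rfl, fun _ _ _ _ _ _ _ _ => rfl⟩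

theorem neg (h : ActsOn A R) : ActsOn (-A) R := by simpa using h.smul (-1)

theorem sum {α : Type*} (s : Finset α) {f : α → Matrix (∀ s, ι s) (∀ s, ι s) ℂ}
    (h : ∀ i ∈ s, ActsOn (f i) R) : ActsOn (∑ i ∈ s, f i) R := by
  classical
  induction s using Finset.induction_on with
  | empty => simpa using of_zero R
  | insert i s hi ih =>
    rw [Finset.sum_insert hi]
    exact (h i (by simp)).add (ih fun j hj => h j (by simp [hj]))

theorem conjTranspose (h : ActsOn A R) : ActsOn A.conjTranspose R :=
  ⟨fun x y ⟨s, hs, hxy⟩ => by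
      rw [Matrix.conjTranspose_apply, h.zero y x ⟨s, hs, hxy.symm⟩, star_zero],
    fun x y x' y' h1 h2 h3 h4 => by
      rw [Matrix.conjTranspose_apply, Matrix.conjTranspose_apply,
        h.eq y x y' x' h2 h1 (fun s hs => (h3 s hs).symm) (fun s hs => (h4 s hs).symm)]⟩

theorem mul (h : ActsOn A R) (h' : ActsOn A' R) : ActsOn (A * A') R := by
  constructor
  · rintro x y ⟨s, hs, hxy⟩
    rw [Matrix.mul_apply]
    refine Finset.sum_eq_zero fun z _ => ?_
    by_cases hz : x s = z s
    · rw [h'.zero z y ⟨s, hs, fun h => hxy (hz.trans h)⟩, mul_zero]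
    · rw [h.zero x z ⟨s, hs, hz⟩, zero_mul]
  · intro x y x' y' h1 h2 h3 h4
    have filt : ∀ x y : ∀ s, ι s, (A * A') x y =
        ∑ z ∈ Finset.univ.filter (fun z => ∀ s, s ∉ R → x s = z s), A x z * A' z y := by
      intro x y
      rw [Matrix.mul_apply]
      symm
      refine Finset.sum_filter_of_ne fun z _ hz => ?_
      by_contra hc
      push Not at hc
      exact hz (by rw [h.zero x z hc, zero_mul])
    rw [filt, filt]
    refine Finset.sum_bij' (fun z _ s => if s ∈ R then z s else x' s)
      (fun z _ s => if s ∈ R then z s else x s) ?_ ?_ ?_ ?_ ?_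
    · intro z _
      simp only [Finset.mem_filter, Finset.mem_univ, true_and]
      intro s hs
      rw [if_neg hs]
    · intro z _
      simp only [Finset.mem_filter, Finset.mem_univ, true_and]
      intro s hs
      rw [if_neg hs]
    · intro z hz
      ext1 s
      by_cases hs : s ∈ R
      · simp [hs]
      · simpa [hs] using (Finset.mem_filter.1 hz).2 s hs
    · intro z hz
      ext1 s
      by_cases hs : s ∈ R
      · simp [hs]
      · simpa [hs] using (Finset.mem_filter.1 hz).2 s hs
    · intro z hz
      have hz := (Finset.mem_filter.1 hz).2
      congr 1
      · exact h.eq _ _ _ _ h1 (fun s hs => by simp [hs]) hz (fun s hs => by simp [hs])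
      · exact h'.eq _ _ _ _ (fun s hs => by simp [hs]) h2
          (fun s hs => by rw [← hz s hs, h3 s hs]) (fun s hs => by simp [hs, h4 s hs])

theorem commute (h : ActsOn A R) (h' : ActsOn A' R') (hR : Disjoint R R') : Commute A A' := by
  have hd : ∀ s, s ∈ R → s ∉ R' := fun s hs => Finset.disjoint_left.1 hR hs
  have hd' : ∀ s, s ∈ R' → s ∉ R := fun s hs => Finset.disjoint_right.1 hR hs
  ext x y
  rw [Matrix.mul_apply, Matrix.mul_apply,
    Fintype.sum_eq_single (fun s => if s ∈ R then y s else x s),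
    Fintype.sum_eq_single (fun s => if s ∈ R then x s else y s)]
  · rw [mul_comm]
    congr 1
    · by_cases hxy : ∀ s, s ∉ R → s ∉ R' → x s = y s
      · refine h'.eq _ _ _ _ ?_ ?_ ?_ ?_
        · intro s hs; simp [hd' s hs]
        · intro s hs; simp [hd' s hs]
        · intro s hs
          by_cases hs' : s ∈ R
          · simp [hs']
          · simp [hs', hxy s hs' hs]
        · intro s hs
          by_cases hs' : s ∈ R
          · simp [hs']
          · simp [hs', hxy s hs' hs]
      · push Not at hxy
        obtain ⟨s, hs, hs', hne⟩ := hxy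
        rw [h'.zero _ _ ⟨s, hs', by simpa [hs] using hne⟩,
          h'.zero _ _ ⟨s, hs', by simpa [hs] using hne⟩]
    · refine h.eq _ _ _ _ ?_ ?_ ?_ ?_ <;> intro s hs <;> simp [hs]
  · intro z hz
    obtain ⟨s, hs⟩ := Function.ne_iff.1 hz
    by_cases hsR : s ∈ R
    · rw [h'.zero x z ⟨s, hd s hsR, by simpa [hsR, eq_comm] using hs⟩, zero_mul]
    · rw [h.zero z y ⟨s, hsR, by simpa [hsR] using hs⟩, mul_zero]
  · intro z hz
    obtain ⟨s, hs⟩ := Function.ne_iff.1 hz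
    by_cases hsR : s ∈ R
    · rw [h'.zero z y ⟨s, hd s hsR, by simpa [hsR] using hs⟩, mul_zero]
    · rw [h.zero x z ⟨s, hsR, by simpa [hsR, eq_comm] using hs⟩, zero_mul]

theorem of_piMap {A : ∀ s, Matrix (ι s) (ι s) ℂ} (h : ∀ s, s ∉ R → A s = 1) :
    ActsOn (piMap A) R := by
  constructor
  · rintro x y ⟨s, hs, hxy⟩
    exact Finset.prod_eq_zero (Finset.mem_univ s) (by rw [h s hs, Matrix.one_apply_ne hxy])
  · intro x y x' y' h1 h2 h3 h4
    refine Finset.prod_congr rfl fun s _ => ?_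
    by_cases hs : s ∈ R
    · rw [h1 s hs, h2 s hs]
    · rw [h s hs, h3 s hs, h4 s hs, Matrix.one_apply_eq, Matrix.one_apply_eq]

theorem one (R : Finset S) : ActsOn (1 : Matrix (∀ s, ι s) (∀ s, ι s) ℂ) R := by
  rw [← piMap_one]
  exact of_piMap fun _ _ => rfl

/-- An operator that commutes with all one-site operators off `R` acts on `R`. -/
theorem of_commute
    (h : ∀ s, s ∉ R → ∀ O : Matrix (ι s) (ι s) ℂ,
      Commute A (piMap (Function.update (fun s => (1 : Matrix (ι s) (ι s) ℂ)) s O))) :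
    ActsOn A R := by
  have entry : ∀ (s : S) (v w : ι s) (x y : ∀ s, ι s),
      piMap (Function.update (fun s => (1 : Matrix (ι s) (ι s) ℂ)) s (Matrix.single v w 1)) x y =
        if x s = v ∧ y s = w ∧ (∀ t, t ≠ s → x t = y t) then 1 else 0 := by
    intro s v w x y
    rw [piMap, ← Finset.mul_prod_erase _ _ (Finset.mem_univ s), Function.update_self]
    by_cases hxy : ∀ t, t ≠ s → x t = y t
    · rw [Finset.prod_eq_one]
      · have hxy' : (∀ t, t ≠ s → x t = y t) ↔ True := iff_true_intro hxy
        simp only [Matrix.single_apply, hxy', and_true, mul_one]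
        simp [eq_comm]
      · intro t ht
        rw [Function.update_of_ne (Finset.ne_of_mem_erase ht), hxy t (Finset.ne_of_mem_erase ht),
          Matrix.one_apply_eq]
    · rw [if_neg (fun h => hxy h.2.2)]
      push Not at hxy
      obtain ⟨t, ht, hne⟩ := hxy
      rw [Finset.prod_eq_zero (Finset.mem_erase.2 ⟨ht, Finset.mem_univ t⟩), mul_zero]
      rw [Function.update_of_ne ht, Matrix.one_apply_ne hne]
  -- Commuting with the matrix unit from `x s` to `v` at the site `s` allows a common value of row
  -- and column there to be changed without changing the entry.
  have step : ∀ (s : S), s ∉ R → ∀ (v : ι s) (x y : ∀ s, ι s),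
      A (Function.update x s v) (Function.update y s v) = if x s = y s then A x y else
        A (Function.update x s v) (Function.update y s v) := by
    intro s hs v x y
    split_ifs with hxy
    · have := congrFun (congrFun (h s hs (Matrix.single v (x s) 1)).eq (Function.update x s v)) y
      rw [Matrix.mul_apply, Matrix.mul_apply,
        Fintype.sum_eq_single (Function.update y s v), Fintype.sum_eq_single x] at this
      · rw [entry, entry, if_pos, if_pos, mul_one, one_mul] at this
        · exact this
        · exact ⟨by simp, rfl, fun t ht => by simp [ht]⟩
        · exact ⟨by simp, hxy.symm, fun t ht => by simp [ht]⟩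
      · intro z hz
        rw [entry, if_neg, zero_mul]
        rintro ⟨-, h1, h2⟩
        apply hz
        ext1 t
        by_cases ht : t = s
        · subst ht; exact h1
        · rw [← h2 t ht, Function.update_of_ne ht]
      · intro z hz
        rw [entry, if_neg, mul_zero]
        rintro ⟨h1, -, h2⟩
        apply hz
        ext1 t
        by_cases ht : t = s
        · subst ht; simp [h1]
        · rw [h2 t ht, Function.update_of_ne ht]
    · rfl
  constructor
  · rintro x y ⟨s, hs, hxy⟩
    have := congrFun (congrFun (h s hs (Matrix.single (x s) (x s) 1)).eq x) y
    rw [Matrix.mul_apply, Matrix.mul_apply, Finset.sum_eq_zero, Fintype.sum_eq_single x] at this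
    · rw [entry, if_pos ⟨rfl, rfl, fun _ _ => rfl⟩, one_mul] at this
      exact this.symm
    · intro z hz
      rw [entry, if_neg, zero_mul]
      rintro ⟨-, h1, h2⟩
      apply hz
      ext1 t
      by_cases ht : t = s
      · subst ht; exact h1
      · exact (h2 t ht).symm
    · intro z _
      rw [entry, if_neg, mul_zero]
      rintro ⟨-, h1, -⟩
      exact hxy h1.symm
  · intro x y x' y' h1 h2 h3 h4
    -- The values off `R` are replaced one site at a time.
    have key : ∀ T : Finset S, Disjoint T R →
        A x y = A (fun s => if s ∈ T then x' s else x s) (fun s => if s ∈ T then y' s else y s) := by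
      intro T
      induction T using Finset.induction_on with
      | empty => intro _; simp
      | insert s T hs ih =>
        intro hT
        rw [Finset.disjoint_insert_left] at hT
        rw [ih hT.2]
        have e : ∀ x x' : ∀ s, ι s, (fun t => if t ∈ insert s T then x' t else x t) =
            Function.update (fun t => if t ∈ T then x' t else x t) s (x' s) := by
          intro x x'
          ext1 t
          by_cases ht : t = s
          · subst ht; simp
          · simp [ht]
        rw [e, e, ← h4 s hT.1, step s hT.1, if_pos]
        simp [hs, h3 s hT.1]
    have e : ∀ x x' : ∀ s, ι s, (∀ s ∈ R, x s = x' s) →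
        (fun t => if t ∈ Rᶜ then x' t else x t) = x' := by
      intro x x' hx
      ext1 t
      by_cases ht : t ∈ R
      · simp [ht, hx t ht]
      · simp [ht]
    rw [key Rᶜ disjoint_compl_left, e x x' h1, e y y' h2]

end ActsOn

end LocalOperators

/-! ### The operators of a PEPS -/

namespace PEPS

open SchriefferWolff

variable {𝒯 : SiteTensors} (Λ : PEPS 𝒯)

theorem localProj_mul_self (h𝒯 : 𝒯.IsIsometric) (s : Λ.S) :
    Λ.localProj s * Λ.localProj s = Λ.localProj s := by
  simp only [localProj]
  rw [Matrix.mul_assoc, ← Matrix.mul_assoc (𝒯.map _), h𝒯, Matrix.one_mul]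

theorem localProj_conjTranspose (s : Λ.S) :
    (Λ.localProj s).conjTranspose = Λ.localProj s := by
  simp [localProj, Matrix.conjTranspose_mul]

theorem siteProj_eq_piMap (R : Finset Λ.S) :
    Λ.siteProj R = piMap fun s => if s ∈ R then Λ.localProj s else 1 := rfl

theorem codeMap_eq_piMap : Λ.codeMap = piMap fun s => 𝒯.map (Λ.type s) := rfl

theorem siteProj_mul (h𝒯 : 𝒯.IsIsometric) (A B : Finset Λ.S) :
    Λ.siteProj A * Λ.siteProj B = Λ.siteProj (A ∪ B) := by
  simp only [siteProj_eq_piMap, piMap_mul]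
  congr 1
  ext1 s
  by_cases hA : s ∈ A <;> by_cases hB : s ∈ B <;> simp [hA, hB, Λ.localProj_mul_self h𝒯]

theorem siteProj_empty : Λ.siteProj ∅ = 1 := by
  simp [siteProj_eq_piMap, piMap_one]

theorem siteProj_isHermitian (R : Finset Λ.S) : (Λ.siteProj R).IsHermitian := by
  rw [Matrix.IsHermitian, siteProj_eq_piMap, piMap_conjTranspose]
  congr 1
  ext1 s
  split_ifs <;> simp [localProj_conjTranspose]

theorem actsOn_siteProj (R : Finset Λ.S) : ActsOn (Λ.siteProj R) R :=
  ActsOn.of_piMap fun _ hs => if_neg hs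

theorem siteProj_mul_of_subset (h𝒯 : 𝒯.IsIsometric) {A B : Finset Λ.S} (h : A ⊆ B) :
    Λ.siteProj A * Λ.siteProj B = Λ.siteProj B := by
  rw [Λ.siteProj_mul h𝒯, Finset.union_eq_right.2 h]

theorem siteProj_mul_of_superset (h𝒯 : 𝒯.IsIsometric) {A B : Finset Λ.S} (h : A ⊆ B) :
    Λ.siteProj B * Λ.siteProj A = Λ.siteProj B := by
  rw [Λ.siteProj_mul h𝒯, Finset.union_eq_left.2 h]

theorem P₀_mul_siteProj (h𝒯 : 𝒯.IsIsometric) (A : Finset Λ.S) :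
    Λ.P₀ * Λ.siteProj A = Λ.P₀ := Λ.siteProj_mul_of_superset h𝒯 (Finset.subset_univ A)

theorem siteProj_mul_P₀ (h𝒯 : 𝒯.IsIsometric) (A : Finset Λ.S) :
    Λ.siteProj A * Λ.P₀ = Λ.P₀ := Λ.siteProj_mul_of_subset h𝒯 (Finset.subset_univ A)

theorem P₀_mul_self (h𝒯 : 𝒯.IsIsometric) : Λ.P₀ * Λ.P₀ = Λ.P₀ := Λ.P₀_mul_siteProj h𝒯 _

theorem P₀_isHermitian : Λ.P₀.IsHermitian := Λ.siteProj_isHermitian _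

theorem codeMap_mul_conjTranspose (h𝒯 : 𝒯.IsIsometric) :
    Λ.codeMap * Λ.codeMap.conjTranspose = 1 := by
  rw [codeMap_eq_piMap, piMap_conjTranspose, piMap_mul, ← piMap_one]
  congr 1
  ext1 s
  exact h𝒯 _

theorem codeMap_conjTranspose_mul : Λ.codeMap.conjTranspose * Λ.codeMap = Λ.P₀ := by
  rw [P₀, siteProj_eq_piMap, codeMap_eq_piMap, piMap_conjTranspose, piMap_mul]
  congr 1
  ext1 s
  simp [localProj]

theorem codeMap_mul_P₀ (h𝒯 : 𝒯.IsIsometric) : Λ.codeMap * Λ.P₀ = Λ.codeMap := by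
  rw [← codeMap_conjTranspose_mul, ← Matrix.mul_assoc, Λ.codeMap_mul_conjTranspose h𝒯,
    Matrix.one_mul]

theorem P₀_mul_codeMap_conjTranspose (h𝒯 : 𝒯.IsIsometric) :
    Λ.P₀ * Λ.codeMap.conjTranspose = Λ.codeMap.conjTranspose := by
  rw [← codeMap_conjTranspose_mul, Matrix.mul_assoc, Λ.codeMap_mul_conjTranspose h𝒯,
    Matrix.mul_one]

/-- Compressing a local operator to the code space gives a local operator. -/
theorem actsOn_codeMap_mul (h𝒯 : 𝒯.IsIsometric) {A : Matrix Λ.VirtCfg Λ.VirtCfg ℂ}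
    {R : Finset Λ.S} (hA : ActsOn A R) :
    ActsOn (Λ.codeMap * A * Λ.codeMap.conjTranspose) R := by
  refine ActsOn.of_commute fun s hs O => ?_
  -- A one-site operator O on the code qudit is intertwined by the code map with 𝒫†O𝒫 on the virtual
  -- qudits of the same site. As the latter commutes with `A`, the former commutes with the
  -- compression, and `ActsOn.of_commute` applies.
  set lift : Matrix (Λ.CodeSite s) (Λ.CodeSite s) ℂ → Matrix Λ.VirtCfg Λ.VirtCfg ℂ := fun O =>
    piMap (Function.update (fun s => (1 : Matrix (Λ.SiteCfg s) (Λ.SiteCfg s) ℂ)) s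
      ((𝒯.map (Λ.type s)).conjTranspose * O * 𝒯.map (Λ.type s))) with hlift
  have hl : ∀ O, piMap (Function.update
      (fun s => (1 : Matrix (Λ.CodeSite s) (Λ.CodeSite s) ℂ)) s O) * Λ.codeMap =
      Λ.codeMap * lift O := by
    intro O
    rw [codeMap_eq_piMap, hlift, piMap_mul, piMap_mul]
    congr 1
    ext1 t
    by_cases ht : t = s
    · subst ht
      simp only [Function.update_self]
      rw [Matrix.mul_assoc, ← Matrix.mul_assoc (𝒯.map _), h𝒯, Matrix.one_mul]
    · simp [Function.update_of_ne ht]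
  have hl' : Λ.codeMap.conjTranspose * piMap (Function.update
      (fun s => (1 : Matrix (Λ.CodeSite s) (Λ.CodeSite s) ℂ)) s O) =
      lift O * Λ.codeMap.conjTranspose := by
    rw [codeMap_eq_piMap, hlift, piMap_conjTranspose, piMap_mul, piMap_mul]
    congr 1
    ext1 t
    by_cases ht : t = s
    · subst ht
      simp only [Function.update_self]
      rw [Matrix.mul_assoc, h𝒯, Matrix.mul_one]
    · simp [Function.update_of_ne ht]
  have hc : Commute A (lift O) := by
    refine hA.commute (R' := {s}) (ActsOn.of_piMap fun t ht => ?_) (by simpa using hs)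
    exact Function.update_of_ne (by simpa using ht) _ _
  rw [Commute, SemiconjBy, Matrix.mul_assoc, hl', ← Matrix.mul_assoc, Matrix.mul_assoc _ A, hc.eq,
    ← Matrix.mul_assoc, ← hl, Matrix.mul_assoc _ Λ.codeMap A, Matrix.mul_assoc]

/-! #### Bond projections -/

/-- The unnormalized maximally entangled state of two qudits. -/
def entangled (D : ℕ) : (Bool → Fin D) → ℂ := fun a => if a false = a true then 1 else 0

/-- The projection onto the maximally entangled state of two qudits. -/
noncomputable def entangledProj (D : ℕ) : Matrix (Bool → Fin D) (Bool → Fin D) ℂ :=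
  fun a b => if a false = a true ∧ b false = b true then (D : ℂ)⁻¹ else 0

theorem entangledProj_mul_apply (D : ℕ) (a b : Bool → Fin D) :
    entangledProj D a b = (D : ℂ)⁻¹ * entangled D a * entangled D b := by
  simp only [entangledProj, entangled]
  split_ifs <;> simp_all

theorem sum_entangled_sq (D : ℕ) : ∑ a, entangled D a * entangled D a = D := by
  rw [← (Equiv.boolArrowEquivProd (Fin D)).symm.sum_comp, Fintype.sum_prod_type]
  simp [entangled, Equiv.boolArrowEquivProd]

theorem entangledProj_mul_self (D : ℕ) : entangledProj D * entangledProj D = entangledProj D := by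
  ext a b
  simp only [Matrix.mul_apply, entangledProj_mul_apply]
  have : ∀ c, (D : ℂ)⁻¹ * entangled D a * entangled D c * ((D : ℂ)⁻¹ * entangled D c * entangled D b)
    = (D : ℂ)⁻¹ * (D : ℂ)⁻¹ * entangled D a * entangled D b * (entangled D c * entangled D c) :=
    fun c => by ring
  simp only [this, ← Finset.mul_sum, sum_entangled_sq]
  rcases Nat.eq_zero_or_pos D with rfl | hD
  · simp
  · have : (D : ℂ) ≠ 0 := by exact_mod_cast hD.ne'
    field_simp

theorem entangledProj_conjTranspose (D : ℕ) : (entangledProj D).conjTranspose = entangledProj D := by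
  ext a b
  simp only [Matrix.conjTranspose_apply, entangledProj, and_comm]
  split_ifs <;> simp

theorem entangledProj_mulVec (D : ℕ) : (entangledProj D).mulVec (entangled D) = entangled D := by
  ext a
  simp only [Matrix.mulVec, dotProduct, entangledProj_mul_apply, mul_assoc, ← Finset.mul_sum,
    sum_entangled_sq]
  have hD : D ≠ 0 := by rintro rfl; exact Fin.elim0 (a true)
  have : (D : ℂ) ≠ 0 := by exact_mod_cast hD
  field_simp

/-- A configuration of the virtual qudits, sorted by edges. -/
def edgeEquiv : Λ.VirtCfg ≃ (Λ.E → Bool → Fin 𝒯.D) where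
  toFun x e i := Λ.endVal x e i
  invFun z s l := z (Λ.ends.symm ⟨s, l⟩).1 (Λ.ends.symm ⟨s, l⟩).2
  left_inv x := by
    ext1 s
    ext1 l
    simp only [endVal]
    rw [Equiv.apply_symm_apply]
  right_inv z := by
    ext1 e
    ext1 i
    simp [endVal]

/-- Sorted by edges instead of sites, the virtual qudits turn bond projections into tensor products,
so their algebra can be checked edge by edge. -/
theorem bondProj_eq_submatrix (F : Finset Λ.E) :
    Λ.bondProj F = (piMap fun e => if e ∈ F then entangledProj 𝒯.D else 1).submatrix
      Λ.edgeEquiv Λ.edgeEquiv := by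
  ext x y
  simp only [Matrix.submatrix_apply, piMap, bondProj]
  rw [← Finset.prod_mul_prod_compl F]
  congr 1
  · refine Finset.prod_congr rfl fun e he => ?_
    rw [if_pos he]
    rfl
  · refine Finset.prod_congr rfl fun e he => ?_
    rw [if_neg (Finset.mem_compl.1 he), Matrix.one_apply]
    refine if_congr ?_ rfl rfl
    rw [funext_iff, Bool.forall_bool]
    rfl

theorem bondProj_mul (F F' : Finset Λ.E) :
    Λ.bondProj F * Λ.bondProj F' = Λ.bondProj (F ∪ F') := by
  simp only [bondProj_eq_submatrix, Matrix.submatrix_mul_equiv, piMap_mul]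
  congr 2
  ext1 e
  by_cases hA : e ∈ F <;> by_cases hB : e ∈ F' <;> simp [hA, hB, entangledProj_mul_self]

theorem bondProj_empty : Λ.bondProj ∅ = 1 := by
  simp [bondProj_eq_submatrix, piMap_one]

theorem bondProj_isHermitian (F : Finset Λ.E) : (Λ.bondProj F).IsHermitian := by
  rw [Matrix.IsHermitian, bondProj_eq_submatrix, Matrix.conjTranspose_submatrix,
    piMap_conjTranspose]
  congr 2
  ext1 e
  split_ifs <;> simp [entangledProj_conjTranspose]

theorem bondProj_mulVec_bondState (F : Finset Λ.E) :
    (Λ.bondProj F).mulVec Λ.bondState = Λ.bondState := by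
  have h : Λ.bondState = (fun z : Λ.E → Bool → Fin 𝒯.D => ∏ e, entangled 𝒯.D (z e)) ∘ Λ.edgeEquiv :=
    rfl
  rw [bondProj_eq_submatrix, Matrix.submatrix_mulVec_equiv]
  conv_rhs => rw [h]
  have h' : Λ.bondState ∘ Λ.edgeEquiv.symm =
      (fun z : Λ.E → Bool → Fin 𝒯.D => ∏ e, entangled 𝒯.D (z e)) := by
    rw [h, Function.comp_assoc, Equiv.self_comp_symm, Function.comp_id]
  rw [h', piMap_mulVec]
  congr 1
  ext z
  refine Finset.prod_congr rfl fun e _ => ?_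
  split_ifs
  · rw [entangledProj_mulVec]
  · rw [Matrix.one_mulVec]

theorem mem_sitesOf {F : Finset Λ.E} {s : Λ.S} :
    s ∈ Λ.sitesOf F ↔ ∃ e ∈ F, ∃ i, Λ.endSite e i = s := by
  simp only [sitesOf, Finset.mem_biUnion, Finset.mem_insert, Finset.mem_singleton,
    Bool.exists_bool, eq_comm]

theorem endSite_mem_sitesOf {F : Finset Λ.E} {e : Λ.E} (he : e ∈ F) (i : Bool) :
    Λ.endSite e i ∈ Λ.sitesOf F := Λ.mem_sitesOf.2 ⟨e, he, i, rfl⟩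

theorem sitesOf_mono {F F' : Finset Λ.E} (h : F ⊆ F') : Λ.sitesOf F ⊆ Λ.sitesOf F' :=
  Finset.biUnion_subset_biUnion_of_subset_left _ h

theorem actsOn_bondProj (F : Finset Λ.E) : ActsOn (Λ.bondProj F) (Λ.sitesOf F) := by
  have ev : ∀ (x x' : Λ.VirtCfg) (e : Λ.E) (i : Bool), x (Λ.endSite e i) = x' (Λ.endSite e i) →
      Λ.endVal x e i = Λ.endVal x' e i := fun x x' e i h => congrFun h _
  constructor
  · rintro x y ⟨s, hs, hxy⟩
    obtain ⟨l, hl⟩ := Function.ne_iff.1 hxy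
    obtain ⟨⟨e, i⟩, hei⟩ := Λ.ends.surjective ⟨s, l⟩
    have hes : Λ.endSite e i = s := by rw [endSite, hei]
    have he : e ∉ F := fun he => hs (hes ▸ Λ.endSite_mem_sitesOf he i)
    have hne : Λ.endVal x e i ≠ Λ.endVal y e i := by
      simp only [endVal]
      rw [hei]
      exact hl
    rw [bondProj, Finset.prod_eq_zero (i := e) (Finset.mem_compl.2 he), mul_zero]
    rw [if_neg]
    cases i
    · exact fun h => hne h.1
    · exact fun h => hne h.2
  · intro x y x' y' h1 h2 h3 h4
    simp only [bondProj]
    congr 1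
    · refine Finset.prod_congr rfl fun e he => ?_
      rw [ev x x' e false (h1 _ (Λ.endSite_mem_sitesOf he _)),
        ev x x' e true (h1 _ (Λ.endSite_mem_sitesOf he _)),
        ev y y' e false (h2 _ (Λ.endSite_mem_sitesOf he _)),
        ev y y' e true (h2 _ (Λ.endSite_mem_sitesOf he _))]
    · refine Finset.prod_congr rfl fun e _ => ?_
      have : ∀ i, Λ.endVal x e i = Λ.endVal y e i ↔ Λ.endVal x' e i = Λ.endVal y' e i := by
        intro i
        by_cases hs : Λ.endSite e i ∈ Λ.sitesOf F
        · rw [ev x x' e i (h1 _ hs), ev y y' e i (h2 _ hs)]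
        · exact iff_of_true (ev _ _ _ _ (h3 _ hs)) (ev _ _ _ _ (h4 _ hs))
      simp only [this]

/-! #### Reduced resolvents -/

/-- The weights in the expansion of the reduced resolvent in products of projections. -/
noncomputable def resWeight (m b : ℕ) : ℝ := (b.factorial * (m - b - 1).factorial : ℕ) / m.factorial

/-- The unperturbed Hamiltonian of the sites in `U`. -/
def siteHam (U : Finset Λ.S) : Matrix Λ.VirtCfg Λ.VirtCfg ℂ := ∑ s ∈ U, (1 - Λ.siteProj {s})

/-- The reduced resolvent of the unperturbed Hamiltonian of the sites in `U`. -/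
noncomputable def siteRes (U : Finset Λ.S) : Matrix Λ.VirtCfg Λ.VirtCfg ℂ :=
  ∑ B ∈ U.ssubsets, (resWeight U.card B.card : ℂ) • (Λ.siteProj B - Λ.siteProj U)

theorem siteRes_eq_powerset (U : Finset Λ.S) : Λ.siteRes U =
    ∑ B ∈ U.powerset, (resWeight U.card B.card : ℂ) • (Λ.siteProj B - Λ.siteProj U) := by
  rw [siteRes, Finset.ssubsets, ← Finset.add_sum_erase _ _ (Finset.mem_powerset_self U)]
  simp

/-- The weight b!(m-b-1)!/m! is the integral of q^(m-b-1)(1-q)^b over [0,1]. It arises from G =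
∫(exp(-τH) - P_U)dτ with exp(-τH) = ∏(q + (1-q)P_s), q = exp(-τ). The identity says that the
coefficient of each P_B in H G vanishes except for B = ∅ and B = U. -/
theorem resWeight_identity {m b : ℕ} (hb : b ≤ m) (hm : 0 < m) :
    ((m - b : ℕ) : ℝ) * resWeight m b - (b : ℝ) * resWeight m (b - 1) =
      (if b = 0 then 1 else 0) - (if b = m then 1 else 0) := by
  have hm' : (m.factorial : ℝ) ≠ 0 := by exact_mod_cast m.factorial_ne_zero
  have h1 : b < m → ((m - b : ℕ) : ℝ) * resWeight m b =
      (b.factorial * (m - b).factorial : ℕ) / m.factorial := by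
    intro h
    obtain ⟨k, rfl⟩ : ∃ k, m = b + k + 1 := ⟨m - b - 1, by omega⟩
    rw [resWeight, show b + k + 1 - b = k + 1 by omega, show k + 1 - 1 = k by omega,
      Nat.factorial_succ k]
    push_cast
    ring
  have h2 : 0 < b → (b : ℝ) * resWeight m (b - 1) =
      (b.factorial * (m - b).factorial : ℕ) / m.factorial := by
    intro h
    obtain ⟨k, rfl⟩ : ∃ k, b = k + 1 := ⟨b - 1, by omega⟩
    rw [resWeight, show k + 1 - 1 = k by omega, show m - k - 1 = m - (k + 1) by omega,
      Nat.factorial_succ k]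
    push_cast
    ring
  rcases Nat.eq_zero_or_pos b with rfl | hb0
  · rw [h1 hm, if_pos rfl, if_neg hm.ne]
    simp [hm']
  · rcases hb.eq_or_lt with rfl | hbm
    · rw [h2 hb0, if_neg hb0.ne', if_pos rfl]
      simp [hm']
    · rw [h1 hbm, h2 hb0, if_neg hb0.ne', if_neg hbm.ne, sub_self, sub_self]

theorem sum_powerset_insert {α M : Type*} [DecidableEq α] [AddCommMonoid M] (U : Finset α)
    (f : Finset α → α → M) :
    ∑ B ∈ U.powerset, ∑ s ∈ U \ B, f (insert s B) s = ∑ B ∈ U.powerset, ∑ s ∈ B, f B s := by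
  rw [Finset.sum_sigma', Finset.sum_sigma']
  refine Finset.sum_bij' (fun p _ => ⟨insert p.2 p.1, p.2⟩) (fun p _ => ⟨p.1.erase p.2, p.2⟩)
    ?_ ?_ ?_ ?_ ?_
  · rintro ⟨B, s⟩ h
    simp only [Finset.mem_sigma, Finset.mem_powerset, Finset.mem_sdiff] at h ⊢
    exact ⟨Finset.insert_subset h.2.1 h.1, Finset.mem_insert_self _ _⟩
  · rintro ⟨B, s⟩ h
    simp only [Finset.mem_sigma, Finset.mem_powerset, Finset.mem_sdiff] at h ⊢
    exact ⟨(Finset.erase_subset _ _).trans h.1, h.1 h.2, Finset.notMem_erase _ _⟩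
  · rintro ⟨B, s⟩ h
    simp only [Finset.mem_sigma, Finset.mem_powerset, Finset.mem_sdiff] at h ⊢
    simp [Finset.erase_insert h.2.2]
  · rintro ⟨B, s⟩ h
    simp only [Finset.mem_sigma, Finset.mem_powerset] at h ⊢
    simp [Finset.insert_erase h.2]
  · rintro ⟨B, s⟩ h
    rfl

theorem siteHam_mul_siteProj (h𝒯 : 𝒯.IsIsometric) {U B : Finset Λ.S} (hB : B ⊆ U) :
    Λ.siteHam U * Λ.siteProj B = ∑ s ∈ U \ B, (Λ.siteProj B - Λ.siteProj (insert s B)) := by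
  rw [siteHam, Finset.sum_mul, ← Finset.sum_sdiff hB]
  have : ∀ s, (1 - Λ.siteProj {s}) * Λ.siteProj B = Λ.siteProj B - Λ.siteProj (insert s B) := by
    intro s
    rw [sub_mul, one_mul, Λ.siteProj_mul h𝒯, Finset.insert_eq]
  simp only [this]
  rw [add_eq_left]
  refine Finset.sum_eq_zero fun s hs => ?_
  rw [Finset.insert_eq_of_mem hs, sub_self]

/-- H maps P_B to the sum of P_B - P_{B ∪ {s}} over the missing sites s. Collecting the coefficient
of each P_B leaves the telescoping identity for the weights. The gain over the spectral formula is
an expansion in words with positive weights, up to P_U. -/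
theorem siteHam_mul_siteRes (h𝒯 : 𝒯.IsIsometric) (U : Finset Λ.S) :
    Λ.siteHam U * Λ.siteRes U = 1 - Λ.siteProj U := by
  rcases U.eq_empty_or_nonempty with rfl | hU
  · simp [siteHam, siteProj_empty]
  have h0 : Λ.siteHam U * Λ.siteProj U = 0 := by
    rw [Λ.siteHam_mul_siteProj h𝒯 subset_rfl]; simp
  have h1 : Λ.siteHam U * Λ.siteRes U =
      ∑ B ∈ U.powerset, ∑ s ∈ U \ B, (resWeight U.card B.card : ℂ) • Λ.siteProj B
      - ∑ B ∈ U.powerset, ∑ s ∈ B, (resWeight U.card (B.card - 1) : ℂ) • Λ.siteProj B := by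
    rw [← sum_powerset_insert U
      (fun B _ => (resWeight U.card (B.card - 1) : ℂ) • Λ.siteProj B),
      ← Finset.sum_sub_distrib, siteRes_eq_powerset, Finset.mul_sum]
    refine Finset.sum_congr rfl fun B hB => ?_
    rw [Matrix.mul_smul, Matrix.mul_sub, h0, sub_zero,
      Λ.siteHam_mul_siteProj h𝒯 (Finset.mem_powerset.1 hB), Finset.smul_sum,
      ← Finset.sum_sub_distrib]
    refine Finset.sum_congr rfl fun s hs => ?_
    rw [Finset.card_insert_of_notMem (Finset.mem_sdiff.1 hs).2, smul_sub]
    rfl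
  rw [h1, ← Finset.sum_sub_distrib]
  have h2 : ∀ B ∈ U.powerset,
      ∑ s ∈ U \ B, (resWeight U.card B.card : ℂ) • Λ.siteProj B
        - ∑ s ∈ B, (resWeight U.card (B.card - 1) : ℂ) • Λ.siteProj B =
      (if B = ∅ then Λ.siteProj B else 0) - (if B = U then Λ.siteProj B else 0) := by
    intro B hB
    rw [Finset.mem_powerset] at hB
    rw [Finset.sum_const, Finset.sum_const, Finset.card_sdiff_of_subset hB, ← Nat.cast_smul_eq_nsmul ℂ,
      ← Nat.cast_smul_eq_nsmul ℂ, smul_smul, smul_smul, ← sub_smul]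
    have := congrArg (fun x : ℝ => (x : ℂ))
      (resWeight_identity (Finset.card_le_card hB) (Finset.card_pos.2 hU))
    push_cast at this
    rw [this]
    have e : B.card = U.card ↔ B = U :=
      ⟨fun h => Finset.eq_of_subset_of_card_le hB h.ge, fun h => by rw [h]⟩
    simp only [Finset.card_eq_zero, e, sub_smul]
    split_ifs <;> simp
  rw [Finset.sum_congr rfl h2, Finset.sum_sub_distrib, Finset.sum_ite_eq', Finset.sum_ite_eq',
    if_pos (Finset.empty_mem_powerset U), if_pos (Finset.mem_powerset_self U), siteProj_empty]

theorem siteHam_isHermitian (U : Finset Λ.S) : (Λ.siteHam U).IsHermitian :=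
  isHermitian_sum _ fun _ _ => Matrix.isHermitian_one.sub (Λ.siteProj_isHermitian _)

theorem siteRes_isHermitian (U : Finset Λ.S) : (Λ.siteRes U).IsHermitian := by
  refine isHermitian_sum _ fun B _ => ?_
  have := (Λ.siteProj_isHermitian B).sub (Λ.siteProj_isHermitian U)
  rw [Matrix.IsHermitian, Matrix.conjTranspose_smul, this.eq]
  simp

theorem siteRes_isResolvent (h𝒯 : 𝒯.IsIsometric) (U : Finset Λ.S) :
    IsResolvent (Λ.siteProj U) (Λ.siteHam U) (Λ.siteRes U) := by
  have hP := Λ.siteProj_isHermitian U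
  have hH := Λ.siteHam_isHermitian U
  have hG := Λ.siteRes_isHermitian U
  have hPG : Λ.siteProj U * Λ.siteRes U = 0 := by
    rw [siteRes, Finset.mul_sum]
    refine Finset.sum_eq_zero fun B hB => ?_
    rw [Matrix.mul_smul, Matrix.mul_sub,
      Λ.siteProj_mul_of_superset h𝒯 (Finset.mem_ssubsets.1 hB).subset,
      Λ.siteProj_mul_of_subset h𝒯 subset_rfl, sub_self, smul_zero]
  have hHP : Λ.siteHam U * Λ.siteProj U = 0 := by
    rw [Λ.siteHam_mul_siteProj h𝒯 subset_rfl]; simp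
  have hHG := Λ.siteHam_mul_siteRes h𝒯 U
  refine ⟨Λ.siteProj_mul_of_subset h𝒯 subset_rfl, hPG, ?_, hHP, ?_, hHG, ?_⟩
  · simpa [Matrix.conjTranspose_mul, hP.eq, hG.eq] using congrArg Matrix.conjTranspose hPG
  · simpa [Matrix.conjTranspose_mul, hP.eq, hH.eq] using congrArg Matrix.conjTranspose hHP
  · simpa [Matrix.conjTranspose_mul, hG.eq, hH.eq, hP.eq] using congrArg Matrix.conjTranspose hHG

theorem actsOn_siteHam (U : Finset Λ.S) : ActsOn (Λ.siteHam U) U :=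
  ActsOn.sum _ fun s hs => by
    rw [sub_eq_add_neg]
    exact (ActsOn.one U).add (((Λ.actsOn_siteProj {s}).mono (by simpa using hs)).neg)

theorem actsOn_siteRes (U : Finset Λ.S) : ActsOn (Λ.siteRes U) U :=
  ActsOn.sum _ fun B hB => by
    rw [sub_eq_add_neg]
    exact (((Λ.actsOn_siteProj B).mono (Finset.mem_ssubsets.1 hB).subset).add
      (Λ.actsOn_siteProj U).neg).smul _

theorem siteHam_univ : Λ.siteHam Finset.univ = Λ.H₀ := rfl

/-- The projection onto the states that are excited exactly at the sites of `A`. -/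
def excProj (A : Finset Λ.S) : Matrix Λ.VirtCfg Λ.VirtCfg ℂ :=
  Λ.tensorOp (fun s => if s ∈ A then 1 - Λ.localProj s else Λ.localProj s)

theorem excProj_mul_siteProj (h𝒯 : 𝒯.IsIsometric) (A : Finset Λ.S) (s : Λ.S) :
    Λ.excProj A * Λ.siteProj {s} = if s ∈ A then 0 else Λ.excProj A := by
  have hs := Λ.localProj_mul_self h𝒯 s
  have h : Λ.excProj A * Λ.siteProj {s} = piMap fun t =>
      (if t ∈ A then 1 - Λ.localProj t else Λ.localProj t) *
        (if t ∈ ({s} : Finset Λ.S) then Λ.localProj t else 1) := piMap_mul _ _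
  rw [h]
  split_ifs with hA
  · refine piMap_eq_zero (i := s) ?_
    rw [if_pos hA, if_pos (Finset.mem_singleton_self s), sub_mul, one_mul, hs, sub_self]
  · show _ = piMap _
    congr 1
    ext1 t
    by_cases ht : t = s
    · subst ht
      rw [if_neg hA, if_pos (Finset.mem_singleton_self t), hs]
    · rw [if_neg (by simpa using ht) (c := t ∈ ({s} : Finset Λ.S)), Matrix.mul_one]

theorem sum_excProj : ∑ A, Λ.excProj A = 1 := by
  rw [← piMap_one]
  ext x y
  rw [Matrix.sum_apply]
  have : ∀ s, (1 : Matrix (Λ.SiteCfg s) (Λ.SiteCfg s) ℂ) (x s) (y s) =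
      (1 - Λ.localProj s) (x s) (y s) + Λ.localProj s (x s) (y s) := by
    intro s; simp
  simp only [piMap, this]
  rw [Finset.prod_add, Finset.powerset_univ]
  refine Finset.sum_congr rfl fun A _ => ?_
  simp only [excProj, tensorOp]
  rw [← Finset.prod_mul_prod_compl A]
  congr 1
  · exact Finset.prod_congr rfl fun s hs => by rw [if_pos hs]
  · rw [← Finset.compl_eq_univ_sdiff]
    exact Finset.prod_congr rfl fun s hs => by rw [if_neg (Finset.mem_compl.1 hs)]

/-- A reduced resolvent is unique: G = G(HG') = (GH)G' = (1 - P)G' = G'. -/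
theorem resolvent_eq_siteRes (h𝒯 : 𝒯.IsIsometric) : Λ.resolvent = Λ.siteRes Finset.univ := by
  have hR := Λ.siteRes_isResolvent h𝒯 Finset.univ
  have hexc : Λ.excProj ∅ = Λ.P₀ := by
    simp [excProj, P₀, siteProj]
  have hTH : ∀ A, Λ.excProj A * Λ.H₀ = (A.card : ℂ) • Λ.excProj A := by
    intro A
    rw [H₀, Finset.mul_sum]
    have : ∀ s, Λ.excProj A * (1 - Λ.siteProj {s}) = if s ∈ A then Λ.excProj A else 0 := by
      intro s
      rw [mul_sub, mul_one, Λ.excProj_mul_siteProj h𝒯]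
      split_ifs <;> simp
    simp only [this, Finset.sum_ite_mem, Finset.univ_inter, Finset.sum_const,
      ← Nat.cast_smul_eq_nsmul ℂ]
  have hGH : Λ.resolvent * Λ.H₀ = 1 - Λ.P₀ := by
    show (∑ A : Finset Λ.S, ((A.card : ℂ)⁻¹) • Λ.excProj A) * Λ.H₀ = _
    rw [Finset.sum_mul, ← Λ.sum_excProj, ← hexc, eq_sub_iff_add_eq,
      ← Finset.add_sum_erase _ _ (Finset.mem_univ ∅), ← Finset.add_sum_erase _ _ (Finset.mem_univ ∅)]
    simp only [Finset.card_empty, Nat.cast_zero, inv_zero, zero_smul, zero_mul, zero_add]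
    rw [add_comm]
    congr 1
    refine Finset.sum_congr rfl fun A hA => ?_
    have : (A.card : ℂ) ≠ 0 := by
      have := Finset.card_ne_zero.2 (Finset.nonempty_iff_ne_empty.2 (Finset.ne_of_mem_erase hA))
      exact_mod_cast this
    rw [Matrix.smul_mul, hTH, smul_smul, inv_mul_cancel₀ this, one_smul]
  have hGP : Λ.resolvent * Λ.P₀ = 0 := by
    show (∑ A : Finset Λ.S, ((A.card : ℂ)⁻¹) • Λ.excProj A) * Λ.P₀ = _
    rw [Finset.sum_mul]
    refine Finset.sum_eq_zero fun A _ => ?_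
    rcases A.eq_empty_or_nonempty with rfl | ⟨s, hs⟩
    · simp
    · rw [← Λ.siteProj_mul_P₀ h𝒯 {s}, Matrix.smul_mul, ← Matrix.mul_assoc,
        Λ.excProj_mul_siteProj h𝒯, if_pos hs, zero_mul, smul_zero]
  have e1 : Λ.resolvent * (Λ.H₀ * Λ.siteRes Finset.univ) = Λ.resolvent := by
    have := hR.HG
    rw [siteHam_univ] at this
    rw [this, mul_sub, mul_one, show Λ.siteProj Finset.univ = Λ.P₀ from rfl, hGP, sub_zero]
  rw [← e1, ← mul_assoc, hGH, sub_mul, one_mul, show Λ.P₀ = Λ.siteProj Finset.univ from rfl, hR.PG,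
    sub_zero]

end PEPS

/-! ### Quadratic forms of matrices -/

section QuadraticForms

variable {n : Type} [Fintype n]

/-- The squared norm of a vector. -/
def nsq (x : n → ℂ) : ℝ := (star x ⬝ᵥ x).re

/-- The real part of the expectation value of a matrix. -/
def qform (A : Matrix n n ℂ) (x : n → ℂ) : ℝ := (star x ⬝ᵥ A.mulVec x).re

theorem star_dotProduct_comm (x y : n → ℂ) : star x ⬝ᵥ y = star (star y ⬝ᵥ x) := by
  rw [Matrix.star_dotProduct]

theorem star_mulVec_dotProduct {m : Type} [Fintype m] (A : Matrix m n ℂ) (x : n → ℂ) (y : m → ℂ) :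
    star (A.mulVec x) ⬝ᵥ y = star x ⬝ᵥ A.conjTranspose.mulVec y := by
  rw [Matrix.star_mulVec, Matrix.dotProduct_mulVec]

theorem nsq_eq_sum (x : n → ℂ) : nsq x = ∑ i, ‖x i‖ ^ 2 := by
  simp only [nsq, dotProduct, Complex.re_sum]
  refine Finset.sum_congr rfl fun i _ => ?_
  rw [Pi.star_apply, Complex.star_def, ← Complex.normSq_eq_norm_sq, Complex.normSq_apply]
  simp

theorem nsq_nonneg (x : n → ℂ) : 0 ≤ nsq x := by
  rw [nsq_eq_sum]; positivity

theorem nsq_eq_zero {x : n → ℂ} : nsq x = 0 ↔ x = 0 := by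
  rw [nsq_eq_sum, Finset.sum_eq_zero_iff_of_nonneg (fun i _ => by positivity)]
  simp [funext_iff]

theorem nsq_pos {x : n → ℂ} (h : x ≠ 0) : 0 < nsq x :=
  lt_of_le_of_ne (nsq_nonneg x) fun h' => h (nsq_eq_zero.1 h'.symm)

theorem star_dotProduct_self (x : n → ℂ) : star x ⬝ᵥ x = (nsq x : ℂ) := by
  apply Complex.ext
  · rfl
  · have := congrArg Complex.im (star_dotProduct_comm x x)
    simp only [Complex.star_def, Complex.conj_im, Complex.ofReal_im] at this ⊢
    linarith

theorem nsq_smul (c : ℝ) (x : n → ℂ) : nsq ((c : ℂ) • x) = c ^ 2 * nsq x := by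
  simp only [nsq_eq_sum, Pi.smul_apply, smul_eq_mul, norm_mul, mul_pow, Complex.norm_real,
    Real.norm_eq_abs, sq_abs, Finset.mul_sum]

theorem nsq_sub (x y : n → ℂ) : nsq (x - y) = nsq x + nsq y - 2 * (star x ⬝ᵥ y).re := by
  simp only [nsq, star_sub, sub_dotProduct, dotProduct_sub, Complex.sub_re]
  rw [star_dotProduct_comm y x, Complex.star_def, Complex.conj_re]
  ring

theorem re_dotProduct_le (x y : n → ℂ) : (star x ⬝ᵥ y).re ≤ (nsq x + nsq y) / 2 := by
  have := nsq_nonneg (x - y)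
  rw [nsq_sub] at this
  linarith

theorem nsq_mulVec {m : Type} [Fintype m] (A : Matrix m n ℂ) (x : n → ℂ) :
    nsq (A.mulVec x) = qform (A.conjTranspose * A) x := by
  rw [nsq, qform, star_mulVec_dotProduct, Matrix.mulVec_mulVec]

theorem qform_conjTranspose (A : Matrix n n ℂ) (x : n → ℂ) :
    qform A.conjTranspose x = qform A x := by
  rw [qform, ← star_mulVec_dotProduct, star_dotProduct_comm, Complex.star_def, Complex.conj_re,
    qform]

theorem qform_add (A B : Matrix n n ℂ) (x : n → ℂ) :
    qform (A + B) x = qform A x + qform B x := by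
  simp [qform, Matrix.add_mulVec, dotProduct_add]

theorem qform_neg (A : Matrix n n ℂ) (x : n → ℂ) : qform (-A) x = -qform A x := by
  simp [qform, Matrix.neg_mulVec]

theorem qform_sub (A B : Matrix n n ℂ) (x : n → ℂ) :
    qform (A - B) x = qform A x - qform B x := by
  rw [sub_eq_add_neg, qform_add, qform_neg, sub_eq_add_neg]

theorem qform_smul (c : ℝ) (A : Matrix n n ℂ) (x : n → ℂ) :
    qform ((c : ℂ) • A) x = c * qform A x := by
  simp [qform, Matrix.smul_mulVec]

theorem qform_zero (x : n → ℂ) : qform (0 : Matrix n n ℂ) x = 0 := by simp [qform]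

theorem qform_sum {α : Type*} (s : Finset α) (f : α → Matrix n n ℂ) (x : n → ℂ) :
    qform (∑ i ∈ s, f i) x = ∑ i ∈ s, qform (f i) x := by
  classical
  induction s using Finset.induction_on with
  | empty => simp [qform_zero]
  | insert i s hi ih => rw [Finset.sum_insert hi, Finset.sum_insert hi, qform_add, ih]

theorem qform_of_eigen {A : Matrix n n ℂ} {x : n → ℂ} {c : ℝ} (h : A.mulVec x = (c : ℂ) • x) :
    qform A x = c * nsq x := by
  rw [qform, h, dotProduct_smul, nsq]
  simp

theorem qform_mul_conjTranspose_mul {m : Type} [Fintype m] (A : Matrix m m ℂ) (B : Matrix m n ℂ)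
    (x : n → ℂ) :
    qform (B.conjTranspose * A * B) x = qform A (B.mulVec x) := by
  rw [qform, qform, star_mulVec_dotProduct, Matrix.mulVec_mulVec, Matrix.mulVec_mulVec]

open scoped ComplexOrder in
theorem qform_le_of_isGreatest [DecidableEq n] {A : Matrix n n ℂ} (hA : A.IsHermitian) {η : ℝ}
    (h : ∀ μ ∈ realEigenvalues A, μ ≤ η) (x : n → ℂ) : qform A x ≤ η * nsq x := by
  have hB : ((η : ℂ) • (1 : Matrix n n ℂ) - A).IsHermitian := by
    rw [Matrix.IsHermitian, Matrix.conjTranspose_sub, hA.eq]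
    simp
  have hpos : ((η : ℂ) • (1 : Matrix n n ℂ) - A).PosSemidef := by
    rw [hB.posSemidef_iff_eigenvalues_nonneg]
    intro i
    have hv := hB.mulVec_eigenvectorBasis i
    set v := hB.eigenvectorBasis i with hv'
    have hne : v.ofLp ≠ 0 := by
      intro h0
      have : v ≠ 0 := hB.eigenvectorBasis.orthonormal.ne_zero i
      exact this (by ext j; exact congrFun h0 j)
    have := h (η - hB.eigenvalues i) ⟨v.ofLp, hne, ?_⟩
    · simpa using this
    · rw [Matrix.sub_mulVec, Matrix.smul_mulVec, Matrix.one_mulVec] at hv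
      push_cast
      rw [sub_smul]
      have e : ((hB.eigenvalues i : ℝ) : ℂ) • v.ofLp = hB.eigenvalues i • v.ofLp := by
        ext; simp
      rw [e, ← hv]
      simp
  have h2 := hpos.re_dotProduct_nonneg x
  have h3 : qform ((η : ℂ) • (1 : Matrix n n ℂ) - A) x = η * nsq x - qform A x := by
    rw [qform_sub, qform_smul, qform, Matrix.one_mulVec, nsq]
  have h4 : 0 ≤ qform ((η : ℂ) • (1 : Matrix n n ℂ) - A) x := h2
  linarith

end QuadraticForms

/-! ### Families of operators with a common maximizing vector -/

section CommonMaximizer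

variable {n : Type} [Fintype n] [DecidableEq n]

/-- `ψ` is an eigenvector of the real part of `Y`, for the largest, nonnegative eigenvalue `η`. -/
structure MaximizesRe (Y : Matrix n n ℂ) (ψ : n → ℂ) (η : ℝ) : Prop where
  nonneg : 0 ≤ η
  bound : ∀ φ, qform Y φ ≤ η * nsq φ
  eigen : Y.mulVec ψ + Y.conjTranspose.mulVec ψ = ((2 * η : ℝ) : ℂ) • ψ

/-- `ψ` is an eigenvector of `Y` and of its adjoint, for the operator norm `η` of `Y`. -/
structure Maximizes (Y : Matrix n n ℂ) (ψ : n → ℂ) (η : ℝ) : Prop where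
  nonneg : 0 ≤ η
  eigen : Y.mulVec ψ = (η : ℂ) • ψ
  eigen' : Y.conjTranspose.mulVec ψ = (η : ℂ) • ψ
  bound : ∀ φ, nsq (Y.mulVec φ) ≤ η ^ 2 * nsq φ
  bound' : ∀ φ, nsq (Y.conjTranspose.mulVec φ) ≤ η ^ 2 * nsq φ

variable {𝒲 : Set (Matrix n n ℂ)} {ψ : n → ℂ}

theorem MaximizesRe.herm_eigen {A : Matrix n n ℂ} (hA : A.IsHermitian) {β : ℝ}
    (h : MaximizesRe A ψ β) : A.mulVec ψ = (β : ℂ) • ψ := by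
  have := h.eigen
  rw [hA.eq, ← two_smul ℂ] at this
  have h2 := congrArg (fun v => (2 : ℂ)⁻¹ • v) this
  simp only [smul_smul] at h2
  push_cast at h2
  rw [inv_mul_cancel₀ two_ne_zero, one_smul, ← mul_assoc, inv_mul_cancel₀ two_ne_zero,
    one_mul] at h2
  exact h2

theorem smul_right_cancel_real {ψ : n → ℂ} (hψ : ψ ≠ 0) {a b : ℝ}
    (h : (a : ℂ) • ψ = (b : ℂ) • ψ) : a = b := by
  exact_mod_cast smul_left_injective ℂ hψ h

/-- `Y†Y` and `YY†` have the same largest eigenvalue. -/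
theorem maximizesRe_gram_unique (hψ : ψ ≠ 0) {Y : Matrix n n ℂ} {β β' : ℝ}
    (h : MaximizesRe (Y.conjTranspose * Y) ψ β) (h' : MaximizesRe (Y * Y.conjTranspose) ψ β') :
    β' ≤ β := by
  have e' := h'.herm_eigen (Matrix.isHermitian_mul_conjTranspose_self Y)
  have h1 : nsq (Y.conjTranspose.mulVec ψ) = β' * nsq ψ := by
    rw [nsq_mulVec, Matrix.conjTranspose_conjTranspose, qform_of_eigen e']
  have h2 := h.bound (Y.conjTranspose.mulVec ψ)
  rw [← nsq_mulVec, Matrix.mulVec_mulVec, e', nsq_smul, h1] at h2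
  have hpos := nsq_pos hψ
  by_contra hlt
  push Not at hlt
  have : 0 < β' := lt_of_le_of_lt h.nonneg hlt
  nlinarith [mul_pos this hpos]

/-- Both relations follow by applying `Y` and its adjoint to Yψ + Y†ψ = 2ηψ. With η = √β cos θ they
read √β₂ = β and η₂ = β cos 2θ: squaring the operator doubles the angle. -/
theorem maximizesRe_sq (hψ : ψ ≠ 0) {Y : Matrix n n ℂ} {η η₂ β β₂ : ℝ}
    (h : MaximizesRe Y ψ η) (h₂ : MaximizesRe (Y * Y) ψ η₂)
    (hβ : MaximizesRe (Y.conjTranspose * Y) ψ β) (hβ' : MaximizesRe (Y * Y.conjTranspose) ψ β)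
    (hβ₂ : MaximizesRe ((Y * Y).conjTranspose * (Y * Y)) ψ β₂) :
    η₂ = 2 * η ^ 2 - β ∧ β₂ = β ^ 2 := by
  have e := hβ.herm_eigen (Matrix.isHermitian_conjTranspose_mul_self Y)
  have e' := hβ'.herm_eigen (Matrix.isHermitian_mul_conjTranspose_self Y)
  have e₂ := hβ₂.herm_eigen (Matrix.isHermitian_conjTranspose_mul_self _)
  set y := Y.mulVec ψ with hy
  set y' := Y.conjTranspose.mulVec ψ with hy'
  have hsum : y + y' = ((2 * η : ℝ) : ℂ) • ψ := h.eigen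
  rw [← Matrix.mulVec_mulVec, ← hy] at e
  rw [← Matrix.mulVec_mulVec, ← hy'] at e'
  have e2 := h₂.eigen
  rw [Matrix.conjTranspose_mul, ← Matrix.mulVec_mulVec, ← Matrix.mulVec_mulVec, ← hy, ← hy'] at e2
  have a1 : Y.mulVec y + Y.mulVec y' = ((2 * η : ℝ) : ℂ) • y := by
    rw [← Matrix.mulVec_add, hsum, Matrix.mulVec_smul]
  have a2 : Y.conjTranspose.mulVec y + Y.conjTranspose.mulVec y' = ((2 * η : ℝ) : ℂ) • y' := by
    rw [← Matrix.mulVec_add, hsum, Matrix.mulVec_smul]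
  constructor
  · have : ((2 * η₂ + 2 * β : ℝ) : ℂ) • ψ = ((4 * η ^ 2 : ℝ) : ℂ) • ψ := by
      calc ((2 * η₂ + 2 * β : ℝ) : ℂ) • ψ
          = ((2 * η₂ : ℝ) : ℂ) • ψ + (β : ℂ) • ψ + (β : ℂ) • ψ := by push_cast; module
        _ = (Y.mulVec y + Y.mulVec y') + (Y.conjTranspose.mulVec y + Y.conjTranspose.mulVec y') := by
          rw [← e2, e, e']; abel
        _ = ((2 * η : ℝ) : ℂ) • (y + y') := by rw [a1, a2, smul_add]
        _ = ((4 * η ^ 2 : ℝ) : ℂ) • ψ := by rw [hsum]; push_cast; module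
    have := smul_right_cancel_real hψ this
    linarith
  · have h1 : Y.conjTranspose.mulVec (Y.mulVec y') = (β : ℂ) • y' := by
      rw [e', Matrix.mulVec_smul]
    have h2 : Y.conjTranspose.mulVec (Y.mulVec y) = (β : ℂ) • y := by
      have : y = ((2 * η : ℝ) : ℂ) • ψ - y' := by rw [← hsum]; abel
      conv_lhs => rw [this]
      rw [Matrix.mulVec_sub, Matrix.mulVec_sub, h1, Matrix.mulVec_smul, Matrix.mulVec_smul, ← hy, e]
      conv_rhs => rw [this]
      module
    rw [Matrix.conjTranspose_mul, ← Matrix.mulVec_mulVec, ← Matrix.mulVec_mulVec,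
      ← Matrix.mulVec_mulVec, ← hy, h2, Matrix.mulVec_smul, e, smul_smul] at e₂
    have : ((β * β : ℝ) : ℂ) • ψ = (β₂ : ℂ) • ψ := by rw [← e₂]; push_cast; rfl
    rw [← smul_right_cancel_real hψ this, sq]

/-- If `ψ` maximizes the real parts of a family of operators that is closed under products and
adjoints, then it is an eigenvector of each of them, for its norm. -/
theorem maximizes_of_maximizesRe (hψ : ψ ≠ 0) (hmul : ∀ X ∈ 𝒲, ∀ Y ∈ 𝒲, X * Y ∈ 𝒲)
    (hstar : ∀ X ∈ 𝒲, X.conjTranspose ∈ 𝒲) (h : ∀ X ∈ 𝒲, ∃ η, MaximizesRe X ψ η)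
    {Y : Matrix n n ℂ} (hY : Y ∈ 𝒲) : ∃ η, Maximizes Y ψ η := by
  have gram : ∀ Y ∈ 𝒲, ∃ β, MaximizesRe (Y.conjTranspose * Y) ψ β ∧
      MaximizesRe (Y * Y.conjTranspose) ψ β := by
    intro Y hY
    obtain ⟨β, hβ⟩ := h _ (hmul _ (hstar _ hY) _ hY)
    obtain ⟨β', hβ'⟩ := h _ (hmul _ hY _ (hstar _ hY))
    have h1 := maximizesRe_gram_unique hψ hβ hβ'
    have h2 := maximizesRe_gram_unique (Y := Y.conjTranspose) (β := β') (β' := β) hψ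
      (by simpa using hβ') (by simpa using hβ)
    have : β = β' := le_antisymm h2 h1
    exact ⟨β, hβ, this ▸ hβ'⟩
  -- Since cos(2^k θ) stays nonnegative for all k, the angle is zero. Quantitatively, √β₂ - η₂ =
  -- 2(√β - η)(√β + η), so a relative bound on the deficit of Y² implies half that bound for Y; the
  -- start of the induction is η ≥ 0.
  have key : ∀ k : ℕ, ∀ Y ∈ 𝒲, ∀ η β, MaximizesRe Y ψ η →
      MaximizesRe (Y.conjTranspose * Y) ψ β → √β - η ≤ (1 / 2) ^ k * √β := by
    intro k
    induction k with
    | zero =>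
      intro Y hY η β hη hβ
      have := hη.nonneg
      simpa using this
    | succ k ih =>
      intro Y hY η β hη hβ
      obtain ⟨β', hβ1, hβ2⟩ := gram Y hY
      have hb : β' = β := by
        have e1 := hβ.herm_eigen (Matrix.isHermitian_conjTranspose_mul_self Y)
        have e2 := hβ1.herm_eigen (Matrix.isHermitian_conjTranspose_mul_self Y)
        exact smul_right_cancel_real hψ (e2.symm.trans e1)
      subst hb
      obtain ⟨η₂, hη₂⟩ := h _ (hmul _ hY _ hY)
      obtain ⟨β₂, hβ₂, -⟩ := gram _ (hmul _ hY _ hY)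
      obtain ⟨i1, i2⟩ := maximizesRe_sq hψ hη hη₂ hβ1 hβ2 hβ₂
      have := ih _ (hmul _ hY _ hY) η₂ β₂ hη₂ hβ₂
      have hs : √β₂ = β' := by rw [i2, Real.sqrt_sq hβ.nonneg]
      rw [hs, i1] at this
      have hsq : √β' * √β' = β' := Real.mul_self_sqrt hβ.nonneg
      have hη0 := hη.nonneg
      set t := √β'
      have ht : 0 ≤ t := Real.sqrt_nonneg _
      rcases ht.eq_or_lt with h0 | h0
      · rw [← h0]; simpa using hη0
      · rw [← hsq] at this
        have h1 : (t - η) * (t + η) ≤ (1 / 2) ^ (k + 1) * t * t := by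
          rw [pow_succ]; nlinarith
        by_contra hlt
        push Not at hlt
        have hp : 0 ≤ (1 / 2 : ℝ) ^ (k + 1) * t := by positivity
        nlinarith
  obtain ⟨η, hη⟩ := h Y hY
  obtain ⟨β, hβ, hβ'⟩ := gram Y hY
  have hle : √β ≤ η := by
    have hlim : Filter.Tendsto (fun k : ℕ => (1 / 2 : ℝ) ^ k * √β) Filter.atTop (nhds (0 * √β)) :=
      (tendsto_pow_atTop_nhds_zero_of_lt_one (by norm_num) (by norm_num)).mul_const _
    have := ge_of_tendsto' hlim fun k => key k Y hY η β hη hβ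
    linarith
  have hβη : β ≤ η ^ 2 := by
    have h0 := Real.sqrt_nonneg β
    calc β = √β ^ 2 := (Real.sq_sqrt hβ.nonneg).symm
      _ ≤ η ^ 2 := by gcongr
  have hq : qform Y ψ = η * nsq ψ := by
    have h1 := congrArg (fun v => (star ψ ⬝ᵥ v).re) hη.eigen
    simp only [dotProduct_add, Complex.add_re, dotProduct_smul, star_dotProduct_self] at h1
    have h2 := qform_conjTranspose Y ψ
    simp only [qform] at h2 ⊢
    rw [h2] at h1
    have h3 : (((2 * η : ℝ) : ℂ) • ((nsq ψ : ℝ) : ℂ)).re = 2 * η * nsq ψ := by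
      rw [smul_eq_mul, ← Complex.ofReal_mul, Complex.ofReal_re]
    linarith
  have bound : ∀ {Z : Matrix n n ℂ} {β}, MaximizesRe (Z.conjTranspose * Z) ψ β → β ≤ η ^ 2 →
      ∀ φ, nsq (Z.mulVec φ) ≤ η ^ 2 * nsq φ := by
    intro Z β hZ hle φ
    rw [nsq_mulVec]
    exact (hZ.bound φ).trans (mul_le_mul_of_nonneg_right hle (nsq_nonneg φ))
  -- Equality in the norm bound: ‖Zψ - ηψ‖² = ‖Zψ‖² - 2η Re⟨ψ, Zψ⟩ + η²‖ψ‖² is at most zero.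
  have eig : ∀ {Z : Matrix n n ℂ}, qform Z ψ = η * nsq ψ →
      (∀ φ, nsq (Z.mulVec φ) ≤ η ^ 2 * nsq φ) → Z.mulVec ψ = (η : ℂ) • ψ := by
    intro Z hZ hb
    rw [← sub_eq_zero, ← nsq_eq_zero]
    refine le_antisymm ?_ (nsq_nonneg _)
    rw [nsq_sub, nsq_smul, dotProduct_smul, star_dotProduct_comm]
    have : ((η : ℂ) • star (star ψ ⬝ᵥ Z.mulVec ψ)).re = η * qform Z ψ := by
      simp [qform]
    rw [this, hZ]
    have := hb ψ
    nlinarith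
  have b1 := bound hβ hβη
  have b2 := bound (Z := Y.conjTranspose) (by simpa using hβ') hβη
  exact ⟨η, hη.nonneg, eig hq b1, eig (by rw [qform_conjTranspose, hq]) b2, b1, b2⟩

end CommonMaximizer

/-! ### Words in the projections of a PEPS -/

theorem nsq_mulVec_le_of_proj {n : Type} [Fintype n] [DecidableEq n] {A : Matrix n n ℂ}
    (hA : A.IsHermitian) (hA2 : A * A = A) (x : n → ℂ) : nsq (A.mulVec x) ≤ nsq x := by
  have h : nsq (A.mulVec x) = (star x ⬝ᵥ A.mulVec x).re := by
    rw [nsq_mulVec, hA.eq, hA2, qform]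
  have := re_dotProduct_le x (A.mulVec x)
  linarith

namespace PEPS

variable {𝒯 : SiteTensors} (Λ : PEPS 𝒯)

/-- The products of site projections and bond projections. -/
def words : Submonoid (Matrix Λ.VirtCfg Λ.VirtCfg ℂ) :=
  Submonoid.closure (Set.range Λ.siteProj ∪ Set.range Λ.bondProj)

theorem siteProj_mem_words (B : Finset Λ.S) : Λ.siteProj B ∈ Λ.words :=
  Submonoid.subset_closure (Or.inl ⟨B, rfl⟩)

theorem bondProj_mem_words (F : Finset Λ.E) : Λ.bondProj F ∈ Λ.words :=
  Submonoid.subset_closure (Or.inr ⟨F, rfl⟩)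

theorem P₀_mem_words : Λ.P₀ ∈ Λ.words := Λ.siteProj_mem_words _

theorem conjTranspose_mem_words {x : Matrix Λ.VirtCfg Λ.VirtCfg ℂ} (hx : x ∈ Λ.words) :
    x.conjTranspose ∈ Λ.words := by
  induction hx using Submonoid.closure_induction with
  | mem x hx =>
    rcases hx with ⟨B, rfl⟩ | ⟨F, rfl⟩
    · rw [(Λ.siteProj_isHermitian B).eq]; exact Λ.siteProj_mem_words B
    · rw [(Λ.bondProj_isHermitian F).eq]; exact Λ.bondProj_mem_words F
  | one => rw [Matrix.conjTranspose_one]; exact one_mem _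
  | mul x y _ _ hx hy => rw [Matrix.conjTranspose_mul]; exact mul_mem hy hx

theorem nsq_word_mulVec_le (h𝒯 : 𝒯.IsIsometric) {x : Matrix Λ.VirtCfg Λ.VirtCfg ℂ}
    (hx : x ∈ Λ.words) (v : Λ.VirtCfg → ℂ) : nsq (x.mulVec v) ≤ nsq v := by
  induction hx using Submonoid.closure_induction generalizing v with
  | mem x hx =>
    rcases hx with ⟨B, rfl⟩ | ⟨F, rfl⟩
    · exact nsq_mulVec_le_of_proj (Λ.siteProj_isHermitian B)
        (by rw [Λ.siteProj_mul h𝒯, Finset.union_self]) v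
    · exact nsq_mulVec_le_of_proj (Λ.bondProj_isHermitian F)
        (by rw [bondProj_mul, Finset.union_self]) v
  | one => rw [Matrix.one_mulVec]
  | mul x y _ _ hx hy => rw [← Matrix.mulVec_mulVec]; exact (hx _).trans (hy _)

theorem exists_list_of_mem_words {x : Matrix Λ.VirtCfg Λ.VirtCfg ℂ} (hx : x ∈ Λ.words) :
    ∃ w : List (Finset Λ.S × Finset Λ.E),
      (w.map (fun p => Λ.siteProj p.1 * Λ.bondProj p.2)).prod = x := by
  induction hx using Submonoid.closure_induction with
  | mem x hx =>
    rcases hx with ⟨B, rfl⟩ | ⟨F, rfl⟩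
    · exact ⟨[(B, ∅)], by simp [bondProj_empty]⟩
    · exact ⟨[(∅, F)], by simp [siteProj_empty]⟩
  | one => exact ⟨[], rfl⟩
  | mul x y _ _ hx hy =>
    obtain ⟨w, rfl⟩ := hx
    obtain ⟨w', rfl⟩ := hy
    exact ⟨w ++ w', by simp⟩

theorem codeMap_mulVec_virtState (h𝒯 : 𝒯.IsIsometric) :
    Λ.codeMap.mulVec Λ.virtState = Λ.codeState := by
  rw [virtState, Matrix.mulVec_mulVec, Λ.codeMap_mul_P₀ h𝒯, codeState]

theorem codeMap_conjTranspose_mulVec_codeState :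
    Λ.codeMap.conjTranspose.mulVec Λ.codeState = Λ.virtState := by
  rw [codeState, Matrix.mulVec_mulVec, codeMap_conjTranspose_mul, virtState]

theorem virtState_ne_zero (h𝒯 : 𝒯.IsIsometric) (h : Λ.codeState ≠ 0) : Λ.virtState ≠ 0 := by
  intro h0
  rw [← Λ.codeMap_mulVec_virtState h𝒯, h0, Matrix.mulVec_zero] at h
  exact h rfl

theorem P₀_mulVec_virtState (h𝒯 : 𝒯.IsIsometric) : Λ.P₀.mulVec Λ.virtState = Λ.virtState := by
  rw [virtState, Matrix.mulVec_mulVec, Λ.P₀_mul_self h𝒯]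

/-- For P₀ = 1 there is no vector outside the code space to witness the eigenvalue zero; this lemma
replaces it in the proof that the largest eigenvalues are nonnegative. -/
theorem word_eq_bondProj (h𝒯 : 𝒯.IsIsometric) (h1 : Λ.P₀ = 1)
    {x : Matrix Λ.VirtCfg Λ.VirtCfg ℂ} (hx : x ∈ Λ.words) : ∃ F, x = Λ.bondProj F := by
  induction hx using Submonoid.closure_induction with
  | mem x hx =>
    rcases hx with ⟨B, rfl⟩ | ⟨F, rfl⟩
    · refine ⟨∅, ?_⟩
      have := Λ.siteProj_mul_P₀ h𝒯 B
      rwa [h1, mul_one, ← bondProj_empty] at this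
    · exact ⟨F, rfl⟩
  | one => exact ⟨∅, Λ.bondProj_empty.symm⟩
  | mul x y _ _ hx hy =>
    obtain ⟨F, rfl⟩ := hx
    obtain ⟨F', rfl⟩ := hy
    exact ⟨F ∪ F', Λ.bondProj_mul F F'⟩

/-- Prepending the set of all sites to the sequence of regions makes the outer projections equal to
P₀. The largest eigenvalue is nonnegative: if P₀ ≠ 1, the complement of the code space provides the
eigenvalue zero; if P₀ = 1, the word is a projection, whose eigenvalue equals its square. -/
theorem exists_maximizesRe (h𝒯 : 𝒯.IsIsometric) (hψ : Λ.codeState ≠ 0) (hq : Λ.IsQuasiInjective)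
    {x : Matrix Λ.VirtCfg Λ.VirtCfg ℂ} (hx : x ∈ Λ.words) :
    ∃ η, MaximizesRe (Λ.P₀ * x * Λ.P₀) Λ.virtState η := by
  obtain ⟨w, hw⟩ := Λ.exists_list_of_mem_words hx
  set Y := Λ.P₀ * x * Λ.P₀ with hY
  obtain ⟨η, hη, he⟩ := hq ((Finset.univ, ∅) :: w)
  have hU : Λ.Upsilon ((Finset.univ, ∅) :: w) = (1 / 2 : ℂ) • (Y + Y.conjTranspose) := by
    have hs : Λ.wordSites ((Finset.univ, ∅) :: w) = Finset.univ := by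
      simp [wordSites]
    have : Λ.siteProj Finset.univ *
        (((Finset.univ, ∅) :: w).map (fun p => Λ.siteProj p.1 * Λ.bondProj p.2)).prod *
        Λ.siteProj Finset.univ = Y := by
      rw [List.map_cons, List.prod_cons, hw, bondProj_empty, mul_one, ← mul_assoc,
        Λ.siteProj_mul_of_subset h𝒯 subset_rfl]
      rfl
    rw [Upsilon, hs, this]
  have hherm : (Λ.Upsilon ((Finset.univ, ∅) :: w)).IsHermitian := by
    rw [hU, Matrix.IsHermitian, Matrix.conjTranspose_smul, Matrix.conjTranspose_add,
      Matrix.conjTranspose_conjTranspose, add_comm]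
    simp
  have hYP : Y * Λ.P₀ = Y := by rw [hY, Matrix.mul_assoc, Λ.P₀_mul_self h𝒯]
  have hPY : Λ.P₀ * Y = Y := by rw [hY, ← Matrix.mul_assoc, ← Matrix.mul_assoc, Λ.P₀_mul_self h𝒯]
  have hYP' : Y.conjTranspose * Λ.P₀ = Y.conjTranspose := by
    have := congrArg Matrix.conjTranspose hPY
    rwa [Matrix.conjTranspose_mul, Λ.P₀_isHermitian.eq] at this
  refine ⟨η, ?_, ?_, ?_⟩
  · by_cases h1 : Λ.P₀ = 1
    · obtain ⟨F, rfl⟩ := Λ.word_eq_bondProj h𝒯 h1 hx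
      have hYF : Y = Λ.bondProj F := by rw [hY, h1, one_mul, mul_one]
      rw [hU, hYF, (Λ.bondProj_isHermitian F).eq] at he
      have e2 : (1 / 2 : ℂ) • (Λ.bondProj F + Λ.bondProj F) = Λ.bondProj F := by
        rw [← two_smul ℂ, smul_smul]; norm_num
      rw [e2] at he
      have h2 := congrArg (Λ.bondProj F).mulVec he
      rw [Matrix.mulVec_mulVec, bondProj_mul, Finset.union_self, Matrix.mulVec_smul, he,
        smul_smul] at h2
      have h3 : (η : ℂ) • Λ.virtState = ((η * η : ℝ) : ℂ) • Λ.virtState := by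
        rw [h2]; push_cast; rfl
      have := smul_right_cancel_real (Λ.virtState_ne_zero h𝒯 hψ) h3
      rw [this]
      exact mul_self_nonneg η
    · obtain ⟨v, hv⟩ : ∃ v, (1 - Λ.P₀).mulVec v ≠ 0 := by
        by_contra hcon
        push Not at hcon
        apply h1
        rw [eq_comm, ← sub_eq_zero]
        exact Matrix.ext_of_mulVec_single fun i => by rw [hcon, Matrix.zero_mulVec]
      refine hη.2 ⟨(1 - Λ.P₀).mulVec v, hv, ?_⟩
      rw [hU, Matrix.mulVec_mulVec, Matrix.smul_mul, Matrix.add_mul, Matrix.mul_sub,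
        Matrix.mul_sub, Matrix.mul_one, Matrix.mul_one, hYP, hYP']
      simp
  · intro φ
    have := qform_le_of_isGreatest hherm hη.2 φ
    have e : ((1 / 2 : ℝ) : ℂ) = (1 / 2 : ℂ) := by push_cast; rfl
    rw [hU, ← e, qform_smul, qform_add, qform_conjTranspose] at this
    linarith
  · rw [hU, Matrix.smul_mulVec, Matrix.add_mulVec] at he
    have := congrArg (fun v => (2 : ℂ) • v) he
    simp only [smul_smul] at this
    norm_num at this
    rw [this]
    push_cast
    rfl

/-- Every word, compressed to the code space, attains its norm at the encoded PEPS. -/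
theorem exists_maximizes (h𝒯 : 𝒯.IsIsometric) (hψ : Λ.codeState ≠ 0) (hq : Λ.IsQuasiInjective)
    {x : Matrix Λ.VirtCfg Λ.VirtCfg ℂ} (hx : x ∈ Λ.words) :
    ∃ η, Maximizes (Λ.P₀ * x * Λ.P₀) Λ.virtState η := by
  refine maximizes_of_maximizesRe (𝒲 := {Y | ∃ x ∈ Λ.words, Y = Λ.P₀ * x * Λ.P₀})
    (Λ.virtState_ne_zero h𝒯 hψ) ?_ ?_ ?_ ⟨x, hx, rfl⟩
  · rintro _ ⟨x, hx, rfl⟩ _ ⟨y, hy, rfl⟩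
    refine ⟨x * Λ.P₀ * y, mul_mem (mul_mem hx Λ.P₀_mem_words) hy, ?_⟩
    simp only [Matrix.mul_assoc]
    rw [← Matrix.mul_assoc Λ.P₀ Λ.P₀, Λ.P₀_mul_self h𝒯]
  · rintro _ ⟨x, hx, rfl⟩
    refine ⟨_, Λ.conjTranspose_mem_words hx, ?_⟩
    rw [Matrix.conjTranspose_mul, Matrix.conjTranspose_mul, Λ.P₀_isHermitian.eq, Matrix.mul_assoc]
  · rintro _ ⟨x, hx, rfl⟩
    exact Λ.exists_maximizesRe h𝒯 hψ hq hx

/-! #### The defect of a vector -/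

/-- The expectation value of `x` in the encoded PEPS. -/
noncomputable def mean (x : Matrix Λ.VirtCfg Λ.VirtCfg ℂ) : ℝ :=
  qform x Λ.virtState / nsq Λ.virtState

/-- By how much the expectation value of `x` in `φ` falls short of that in the encoded PEPS. -/
noncomputable def defect (x : Matrix Λ.VirtCfg Λ.VirtCfg ℂ) (φ : Λ.VirtCfg → ℂ) : ℝ :=
  Λ.mean x * nsq φ - qform x φ

theorem mean_add (x y : Matrix Λ.VirtCfg Λ.VirtCfg ℂ) :
    Λ.mean (x + y) = Λ.mean x + Λ.mean y := by rw [mean, qform_add, add_div]; rfl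

theorem mean_smul (c : ℝ) (x : Matrix Λ.VirtCfg Λ.VirtCfg ℂ) :
    Λ.mean ((c : ℂ) • x) = c * Λ.mean x := by rw [mean, qform_smul, mul_div_assoc]; rfl

theorem defect_add (x y : Matrix Λ.VirtCfg Λ.VirtCfg ℂ) (φ : Λ.VirtCfg → ℂ) :
    Λ.defect (x + y) φ = Λ.defect x φ + Λ.defect y φ := by
  rw [defect, mean_add, qform_add, defect, defect]; ring

theorem defect_smul (c : ℝ) (x : Matrix Λ.VirtCfg Λ.VirtCfg ℂ) (φ : Λ.VirtCfg → ℂ) :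
    Λ.defect ((c : ℂ) • x) φ = c * Λ.defect x φ := by
  rw [defect, mean_smul, qform_smul, defect]; ring

theorem defect_zero (φ : Λ.VirtCfg → ℂ) : Λ.defect 0 φ = 0 := by
  simp [defect, mean, qform_zero]

theorem defect_neg (x : Matrix Λ.VirtCfg Λ.VirtCfg ℂ) (φ : Λ.VirtCfg → ℂ) :
    Λ.defect (-x) φ = -Λ.defect x φ := by
  simpa using Λ.defect_smul (-1) x φ

theorem defect_sum {α : Type*} (s : Finset α) (f : α → Matrix Λ.VirtCfg Λ.VirtCfg ℂ)
    (φ : Λ.VirtCfg → ℂ) : Λ.defect (∑ i ∈ s, f i) φ = ∑ i ∈ s, Λ.defect (f i) φ := by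
  classical
  induction s using Finset.induction_on with
  | empty => simp [defect_zero]
  | insert i s hi ih => rw [Finset.sum_insert hi, Finset.sum_insert hi, defect_add, ih]

variable {Λ}

theorem qform_compress (x : Matrix Λ.VirtCfg Λ.VirtCfg ℂ) {φ : Λ.VirtCfg → ℂ}
    (hφ : Λ.P₀.mulVec φ = φ) : qform (Λ.P₀ * x * Λ.P₀) φ = qform x φ := by
  have := qform_mul_conjTranspose_mul x Λ.P₀ φ
  rwa [Λ.P₀_isHermitian.eq, hφ] at this

theorem mean_compress (h𝒯 : 𝒯.IsIsometric) (x : Matrix Λ.VirtCfg Λ.VirtCfg ℂ) :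
    Λ.mean (Λ.P₀ * x * Λ.P₀) = Λ.mean x := by
  rw [mean, qform_compress x (Λ.P₀_mulVec_virtState h𝒯), mean]

theorem defect_compress (h𝒯 : 𝒯.IsIsometric) (x : Matrix Λ.VirtCfg Λ.VirtCfg ℂ)
    {φ : Λ.VirtCfg → ℂ} (hφ : Λ.P₀.mulVec φ = φ) :
    Λ.defect (Λ.P₀ * x * Λ.P₀) φ = Λ.defect x φ := by
  rw [defect, mean_compress h𝒯, qform_compress x hφ, defect]

theorem maximizes_mean (h𝒯 : 𝒯.IsIsometric) (hψ : Λ.codeState ≠ 0) (hq : Λ.IsQuasiInjective)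
    {x : Matrix Λ.VirtCfg Λ.VirtCfg ℂ} (hx : x ∈ Λ.words) :
    Maximizes (Λ.P₀ * x * Λ.P₀) Λ.virtState (Λ.mean x) := by
  obtain ⟨η, hη⟩ := Λ.exists_maximizes h𝒯 hψ hq hx
  have : Λ.mean x = η := by
    rw [← mean_compress h𝒯, mean, qform_of_eigen hη.eigen, mul_div_assoc,
      div_self (nsq_pos (Λ.virtState_ne_zero h𝒯 hψ)).ne', mul_one]
  rwa [this]

theorem mean_nonneg (h𝒯 : 𝒯.IsIsometric) (hψ : Λ.codeState ≠ 0) (hq : Λ.IsQuasiInjective)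
    {x : Matrix Λ.VirtCfg Λ.VirtCfg ℂ} (hx : x ∈ Λ.words) : 0 ≤ Λ.mean x :=
  (maximizes_mean h𝒯 hψ hq hx).nonneg

theorem mean_le_one (h𝒯 : 𝒯.IsIsometric) (hψ : Λ.codeState ≠ 0)
    {x : Matrix Λ.VirtCfg Λ.VirtCfg ℂ} (hx : x ∈ Λ.words) : Λ.mean x ≤ 1 := by
  have hpos := nsq_pos (Λ.virtState_ne_zero h𝒯 hψ)
  rw [mean, div_le_one hpos, qform]
  have h1 := re_dotProduct_le Λ.virtState (x.mulVec Λ.virtState)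
  have h2 := Λ.nsq_word_mulVec_le h𝒯 hx Λ.virtState
  linarith

/-- Expanding the square and using that the mean is the norm of the compressed word. A small defect
thus makes φ almost an eigenvector. -/
theorem nsq_sub_mean_smul (h𝒯 : 𝒯.IsIsometric) (hψ : Λ.codeState ≠ 0) (hq : Λ.IsQuasiInjective)
    {x : Matrix Λ.VirtCfg Λ.VirtCfg ℂ} (hx : x ∈ Λ.words) {φ : Λ.VirtCfg → ℂ}
    (hφ : Λ.P₀.mulVec φ = φ) :
    nsq ((Λ.P₀ * x * Λ.P₀).mulVec φ - (Λ.mean x : ℂ) • φ) ≤ 2 * Λ.mean x * Λ.defect x φ := by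
  have h := (maximizes_mean h𝒯 hψ hq hx).bound φ
  rw [nsq_sub, nsq_smul, dotProduct_smul, star_dotProduct_comm, defect]
  have : ((Λ.mean x : ℂ) • star (star φ ⬝ᵥ (Λ.P₀ * x * Λ.P₀).mulVec φ)).re =
      Λ.mean x * qform x φ := by
    rw [← qform_compress x hφ]; simp [qform]
  rw [this]
  nlinarith

theorem defect_conjTranspose (x : Matrix Λ.VirtCfg Λ.VirtCfg ℂ) (φ : Λ.VirtCfg → ℂ) :
    Λ.defect x.conjTranspose φ = Λ.defect x φ := by
  rw [defect, mean, qform_conjTranspose, qform_conjTranspose]; rfl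

/-- The mean is the norm of the compressed word. If it is zero, the compressed word annihilates φ;
otherwise the preceding bound is divided by it. -/
theorem defect_nonneg (h𝒯 : 𝒯.IsIsometric) (hψ : Λ.codeState ≠ 0) (hq : Λ.IsQuasiInjective)
    {x : Matrix Λ.VirtCfg Λ.VirtCfg ℂ} (hx : x ∈ Λ.words) {φ : Λ.VirtCfg → ℂ}
    (hφ : Λ.P₀.mulVec φ = φ) : 0 ≤ Λ.defect x φ := by
  have h := maximizes_mean h𝒯 hψ hq hx
  have h0 := h.nonneg
  rcases h0.eq_or_lt with h0 | h0
  · have hb := h.bound φ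
    rw [← h0] at hb
    have hz : (Λ.P₀ * x * Λ.P₀).mulVec φ = 0 :=
      nsq_eq_zero.1 (le_antisymm (by linarith) (nsq_nonneg _))
    rw [defect, ← h0, ← qform_compress x hφ, qform, hz]
    simp
  · have := nsq_sub_mean_smul h𝒯 hψ hq hx hφ
    have h2 := nsq_nonneg ((Λ.P₀ * x * Λ.P₀).mulVec φ - (Λ.mean x : ℂ) • φ)
    exact nonneg_of_mul_nonneg_right (h2.trans this) (by linarith)

/-- The defect of a product through the code space is controlled by those of its factors. -/
theorem defect_mul_P₀_mul_le (h𝒯 : 𝒯.IsIsometric) (hψ : Λ.codeState ≠ 0)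
    (hq : Λ.IsQuasiInjective) {x y : Matrix Λ.VirtCfg Λ.VirtCfg ℂ} (hx : x ∈ Λ.words)
    (hy : y ∈ Λ.words) {φ : Λ.VirtCfg → ℂ} (hφ : Λ.P₀.mulVec φ = φ) :
    Λ.defect (x * Λ.P₀ * y) φ ≤ 2 * (Λ.defect x φ + Λ.defect y φ) := by
  set X := Λ.P₀ * x * Λ.P₀ with hX
  set Y := Λ.P₀ * y * Λ.P₀ with hY
  have mx := maximizes_mean h𝒯 hψ hq hx
  have my := maximizes_mean h𝒯 hψ hq hy
  have hxy : Λ.P₀ * (x * Λ.P₀ * y) * Λ.P₀ = X * Y := by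
    rw [hX, hY]
    simp only [Matrix.mul_assoc]
    rw [← Matrix.mul_assoc Λ.P₀ Λ.P₀, Λ.P₀_mul_self h𝒯]
  have hmean : Λ.mean (x * Λ.P₀ * y) = Λ.mean x * Λ.mean y := by
    have : (X * Y).mulVec Λ.virtState = ((Λ.mean x * Λ.mean y : ℝ) : ℂ) • Λ.virtState := by
      rw [← Matrix.mulVec_mulVec, my.eigen, Matrix.mulVec_smul, mx.eigen, smul_smul]
      push_cast
      rw [mul_comm]
    rw [← mean_compress h𝒯, hxy, mean, qform_of_eigen this, mul_div_assoc,
      div_self (nsq_pos (Λ.virtState_ne_zero h𝒯 hψ)).ne', mul_one]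
  have hx' := Λ.conjTranspose_mem_words hx
  have hxc : X.conjTranspose = Λ.P₀ * x.conjTranspose * Λ.P₀ := by
    rw [hX, Matrix.conjTranspose_mul, Matrix.conjTranspose_mul, Λ.P₀_isHermitian.eq,
      Matrix.mul_assoc]
  have hmc : Λ.mean x.conjTranspose = Λ.mean x := by rw [mean, qform_conjTranspose]; rfl
  have hu := nsq_sub_mean_smul h𝒯 hψ hq hx' hφ
  have hv := nsq_sub_mean_smul h𝒯 hψ hq hy hφ
  rw [← hxc, hmc, defect_conjTranspose] at hu
  rw [← hY] at hv
  set u := X.conjTranspose.mulVec φ - (Λ.mean x : ℂ) • φ with hu'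
  set v := Y.mulVec φ - (Λ.mean y : ℂ) • φ with hv'
  have hqf : qform (x * Λ.P₀ * y) φ = (star (X.conjTranspose.mulVec φ) ⬝ᵥ Y.mulVec φ).re := by
    rw [← qform_compress _ hφ, hxy, qform, star_mulVec_dotProduct,
      Matrix.conjTranspose_conjTranspose, Matrix.mulVec_mulVec]
  have e1 : X.conjTranspose.mulVec φ = u + (Λ.mean x : ℂ) • φ := by rw [hu']; abel
  have e2 : Y.mulVec φ = v + (Λ.mean y : ℂ) • φ := by rw [hv']; abel
  have huφ : (star u ⬝ᵥ φ).re = -Λ.defect x φ := by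
    rw [hu', star_sub, sub_dotProduct, star_smul, smul_dotProduct, star_mulVec_dotProduct,
      Matrix.conjTranspose_conjTranspose, star_dotProduct_self, Complex.sub_re, defect,
      ← qform_compress x hφ]
    simp [qform, hX]
  have hvφ : (star φ ⬝ᵥ v).re = -Λ.defect y φ := by
    rw [hv', dotProduct_sub, dotProduct_smul, star_dotProduct_self, Complex.sub_re, defect,
      ← qform_compress y hφ]
    simp [qform, hY]
  have huv : -(star u ⬝ᵥ v).re ≤ (nsq u + nsq v) / 2 := by
    have := re_dotProduct_le u (-v)
    have h1 : nsq (-v) = nsq v := by simp [nsq]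
    rw [h1, dotProduct_neg, Complex.neg_re] at this
    exact this
  -- With X†φ = u + mean(x)φ and Yφ = v + mean(y)φ, the cross terms give mean(y)·defect(x) +
  -- mean(x)·defect(y), and ⟨u, v⟩ costs at most mean(x)·defect(x) + mean(y)·defect(y). As the means
  -- are at most one, the factor two results.
  have hexp : qform (x * Λ.P₀ * y) φ = (star u ⬝ᵥ v).re + Λ.mean y * (star u ⬝ᵥ φ).re
      + Λ.mean x * (star φ ⬝ᵥ v).re + Λ.mean x * Λ.mean y * nsq φ := by
    rw [hqf, e1, e2, star_add, add_dotProduct, dotProduct_add, dotProduct_add, star_smul,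
      smul_dotProduct, smul_dotProduct, dotProduct_smul, dotProduct_smul, star_dotProduct_self]
    simp
    ring
  have dx := defect_nonneg h𝒯 hψ hq hx hφ
  have dy := defect_nonneg h𝒯 hψ hq hy hφ
  have mx1 := mean_le_one (Λ := Λ) h𝒯 hψ hx
  have my1 := mean_le_one (Λ := Λ) h𝒯 hψ hy
  have mx0 := mx.nonneg
  have my0 := my.nonneg
  rw [defect, hmean, hexp, huφ, hvφ]
  have p1 : Λ.mean x * Λ.defect x φ ≤ Λ.defect x φ := mul_le_of_le_one_left dx mx1
  have p2 : Λ.mean x * Λ.defect y φ ≤ Λ.defect y φ := mul_le_of_le_one_left dy mx1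
  have p3 : Λ.mean y * Λ.defect x φ ≤ Λ.defect x φ := mul_le_of_le_one_left dx my1
  have p4 : Λ.mean y * Λ.defect y φ ≤ Λ.defect y φ := mul_le_of_le_one_left dy my1
  nlinarith

end PEPS

/-! ### Linear combinations with bounded coefficients -/

section Combinations

variable {n : Type} [Fintype n] [DecidableEq n]

/-- `Comb A C x`: `x` is a real linear combination of elements of `A`, the absolute values of
whose coefficients add up to at most `C`. -/
inductive Comb (A : Set (Matrix n n ℂ)) : ℝ → Matrix n n ℂ → Prop
  | of {x : Matrix n n ℂ} : x ∈ A → Comb A 1 x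
  | zero : Comb A 0 0
  | add {C C' : ℝ} {x y : Matrix n n ℂ} : Comb A C x → Comb A C' y → Comb A (C + C') (x + y)
  | smul {C : ℝ} {x : Matrix n n ℂ} (c : ℝ) : Comb A C x → Comb A (|c| * C) ((c : ℂ) • x)
  | mono {C C' : ℝ} {x : Matrix n n ℂ} : Comb A C x → C ≤ C' → Comb A C' x

namespace Comb

variable {A B D : Set (Matrix n n ℂ)} {C C' : ℝ} {x y : Matrix n n ℂ}

theorem nonneg (h : Comb A C x) : 0 ≤ C := by
  induction h with
  | of _ => exact zero_le_one
  | zero => exact le_rfl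
  | add _ _ h h' => exact add_nonneg h h'
  | smul c _ h => exact mul_nonneg (abs_nonneg c) h
  | mono _ hC h => exact h.trans hC

theorem zero_of_nonneg (hC : 0 ≤ C) : Comb A C 0 := Comb.zero.mono hC

theorem neg (h : Comb A C x) : Comb A C (-x) := by simpa using h.smul (-1)

theorem eq_zero (h : Comb ∅ C x) : x = 0 := by
  induction h with
  | of h => exact h.elim
  | zero => rfl
  | add _ _ h h' => rw [h, h', add_zero]
  | smul c _ h => rw [h, smul_zero]
  | mono _ _ h => exact h

theorem subset (h : Comb A C x) (hAB : A ⊆ B) : Comb B C x := by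
  induction h with
  | of h => exact .of (hAB h)
  | zero => exact .zero
  | add _ _ h h' => exact h.add h'
  | smul c _ h => exact h.smul c
  | mono _ hC h => exact h.mono hC

theorem sum {ι : Type*} (s : Finset ι) {f : ι → Matrix n n ℂ} (h : ∀ i ∈ s, Comb A C (f i)) :
    Comb A (s.card * C) (∑ i ∈ s, f i) := by
  classical
  induction s using Finset.induction_on with
  | empty => simpa using Comb.zero
  | insert i s hi ih =>
    rw [Finset.sum_insert hi, Finset.card_insert_of_notMem hi]
    refine ((h i (by simp)).add (ih fun j hj => h j (by simp [hj]))).mono (le_of_eq ?_)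
    push_cast
    ring

theorem mul (hAB : ∀ x ∈ A, ∀ y ∈ B, x * y ∈ D) (hx : Comb A C x) (hy : Comb B C' y) :
    Comb D (C * C') (x * y) := by
  have hC' := hy.nonneg
  induction hx with
  | of hx =>
    rw [one_mul]
    induction hy with
    | of hy => exact .of (hAB _ hx _ hy)
    | zero => rw [mul_zero]; exact .zero
    | add h h' ih ih' => rw [mul_add]; exact (ih h.nonneg).add (ih' h'.nonneg)
    | smul c h ih => rw [Matrix.mul_smul]; exact (ih h.nonneg).smul c
    | mono h hC ih => exact (ih h.nonneg).mono hC
  | zero => rw [zero_mul, zero_mul]; exact .zero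
  | add _ _ h h' => rw [add_mul, add_mul]; exact h.add h'
  | smul c _ h => rw [Matrix.smul_mul, mul_assoc]; exact h.smul c
  | mono _ hC h => exact h.mono (mul_le_mul_of_nonneg_right hC hC')

end Comb

end Combinations

/-! ### Cluster expansions -/

section Clusters

variable {α : Type} [DecidableEq α]

/-- The cluster coefficients of a product. -/
def clusterMul {R : Type*} [Ring R] (c c' : Finset α → R) (F : Finset α) : R :=
  ∑ p ∈ (F.powerset ×ˢ F.powerset).filter (fun p => p.1 ∪ p.2 = F), c p.1 * c' p.2

/-- Pairs of subsets are grouped by their union: summation over subsets turns the union convolution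
into the product. -/
theorem sum_clusterMul {R : Type*} [Ring R] (c c' : Finset α → R) (F : Finset α) :
    ∑ F' ∈ F.powerset, clusterMul c c' F' =
      (∑ F' ∈ F.powerset, c F') * ∑ F' ∈ F.powerset, c' F' := by
  rw [Finset.sum_mul_sum, ← Finset.sum_product',
    ← Finset.sum_fiberwise_of_maps_to (s := F.powerset ×ˢ F.powerset) (t := F.powerset)
      (g := fun p => p.1 ∪ p.2)]
  · refine Finset.sum_congr rfl fun F' hF' => ?_
    rw [Finset.mem_powerset] at hF'
    refine Finset.sum_congr ?_ fun _ _ => rfl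
    ext ⟨A, B⟩
    simp only [Finset.mem_filter, Finset.mem_product, Finset.mem_powerset]
    constructor
    · rintro ⟨⟨h1, h2⟩, h3⟩
      exact ⟨⟨h1.trans hF', h2.trans hF'⟩, h3⟩
    · rintro ⟨-, h3⟩
      exact ⟨⟨h3 ▸ Finset.subset_union_left, h3 ▸ Finset.subset_union_right⟩, h3⟩
  · rintro ⟨A, B⟩ h
    simp only [Finset.mem_product, Finset.mem_powerset] at h ⊢
    exact Finset.union_subset h.1 h.2

/-- The cluster coefficients are determined by the sums over the subsets. -/
theorem cluster_unique {R : Type*} [AddCommGroup R] {c c' : Finset α → R} (F : Finset α)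
    (h : ∀ F' ⊆ F, ∑ A ∈ F'.powerset, c A = ∑ A ∈ F'.powerset, c' A) : c F = c' F := by
  induction F using Finset.strongInduction with
  | H F ih =>
    have hF := h F subset_rfl
    rw [← Finset.add_sum_erase _ _ (Finset.mem_powerset_self F),
      ← Finset.add_sum_erase (a := F) _ c' (Finset.mem_powerset_self F)] at hF
    have : ∑ A ∈ F.powerset.erase F, c A = ∑ A ∈ F.powerset.erase F, c' A := by
      refine Finset.sum_congr rfl fun A hA => ?_
      rw [Finset.mem_erase, Finset.mem_powerset] at hA
      exact ih A (hA.2.ssubset_of_ne hA.1) fun F' hF' => h F' (hF'.trans hA.2)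
    rw [this] at hF
    exact add_right_cancel hF

theorem sum_powerset_singletons {R : Type*} [AddCommMonoid R] (f : α → R) (F : Finset α) :
    ∑ A ∈ F.powerset, (if A.card = 1 then ∑ e ∈ A, f e else 0) = ∑ e ∈ F, f e := by
  rw [← Finset.sum_filter, ← Finset.powersetCard_eq_filter, Finset.powersetCard_one,
    Finset.sum_map]
  simp

variable {n : Type} [Fintype n] [DecidableEq n]

/-- `f F` is the sum over the subsets of `F` of combinations with the given terms. -/
def HasClusters (A : Finset α → Set (Matrix n n ℂ)) (C : ℝ) (f : Finset α → Matrix n n ℂ) : Prop :=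
  ∃ c : Finset α → Matrix n n ℂ, (∀ F, f F = ∑ F' ∈ F.powerset, c F') ∧ ∀ F, Comb (A F) C (c F)

namespace HasClusters

variable {A B D : Finset α → Set (Matrix n n ℂ)} {C C' : ℝ} {f g : Finset α → Matrix n n ℂ}

theorem mono (h : HasClusters A C f) (hC : C ≤ C') : HasClusters A C' f :=
  h.imp fun _ h => ⟨h.1, fun F => (h.2 F).mono hC⟩

theorem nonneg (h : HasClusters A C f) : 0 ≤ C := by
  obtain ⟨c, -, h⟩ := h
  exact (h ∅).nonneg

theorem add (hf : HasClusters A C f) (hg : HasClusters A C' g) :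
    HasClusters A (C + C') (fun F => f F + g F) := by
  obtain ⟨c, h1, h2⟩ := hf
  obtain ⟨c', h1', h2'⟩ := hg
  exact ⟨fun F => c F + c' F, fun F => by simp only [h1, h1', Finset.sum_add_distrib],
    fun F => (h2 F).add (h2' F)⟩

theorem smul (a : ℝ) (hf : HasClusters A C f) :
    HasClusters A (|a| * C) (fun F => (a : ℂ) • f F) := by
  obtain ⟨c, h1, h2⟩ := hf
  exact ⟨fun F => (a : ℂ) • c F, fun F => by simp only [h1, Finset.smul_sum], fun F => (h2 F).smul a⟩

theorem zero : HasClusters A 0 (fun _ => 0) :=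
  ⟨fun _ => 0, fun F => by simp, fun _ => .zero⟩

theorem const {x : Matrix n n ℂ} (h : Comb (A ∅) C x) : HasClusters A C (fun _ => x) := by
  classical
  refine ⟨fun F => if F = ∅ then x else 0, fun F => ?_, fun F => ?_⟩
  · simp
  · dsimp only
    split_ifs with hF
    · rw [hF]; exact h
    · exact Comb.zero_of_nonneg h.nonneg

theorem mul {k l : ℕ} (hA : ∀ F, ∀ x ∈ A F, F.card ≤ k) (hB : ∀ F, ∀ x ∈ B F, F.card ≤ l)
    (hAB : ∀ F F', ∀ x ∈ A F, ∀ y ∈ B F', x * y ∈ D (F ∪ F')) (hf : HasClusters A C f)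
    (hg : HasClusters B C' g) : HasClusters D (4 ^ (k + l) * (C * C')) (fun F => f F * g F) := by
  have hC := hf.nonneg
  have hC' := hg.nonneg
  obtain ⟨c, h1, h2⟩ := hf
  obtain ⟨c', h1', h2'⟩ := hg
  refine ⟨clusterMul c c', fun F => by simp only [h1, h1', sum_clusterMul], fun F => ?_⟩
  have hc : ∀ F, k < F.card → c F = 0 := by
    intro F hF
    refine ((h2 F).subset (B := ∅) fun x hx => ?_).eq_zero
    exact absurd (hA F x hx) (not_le.2 hF)
  have hc' : ∀ F, l < F.card → c' F = 0 := by
    intro F hF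
    refine ((h2' F).subset (B := ∅) fun x hx => ?_).eq_zero
    exact absurd (hB F x hx) (not_le.2 hF)
  by_cases hF : F.card ≤ k + l
  · refine (Comb.sum (C := C * C') _ fun p hp => ?_).mono ?_
    · rw [Finset.mem_filter] at hp
      exact Comb.mul (fun x hx y hy => hp.2 ▸ hAB _ _ x hx y hy) (h2 p.1) (h2' p.2)
    · gcongr
      -- At most 4^|F| pairs of subsets, and only clusters with at most k + l edges have a nonzero
      -- coefficient.
      have h4 : ((F.powerset ×ˢ F.powerset).filter (fun p => p.1 ∪ p.2 = F)).card ≤ 4 ^ (k + l) := by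
        refine (Finset.card_filter_le _ _).trans ?_
        rw [Finset.card_product, Finset.card_powerset, ← mul_pow]
        exact Nat.pow_le_pow_right (by norm_num) hF
      exact_mod_cast h4
  · have : clusterMul c c' F = 0 := by
      refine Finset.sum_eq_zero fun p hp => ?_
      rw [Finset.mem_filter] at hp
      by_cases hk : k < p.1.card
      · rw [hc _ hk, zero_mul]
      · have := Finset.card_union_le p.1 p.2
        rw [hp.2] at this
        rw [hc' _ (by omega), mul_zero]
    rw [this]
    exact Comb.zero_of_nonneg (by positivity)

end HasClusters

end Clusters

/-! ### Monomials -/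

namespace PEPS

open SchriefferWolff

variable {𝒯 : SiteTensors} (Λ : PEPS 𝒯)

/-- The products `P_{B₀} M_{e₁} P_{B₁} ⋯ M_{eₖ} P_{Bₖ}` with `Bᵢ ⊆ U`, where `F = {e₁, …, eₖ}`. -/
inductive IsMono (U : Finset Λ.S) : ℕ → Finset Λ.E → Matrix Λ.VirtCfg Λ.VirtCfg ℂ → Prop
  | proj {B : Finset Λ.S} : B ⊆ U → IsMono U 0 ∅ (Λ.siteProj B)
  | cons {k : ℕ} {F : Finset Λ.E} {x : Matrix Λ.VirtCfg Λ.VirtCfg ℂ} {B : Finset Λ.S} (e : Λ.E) :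
      B ⊆ U → IsMono U k F x → IsMono U (k + 1) (insert e F) (Λ.siteProj B * Λ.bondProj {e} * x)

variable {Λ}

namespace IsMono

variable {U U' : Finset Λ.S} {k l : ℕ} {F F' : Finset Λ.E} {x y : Matrix Λ.VirtCfg Λ.VirtCfg ℂ}

theorem one : Λ.IsMono U 0 ∅ 1 := by
  rw [← siteProj_empty]
  exact .proj (Finset.empty_subset U)

theorem bond (e : Λ.E) : Λ.IsMono U 1 {e} (Λ.bondProj {e}) := by
  have := IsMono.cons (B := ∅) e (Finset.empty_subset U) (one (Λ := Λ) (U := U))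
  simpa [siteProj_empty] using this

theorem mem_words (h : Λ.IsMono U k F x) : x ∈ Λ.words := by
  induction h with
  | proj _ => exact Λ.siteProj_mem_words _
  | cons e _ _ ih =>
    exact mul_mem (mul_mem (Λ.siteProj_mem_words _) (Λ.bondProj_mem_words _)) ih

theorem card_le (h : Λ.IsMono U k F x) : F.card ≤ k := by
  induction h with
  | proj _ => simp
  | cons e _ _ ih => exact (Finset.card_insert_le _ _).trans (Nat.succ_le_succ ih)

theorem edges_nonempty (h : Λ.IsMono U k F x) (hk : 1 ≤ k) : F.Nonempty := by
  cases h with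
  | proj _ => omega
  | cons e _ _ => exact Finset.insert_nonempty _ _

theorem degree_pos (h : Λ.IsMono U k F x) (hF : F.Nonempty) : 1 ≤ k := by
  cases h with
  | proj _ => simp at hF
  | cons e _ _ => omega

theorem proj_mul (h𝒯 : 𝒯.IsIsometric) {B : Finset Λ.S} (hB : B ⊆ U) (h : Λ.IsMono U k F x) :
    Λ.IsMono U k F (Λ.siteProj B * x) := by
  cases h with
  | proj hB' =>
    rw [Λ.siteProj_mul h𝒯]
    exact .proj (Finset.union_subset hB hB')
  | cons e hB' h =>
    rw [← Matrix.mul_assoc, ← Matrix.mul_assoc, Λ.siteProj_mul h𝒯]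
    exact .cons e (Finset.union_subset hB hB') h

theorem mul (h𝒯 : 𝒯.IsIsometric) (hx : Λ.IsMono U k F x) (hy : Λ.IsMono U l F' y) :
    Λ.IsMono U (k + l) (F ∪ F') (x * y) := by
  induction hx with
  | proj hB => simpa using proj_mul h𝒯 hB hy
  | @cons k F x B e hB _ ih =>
    rw [Matrix.mul_assoc, Finset.insert_union, show k + 1 + l = k + l + 1 by ring]
    exact .cons e hB ih

theorem actsOn (h : Λ.IsMono U k F x) (hU : U ⊆ U') (hF : Λ.sitesOf F ⊆ U') : ActsOn x U' := by
  induction h with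
  | proj hB => exact (Λ.actsOn_siteProj _).mono (hB.trans hU)
  | @cons k F x B e hB _ ih =>
    have h1 : Λ.sitesOf {e} ⊆ U' := (Λ.sitesOf_mono (by simp)).trans hF
    have h2 : Λ.sitesOf F ⊆ U' := (Λ.sitesOf_mono (Finset.subset_insert e F)).trans hF
    exact (((Λ.actsOn_siteProj _).mono (hB.trans hU)).mul ((Λ.actsOn_bondProj _).mono h1)).mul
      (ih h2)

/-- A monomial whose edges do not cross the boundary of a region is a product of a monomial in
the region and one outside. -/
theorem split (h𝒯 : 𝒯.IsIsometric) (h : Λ.IsMono U k F x) (U₁ : Finset Λ.S)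
    (hF : ∀ e ∈ F, (∀ i, Λ.endSite e i ∈ U₁) ∨ (∀ i, Λ.endSite e i ∉ U₁)) :
    ∃ k₁ k₂ x₁ x₂, k₁ + k₂ = k ∧ x = x₁ * x₂ ∧
      Λ.IsMono U₁ k₁ (F.filter fun e => ∀ i, Λ.endSite e i ∈ U₁) x₁ ∧
      Λ.IsMono U₁ᶜ k₂ (F.filter fun e => ¬ ∀ i, Λ.endSite e i ∈ U₁) x₂ := by
  induction h with
  | @proj B hB =>
    refine ⟨0, 0, Λ.siteProj (B ∩ U₁), Λ.siteProj (B \ U₁), rfl, ?_, ?_, ?_⟩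
    · rw [Λ.siteProj_mul h𝒯, Finset.union_comm, Finset.sdiff_union_inter]
    · simpa using IsMono.proj (Λ := Λ) (Finset.inter_subset_right (s₁ := B) (s₂ := U₁))
    · refine IsMono.proj fun s hs => ?_
      rw [Finset.mem_compl]
      exact (Finset.mem_sdiff.1 hs).2
  | @cons k F x B e hB hx ih =>
    obtain ⟨k₁, k₂, x₁, x₂, hk, hx12, h1, h2⟩ := ih fun e' he' => hF e' (by simp [he'])
    have hB1 : B ∩ U₁ ⊆ U₁ := Finset.inter_subset_right
    have hB2 : B \ U₁ ⊆ U₁ᶜ := fun s hs => by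
      rw [Finset.mem_compl]; exact (Finset.mem_sdiff.1 hs).2
    have hBB : Λ.siteProj B = Λ.siteProj (B ∩ U₁) * Λ.siteProj (B \ U₁) := by
      rw [Λ.siteProj_mul h𝒯, Finset.union_comm, Finset.sdiff_union_inter]
    have hdis : Disjoint U₁ U₁ᶜ := disjoint_compl_right
    have a1 : ActsOn x₁ U₁ := h1.actsOn subset_rfl fun s hs => by
      obtain ⟨e', he', i, rfl⟩ := Λ.mem_sitesOf.1 hs
      exact (Finset.mem_filter.1 he').2 i
    have p2 : ActsOn (Λ.siteProj (B \ U₁)) U₁ᶜ := (Λ.actsOn_siteProj _).mono hB2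
    rcases hF e (by simp) with he | he
    · have b1 : ActsOn (Λ.bondProj {e}) U₁ := (Λ.actsOn_bondProj _).mono fun s hs => by
        obtain ⟨e', he', i, rfl⟩ := Λ.mem_sitesOf.1 hs
        rw [Finset.mem_singleton] at he'
        exact he' ▸ he i
      refine ⟨k₁ + 1, k₂, Λ.siteProj (B ∩ U₁) * Λ.bondProj {e} * x₁, Λ.siteProj (B \ U₁) * x₂,
        by omega, ?_, ?_, ?_⟩
      · have c := (b1.mul a1).commute p2 hdis
        rw [hBB, hx12]
        calc Λ.siteProj (B ∩ U₁) * Λ.siteProj (B \ U₁) * Λ.bondProj {e} * (x₁ * x₂)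
            = Λ.siteProj (B ∩ U₁) * (Λ.siteProj (B \ U₁) * (Λ.bondProj {e} * x₁)) * x₂ := by
              simp only [Matrix.mul_assoc]
          _ = Λ.siteProj (B ∩ U₁) * Λ.bondProj {e} * x₁ * (Λ.siteProj (B \ U₁) * x₂) := by
              rw [← c.eq]; simp only [Matrix.mul_assoc]
      · rw [Finset.filter_insert, if_pos he]
        exact .cons e hB1 h1
      · rw [Finset.filter_insert, if_neg (not_not.2 he)]
        exact h2.proj_mul h𝒯 hB2
    · have b2 : ActsOn (Λ.bondProj {e}) U₁ᶜ := (Λ.actsOn_bondProj _).mono fun s hs => by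
        obtain ⟨e', he', i, rfl⟩ := Λ.mem_sitesOf.1 hs
        rw [Finset.mem_singleton] at he'
        exact Finset.mem_compl.2 (he' ▸ he i)
      have hne : ¬ ∀ i, Λ.endSite e i ∈ U₁ := fun h => he true (h true)
      refine ⟨k₁, k₂ + 1, Λ.siteProj (B ∩ U₁) * x₁, Λ.siteProj (B \ U₁) * Λ.bondProj {e} * x₂,
        by omega, ?_, ?_, ?_⟩
      · have c := a1.commute (p2.mul b2) hdis
        rw [hBB, hx12]
        calc Λ.siteProj (B ∩ U₁) * Λ.siteProj (B \ U₁) * Λ.bondProj {e} * (x₁ * x₂)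
            = Λ.siteProj (B ∩ U₁) * (Λ.siteProj (B \ U₁) * Λ.bondProj {e} * x₁) * x₂ := by
              simp only [Matrix.mul_assoc]
          _ = Λ.siteProj (B ∩ U₁) * x₁ * (Λ.siteProj (B \ U₁) * Λ.bondProj {e} * x₂) := by
              rw [← c.eq]; simp only [Matrix.mul_assoc]
      · rw [Finset.filter_insert, if_neg hne]
        exact h1.proj_mul h𝒯 hB1
      · rw [Finset.filter_insert, if_pos hne]
        exact .cons e hB2 h2

end IsMono

variable (Λ)

/-- The monomials of degree `k` with edge set `F`. -/
def monos (U : Finset Λ.S) (k : ℕ) (F : Finset Λ.E) : Set (Matrix Λ.VirtCfg Λ.VirtCfg ℂ) :=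
  {x | Λ.IsMono U k F x}

/-- The products of two monomials of positive degree, with a projection onto the code space in
between. -/
def thruMonos (U : Finset Λ.S) (j : ℕ) (F : Finset Λ.E) : Set (Matrix Λ.VirtCfg Λ.VirtCfg ℂ) :=
  {z | ∃ k l F₁ F₂ x y, 1 ≤ k ∧ 1 ≤ l ∧ k + l = j ∧ F₁ ∪ F₂ = F ∧ Λ.IsMono U k F₁ x ∧
    Λ.IsMono U l F₂ y ∧ z = x * Λ.siteProj U * y}

/-- The part of the perturbation on a set of edges. -/
noncomputable def pert (F : Finset Λ.E) : Matrix Λ.VirtCfg Λ.VirtCfg ℂ :=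
  -∑ e ∈ F, Λ.bondProj {e}

theorem pert_univ : Λ.pert Finset.univ = Λ.V := rfl

theorem resWeight_pos (m b : ℕ) : 0 < resWeight m b := by
  rw [resWeight]
  have h1 := Nat.factorial_pos b
  have h2 := Nat.factorial_pos (m - b - 1)
  have h3 := Nat.factorial_pos m
  positivity

theorem resWeight_le_one {m b : ℕ} (hb : b < m) : resWeight m b ≤ 1 := by
  rw [resWeight, div_le_one (by exact_mod_cast m.factorial_pos)]
  have h1 := Nat.le_of_dvd (Nat.factorial_pos _)
    (Nat.factorial_mul_factorial_dvd_factorial_add b (m - b - 1))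
  have h2 := Nat.factorial_le (show b + (m - b - 1) ≤ m by omega)
  exact_mod_cast h1.trans h2

theorem le_resWeight (m b : ℕ) : 1 / (m.factorial : ℝ) ≤ resWeight m b := by
  rw [resWeight]
  have h1 : 1 ≤ b.factorial * (m - b - 1).factorial := Nat.mul_pos (Nat.factorial_pos b) (Nat.factorial_pos _)
  gcongr
  exact_mod_cast h1

variable {Λ}

theorem resWeight_card_le {U B : Finset Λ.S} (hB : B ∈ U.ssubsets) :
    resWeight U.card B.card ≤ 1 :=
  resWeight_le_one (Finset.card_lt_card (Finset.mem_ssubsets.1 hB))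

theorem hasClusters_pert (U : Finset Λ.S) : HasClusters (Λ.monos U 1) 1 Λ.pert := by
  refine ⟨fun A => if A.card = 1 then ∑ e ∈ A, -Λ.bondProj {e} else 0, fun F => ?_, fun F => ?_⟩
  · rw [sum_powerset_singletons (fun e => -Λ.bondProj {e}), pert, Finset.sum_neg_distrib]
  · dsimp only
    split_ifs with hF
    · obtain ⟨e, rfl⟩ := Finset.card_eq_one.1 hF
      rw [Finset.sum_singleton]
      exact (Comb.of (IsMono.bond e)).neg
    · exact Comb.zero_of_nonneg zero_le_one

theorem comb_siteRes (U : Finset Λ.S) :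
    Comb (Λ.monos U 0 ∅) (2 ^ U.card * 2) (Λ.siteRes U) := by
  refine (Comb.sum (C := 2) _ fun B hB => ?_).mono ?_
  · have h1 : Comb (Λ.monos U 0 ∅) 2 (Λ.siteProj B - Λ.siteProj U) := by
      rw [sub_eq_add_neg]
      exact ((Comb.of (.proj (Finset.mem_ssubsets.1 hB).subset)).add
        (Comb.of (.proj subset_rfl)).neg).mono (by norm_num)
    refine (h1.smul _).mono ?_
    rw [abs_of_pos (resWeight_pos _ _)]
    linarith [resWeight_card_le hB]
  · gcongr
    have : U.ssubsets.card ≤ 2 ^ U.card := by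
      rw [← Finset.card_powerset]
      exact Finset.card_le_card (Finset.erase_subset _ _)
    exact_mod_cast this

/-- The noncommutative polynomials in the projection, the reduced resolvent and the perturbation
have cluster expansions with bounds that depend only on the number of sites. -/
theorem exists_hasClusters (h𝒯 : 𝒯.IsIsometric) (m : ℕ) {k : ℕ} {X : NCFamily}
    (hX : IsNCPoly k X) : ∃ C : ℝ, ∀ (Λ : PEPS 𝒯) (U : Finset Λ.S), U.card ≤ m →
      HasClusters (Λ.monos U k) C (fun F => X _ (Λ.siteProj U) (Λ.siteRes U) (Λ.pert F)) := by
  induction hX with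
  | proj => exact ⟨1, fun Λ U _ => .const (.of (.proj subset_rfl))⟩
  | res =>
    refine ⟨2 ^ m * 2, fun Λ U hU => .const ((comb_siteRes U).mono ?_)⟩
    gcongr
    norm_num
  | pert => exact ⟨1, fun Λ U _ => hasClusters_pert U⟩
  | one => exact ⟨1, fun Λ U _ => .const (.of IsMono.one)⟩
  | zero k => exact ⟨0, fun Λ U _ => .zero⟩
  | add _ _ h h' =>
    obtain ⟨C, h⟩ := h
    obtain ⟨C', h'⟩ := h'
    exact ⟨C + C', fun Λ U hU => (h Λ U hU).add (h' Λ U hU)⟩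
  | smul c _ h =>
    obtain ⟨C, h⟩ := h
    exact ⟨|c| * C, fun Λ U hU => (h Λ U hU).smul c⟩
  | @mul k l _ _ _ _ h h' =>
    obtain ⟨C, h⟩ := h
    obtain ⟨C', h'⟩ := h'
    exact ⟨4 ^ (k + l) * (C * C'), fun Λ U hU => HasClusters.mul (fun F x hx => hx.card_le)
      (fun F x hx => hx.card_le) (fun F F' x hx y hy => hx.mul h𝒯 hy) (h Λ U hU) (h' Λ U hU)⟩

theorem thruMonos_card_le {U : Finset Λ.S} {j : ℕ} {F : Finset Λ.E}
    {z : Matrix Λ.VirtCfg Λ.VirtCfg ℂ} (h : z ∈ Λ.thruMonos U j F) : F.card ≤ j := by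
  obtain ⟨k, l, F₁, F₂, x, y, -, -, rfl, rfl, hx, hy, -⟩ := h
  exact (Finset.card_union_le _ _).trans (add_le_add hx.card_le hy.card_le)

/-- Products through the code space of two cluster expansions. -/
theorem hasClusters_mul_siteProj_mul {U : Finset Λ.S} {k l : ℕ} {C C' : ℝ}
    {f g : Finset Λ.E → Matrix Λ.VirtCfg Λ.VirtCfg ℂ} (hk : 1 ≤ k) (hl : 1 ≤ l)
    (hf : HasClusters (Λ.monos U k) C f) (hg : HasClusters (Λ.monos U l) C' g) :
    HasClusters (Λ.thruMonos U (k + l)) (4 ^ (k + l) * (4 ^ k * C * C'))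
      (fun F => f F * Λ.siteProj U * g F) := by
  have h1 : HasClusters (fun F => {z | ∃ x, Λ.IsMono U k F x ∧ z = x * Λ.siteProj U})
      (4 ^ (k + 0) * (C * 1)) (fun F => f F * Λ.siteProj U) := by
    refine HasClusters.mul (B := fun F => {z | F = ∅ ∧ z = Λ.siteProj U})
      (fun F x hx => hx.card_le) ?_ ?_ hf (.const (.of ⟨rfl, rfl⟩))
    · rintro _ _ ⟨rfl, -⟩; simp
    · rintro F F' x hx y ⟨rfl, rfl⟩
      rw [Finset.union_empty]
      exact ⟨x, hx, rfl⟩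
  have h2 := HasClusters.mul (k := k) (l := l) (D := Λ.thruMonos U (k + l)) ?_
    (fun F x hx => hx.card_le) ?_ h1 hg
  · simpa using h2
  · rintro F _ ⟨x, hx, rfl⟩; exact hx.card_le
  · rintro F F' _ ⟨x, hx, rfl⟩ y hy
    exact ⟨k, l, F, F', x, y, hk, hl, rfl, rfl, hx, hy, rfl⟩

theorem exists_hasClusters_thru (h𝒯 : 𝒯.IsIsometric) (m : ℕ) {k : ℕ} {X : NCFamily}
    (hX : IsThru k X) : ∃ C : ℝ, ∀ (Λ : PEPS 𝒯) (U : Finset Λ.S), U.card ≤ m →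
      HasClusters (Λ.thruMonos U k) C (fun F => X _ (Λ.siteProj U) (Λ.siteRes U) (Λ.pert F)) := by
  induction hX with
  | zero k => exact ⟨0, fun Λ U _ => .zero⟩
  | @mk k l X Y hX hY hk hl =>
    obtain ⟨C, h⟩ := exists_hasClusters h𝒯 m hX
    obtain ⟨C', h'⟩ := exists_hasClusters h𝒯 m hY
    exact ⟨_, fun Λ U hU => hasClusters_mul_siteProj_mul hk hl (h Λ U hU) (h' Λ U hU)⟩
  | add _ _ h h' =>
    obtain ⟨C, h⟩ := h
    obtain ⟨C', h'⟩ := h'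
    exact ⟨C + C', fun Λ U hU => (h Λ U hU).add (h' Λ U hU)⟩
  | smul c _ h =>
    obtain ⟨C, h⟩ := h
    exact ⟨|c| * C, fun Λ U hU => (h Λ U hU).smul c⟩

end PEPS

/-! ### The leading part of the cluster expansion -/

namespace PEPS

open SchriefferWolff

variable {𝒯 : SiteTensors} (Λ : PEPS 𝒯)

/-- The sum of the weights in the reduced resolvent. -/
noncomputable def weightSum (U : Finset Λ.S) : ℝ := ∑ B ∈ U.ssubsets, resWeight U.card B.card

/-- The reduced resolvent, up to a multiple of the projection onto the code space of `U`. -/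
noncomputable def posRes (U : Finset Λ.S) : Matrix Λ.VirtCfg Λ.VirtCfg ℂ :=
  ∑ B ∈ U.ssubsets, (resWeight U.card B.card : ℂ) • Λ.siteProj B

/-- The sum of the bond projections of the edges in `F`. -/
noncomputable def bondSum (F : Finset Λ.E) : Matrix Λ.VirtCfg Λ.VirtCfg ℂ :=
  ∑ e ∈ F, Λ.bondProj {e}

/-- The cluster coefficients of the product of the sum of the bonds with `posRes`. -/
noncomputable def leadLetter (U : Finset Λ.S) (F : Finset Λ.E) : Matrix Λ.VirtCfg Λ.VirtCfg ℂ :=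
  if F.card = 1 then ∑ e ∈ F, Λ.bondProj {e} * Λ.posRes U else 0

/-- The cluster coefficients of the powers of the product of the sum of the bonds with `posRes`. -/
noncomputable def lead (U : Finset Λ.S) : ℕ → Finset Λ.E → Matrix Λ.VirtCfg Λ.VirtCfg ℂ
  | 0 => fun F => if F = ∅ then 1 else 0
  | j + 1 => clusterMul (Λ.leadLetter U) (lead U j)

theorem sum_leadLetter (U : Finset Λ.S) (F : Finset Λ.E) :
    ∑ F' ∈ F.powerset, Λ.leadLetter U F' = Λ.bondSum F * Λ.posRes U := by
  rw [bondSum, Finset.sum_mul, ← sum_powerset_singletons (fun e => Λ.bondProj {e} * Λ.posRes U)]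
  rfl

theorem sum_lead (U : Finset Λ.S) (j : ℕ) (F : Finset Λ.E) :
    ∑ F' ∈ F.powerset, Λ.lead U j F' = (Λ.bondSum F * Λ.posRes U) ^ j := by
  induction j with
  | zero => simp [lead]
  | succ j ih => rw [lead, sum_clusterMul, sum_leadLetter, ih, pow_succ']

/-- The negative part of the reduced resolvent is a multiple of P_U; in a chain it only produces
terms through the code space. -/
theorem siteRes_eq (U : Finset Λ.S) :
    Λ.siteRes U = Λ.posRes U - (Λ.weightSum U : ℂ) • Λ.siteProj U := by
  simp only [siteRes, posRes, weightSum, smul_sub, Finset.sum_sub_distrib, Complex.ofReal_sum,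
    Finset.sum_smul]

theorem weightSum_pos {U : Finset Λ.S} (hU : U.Nonempty) : 0 < Λ.weightSum U :=
  Finset.sum_pos (fun _ _ => resWeight_pos _ _)
    ⟨∅, Finset.mem_ssubsets.2 (Finset.empty_ssubset.2 hU)⟩

theorem weightSum_nonneg (U : Finset Λ.S) : 0 ≤ Λ.weightSum U :=
  Finset.sum_nonneg fun _ _ => (resWeight_pos _ _).le

theorem card_ssubsets_le {α : Type*} [DecidableEq α] (U : Finset α) :
    U.ssubsets.card ≤ 2 ^ U.card := by
  rw [← Finset.card_powerset]
  exact Finset.card_le_card (Finset.erase_subset _ _)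

theorem weightSum_le (U : Finset Λ.S) : Λ.weightSum U ≤ 2 ^ U.card := by
  refine (Finset.sum_le_card_nsmul _ _ 1 fun B hB => resWeight_card_le hB).trans ?_
  rw [nsmul_eq_mul, mul_one]
  exact_mod_cast card_ssubsets_le U

/-- Next to P₀ a factor `posRes` may be inserted at the price of dividing by the weight sum. This
completes the leading chain to a full power of `bondSum * posRes`, whose cluster coefficients obey
the simple recursion `lead`. -/
theorem posRes_mul_P₀ (h𝒯 : 𝒯.IsIsometric) (U : Finset Λ.S) :
    Λ.posRes U * Λ.P₀ = (Λ.weightSum U : ℂ) • Λ.P₀ := by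
  simp only [posRes, weightSum, Finset.sum_mul, Matrix.smul_mul, Λ.siteProj_mul_P₀ h𝒯,
    Complex.ofReal_sum, Finset.sum_smul]

/-! #### Nonnegative combinations of words -/

/-- The nonnegative linear combinations of words. -/
inductive IsPos : Matrix Λ.VirtCfg Λ.VirtCfg ℂ → Prop
  | of {x : Matrix Λ.VirtCfg Λ.VirtCfg ℂ} : x ∈ Λ.words → IsPos x
  | zero : IsPos 0
  | add {x y : Matrix Λ.VirtCfg Λ.VirtCfg ℂ} : IsPos x → IsPos y → IsPos (x + y)
  | smul {x : Matrix Λ.VirtCfg Λ.VirtCfg ℂ} {c : ℝ} : 0 ≤ c → IsPos x → IsPos ((c : ℂ) • x)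

variable {Λ}

namespace IsPos

variable {x y : Matrix Λ.VirtCfg Λ.VirtCfg ℂ}

theorem sum {ι : Type*} (s : Finset ι) {f : ι → Matrix Λ.VirtCfg Λ.VirtCfg ℂ}
    (h : ∀ i ∈ s, Λ.IsPos (f i)) : Λ.IsPos (∑ i ∈ s, f i) := by
  classical
  induction s using Finset.induction_on with
  | empty => simpa using IsPos.zero
  | insert i s hi ih =>
    rw [Finset.sum_insert hi]
    exact (h i (by simp)).add (ih fun j hj => h j (by simp [hj]))

theorem mul (hx : Λ.IsPos x) (hy : Λ.IsPos y) : Λ.IsPos (x * y) := by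
  induction hx with
  | of hx =>
    induction hy with
    | of hy => exact .of (mul_mem hx hy)
    | zero => rw [mul_zero]; exact .zero
    | add _ _ h h' => rw [mul_add]; exact h.add h'
    | smul hc _ h => rw [Matrix.mul_smul]; exact h.smul hc
  | zero => rw [zero_mul]; exact .zero
  | add _ _ h h' => rw [add_mul]; exact h.add h'
  | smul hc _ h => rw [Matrix.smul_mul]; exact h.smul hc

theorem defect_nonneg (h𝒯 : 𝒯.IsIsometric) (hψ : Λ.codeState ≠ 0) (hq : Λ.IsQuasiInjective)
    (h : Λ.IsPos x) {φ : Λ.VirtCfg → ℂ} (hφ : Λ.P₀.mulVec φ = φ) : 0 ≤ Λ.defect x φ := by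
  induction h with
  | of hx => exact PEPS.defect_nonneg h𝒯 hψ hq hx hφ
  | zero => rw [defect_zero]
  | add _ _ h h' => rw [defect_add]; exact add_nonneg h h'
  | smul hc _ h => rw [defect_smul]; exact mul_nonneg hc h

theorem mean_nonneg (h𝒯 : 𝒯.IsIsometric) (hψ : Λ.codeState ≠ 0) (hq : Λ.IsQuasiInjective)
    (h : Λ.IsPos x) : 0 ≤ Λ.mean x := by
  induction h with
  | of hx => exact PEPS.mean_nonneg h𝒯 hψ hq hx
  | zero => simp [mean, qform_zero]
  | add _ _ h h' => rw [mean_add]; exact add_nonneg h h'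
  | smul hc _ h => rw [mean_smul]; exact mul_nonneg hc h

end IsPos

theorem isPos_posRes (U : Finset Λ.S) : Λ.IsPos (Λ.posRes U) :=
  IsPos.sum _ fun _ _ => (IsPos.of (Λ.siteProj_mem_words _)).smul (resWeight_pos _ _).le

theorem isPos_leadLetter (U : Finset Λ.S) (F : Finset Λ.E) : Λ.IsPos (Λ.leadLetter U F) := by
  rw [leadLetter]
  split_ifs
  · exact IsPos.sum _ fun _ _ => (IsPos.of (Λ.bondProj_mem_words _)).mul (isPos_posRes U)
  · exact .zero

theorem isPos_clusterMul {c c' : Finset Λ.E → Matrix Λ.VirtCfg Λ.VirtCfg ℂ}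
    (hc : ∀ F, Λ.IsPos (c F)) (hc' : ∀ F, Λ.IsPos (c' F)) (F : Finset Λ.E) :
    Λ.IsPos (clusterMul c c' F) :=
  IsPos.sum _ fun _ _ => (hc _).mul (hc' _)

theorem isPos_lead (U : Finset Λ.S) (j : ℕ) (F : Finset Λ.E) : Λ.IsPos (Λ.lead U j F) := by
  induction j generalizing F with
  | zero =>
    simp only [lead]
    split_ifs
    · exact .of (one_mem _)
    · exact .zero
  | succ j ih => exact isPos_clusterMul (isPos_leadLetter U) ih F

variable (Λ)

/-- The words `M_{e₁} P_{B₁} ⋯ M_{eₖ} P_{Bₖ}` with proper subsets `Bᵢ` of `U`, and their weights in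
the leading part. -/
inductive IsGood (U : Finset Λ.S) :
    ℕ → Finset Λ.E → Matrix Λ.VirtCfg Λ.VirtCfg ℂ → ℝ → Prop
  | one : IsGood U 0 ∅ 1 1
  | cons {k : ℕ} {F : Finset Λ.E} {x : Matrix Λ.VirtCfg Λ.VirtCfg ℂ} {g : ℝ} {B : Finset Λ.S}
      (e : Λ.E) : B ⊂ U → IsGood U k F x g →
      IsGood U (k + 1) (insert e F) (Λ.bondProj {e} * Λ.siteProj B * x)
        (resWeight U.card B.card * g)

variable {Λ}

namespace IsGood

variable {U : Finset Λ.S} {k : ℕ} {F : Finset Λ.E} {x : Matrix Λ.VirtCfg Λ.VirtCfg ℂ} {g : ℝ}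

theorem mem_words (h : Λ.IsGood U k F x g) : x ∈ Λ.words := by
  induction h with
  | one => exact one_mem _
  | cons e _ _ ih =>
    exact mul_mem (mul_mem (Λ.bondProj_mem_words _) (Λ.siteProj_mem_words _)) ih

theorem le_weight (h : Λ.IsGood U k F x g) : (1 / (U.card.factorial : ℝ)) ^ k ≤ g := by
  induction h with
  | one => simp
  | cons e _ _ ih =>
    rw [pow_succ']
    exact mul_le_mul (le_resWeight _ _) ih (by positivity) (resWeight_pos _ _).le

theorem isMono (h𝒯 : 𝒯.IsIsometric) (h : Λ.IsGood U k F x g) : Λ.IsMono U k F x := by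
  induction h with
  | one => exact .one
  | @cons k F x g B e hB _ ih =>
    have := (ih.proj_mul h𝒯 hB.subset).cons (B := ∅) e (Finset.empty_subset U)
    rwa [siteProj_empty, one_mul, ← Matrix.mul_assoc] at this

/-- `lead` is a sum with nonnegative weights over words that include `x` with at least the weight
`g`. In the induction the term for the pair ({e}, F) is split off, and the difference telescopes
into products of nonnegative combinations. -/
theorem isPos_sub (h : Λ.IsGood U k F x g) : Λ.IsPos (Λ.lead U k F - (g : ℂ) • x) := by
  induction h with
  | one => simpa [lead] using IsPos.zero
  | @cons k F x g B e hB hx ih =>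
    have hmem : (({e}, F) : Finset Λ.E × Finset Λ.E) ∈ ((insert e F).powerset ×ˢ
        (insert e F).powerset).filter (fun p => p.1 ∪ p.2 = insert e F) := by
      simp [Finset.singleton_union]
    have hl : Λ.IsPos (Λ.leadLetter U {e} -
        (resWeight U.card B.card : ℂ) • (Λ.bondProj {e} * Λ.siteProj B)) := by
      rw [leadLetter, if_pos (Finset.card_singleton e), Finset.sum_singleton, posRes,
        ← Finset.add_sum_erase _ _ (Finset.mem_ssubsets.2 hB), mul_add, Matrix.mul_smul,
        add_sub_cancel_left]
      exact (IsPos.of (Λ.bondProj_mem_words _)).mul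
        (IsPos.sum _ fun _ _ => (IsPos.of (Λ.siteProj_mem_words _)).smul (resWeight_pos _ _).le)
    rw [lead, clusterMul, ← Finset.add_sum_erase _ _ hmem]
    have e1 : Λ.leadLetter U {e} * Λ.lead U k F +
        (∑ p ∈ (((insert e F).powerset ×ˢ (insert e F).powerset).filter
          (fun p => p.1 ∪ p.2 = insert e F)).erase ({e}, F), Λ.leadLetter U p.1 * Λ.lead U k p.2)
        - ((resWeight U.card B.card * g : ℝ) : ℂ) • (Λ.bondProj {e} * Λ.siteProj B * x) =
        (Λ.leadLetter U {e} - (resWeight U.card B.card : ℂ) • (Λ.bondProj {e} * Λ.siteProj B)) *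
          Λ.lead U k F
        + (resWeight U.card B.card : ℂ) • (Λ.bondProj {e} * Λ.siteProj B) *
          (Λ.lead U k F - (g : ℂ) • x)
        + (∑ p ∈ (((insert e F).powerset ×ˢ (insert e F).powerset).filter
          (fun p => p.1 ∪ p.2 = insert e F)).erase ({e}, F),
            Λ.leadLetter U p.1 * Λ.lead U k p.2) := by
      rw [sub_mul, mul_sub, Complex.ofReal_mul, Matrix.mul_smul, Matrix.smul_mul, Matrix.smul_mul,
        smul_smul, mul_comm (g : ℂ)]
      abel
    rw [e1]
    refine ((hl.mul (isPos_lead U k F)).add (IsPos.mul (IsPos.smul (resWeight_pos _ _).le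
      (.of (mul_mem (Λ.bondProj_mem_words _) (Λ.siteProj_mem_words _)))) ih)).add ?_
    exact IsPos.sum _ fun _ _ => (isPos_leadLetter U _).mul (isPos_lead U k _)

end IsGood

/-! #### Expansion of the leading term -/

theorem comb_posRes (U : Finset Λ.S) : Comb (Λ.monos U 0 ∅) (2 ^ U.card) (Λ.posRes U) := by
  refine (Comb.sum (C := 1) _ fun B hB => ?_).mono ?_
  · refine ((Comb.of (.proj (Finset.mem_ssubsets.1 hB).subset)).smul _).mono ?_
    rw [abs_of_pos (resWeight_pos _ _)]
    linarith [resWeight_card_le hB]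
  · rw [mul_one]
    exact_mod_cast card_ssubsets_le U

theorem hasClusters_bondSum (U : Finset Λ.S) : HasClusters (Λ.monos U 1) 1 Λ.bondSum := by
  have h := (hasClusters_pert (Λ := Λ) U).smul (-1)
  have e : (fun F => ((-1 : ℝ) : ℂ) • Λ.pert F) = Λ.bondSum := by
    ext1 F
    simp [pert, bondSum]
  rw [e] at h
  simpa using h

/-- The resolvents of the chain are replaced by `posRes` one after another. Each replacement costs a
multiple of P_U between two factors that both contain bonds, that is, a term through the code space.
-/
theorem exists_hasClusters_leading (h𝒯 : 𝒯.IsIsometric) (m i : ℕ) :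
    ∃ C C' : ℝ, ∀ (Λ : PEPS 𝒯) (U : Finset Λ.S), U.card ≤ m →
      HasClusters (Λ.monos U (i + 1)) C
        (fun F => Λ.bondSum F * (Λ.posRes U * Λ.bondSum F) ^ i) ∧
      HasClusters (Λ.thruMonos U (i + 1)) C'
        (fun F => Λ.bondSum F * (Λ.siteRes U * Λ.bondSum F) ^ i
          - Λ.bondSum F * (Λ.posRes U * Λ.bondSum F) ^ i) := by
  have mulM : ∀ {Λ : PEPS 𝒯} {U : Finset Λ.S} {k l : ℕ} {C C' : ℝ}
      {f g : Finset Λ.E → Matrix Λ.VirtCfg Λ.VirtCfg ℂ}, HasClusters (Λ.monos U k) C f →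
      HasClusters (Λ.monos U l) C' g →
      HasClusters (Λ.monos U (k + l)) (4 ^ (k + l) * (C * C')) (fun F => f F * g F) :=
    fun hf hg => HasClusters.mul (fun F x hx => hx.card_le) (fun F x hx => hx.card_le)
      (fun F F' x hx y hy => hx.mul h𝒯 hy) hf hg
  induction i with
  | zero =>
    refine ⟨1, 0, fun Λ U _ => ⟨?_, ?_⟩⟩
    · simpa using hasClusters_bondSum U
    · simpa using HasClusters.zero
  | succ i ih =>
    obtain ⟨C, C', h⟩ := ih
    refine ⟨4 ^ (i + 1 + (0 + 1)) * (C * (4 ^ (0 + 1) * (2 ^ m * 1))),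
      4 ^ (i + 1 + (0 + 1)) * (C' * (4 ^ (0 + 1) * (2 ^ m * 2 * 1)))
        + 2 ^ m * (4 ^ (i + 1 + 1) * (4 ^ (i + 1) * C * 1)), fun Λ U hU => ?_⟩
    obtain ⟨h1, h2⟩ := h Λ U hU
    have h2m : (2 : ℝ) ^ U.card ≤ 2 ^ m := pow_le_pow_right₀ (by norm_num) hU
    have hG' : HasClusters (Λ.monos U (0 + 1)) (4 ^ (0 + 1) * (2 ^ m * 1))
        (fun F => Λ.posRes U * Λ.bondSum F) :=
      mulM (.const ((comb_posRes U).mono h2m)) (hasClusters_bondSum U)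
    have hG : HasClusters (Λ.monos U (0 + 1)) (4 ^ (0 + 1) * (2 ^ m * 2 * 1))
        (fun F => Λ.siteRes U * Λ.bondSum F) :=
      mulM (.const ((comb_siteRes U).mono (by gcongr))) (hasClusters_bondSum U)
    constructor
    · have := mulM h1 hG'
      simp only [Matrix.mul_assoc, ← pow_succ] at this
      exact this
    · have t1 : HasClusters (Λ.thruMonos U (i + 1 + (0 + 1)))
          (4 ^ (i + 1 + (0 + 1)) * (C' * (4 ^ (0 + 1) * (2 ^ m * 2 * 1)))) (fun F =>
          (Λ.bondSum F * (Λ.siteRes U * Λ.bondSum F) ^ i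
            - Λ.bondSum F * (Λ.posRes U * Λ.bondSum F) ^ i) * (Λ.siteRes U * Λ.bondSum F)) := by
        refine HasClusters.mul (fun F x hx => thruMonos_card_le hx) (fun F x hx => hx.card_le) ?_
          h2 hG
        rintro F F' z ⟨k, l, F₁, F₂, x, y, hk, hl, hkl, rfl, hx, hy, rfl⟩ w hw
        exact ⟨k, l + (0 + 1), F₁, F₂ ∪ F', x, y * w, hk, by omega, by omega,
          (Finset.union_assoc _ _ _).symm, hx, hy.mul h𝒯 hw, by simp only [Matrix.mul_assoc]⟩
      have t2 := (hasClusters_mul_siteProj_mul (by omega) le_rfl h1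
        (hasClusters_bondSum (Λ := Λ) U)).smul (-Λ.weightSum U)
      have t2' := t2.mono (C' := 2 ^ m * (4 ^ (i + 1 + 1) * (4 ^ (i + 1) * C * 1))) (by
        have h0 := h1.nonneg
        rw [abs_neg, abs_of_nonneg (Λ.weightSum_nonneg U)]
        gcongr
        exact (Λ.weightSum_le U).trans h2m)
      have t3 := t1.add t2'
      have e : ∀ F, (Λ.bondSum F * (Λ.siteRes U * Λ.bondSum F) ^ i
            - Λ.bondSum F * (Λ.posRes U * Λ.bondSum F) ^ i) * (Λ.siteRes U * Λ.bondSum F)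
          + ((-Λ.weightSum U : ℝ) : ℂ) • (Λ.bondSum F * (Λ.posRes U * Λ.bondSum F) ^ i *
            Λ.siteProj U * Λ.bondSum F) = Λ.bondSum F * (Λ.siteRes U * Λ.bondSum F) ^ (i + 1)
            - Λ.bondSum F * (Λ.posRes U * Λ.bondSum F) ^ (i + 1) := by
        intro F
        have : Λ.bondSum F * (Λ.posRes U * Λ.bondSum F) ^ i * (Λ.siteRes U * Λ.bondSum F) =
            Λ.bondSum F * (Λ.posRes U * Λ.bondSum F) ^ (i + 1) - (Λ.weightSum U : ℂ) •
            (Λ.bondSum F * (Λ.posRes U * Λ.bondSum F) ^ i * Λ.siteProj U * Λ.bondSum F) := by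
          rw [siteRes_eq, sub_mul, mul_sub, pow_succ]
          simp only [Matrix.smul_mul, Matrix.mul_smul, Matrix.mul_assoc]
        rw [sub_mul, this, pow_succ (Λ.siteRes U * Λ.bondSum F), Complex.ofReal_neg, neg_smul,
          ← Matrix.mul_assoc (Λ.bondSum F) ((Λ.siteRes U * Λ.bondSum F) ^ i)]
        abel
      simp only [e] at t3
      exact t3

/-- The cluster coefficients of the effective Hamiltonian on the sites in `U` are, up to terms
through the code space, negative multiples of the nonnegative combinations `lead`. -/
theorem exists_local_clusters (h𝒯 : 𝒯.IsIsometric) (m : ℕ) {j : ℕ} (hj : 1 ≤ j) :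
    ∃ C : ℝ, ∀ (Λ : PEPS 𝒯) (U : Finset Λ.S), U.card ≤ m → U.Nonempty →
      ∃ c : Finset Λ.E → Matrix Λ.VirtCfg Λ.VirtCfg ℂ,
        (∀ F, Λ.P₀ * Vcoeff (Λ.siteProj U) (Λ.siteRes U) (Λ.pert F) j * Λ.P₀ =
          ∑ F' ∈ F.powerset, Λ.P₀ * c F' * Λ.P₀) ∧
        ∀ F, Comb (Λ.thruMonos U j F) C
          (c F + (((Λ.weightSum U)⁻¹ : ℝ) : ℂ) • Λ.lead U j F) := by
  obtain ⟨T, hT, hV⟩ := Vcoeff_lead hj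
  obtain ⟨C₁, h₁⟩ := exists_hasClusters_thru h𝒯 m hT
  obtain ⟨_, C₂, h₂⟩ := exists_hasClusters_leading h𝒯 m (j - 1)
  refine ⟨C₁ + |(-1 : ℝ)| * C₂, fun Λ U hU hne => ?_⟩
  have h₂' := (h₂ Λ U hU).2
  rw [Nat.sub_add_cancel hj] at h₂'
  obtain ⟨c, hc, hcomb⟩ := (h₁ Λ U hU).add (h₂'.smul (-1))
  have hw : (Λ.weightSum U : ℂ) ≠ 0 := by exact_mod_cast (Λ.weightSum_pos hne).ne'
  refine ⟨fun F => c F - (((Λ.weightSum U)⁻¹ : ℝ) : ℂ) • Λ.lead U j F, fun F => ?_, fun F => ?_⟩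
  · have hR := Λ.siteRes_isResolvent h𝒯 U
    have e1 : Λ.P₀ * Vcoeff (Λ.siteProj U) (Λ.siteRes U) (Λ.pert F) j * Λ.P₀ =
        Λ.P₀ * (Λ.siteProj U * Vcoeff (Λ.siteProj U) (Λ.siteRes U) (Λ.pert F) j *
          Λ.siteProj U) * Λ.P₀ := by
      simp only [Matrix.mul_assoc]
      rw [Λ.siteProj_mul_P₀ h𝒯, ← Matrix.mul_assoc Λ.P₀ (Λ.siteProj U), Λ.P₀_mul_siteProj h𝒯]
    have e2 : Λ.P₀ * (Λ.siteProj U * (Λ.pert F * (Λ.siteRes U * Λ.pert F) ^ (j - 1)) *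
        Λ.siteProj U) * Λ.P₀ =
        Λ.P₀ * (Λ.pert F * (Λ.siteRes U * Λ.pert F) ^ (j - 1)) * Λ.P₀ := by
      simp only [Matrix.mul_assoc]
      rw [Λ.siteProj_mul_P₀ h𝒯, ← Matrix.mul_assoc Λ.P₀ (Λ.siteProj U), Λ.P₀_mul_siteProj h𝒯]
    -- The j signs of V = -∑ M_e and the sign (-1)^(j-1) of the leading term combine to a minus sign
    -- at every order. Alternating signs would destroy the energy bound.
    have e3 : (-1 : ℂ) ^ (j - 1) • (Λ.pert F * (Λ.siteRes U * Λ.pert F) ^ (j - 1)) =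
        -(Λ.bondSum F * (Λ.siteRes U * Λ.bondSum F) ^ (j - 1)) := by
      have : Λ.pert F = -Λ.bondSum F := rfl
      rw [this, mul_neg, ← neg_one_smul ℂ (Λ.siteRes U * Λ.bondSum F), smul_pow, neg_mul,
        Matrix.mul_smul, smul_neg, smul_smul, ← mul_pow]
      simp
    -- The chain has one more factor `bondSum` than `posRes`; the missing one is supplied by P₀ on
    -- the right.
    have e4 : Λ.P₀ * (Λ.bondSum F * (Λ.posRes U * Λ.bondSum F) ^ (j - 1)) * Λ.P₀ =
        (((Λ.weightSum U)⁻¹ : ℝ) : ℂ) •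
          (Λ.P₀ * (Λ.bondSum F * Λ.posRes U) ^ j * Λ.P₀) := by
      have : (Λ.bondSum F * Λ.posRes U) ^ j =
          Λ.bondSum F * (Λ.posRes U * Λ.bondSum F) ^ (j - 1) * Λ.posRes U := by
        obtain ⟨i, rfl⟩ : ∃ i, j = i + 1 := ⟨j - 1, by omega⟩
        rw [Nat.add_sub_cancel]
        clear * -
        induction i with
        | zero => simp
        | succ i ih => rw [pow_succ, ih, pow_succ]; simp only [Matrix.mul_assoc]
      rw [this]
      set X := Λ.bondSum F * (Λ.posRes U * Λ.bondSum F) ^ (j - 1)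
      rw [← Matrix.mul_assoc Λ.P₀ X, Matrix.mul_assoc (Λ.P₀ * X), Λ.posRes_mul_P₀ h𝒯,
        Matrix.mul_smul, smul_smul, Complex.ofReal_inv, inv_mul_cancel₀ hw, one_smul]
    have hcF := hc F
    dsimp only at hcF
    rw [e1, hV _ _ _ _ hR.idem hR.PG hR.GP, mul_add, add_mul, Matrix.mul_smul, Matrix.smul_mul,
      e2, ← Matrix.smul_mul, ← Matrix.mul_smul, e3]
    have e5 : T _ (Λ.siteProj U) (Λ.siteRes U) (Λ.pert F) - Λ.bondSum F *
        (Λ.siteRes U * Λ.bondSum F) ^ (j - 1) = ∑ F' ∈ F.powerset, c F' -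
        Λ.bondSum F * (Λ.posRes U * Λ.bondSum F) ^ (j - 1) := by
      rw [← hcF, Complex.ofReal_neg, Complex.ofReal_one, neg_one_smul]
      abel
    calc Λ.P₀ * -(Λ.bondSum F * (Λ.siteRes U * Λ.bondSum F) ^ (j - 1)) * Λ.P₀ +
          Λ.P₀ * T _ (Λ.siteProj U) (Λ.siteRes U) (Λ.pert F) * Λ.P₀
        = Λ.P₀ * (T _ (Λ.siteProj U) (Λ.siteRes U) (Λ.pert F) - Λ.bondSum F *
          (Λ.siteRes U * Λ.bondSum F) ^ (j - 1)) * Λ.P₀ := by noncomm_ring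
      _ = Λ.P₀ * (∑ F' ∈ F.powerset, c F') * Λ.P₀ - Λ.P₀ *
          (Λ.bondSum F * (Λ.posRes U * Λ.bondSum F) ^ (j - 1)) * Λ.P₀ := by
          rw [e5, mul_sub, sub_mul]
      _ = ∑ F' ∈ F.powerset, Λ.P₀ * (c F' - (((Λ.weightSum U)⁻¹ : ℝ) : ℂ) • Λ.lead U j F') *
          Λ.P₀ := by
          rw [e4, ← Λ.sum_lead]
          simp only [mul_sub, sub_mul, Finset.sum_sub_distrib, Finset.mul_sum, Finset.sum_mul,
            Finset.smul_sum, Matrix.mul_smul, Matrix.smul_mul]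
  · simpa using hcomb F

end PEPS

/-! ### Connected clusters of edges -/

namespace PEPS

open SchriefferWolff

variable {𝒯 : SiteTensors} (Λ : PEPS 𝒯)

/-- A nonempty set of edges that is not the union of two nonempty sets with disjoint sets of
sites. -/
def EdgeConn (F : Finset Λ.E) : Prop :=
  F.Nonempty ∧ ∀ F₁ F₂ : Finset Λ.E, F₁ ∪ F₂ = F → F₁.Nonempty → F₂.Nonempty →
    ¬ Disjoint (Λ.sitesOf F₁) (Λ.sitesOf F₂)

variable {Λ}

theorem sitesOf_nonempty {F : Finset Λ.E} (hF : F.Nonempty) : (Λ.sitesOf F).Nonempty := by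
  obtain ⟨e, he⟩ := hF
  exact ⟨_, Λ.endSite_mem_sitesOf he true⟩

theorem disjoint_of_disjoint_sitesOf {F₁ F₂ : Finset Λ.E}
    (h : Disjoint (Λ.sitesOf F₁) (Λ.sitesOf F₂)) : Disjoint F₁ F₂ := by
  rw [Finset.disjoint_left]
  intro e h1 h2
  exact Finset.disjoint_left.1 h (Λ.endSite_mem_sitesOf h1 true) (Λ.endSite_mem_sitesOf h2 true)

theorem edgeConn_singleton (e : Λ.E) : Λ.EdgeConn {e} := by
  refine ⟨Finset.singleton_nonempty e, fun F₁ F₂ h h1 h2 hd => ?_⟩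
  have e1 : F₁ = {e} := (Finset.subset_singleton_iff.1 (h ▸ Finset.subset_union_left)).resolve_left
    h1.ne_empty
  have e2 : F₂ = {e} := (Finset.subset_singleton_iff.1 (h ▸ Finset.subset_union_right)).resolve_left
    h2.ne_empty
  have := disjoint_of_disjoint_sitesOf hd
  rw [e1, e2] at this
  simp at this

theorem sitesOf_singleton_card_le (e : Λ.E) : (Λ.sitesOf {e}).card ≤ 2 := by
  rw [sitesOf, Finset.singleton_biUnion]
  exact Finset.card_le_two

/-- A proper nonempty part of a connected cluster has a neighbour in the cluster. -/
theorem EdgeConn.exists_touching {F F' : Finset Λ.E} (hF : Λ.EdgeConn F) (hF' : F' ⊆ F)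
    (hne : F'.Nonempty) (h : F' ≠ F) :
    ∃ e ∈ F, e ∉ F' ∧ ∃ i, Λ.endSite e i ∈ Λ.sitesOf F' := by
  have h2 : (F \ F').Nonempty := by
    rw [Finset.sdiff_nonempty]
    exact fun h' => h (hF'.antisymm h')
  have := hF.2 F' (F \ F') (Finset.union_sdiff_of_subset hF') hne h2
  rw [Finset.not_disjoint_iff] at this
  obtain ⟨s, hs, hs'⟩ := this
  obtain ⟨e, he, i, rfl⟩ := Λ.mem_sitesOf.1 hs'
  rw [Finset.mem_sdiff] at he
  exact ⟨e, he.1, he.2, i, hs⟩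

/-- A maximal part of the cluster that satisfies the bound is the whole cluster: otherwise an edge
touching it could be added, with at most one new site. -/
theorem EdgeConn.card_sitesOf_le {F : Finset Λ.E} (hF : Λ.EdgeConn F) :
    (Λ.sitesOf F).card ≤ F.card + 1 := by
  obtain ⟨e, he⟩ := hF.1
  obtain ⟨F', hF', hmax⟩ := Finset.exists_max_image
    (F.powerset.filter fun F' => F'.Nonempty ∧ (Λ.sitesOf F').card ≤ F'.card + 1) Finset.card
    ⟨{e}, by simp [he, sitesOf_singleton_card_le e]⟩
  rw [Finset.mem_filter, Finset.mem_powerset] at hF'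
  by_cases h : F' = F
  · rw [← h]; exact hF'.2.2
  · exfalso
    obtain ⟨e', he', hne', i, hi⟩ := hF.exists_touching hF'.1 hF'.2.1 h
    have hsub : Λ.sitesOf (insert e' F') ⊆ insert (Λ.endSite e' (!i)) (Λ.sitesOf F') := by
      intro s hs
      obtain ⟨e₁, he₁, i₁, rfl⟩ := Λ.mem_sitesOf.1 hs
      rw [Finset.mem_insert] at he₁
      rcases he₁ with rfl | he₁
      · by_cases hii : i₁ = i
        · rw [hii]; exact Finset.mem_insert_of_mem hi
        · have : i₁ = !i := by cases i <;> cases i₁ <;> simp_all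
          rw [this]; exact Finset.mem_insert_self _ _
      · exact Finset.mem_insert_of_mem (Λ.endSite_mem_sitesOf he₁ _)
    have hcard := (Finset.card_le_card hsub).trans (Finset.card_insert_le _ _)
    have := hmax (insert e' F') (by
      rw [Finset.mem_filter, Finset.mem_powerset, Finset.card_insert_of_notMem hne']
      exact ⟨Finset.insert_subset he' hF'.1, Finset.insert_nonempty _ _, by omega⟩)
    rw [Finset.card_insert_of_notMem hne'] at this
    omega

theorem mem_of_preconnected {V : Type*} {G : SimpleGraph V} (hG : G.Preconnected) {A : Set V}
    (hA : ∀ s t, G.Adj s t → s ∈ A → t ∈ A) {s : V} (hs : s ∈ A) (t : V) : t ∈ A := by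
  have := (SimpleGraph.reachable_iff_reflTransGen s t).1 (hG s t)
  induction this with
  | refl => exact hs
  | tail _ h ih => exact hA _ _ h ih

/-- If t were not reachable from s, the edges with a reachable end and the remaining ones would
split the cluster into parts without a common site. -/
theorem EdgeConn.isConnectedRegion {F : Finset Λ.E} (hF : Λ.EdgeConn F) :
    Λ.IsConnectedRegion (Λ.sitesOf F) := by
  set G := Λ.siteGraph.induce (Λ.sitesOf F : Set Λ.S) with hG
  have hne : Nonempty ((Λ.sitesOf F : Finset Λ.S) : Set Λ.S) := by
    obtain ⟨s, hs⟩ := sitesOf_nonempty hF.1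
    exact ⟨⟨s, hs⟩⟩
  rw [IsConnectedRegion, SimpleGraph.connected_iff]
  refine ⟨fun s t => ?_, hne⟩
  by_contra hst
  have hadj : ∀ e (he : e ∈ F) i, G.Reachable s ⟨_, Λ.endSite_mem_sitesOf he i⟩ →
      G.Reachable s ⟨_, Λ.endSite_mem_sitesOf he (!i)⟩ := by
    intro e he i h
    by_cases heq : Λ.endSite e i = Λ.endSite e (!i)
    · have : (⟨_, Λ.endSite_mem_sitesOf he (!i)⟩ : ((Λ.sitesOf F : Finset Λ.S) : Set Λ.S)) =
        ⟨_, Λ.endSite_mem_sitesOf he i⟩ := Subtype.ext heq.symm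
      rw [this]; exact h
    · refine h.trans (SimpleGraph.Adj.reachable ?_)
      rw [hG, SimpleGraph.induce_adj]
      exact ⟨heq, e, i, rfl, rfl⟩
  have hall : ∀ e (he : e ∈ F) i i', G.Reachable s ⟨_, Λ.endSite_mem_sitesOf he i⟩ →
      G.Reachable s ⟨_, Λ.endSite_mem_sitesOf he i'⟩ := by
    intro e he i i' h
    by_cases hii : i' = i
    · subst hii; exact h
    · have : i' = !i := by cases i <;> cases i' <;> simp_all
      subst this
      exact hadj e he i h
  classical
  set A : Finset Λ.E := F.filter fun e => ∃ h : e ∈ F, ∃ i,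
    G.Reachable s ⟨_, Λ.endSite_mem_sitesOf h i⟩
  set B : Finset Λ.E := F.filter fun e => ¬ ∃ h : e ∈ F, ∃ i,
    G.Reachable s ⟨_, Λ.endSite_mem_sitesOf h i⟩
  have hAB : A ∪ B = F := Finset.filter_union_filter_not_eq _ _
  have hA : A.Nonempty := by
    obtain ⟨e, he, i, hi⟩ := Λ.mem_sitesOf.1 s.2
    refine ⟨e, Finset.mem_filter.2 ⟨he, he, i, ?_⟩⟩
    have : (⟨_, Λ.endSite_mem_sitesOf he i⟩ : ((Λ.sitesOf F : Finset Λ.S) : Set Λ.S)) = s :=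
      Subtype.ext hi
    rw [this]
  have hB : B.Nonempty := by
    obtain ⟨e, he, i, hi⟩ := Λ.mem_sitesOf.1 t.2
    refine ⟨e, Finset.mem_filter.2 ⟨he, ?_⟩⟩
    rintro ⟨he', i', h⟩
    apply hst
    have := hall e he i' i h
    have e1 : (⟨_, Λ.endSite_mem_sitesOf he i⟩ : ((Λ.sitesOf F : Finset Λ.S) : Set Λ.S)) = t :=
      Subtype.ext hi
    rwa [e1] at this
  apply hF.2 A B hAB hA hB
  rw [Finset.disjoint_left]
  intro u hu hu'
  obtain ⟨e, he, i, rfl⟩ := Λ.mem_sitesOf.1 hu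
  obtain ⟨e', he', i', hi'⟩ := Λ.mem_sitesOf.1 hu'
  obtain ⟨heF, h, i₀, hr⟩ := Finset.mem_filter.1 he
  obtain ⟨heF', hn⟩ := Finset.mem_filter.1 he'
  refine hn ⟨heF', i', ?_⟩
  have e1 : (⟨_, Λ.endSite_mem_sitesOf heF' i'⟩ : ((Λ.sitesOf F : Finset Λ.S) : Set Λ.S)) =
    ⟨_, Λ.endSite_mem_sitesOf heF i⟩ := Subtype.ext hi'
  rw [e1]
  exact hall e heF i₀ i hr

theorem mem_edgesIn {R : Finset Λ.S} {e : Λ.E} : e ∈ Λ.edgesIn R ↔ ∀ i, Λ.endSite e i ∈ R := by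
  simp [edgesIn]

theorem sitesOf_edgesIn_subset (R : Finset Λ.S) : Λ.sitesOf (Λ.edgesIn R) ⊆ R := by
  intro s hs
  obtain ⟨e, he, i, rfl⟩ := Λ.mem_sitesOf.1 hs
  exact mem_edgesIn.1 he i

theorem exists_edge_of_adj {R : Finset Λ.S} {s t : (R : Set Λ.S)}
    (h : (Λ.siteGraph.induce (R : Set Λ.S)).Adj s t) :
    ∃ e ∈ Λ.edgesIn R, ∃ i, Λ.endSite e i = s ∧ Λ.endSite e (!i) = t := by
  rw [SimpleGraph.induce_adj] at h
  obtain ⟨-, e, i, hs, ht⟩ := h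
  refine ⟨e, mem_edgesIn.2 fun i' => ?_, i, hs, ht⟩
  by_cases hii : i' = i
  · rw [hii, hs]; exact s.2
  · have : i' = !i := by cases i <;> cases i' <;> simp_all
    rw [this, ht]; exact t.2

theorem sitesOf_edgesIn {R : Finset Λ.S} (hR : Λ.IsConnectedRegion R)
    (hne : (Λ.edgesIn R).Nonempty) : Λ.sitesOf (Λ.edgesIn R) = R := by
  refine (sitesOf_edgesIn_subset R).antisymm fun s hs => ?_
  obtain ⟨e, he⟩ := hne
  have key := mem_of_preconnected hR.preconnected
    (A := {t : (R : Set Λ.S) | (t : Λ.S) ∈ Λ.sitesOf (Λ.edgesIn R)}) ?_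
    (s := ⟨_, mem_edgesIn.1 he true⟩) (Λ.endSite_mem_sitesOf he true) ⟨s, hs⟩
  · exact key
  · intro s t hst _
    obtain ⟨e, he, i, -, ht⟩ := exists_edge_of_adj hst
    rw [Set.mem_ofPred_eq, ← ht]
    exact Λ.endSite_mem_sitesOf he _

theorem edgeConn_edgesIn {R : Finset Λ.S} (hR : Λ.IsConnectedRegion R)
    (hne : (Λ.edgesIn R).Nonempty) : Λ.EdgeConn (Λ.edgesIn R) := by
  refine ⟨hne, fun F₁ F₂ h12 h1 h2 hd => ?_⟩
  obtain ⟨e₁, he₁⟩ := h1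
  obtain ⟨e₂, he₂⟩ := h2
  have m1 : e₁ ∈ Λ.edgesIn R := h12 ▸ Finset.mem_union_left _ he₁
  have m2 : e₂ ∈ Λ.edgesIn R := h12 ▸ Finset.mem_union_right _ he₂
  have key := mem_of_preconnected hR.preconnected
    (A := {t : (R : Set Λ.S) | (t : Λ.S) ∈ Λ.sitesOf F₁}) ?_
    (s := ⟨_, mem_edgesIn.1 m1 true⟩) (Λ.endSite_mem_sitesOf he₁ true)
    ⟨_, mem_edgesIn.1 m2 true⟩
  · exact Finset.disjoint_left.1 hd key (Λ.endSite_mem_sitesOf he₂ true)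
  · intro s t hst hs
    rw [Set.mem_ofPred_eq] at hs ⊢
    obtain ⟨e, he, i, hs', ht⟩ := exists_edge_of_adj hst
    rw [← h12, Finset.mem_union] at he
    rcases he with he | he
    · rw [← ht]; exact Λ.endSite_mem_sitesOf he _
    · exact absurd (hs' ▸ Λ.endSite_mem_sitesOf he i) (Finset.disjoint_left.1 hd hs)

/-! #### Counting connected clusters -/

/-- The largest degree of a site. -/
def _root_.SiteTensors.maxDeg (𝒯 : SiteTensors) : ℕ :=
  letI := 𝒯.fintypeT
  Finset.univ.sup 𝒯.deg

theorem _root_.SiteTensors.deg_le_maxDeg (t : 𝒯.T) : 𝒯.deg t ≤ 𝒯.maxDeg :=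
  letI := 𝒯.fintypeT
  Finset.le_sup (f := 𝒯.deg) (Finset.mem_univ t)

variable (Λ)

/-- The edges at a site. -/
def edgesAt (s : Λ.S) : Finset Λ.E :=
  Finset.univ.image fun l : Fin (𝒯.deg (Λ.type s)) => (Λ.ends.symm ⟨s, l⟩).1

theorem mem_edgesAt (e : Λ.E) (i : Bool) : e ∈ Λ.edgesAt (Λ.endSite e i) := by
  rw [edgesAt, Finset.mem_image]
  refine ⟨(Λ.ends (e, i)).2, Finset.mem_univ _, ?_⟩
  have : (⟨Λ.endSite e i, (Λ.ends (e, i)).2⟩ : Σ s : Λ.S, Fin (𝒯.deg (Λ.type s))) =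
    Λ.ends (e, i) := rfl
  rw [this, Equiv.symm_apply_apply]

theorem card_edgesAt_le (s : Λ.S) : (Λ.edgesAt s).card ≤ 𝒯.maxDeg :=
  Finset.card_image_le.trans (by simpa using 𝒯.deg_le_maxDeg _)

/-- The edges at distance at most `i` from `e`. -/
def edgeBall (e : Λ.E) : ℕ → Finset Λ.E
  | 0 => {e}
  | i + 1 => edgeBall e i ∪ (Λ.sitesOf (edgeBall e i)).biUnion Λ.edgesAt

theorem card_sitesOf_le (F : Finset Λ.E) : (Λ.sitesOf F).card ≤ F.card * 2 :=
  Finset.card_biUnion_le_card_mul _ _ _ fun _ _ => Finset.card_le_two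

theorem card_edgeBall_le (e : Λ.E) (i : ℕ) :
    (Λ.edgeBall e i).card ≤ (1 + 2 * 𝒯.maxDeg) ^ i := by
  induction i with
  | zero => simp [edgeBall]
  | succ i ih =>
    rw [edgeBall]
    refine (Finset.card_union_le _ _).trans ?_
    have h1 := Finset.card_biUnion_le_card_mul (Λ.sitesOf (Λ.edgeBall e i)) Λ.edgesAt 𝒯.maxDeg
      fun s _ => Λ.card_edgesAt_le s
    have h2 := Λ.card_sitesOf_le (Λ.edgeBall e i)
    calc _ ≤ (Λ.edgeBall e i).card + (Λ.edgeBall e i).card * 2 * 𝒯.maxDeg := by gcongr; exact h1.trans (by gcongr)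
      _ = (Λ.edgeBall e i).card * (1 + 2 * 𝒯.maxDeg) := by ring
      _ ≤ _ := by rw [pow_succ]; gcongr

variable {Λ}

/-- Until the cluster is exhausted, each enlargement of the ball captures at least one more of its
edges. -/
theorem EdgeConn.subset_edgeBall {F : Finset Λ.E} (hF : Λ.EdgeConn F) {e : Λ.E} (he : e ∈ F)
    {r : ℕ} (hr : F.card ≤ r) : F ⊆ Λ.edgeBall e r := by
  have key : ∀ i, F ⊆ Λ.edgeBall e i ∨ i + 1 ≤ (F ∩ Λ.edgeBall e i).card := by
    intro i
    induction i with
    | zero =>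
      right
      have : e ∈ F ∩ Λ.edgeBall e 0 := by simp [edgeBall, he]
      simpa using Finset.card_pos.2 ⟨e, this⟩
    | succ i ih =>
      have hsub : Λ.edgeBall e i ⊆ Λ.edgeBall e (i + 1) := Finset.subset_union_left
      rcases ih with ih | ih
      · exact Or.inl (ih.trans hsub)
      · by_cases h : F ∩ Λ.edgeBall e i = F
        · exact Or.inl ((Finset.inter_eq_left.1 h).trans hsub)
        · right
          obtain ⟨e', he', hne', j, hj⟩ := hF.exists_touching Finset.inter_subset_left
            (Finset.card_pos.1 (by omega)) h
          have hmem : e' ∈ F ∩ Λ.edgeBall e (i + 1) := by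
            refine Finset.mem_inter.2 ⟨he', Finset.mem_union_right _ (Finset.mem_biUnion.2
              ⟨_, Λ.sitesOf_mono Finset.inter_subset_right hj, Λ.mem_edgesAt e' j⟩)⟩
          have : (insert e' (F ∩ Λ.edgeBall e i)).card ≤ (F ∩ Λ.edgeBall e (i + 1)).card :=
            Finset.card_le_card (Finset.insert_subset hmem (Finset.inter_subset_inter_left hsub))
          rw [Finset.card_insert_of_notMem hne'] at this
          omega
  rcases key r with h | h
  · exact h
  · have := Finset.card_le_card (Finset.inter_subset_left (s₁ := F) (s₂ := Λ.edgeBall e r))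
    omega

/-- A bound on the number of connected clusters of at most `r` edges that contain a given edge. -/
def _root_.SiteTensors.clusterBound (𝒯 : SiteTensors) (r : ℕ) : ℕ :=
  2 ^ (1 + 2 * 𝒯.maxDeg) ^ r

-- Such clusters are subsets of a ball whose size is bounded in terms of the largest degree, so the
-- bound does not depend on the graph.
open Classical in
theorem card_clusters_le (e : Λ.E) (r : ℕ) :
    (Finset.univ.filter fun F : Finset Λ.E => Λ.EdgeConn F ∧ F.card ≤ r ∧ e ∈ F).card ≤
      𝒯.clusterBound r := by
  calc _ ≤ (Λ.edgeBall e r).powerset.card := by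
        refine Finset.card_le_card fun F hF => ?_
        rw [Finset.mem_filter] at hF
        exact Finset.mem_powerset.2 (hF.2.1.subset_edgeBall hF.2.2.2 hF.2.2.1)
    _ ≤ _ := by
        rw [Finset.card_powerset]
        exact Nat.pow_le_pow_right (by norm_num) (Λ.card_edgeBall_le e r)

/-! #### Additivity and localization of the effective Hamiltonian -/

theorem Vcoeff_pert_empty (h𝒯 : 𝒯.IsIsometric) (U : Finset Λ.S) {j : ℕ} (hj : 1 ≤ j) :
    Vcoeff (Λ.siteProj U) (Λ.siteRes U) (Λ.pert ∅) j = 0 := by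
  obtain ⟨C, h⟩ := exists_hasClusters h𝒯 U.card (isNCPoly_Vcoeff hj)
  obtain ⟨c, hc, hcomb⟩ := h Λ U le_rfl
  have h1 := hc ∅
  rw [Finset.powerset_empty, Finset.sum_singleton] at h1
  refine h1.trans ?_
  refine ((hcomb ∅).subset (B := ∅) fun x hx => ?_).eq_zero
  exact absurd (IsMono.edges_nonempty hx hj) Finset.not_nonempty_empty

theorem actsOn_pert {F : Finset Λ.E} {U : Finset Λ.S} (h : Λ.sitesOf F ⊆ U) :
    ActsOn (Λ.pert F) U := by
  refine (ActsOn.sum _ fun e he => ?_).neg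
  exact (Λ.actsOn_bondProj _).mono ((Λ.sitesOf_mono (Finset.singleton_subset_iff.2 he)).trans h)

/-- No edge crosses the boundary of U, so U and its complement are independent systems to which
`Vcoeff_add` applies. -/
theorem Vcoeff_pert_add (h𝒯 : 𝒯.IsIsometric) {U : Finset Λ.S} {F₁ F₂ : Finset Λ.E}
    (h1 : Λ.sitesOf F₁ ⊆ U) (h2 : Λ.sitesOf F₂ ⊆ Uᶜ) {j : ℕ} (hj : 1 ≤ j) :
    Λ.P₀ * Vcoeff Λ.P₀ Λ.resolvent (Λ.pert (F₁ ∪ F₂)) j * Λ.P₀ =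
      Λ.P₀ * Vcoeff (Λ.siteProj U) (Λ.siteRes U) (Λ.pert F₁) j * Λ.P₀ +
      Λ.P₀ * Vcoeff (Λ.siteProj Uᶜ) (Λ.siteRes Uᶜ) (Λ.pert F₂) j * Λ.P₀ := by
  have hdis : Disjoint U Uᶜ := disjoint_compl_right
  have hP : Λ.siteProj U * Λ.siteProj Uᶜ = Λ.P₀ := by
    rw [Λ.siteProj_mul h𝒯, Finset.union_compl]; rfl
  have hH : Λ.siteHam U + Λ.siteHam Uᶜ = Λ.siteHam Finset.univ :=
    Finset.sum_add_sum_compl U _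
  have hV : Λ.pert (F₁ ∪ F₂) = Λ.pert F₁ + Λ.pert F₂ := by
    have := disjoint_of_disjoint_sitesOf (Λ := Λ) (F₁ := F₁) (F₂ := F₂)
      (Finset.disjoint_of_subset_left h1 (Finset.disjoint_of_subset_right h2 hdis))
    rw [pert, Finset.sum_union this, pert, pert, neg_add]
  have hR := Λ.siteRes_isResolvent h𝒯 Finset.univ
  have hR' : IsResolvent (Λ.siteProj U * Λ.siteProj Uᶜ) (Λ.siteHam U + Λ.siteHam Uᶜ)
      (Λ.siteRes Finset.univ) := by rw [hP, hH]; exact hR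
  have := Vcoeff_add (V₁ := Λ.pert F₁) (V₂ := Λ.pert F₂) (Λ.siteRes_isResolvent h𝒯 U)
    (Λ.siteRes_isResolvent h𝒯 Uᶜ) hR' ?_ hj
  · rw [hP, ← hV] at this
    rw [Λ.resolvent_eq_siteRes h𝒯]
    exact this
  · have a1 : ∀ x ∈ ({Λ.siteProj U, Λ.siteHam U, Λ.siteRes U, Λ.pert F₁} : Set _), ActsOn x U := by
      rintro x (rfl | rfl | rfl | rfl)
      · exact Λ.actsOn_siteProj U
      · exact Λ.actsOn_siteHam U
      · exact Λ.actsOn_siteRes U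
      · exact actsOn_pert h1
    have a2 : ∀ x ∈ ({Λ.siteProj Uᶜ, Λ.siteHam Uᶜ, Λ.siteRes Uᶜ, Λ.pert F₂} : Set _),
        ActsOn x Uᶜ := by
      rintro x (rfl | rfl | rfl | rfl)
      · exact Λ.actsOn_siteProj Uᶜ
      · exact Λ.actsOn_siteHam Uᶜ
      · exact Λ.actsOn_siteRes Uᶜ
      · exact actsOn_pert h2
    exact fun x hx y hy => (a1 x hx).commute (a2 y hy) hdis

/-- The complement carries no edges and contributes nothing. Estimates on a cluster therefore need
only the resolvent of its own boundedly many sites. -/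
theorem Vcoeff_pert_local (h𝒯 : 𝒯.IsIsometric) {U : Finset Λ.S} {F : Finset Λ.E}
    (h : Λ.sitesOf F ⊆ U) {j : ℕ} (hj : 1 ≤ j) :
    Λ.P₀ * Vcoeff Λ.P₀ Λ.resolvent (Λ.pert F) j * Λ.P₀ =
      Λ.P₀ * Vcoeff (Λ.siteProj U) (Λ.siteRes U) (Λ.pert F) j * Λ.P₀ := by
  have := Vcoeff_pert_add (F₂ := ∅) h𝒯 h (by simp [sitesOf]) hj
  rw [Finset.union_empty, Vcoeff_pert_empty h𝒯 _ hj] at this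
  simpa using this

theorem Vcoeff_pert_union (h𝒯 : 𝒯.IsIsometric) {F₁ F₂ : Finset Λ.E}
    (h : Disjoint (Λ.sitesOf F₁) (Λ.sitesOf F₂)) {j : ℕ} (hj : 1 ≤ j) :
    Λ.P₀ * Vcoeff Λ.P₀ Λ.resolvent (Λ.pert (F₁ ∪ F₂)) j * Λ.P₀ =
      Λ.P₀ * Vcoeff Λ.P₀ Λ.resolvent (Λ.pert F₁) j * Λ.P₀ +
      Λ.P₀ * Vcoeff Λ.P₀ Λ.resolvent (Λ.pert F₂) j * Λ.P₀ := by
  have h2 : Λ.sitesOf F₂ ⊆ (Λ.sitesOf F₁)ᶜ := fun s hs =>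
    Finset.mem_compl.2 (Finset.disjoint_right.1 h hs)
  rw [Vcoeff_pert_add h𝒯 subset_rfl h2 hj, Vcoeff_pert_local h𝒯 subset_rfl hj,
    Vcoeff_pert_local h𝒯 h2 hj]

/-- The linked-cluster theorem: only connected clusters contribute. -/
theorem exists_clusters (h𝒯 : 𝒯.IsIsometric) (Λ : PEPS 𝒯) {j : ℕ} (hj : 1 ≤ j) :
    ∃ h : Finset Λ.E → Matrix Λ.VirtCfg Λ.VirtCfg ℂ,
      (∀ F, Λ.P₀ * Vcoeff Λ.P₀ Λ.resolvent (Λ.pert F) j * Λ.P₀ = ∑ F' ∈ F.powerset, h F') ∧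
      ∀ F, h F ≠ 0 → Λ.EdgeConn F ∧ F.card ≤ j := by
  obtain ⟨C, hC⟩ := exists_hasClusters h𝒯 (Finset.univ : Finset Λ.S).card (isNCPoly_Vcoeff hj)
  obtain ⟨c, hc, hcomb⟩ := hC Λ Finset.univ le_rfl
  have hsum : ∀ F, Λ.P₀ * Vcoeff Λ.P₀ Λ.resolvent (Λ.pert F) j * Λ.P₀ =
      ∑ F' ∈ F.powerset, Λ.P₀ * c F' * Λ.P₀ := by
    intro F
    have := hc F
    dsimp only at this
    rw [Λ.resolvent_eq_siteRes h𝒯]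
    show Λ.P₀ * Vcoeff (Λ.siteProj Finset.univ) _ _ j * Λ.P₀ = _
    rw [this, Finset.mul_sum, Finset.sum_mul]
  have hempty : c ∅ = 0 := by
    refine ((hcomb ∅).subset (B := ∅) fun x hx => ?_).eq_zero
    exact absurd (IsMono.edges_nonempty hx hj) Finset.not_nonempty_empty
  refine ⟨fun F => Λ.P₀ * c F * Λ.P₀, hsum, fun F hF => ?_⟩
  have hcF : c F ≠ 0 := by rintro h0; apply hF; simp [h0]
  refine ⟨⟨?_, ?_⟩, ?_⟩
  · rw [Finset.nonempty_iff_ne_empty]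
    rintro rfl
    exact hcF hempty
  · intro F₁ F₂ h12 hn1 hn2 hd
    apply hF
    have hdF := disjoint_of_disjoint_sitesOf hd
    set a : Finset Λ.E → Matrix Λ.VirtCfg Λ.VirtCfg ℂ := fun F => Λ.P₀ * c F * Λ.P₀
    -- By additivity, the coefficients supported in `F₁` or in `F₂` have the same sums over all
    -- subsets as `a`. They must coincide with `a`, but they vanish on `F`, which is contained in
    -- neither.
    have key := cluster_unique (c := a)
      (c' := fun A => (if A ⊆ F₁ then a A else 0) + if A ⊆ F₂ then a A else 0) F ?_
    · rw [key, if_neg, if_neg, add_zero]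
      · intro h
        obtain ⟨e, he⟩ := hn1
        exact Finset.disjoint_left.1 hdF he (h (h12 ▸ Finset.mem_union_left _ he))
      · intro h
        obtain ⟨e, he⟩ := hn2
        exact Finset.disjoint_left.1 hdF (h (h12 ▸ Finset.mem_union_right _ he)) he
    · intro F' hF'
      have hF'12 : F' = (F' ∩ F₁) ∪ (F' ∩ F₂) := by
        rw [← Finset.inter_union_distrib_left, h12, Finset.inter_eq_left.2 hF']
      have hd' : Disjoint (Λ.sitesOf (F' ∩ F₁)) (Λ.sitesOf (F' ∩ F₂)) :=
        Finset.disjoint_of_subset_left (Λ.sitesOf_mono Finset.inter_subset_right)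
          (Finset.disjoint_of_subset_right (Λ.sitesOf_mono Finset.inter_subset_right) hd)
      have hs : ∀ G : Finset Λ.E, ∑ A ∈ F'.powerset, (if A ⊆ G then a A else 0) =
          ∑ A ∈ (F' ∩ G).powerset, a A := by
        intro G
        rw [← Finset.sum_filter]
        refine Finset.sum_congr ?_ fun _ _ => rfl
        ext A
        rw [Finset.mem_filter, Finset.mem_powerset, Finset.mem_powerset, Finset.subset_inter_iff]
      rw [Finset.sum_add_distrib, hs, hs, ← hsum, ← hsum, ← hsum]
      conv_lhs => rw [hF'12]
      exact Vcoeff_pert_union h𝒯 hd' hj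
  · by_contra hlt
    apply hcF
    refine ((hcomb F).subset (B := ∅) fun x hx => ?_).eq_zero
    exact absurd (IsMono.card_le hx) hlt

end PEPS

/-! ### Bounds on the terms of the cluster expansion -/

namespace PEPS

open SchriefferWolff

variable {𝒯 : SiteTensors} {Λ : PEPS 𝒯}

theorem defect_congr (h𝒯 : 𝒯.IsIsometric) {x y : Matrix Λ.VirtCfg Λ.VirtCfg ℂ}
    (h : Λ.P₀ * x * Λ.P₀ = Λ.P₀ * y * Λ.P₀) {φ : Λ.VirtCfg → ℂ} (hφ : Λ.P₀.mulVec φ = φ) :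
    Λ.defect x φ = Λ.defect y φ := by
  rw [← defect_compress h𝒯 x hφ, h, defect_compress h𝒯 y hφ]

theorem defect_siteProj (h𝒯 : 𝒯.IsIsometric) (hψ : Λ.codeState ≠ 0) (B : Finset Λ.S)
    {φ : Λ.VirtCfg → ℂ} (hφ : Λ.P₀.mulVec φ = φ) : Λ.defect (Λ.siteProj B) φ = 0 := by
  have key : ∀ {φ : Λ.VirtCfg → ℂ}, Λ.P₀.mulVec φ = φ → qform (Λ.siteProj B) φ = nsq φ := by
    intro φ hφ
    rw [← qform_compress _ hφ, Λ.P₀_mul_siteProj h𝒯, Λ.P₀_mul_self h𝒯, qform, hφ, nsq]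
  rw [defect, mean, key hφ, key (Λ.P₀_mulVec_virtState h𝒯),
    div_self (nsq_pos (Λ.virtState_ne_zero h𝒯 hψ)).ne', one_mul, sub_self]

theorem siteProj_mul_compl (h𝒯 : 𝒯.IsIsometric) (U : Finset Λ.S) :
    Λ.siteProj U * Λ.siteProj Uᶜ = Λ.P₀ := by
  rw [Λ.siteProj_mul h𝒯, Finset.union_compl]; rfl

/-- The projections off U commute with `b` and can be taken over from the outer P₀. So the local
projection of a cluster may be exchanged for P₀, for which the defect estimate of products is
available. -/
theorem compress_mul_siteProj_mul (h𝒯 : 𝒯.IsIsometric) {U : Finset Λ.S}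
    (a : Matrix Λ.VirtCfg Λ.VirtCfg ℂ) {b : Matrix Λ.VirtCfg Λ.VirtCfg ℂ} (hb : ActsOn b U) :
    Λ.P₀ * (a * Λ.siteProj U * b) * Λ.P₀ = Λ.P₀ * (a * Λ.P₀ * b) * Λ.P₀ := by
  have c := hb.commute (Λ.actsOn_siteProj Uᶜ) disjoint_compl_right
  have : Λ.P₀ * b * Λ.P₀ = Λ.siteProj U * b * Λ.P₀ := by
    conv_lhs => rw [← siteProj_mul_compl h𝒯 U]
    rw [Matrix.mul_assoc (Λ.siteProj U), ← c.eq, Matrix.mul_assoc, Matrix.mul_assoc b,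
      siteProj_mul_compl h𝒯, Λ.siteProj_mul_P₀ h𝒯, ← Matrix.mul_assoc]
  simp only [Matrix.mul_assoc] at this ⊢
  rw [this]

/-- For disjoint supports a projection P₀ can be inserted for free: half of it moves to the left,
half to the right, into the outer ones. Thus disconnected words also count as products through the
code space. -/
theorem compress_mul_of_disjoint (h𝒯 : 𝒯.IsIsometric) {U : Finset Λ.S}
    {a b : Matrix Λ.VirtCfg Λ.VirtCfg ℂ} (ha : ActsOn a U) (hb : ActsOn b Uᶜ) :
    Λ.P₀ * (a * b) * Λ.P₀ = Λ.P₀ * (a * Λ.P₀ * b) * Λ.P₀ := by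
  have ca := ha.commute (Λ.actsOn_siteProj Uᶜ) disjoint_compl_right
  have cb := hb.commute (Λ.actsOn_siteProj U) disjoint_compl_left
  have hP : Λ.siteProj Uᶜ * Λ.siteProj U = Λ.P₀ := by
    rw [Λ.siteProj_mul h𝒯, Finset.union_comm, Finset.union_compl]; rfl
  have : a * Λ.P₀ * b = Λ.siteProj Uᶜ * (a * b) * Λ.siteProj U := by
    rw [← hP, ← Matrix.mul_assoc, ca.eq, Matrix.mul_assoc (Λ.siteProj Uᶜ * a), ← cb.eq]
    simp only [Matrix.mul_assoc]
  rw [this]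
  simp only [Matrix.mul_assoc]
  rw [Λ.siteProj_mul_P₀ h𝒯, ← Matrix.mul_assoc Λ.P₀ (Λ.siteProj Uᶜ), Λ.P₀_mul_siteProj h𝒯]

/-- Up to the projections onto the code space, a monomial is a good word or a product through the
code space. -/
theorem IsMono.good_or_thru (h𝒯 : 𝒯.IsIsometric) {U : Finset Λ.S} (hU : U.Nonempty) {k : ℕ}
    {F : Finset Λ.E} {x : Matrix Λ.VirtCfg Λ.VirtCfg ℂ} (h : Λ.IsMono U k F x) :
    (∃ B x' g, B ⊆ U ∧ Λ.IsGood U k F x' g ∧ x * Λ.P₀ = Λ.siteProj B * x' * Λ.P₀) ∨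
      ∃ z ∈ Λ.thruMonos U k F, x * Λ.P₀ = z * Λ.P₀ := by
  induction h with
  | @proj B hB => exact Or.inl ⟨B, 1, 1, hB, .one, by rw [mul_one]⟩
  | @cons k F x B e hB hx ih =>
    rcases ih with ⟨B', x', g, hB', hg, hxx'⟩ | ⟨z, ⟨k', l, F₁, F₂, a, b, hk, hl, rfl, rfl, ha, hb,
        rfl⟩, hz⟩
    · rcases Nat.eq_zero_or_pos k with rfl | hk
      · left
        cases hg
        -- The last projection of the monomial is absorbed by P₀ on the right, so the empty set, a
        -- proper subset of U, may take its place.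
        refine ⟨B, _, _, hB, .cons e (Finset.empty_ssubset.2 hU) .one, ?_⟩
        rw [Matrix.mul_assoc, hxx', mul_one, Λ.siteProj_mul_P₀ h𝒯, mul_one, siteProj_empty, mul_one]
      -- An inner projection on all of U is a passage through the code space; one on a proper subset
      -- is allowed in a good word.
      · by_cases hBU : B' = U
        · right
          subst hBU
          refine ⟨Λ.siteProj B * Λ.bondProj {e} * Λ.siteProj B' * x',
            ⟨1, k, {e}, F, Λ.siteProj B * Λ.bondProj {e}, x', le_rfl, hk, by omega,
              (Finset.insert_eq e F).symm, ?_, hg.isMono h𝒯, rfl⟩, ?_⟩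
          · exact (IsMono.bond e).proj_mul h𝒯 hB
          · rw [Matrix.mul_assoc, hxx']
            simp only [Matrix.mul_assoc]
        · left
          refine ⟨B, _, _, hB, .cons e (hB'.ssubset_of_ne hBU) hg, ?_⟩
          rw [Matrix.mul_assoc, hxx']
          simp only [Matrix.mul_assoc]
    · right
      refine ⟨Λ.siteProj B * Λ.bondProj {e} * a * Λ.siteProj U * b,
        ⟨k' + 1, l, insert e F₁, F₂, Λ.siteProj B * Λ.bondProj {e} * a, b, by omega, hl, by omega,
          by rw [Finset.insert_union], .cons e hB ha, hb, rfl⟩, ?_⟩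
      rw [Matrix.mul_assoc, hz]
      simp only [Matrix.mul_assoc]

theorem thruMonos_mem_words {U : Finset Λ.S} {j : ℕ} {F : Finset Λ.E}
    {z : Matrix Λ.VirtCfg Λ.VirtCfg ℂ} (h : z ∈ Λ.thruMonos U j F) : z ∈ Λ.words := by
  obtain ⟨k, l, F₁, F₂, x, y, -, -, -, -, hx, hy, rfl⟩ := h
  exact mul_mem (mul_mem hx.mem_words (Λ.siteProj_mem_words U)) hy.mem_words

theorem thruMonos_actsOn {j : ℕ} {F : Finset Λ.E}
    {z : Matrix Λ.VirtCfg Λ.VirtCfg ℂ} (h : z ∈ Λ.thruMonos (Λ.sitesOf F) j F) :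
    ActsOn z (Λ.sitesOf F) := by
  obtain ⟨k, l, F₁, F₂, x, y, -, -, -, rfl, hx, hy, rfl⟩ := h
  exact ((hx.actsOn subset_rfl (Λ.sitesOf_mono Finset.subset_union_left)).mul
    (Λ.actsOn_siteProj _)).mul (hy.actsOn subset_rfl (Λ.sitesOf_mono Finset.subset_union_right))

variable (Λ)

/-- The leading part of the effective interaction of a cluster, with the opposite sign. -/
noncomputable def leadSum (r : ℕ) (ε : ℝ) (F : Finset Λ.E) : Matrix Λ.VirtCfg Λ.VirtCfg ℂ :=
  (((Λ.weightSum (Λ.sitesOf F))⁻¹ : ℝ) : ℂ) •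
    ∑ j ∈ Finset.Icc 1 r, ((ε ^ j : ℝ) : ℂ) • Λ.lead (Λ.sitesOf F) j F

open Classical in
/-- The connected clusters inside `F`. -/
noncomputable def subclusters (F : Finset Λ.E) : Finset (Finset Λ.E) :=
  F.powerset.filter Λ.EdgeConn

/-- The constant in the bound of the defects of monomials. -/
def monoConst (r : ℕ) : ℝ := 2 ^ (2 * r) * ((2 * r).factorial : ℝ) ^ r

theorem monoConst_pos (r : ℕ) : 0 < monoConst r := by
  have := Nat.factorial_pos (2 * r)
  rw [monoConst]
  positivity

variable {Λ}

theorem mem_subclusters {F F' : Finset Λ.E} :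
    F' ∈ Λ.subclusters F ↔ F' ⊆ F ∧ Λ.EdgeConn F' := by
  simp [subclusters]

theorem isPos_leadSum (r : ℕ) {ε : ℝ} (hε : 0 ≤ ε) (F : Finset Λ.E) :
    Λ.IsPos (Λ.leadSum r ε F) :=
  IsPos.smul (inv_nonneg.2 (Λ.weightSum_nonneg _))
    (IsPos.sum _ fun j _ => (isPos_lead _ j F).smul (pow_nonneg hε j))

theorem defect_leadSum (r : ℕ) (ε : ℝ) (F : Finset Λ.E) (φ : Λ.VirtCfg → ℂ) :
    Λ.defect (Λ.leadSum r ε F) φ = (Λ.weightSum (Λ.sitesOf F))⁻¹ *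
      ∑ j ∈ Finset.Icc 1 r, ε ^ j * Λ.defect (Λ.lead (Λ.sitesOf F) j F) φ := by
  rw [leadSum, defect_smul, defect_sum]
  simp only [defect_smul]

theorem mean_sum {α : Type*} (s : Finset α) (f : α → Matrix Λ.VirtCfg Λ.VirtCfg ℂ) :
    Λ.mean (∑ i ∈ s, f i) = ∑ i ∈ s, Λ.mean (f i) := by
  simp only [mean, qform_sum, Finset.sum_div]

theorem mean_leadSum (r : ℕ) (ε : ℝ) (F : Finset Λ.E) :
    Λ.mean (Λ.leadSum r ε F) = (Λ.weightSum (Λ.sitesOf F))⁻¹ *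
      ∑ j ∈ Finset.Icc 1 r, ε ^ j * Λ.mean (Λ.lead (Λ.sitesOf F) j F) := by
  rw [leadSum, mean_smul, mean_sum]
  simp only [mean_smul]

/-- The factor 4 gained per multiplication is 2 from the defect of a product times 2 for the two
summands. With δ = 1 this is the induction step for monomials; with δ = ε it records that a power of
ε is left over. -/
theorem two_factor_bound {ε δ A d a b s s₁ s₂ : ℝ} {k k₁ k₂ m : ℕ} (hε : 0 < ε) (hδ : 0 ≤ δ)
    (hA : 0 < A) (ha : 0 ≤ a) (hb : 0 ≤ b) (hs : 0 ≤ s) (hd : d ≤ 2 * (a + b))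
    (h₁ : ε ^ k₁ * a ≤ A * 4 ^ k₁ * s₁) (h₂ : ε ^ k₂ * b ≤ A * 4 ^ k₂ * s₂) (hs₁ : s₁ ≤ s)
    (hs₂ : s₂ ≤ s) (hk₁ : ε ^ k ≤ δ * ε ^ k₁) (hk₂ : ε ^ k ≤ δ * ε ^ k₂) (hm₁ : k₁ ≤ m)
    (hm₂ : k₂ ≤ m) : ε ^ k * d ≤ δ * (A * 4 ^ (m + 1)) * s := by
  have one : ∀ {a s₁ : ℝ} {k₁ : ℕ}, 0 ≤ a → ε ^ k₁ * a ≤ A * 4 ^ k₁ * s₁ → s₁ ≤ s →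
      ε ^ k ≤ δ * ε ^ k₁ → k₁ ≤ m → ε ^ k * a ≤ δ * (A * 4 ^ m * s) := by
    intro a s₁ k₁ ha h hs₁ hk hm
    have q : (4 : ℝ) ^ k₁ ≤ 4 ^ m := pow_le_pow_right₀ (by norm_num) hm
    calc ε ^ k * a ≤ δ * ε ^ k₁ * a := mul_le_mul_of_nonneg_right hk ha
      _ = δ * (ε ^ k₁ * a) := by ring
      _ ≤ δ * (A * 4 ^ m * s) := by
        refine mul_le_mul_of_nonneg_left (h.trans ?_) hδ
        exact (mul_le_mul_of_nonneg_left hs₁ (by positivity)).trans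
          (mul_le_mul_of_nonneg_right (mul_le_mul_of_nonneg_left q hA.le) hs)
  have j1 := one ha h₁ hs₁ hk₁ hm₁
  have j2 := one hb h₂ hs₂ hk₂ hm₂
  calc ε ^ k * d ≤ ε ^ k * (2 * (a + b)) := mul_le_mul_of_nonneg_left hd (by positivity)
    _ = 2 * (ε ^ k * a + ε ^ k * b) := by ring
    _ ≤ 2 * (δ * (A * 4 ^ m * s) + δ * (A * 4 ^ m * s)) := by linarith
    _ = _ := by rw [pow_succ]; ring

/-- A cluster of at most r edges has at most 2r sites. So the weight sum is at most 2^(2r), and each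
of the at most r weights of a good word is at least 1/(2r)!; this explains `monoConst`. -/
theorem IsGood.weightSum_le (h𝒯 : 𝒯.IsIsometric) {r k : ℕ} {F : Finset Λ.E}
    {x : Matrix Λ.VirtCfg Λ.VirtCfg ℂ} {g : ℝ} (hkr : k ≤ r)
    (h : Λ.IsGood (Λ.sitesOf F) k F x g) : Λ.weightSum (Λ.sitesOf F) ≤ monoConst r * g := by
  have hFk : F.card ≤ k := (h.isMono h𝒯).card_le
  have hUc : (Λ.sitesOf F).card ≤ 2 * r := by
    have := Λ.card_sitesOf_le F
    omega
  have hwle : Λ.weightSum (Λ.sitesOf F) ≤ 2 ^ (2 * r) :=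
    (Λ.weightSum_le _).trans (pow_le_pow_right₀ one_le_two hUc)
  have hgw := h.le_weight
  have hfl : ((Λ.sitesOf F).card.factorial : ℝ) ≤ ((2 * r).factorial : ℝ) :=
    Nat.cast_le.2 (Nat.factorial_le hUc)
  have hfp : (0 : ℝ) < (Λ.sitesOf F).card.factorial := Nat.cast_pos.2 (Nat.factorial_pos _)
  have hf1 : (1 : ℝ) ≤ ((2 * r).factorial : ℝ) := Nat.one_le_cast.2 (Nat.factorial_pos _)
  rw [monoConst]
  generalize ((2 * r).factorial : ℝ) = f at hfl hf1 ⊢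
  generalize ((Λ.sitesOf F).card.factorial : ℝ) = f' at hfl hfp hgw
  generalize (2 : ℝ) ^ (2 * r) = a at hwle ⊢
  have hgle : 1 ≤ f ^ r * g :=
    calc (1 : ℝ) = f' ^ k * (1 / f') ^ k := by
          rw [← mul_pow, mul_one_div_cancel hfp.ne', one_pow]
      _ ≤ f ^ r * g := by
          refine mul_le_mul ?_ hgw (by positivity) (by positivity)
          exact (pow_le_pow_left₀ hfp.le hfl k).trans (pow_le_pow_right₀ hf1 hkr)
  have ha : 0 ≤ a := (Λ.weightSum_nonneg _).trans hwle
  calc _ ≤ a * 1 := by rw [mul_one]; exact hwle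
    _ ≤ a * (f ^ r * g) := mul_le_mul_of_nonneg_left hgle ha
    _ = _ := by ring

/-! ### Defects of monomials in terms of the leading parts -/

section Bounds

variable {r : ℕ} {ε : ℝ} {φ : Λ.VirtCfg → ℂ}

theorem sum_defect_mono (h𝒯 : 𝒯.IsIsometric) (hψ : Λ.codeState ≠ 0) (hq : Λ.IsQuasiInjective)
    (hε : 0 < ε) (hφ : Λ.P₀.mulVec φ = φ) {F F' : Finset Λ.E} (h : F' ⊆ F) :
    ∑ A ∈ Λ.subclusters F', Λ.defect (Λ.leadSum r ε A) φ ≤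
      ∑ A ∈ Λ.subclusters F, Λ.defect (Λ.leadSum r ε A) φ := by
  refine Finset.sum_le_sum_of_subset_of_nonneg (fun A hA => ?_) fun A _ _ =>
    (isPos_leadSum r hε.le A).defect_nonneg h𝒯 hψ hq hφ
  rw [mem_subclusters] at hA ⊢
  exact ⟨hA.1.trans h, hA.2⟩

theorem sum_defect_nonneg (h𝒯 : 𝒯.IsIsometric) (hψ : Λ.codeState ≠ 0) (hq : Λ.IsQuasiInjective)
    (hε : 0 < ε) (hφ : Λ.P₀.mulVec φ = φ) (F : Finset Λ.E) :
    0 ≤ ∑ A ∈ Λ.subclusters F, Λ.defect (Λ.leadSum r ε A) φ :=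
  Finset.sum_nonneg fun A _ => (isPos_leadSum r hε.le A).defect_nonneg h𝒯 hψ hq hφ

theorem lead_defect_le (h𝒯 : 𝒯.IsIsometric) (hψ : Λ.codeState ≠ 0) (hq : Λ.IsQuasiInjective)
    (hε : 0 < ε) (hφ : Λ.P₀.mulVec φ = φ) (k : ℕ) (F : Finset Λ.E) (hk1 : 1 ≤ k) (hkr : k ≤ r) :
    ε ^ k * Λ.defect (Λ.lead (Λ.sitesOf F) k F) φ ≤
      ∑ j ∈ Finset.Icc 1 r, ε ^ j * Λ.defect (Λ.lead (Λ.sitesOf F) j F) φ :=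
  Finset.single_le_sum (f := fun j => ε ^ j * Λ.defect (Λ.lead (Λ.sitesOf F) j F) φ)
    (fun j _ => mul_nonneg (pow_nonneg hε.le j)
      ((isPos_lead _ j F).defect_nonneg h𝒯 hψ hq hφ)) (Finset.mem_Icc.2 ⟨hk1, hkr⟩)

/-- The leading part minus g times the word is a nonnegative combination of words, hence has
nonnegative defect; so g times the defect of the word is at most that of `lead`, which is one of the
nonnegative terms of `leadSum`. -/
theorem good_defect_le (h𝒯 : 𝒯.IsIsometric) (hψ : Λ.codeState ≠ 0) (hq : Λ.IsQuasiInjective)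
    (hε : 0 < ε) (hφ : Λ.P₀.mulVec φ = φ) {k : ℕ} {F : Finset Λ.E}
    {x : Matrix Λ.VirtCfg Λ.VirtCfg ℂ} {g : ℝ}
    (hF : F.Nonempty) (hk1 : 1 ≤ k) (hkr : k ≤ r) (h : Λ.IsGood (Λ.sitesOf F) k F x g) :
    ε ^ k * Λ.defect x φ ≤ monoConst r * Λ.defect (Λ.leadSum r ε F) φ := by
  have hw := Λ.weightSum_pos (sitesOf_nonempty hF)
  have h1 := h.isPos_sub.defect_nonneg h𝒯 hψ hq hφ
  rw [sub_eq_add_neg, defect_add, defect_neg, defect_smul] at h1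
  have hdx := defect_nonneg h𝒯 hψ hq h.mem_words hφ
  have h2 := lead_defect_le h𝒯 hψ hq hε hφ k F hk1 hkr
  have hwg := h.weightSum_le h𝒯 hkr
  have hL0 : 0 ≤ ∑ j ∈ Finset.Icc 1 r, ε ^ j * Λ.defect (Λ.lead (Λ.sitesOf F) j F) φ :=
    Finset.sum_nonneg fun j _ => mul_nonneg (pow_nonneg hε.le j)
      ((isPos_lead _ j F).defect_nonneg h𝒯 hψ hq hφ)
  rw [defect_leadSum]
  generalize ∑ j ∈ Finset.Icc 1 r, ε ^ j * Λ.defect (Λ.lead (Λ.sitesOf F) j F) φ = L at h2 hL0 ⊢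
  generalize Λ.defect (Λ.lead (Λ.sitesOf F) k F) φ = l at h1 h2
  generalize Λ.defect x φ = d at h1 hdx ⊢
  generalize Λ.weightSum (Λ.sitesOf F) = w at hw hwg ⊢
  have hA := monoConst_pos r
  generalize monoConst r = A at hwg hA ⊢
  have h3 : ε ^ k * (g * d) ≤ L :=
    le_trans (mul_le_mul_of_nonneg_left (by linarith) (pow_nonneg hε.le k)) h2
  have hex : 0 ≤ ε ^ k * d := mul_nonneg (pow_nonneg hε.le k) hdx
  have e1 : ε ^ k * d = w⁻¹ * (w * (ε ^ k * d)) := by field_simp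
  have e2 : w * (ε ^ k * d) ≤ A * L :=
    calc w * (ε ^ k * d) ≤ A * g * (ε ^ k * d) := mul_le_mul_of_nonneg_right hwg hex
      _ = A * (ε ^ k * (g * d)) := by ring
      _ ≤ A * L := mul_le_mul_of_nonneg_left h3 hA.le
  calc ε ^ k * d = w⁻¹ * (w * (ε ^ k * d)) := e1
    _ ≤ w⁻¹ * (A * L) := mul_le_mul_of_nonneg_left e2 (inv_nonneg.2 hw.le)
    _ = A * (w⁻¹ * L) := by ring

/-- Strong induction on the degree. On a connected cluster, a monomial is up to P₀ either a good
word, bounded by the leading part of that cluster, or a product through the code space. On a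
disconnected one, it factors over disjoint supports and is such a product as well. The factors of a
product have smaller degree and their clusters lie inside F. -/
theorem mono_defect_le (h𝒯 : 𝒯.IsIsometric) (hψ : Λ.codeState ≠ 0) (hq : Λ.IsQuasiInjective)
    (hε : 0 < ε) (hε1 : ε ≤ 1) (hφ : Λ.P₀.mulVec φ = φ) {U : Finset Λ.S} {k : ℕ}
    (hkr : k ≤ r) {F : Finset Λ.E}
    {x : Matrix Λ.VirtCfg Λ.VirtCfg ℂ} (h : Λ.IsMono U k F x) :
    ε ^ k * Λ.defect x φ ≤
      monoConst r * 4 ^ k * ∑ A ∈ Λ.subclusters F, Λ.defect (Λ.leadSum r ε A) φ := by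
  induction k using Nat.strong_induction_on generalizing U F x with
  | _ k ih =>
  have hA := monoConst_pos r
  have two : ∀ {U₁ U₂ : Finset Λ.S} {k₁ k₂ : ℕ} {F₁ F₂ : Finset Λ.E}
      {a b : Matrix Λ.VirtCfg Λ.VirtCfg ℂ}, Λ.IsMono U₁ k₁ F₁ a → Λ.IsMono U₂ k₂ F₂ b →
      1 ≤ k₁ → 1 ≤ k₂ → k₁ + k₂ = k → F₁ ⊆ F → F₂ ⊆ F →
      ε ^ k * Λ.defect (a * Λ.P₀ * b) φ ≤
        monoConst r * 4 ^ k * ∑ A ∈ Λ.subclusters F, Λ.defect (Λ.leadSum r ε A) φ := by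
    intro U₁ U₂ k₁ k₂ F₁ F₂ a b ha hb h1 h2 h12 hF1 hF2
    have s1 := sum_defect_mono h𝒯 hψ hq (r := r) hε hφ hF1
    have s2 := sum_defect_mono h𝒯 hψ hq (r := r) hε hφ hF2
    have s0 := sum_defect_nonneg h𝒯 hψ hq (r := r) hε hφ F
    have i1 := ih k₁ (by omega) (by omega) ha
    have i2 := ih k₂ (by omega) (by omega) hb
    have d := defect_mul_P₀_mul_le h𝒯 hψ hq ha.mem_words hb.mem_words hφ
    have da := defect_nonneg h𝒯 hψ hq ha.mem_words hφ
    have db := defect_nonneg h𝒯 hψ hq hb.mem_words hφ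
    have q : k - 1 + 1 = k := by omega
    have key := two_factor_bound (k := k) (δ := 1) (m := k - 1) hε zero_le_one hA da db s0 d i1 i2
      s1 s2 (by rw [one_mul]; exact pow_le_pow_of_le_one hε.le hε1 (by omega))
      (by rw [one_mul]; exact pow_le_pow_of_le_one hε.le hε1 (by omega)) (by omega) (by omega)
    rw [q, one_mul] at key
    exact key
  have s0 := sum_defect_nonneg h𝒯 hψ hq (r := r) hε hφ F
  rcases Nat.eq_zero_or_pos k with rfl | hk
  · cases h with
    | proj hB =>
      rw [defect_siteProj h𝒯 hψ _ hφ, mul_zero]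
      positivity
  have hF := h.edges_nonempty hk
  by_cases hconn : Λ.EdgeConn F
  · have hin : ∀ e ∈ F, ∀ i, Λ.endSite e i ∈ Λ.sitesOf F := fun e he i =>
      Λ.endSite_mem_sitesOf he i
    obtain ⟨k₁, k₂, x₁, x₂, hk12, hx, h1, h2⟩ := h.split h𝒯 (Λ.sitesOf F)
      fun e he => Or.inl (hin e he)
    have f1 : (F.filter fun e => ∀ i, Λ.endSite e i ∈ Λ.sitesOf F) = F :=
      Finset.filter_true_of_mem hin
    have f2 : (F.filter fun e => ¬ ∀ i, Λ.endSite e i ∈ Λ.sitesOf F) = ∅ :=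
      Finset.filter_false_of_mem fun e he => not_not.2 (hin e he)
    rw [f1] at h1
    rw [f2] at h2
    -- All edges of the monomial lie in the cluster, so the outside factor is a site projection,
    -- absorbed by P₀.
    have hk2 : k₂ = 0 := by
      by_contra hne
      exact Finset.not_nonempty_empty (h2.edges_nonempty (Nat.pos_of_ne_zero hne))
    subst hk2
    obtain ⟨B, hx2⟩ : ∃ B, x₂ = Λ.siteProj B := by cases h2 with | proj _ => exact ⟨_, rfl⟩
    have hk1 : k₁ = k := by omega
    subst hk1
    have hd : Λ.defect x φ = Λ.defect x₁ φ := by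
      refine defect_congr h𝒯 ?_ hφ
      rw [hx, hx2]
      simp only [Matrix.mul_assoc]
      rw [Λ.siteProj_mul_P₀ h𝒯]
    rw [hd]
    rcases h1.good_or_thru h𝒯 (sitesOf_nonempty hF) with ⟨B', x', g, hB', hg, he⟩ | ⟨z, hz, he⟩
    · have hd' : Λ.defect x₁ φ = Λ.defect x' φ := by
        refine defect_congr h𝒯 ?_ hφ
        rw [Matrix.mul_assoc, he, ← Matrix.mul_assoc, ← Matrix.mul_assoc, Λ.P₀_mul_siteProj h𝒯]
      rw [hd']
      have hb := good_defect_le h𝒯 hψ hq hε hφ hF hk hkr hg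
      have hmem : F ∈ Λ.subclusters F := mem_subclusters.2 ⟨subset_rfl, hconn⟩
      have hsing := Finset.single_le_sum (f := fun A => Λ.defect (Λ.leadSum r ε A) φ)
        (fun A _ => (isPos_leadSum r hε.le A).defect_nonneg h𝒯 hψ hq hφ) hmem
      refine hb.trans ?_
      have h4 : (1 : ℝ) ≤ 4 ^ k₁ := one_le_pow₀ (by norm_num)
      exact (mul_le_mul_of_nonneg_left hsing hA.le).trans
        (mul_le_mul_of_nonneg_right (le_mul_of_one_le_right hA.le h4) s0)
    · obtain ⟨k', l, F₁, F₂, a, b, hk', hl, hkl, hF12, ha, hb, rfl⟩ := hz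
      have hs2 : F₂ ⊆ F := hF12 ▸ Finset.subset_union_right
      have hs1 : F₁ ⊆ F := hF12 ▸ Finset.subset_union_left
      have hd' : Λ.defect x₁ φ = Λ.defect (a * Λ.P₀ * b) φ := by
        refine defect_congr h𝒯 ?_ hφ
        rw [Matrix.mul_assoc, he, ← Matrix.mul_assoc,
          compress_mul_siteProj_mul h𝒯 a (hb.actsOn subset_rfl (Λ.sitesOf_mono hs2))]
      rw [hd']
      exact two ha hb hk' hl hkl hs1 hs2
  · rw [EdgeConn] at hconn
    push Not at hconn
    obtain ⟨F₁, F₂, hF12, hn1, hn2, hdis⟩ := hconn hF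
    have hin : ∀ e ∈ F₁, ∀ i, Λ.endSite e i ∈ Λ.sitesOf F₁ := fun e he i =>
      Λ.endSite_mem_sitesOf he i
    have hout : ∀ e ∈ F₂, ∀ i, Λ.endSite e i ∉ Λ.sitesOf F₁ := fun e he i =>
      Finset.disjoint_right.1 hdis (Λ.endSite_mem_sitesOf he i)
    obtain ⟨k₁, k₂, x₁, x₂, hk12, hx, h1, h2⟩ := h.split h𝒯 (Λ.sitesOf F₁) (by
      intro e he
      rw [← hF12, Finset.mem_union] at he
      exact he.imp (hin e) (hout e))
    have n1 : (F.filter fun e => ∀ i, Λ.endSite e i ∈ Λ.sitesOf F₁).Nonempty := by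
      obtain ⟨e, he⟩ := hn1
      exact ⟨e, Finset.mem_filter.2 ⟨hF12 ▸ Finset.mem_union_left _ he, hin e he⟩⟩
    have n2 : (F.filter fun e => ¬ ∀ i, Λ.endSite e i ∈ Λ.sitesOf F₁).Nonempty := by
      obtain ⟨e, he⟩ := hn2
      exact ⟨e, Finset.mem_filter.2 ⟨hF12 ▸ Finset.mem_union_right _ he,
        fun h => hout e he true (h true)⟩⟩
    have a1 : ActsOn x₁ (Λ.sitesOf F₁) := h1.actsOn subset_rfl fun s hs => by
      obtain ⟨e', he', i, rfl⟩ := Λ.mem_sitesOf.1 hs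
      exact (Finset.mem_filter.1 he').2 i
    have a2 : ActsOn x₂ (Λ.sitesOf F₁)ᶜ := h2.actsOn subset_rfl fun s hs => by
      obtain ⟨e', he', i, rfl⟩ := Λ.mem_sitesOf.1 hs
      rw [Finset.mem_filter, ← hF12, Finset.mem_union] at he'
      exact Finset.mem_compl.2 ((he'.1.resolve_left fun h => he'.2 (hin e' h)) |> hout e' <| i)
    have hd' : Λ.defect x φ = Λ.defect (x₁ * Λ.P₀ * x₂) φ :=
      defect_congr h𝒯 (by rw [hx, compress_mul_of_disjoint h𝒯 a1 a2]) hφ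
    rw [hd']
    exact two h1 h2 (h1.degree_pos n1) (h2.degree_pos n2) hk12 (Finset.filter_subset _ _)
      (Finset.filter_subset _ _)

/-- Both factors have degree at most j - 1, while the term carries ε^j. The spare ε makes everything
but the leading parts a small perturbation of them. -/
theorem thru_defect_le (h𝒯 : 𝒯.IsIsometric) (hψ : Λ.codeState ≠ 0) (hq : Λ.IsQuasiInjective)
    (hε : 0 < ε) (hε1 : ε ≤ 1) (hφ : Λ.P₀.mulVec φ = φ) {j : ℕ} (hj : j ≤ r) {F : Finset Λ.E}
    {z : Matrix Λ.VirtCfg Λ.VirtCfg ℂ} (h : z ∈ Λ.thruMonos (Λ.sitesOf F) j F) :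
    ε ^ j * Λ.defect z φ ≤
      ε * (monoConst r * 4 ^ (r + 1)) * ∑ A ∈ Λ.subclusters F, Λ.defect (Λ.leadSum r ε A) φ := by
  obtain ⟨k, l, F₁, F₂, a, b, hk, hl, hkl, hF12, ha, hb, rfl⟩ := h
  have hA := monoConst_pos r
  have hs1 : F₁ ⊆ F := hF12 ▸ Finset.subset_union_left
  have hs2 : F₂ ⊆ F := hF12 ▸ Finset.subset_union_right
  have hd' : Λ.defect (a * Λ.siteProj (Λ.sitesOf F) * b) φ = Λ.defect (a * Λ.P₀ * b) φ :=
    defect_congr h𝒯 (compress_mul_siteProj_mul h𝒯 a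
      (hb.actsOn subset_rfl (Λ.sitesOf_mono hs2))) hφ
  rw [hd']
  have s1 := sum_defect_mono h𝒯 hψ hq (r := r) hε hφ hs1
  have s2 := sum_defect_mono h𝒯 hψ hq (r := r) hε hφ hs2
  have s0 := sum_defect_nonneg h𝒯 hψ hq (r := r) hε hφ F
  have i1 := mono_defect_le h𝒯 hψ hq hε hε1 hφ (by omega : k ≤ r) ha
  have i2 := mono_defect_le h𝒯 hψ hq hε hε1 hφ (by omega : l ≤ r) hb
  have d := defect_mul_P₀_mul_le h𝒯 hψ hq ha.mem_words hb.mem_words hφ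
  have da := defect_nonneg h𝒯 hψ hq ha.mem_words hφ
  have db := defect_nonneg h𝒯 hψ hq hb.mem_words hφ
  refine two_factor_bound hε hε.le hA da db s0 d i1 i2 s1 s2 ?_ ?_ (by omega) (by omega)
  · rw [← pow_succ']; exact pow_le_pow_of_le_one hε.le hε1 (by omega)
  · rw [← pow_succ']; exact pow_le_pow_of_le_one hε.le hε1 (by omega)

end Bounds

end PEPS

/-! ### The effective Hamiltonian as a sum over connected clusters -/

namespace PEPS

open SchriefferWolff

variable {𝒯 : SiteTensors} {Λ : PEPS 𝒯}

/-- The compression of `x` to the code space has the encoded PEPS as an eigenvector. -/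
def IsScalarOn (Λ : PEPS 𝒯) (x : Matrix Λ.VirtCfg Λ.VirtCfg ℂ) : Prop :=
  (Λ.P₀ * x * Λ.P₀).mulVec Λ.virtState = (Λ.mean x : ℂ) • Λ.virtState

theorem IsScalarOn.add {x y : Matrix Λ.VirtCfg Λ.VirtCfg ℂ} (hx : Λ.IsScalarOn x)
    (hy : Λ.IsScalarOn y) : Λ.IsScalarOn (x + y) := by
  rw [IsScalarOn] at *
  rw [mul_add, add_mul, Matrix.add_mulVec, hx, hy, mean_add, Complex.ofReal_add, add_smul]

theorem IsScalarOn.smul {x : Matrix Λ.VirtCfg Λ.VirtCfg ℂ} (c : ℝ) (hx : Λ.IsScalarOn x) :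
    Λ.IsScalarOn ((c : ℂ) • x) := by
  rw [IsScalarOn] at *
  rw [Matrix.mul_smul, Matrix.smul_mul, Matrix.smul_mulVec, hx, mean_smul, Complex.ofReal_mul,
    mul_smul]

theorem isScalarOn_zero : Λ.IsScalarOn 0 := by
  simp [IsScalarOn, mean, qform_zero]

theorem IsScalarOn.sum {ι : Type*} (s : Finset ι) {f : ι → Matrix Λ.VirtCfg Λ.VirtCfg ℂ}
    (h : ∀ i ∈ s, Λ.IsScalarOn (f i)) : Λ.IsScalarOn (∑ i ∈ s, f i) := by
  classical
  induction s using Finset.induction_on with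
  | empty => simpa using isScalarOn_zero
  | insert i s hi ih =>
    rw [Finset.sum_insert hi]
    exact (h i (by simp)).add (ih fun j hj => h j (by simp [hj]))

theorem isScalarOn_word (h𝒯 : 𝒯.IsIsometric) (hψ : Λ.codeState ≠ 0) (hq : Λ.IsQuasiInjective)
    {x : Matrix Λ.VirtCfg Λ.VirtCfg ℂ} (hx : x ∈ Λ.words) : Λ.IsScalarOn x :=
  (maximizes_mean h𝒯 hψ hq hx).eigen

theorem IsPos.isScalarOn (h𝒯 : 𝒯.IsIsometric) (hψ : Λ.codeState ≠ 0) (hq : Λ.IsQuasiInjective)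
    {x : Matrix Λ.VirtCfg Λ.VirtCfg ℂ} (hx : Λ.IsPos x) : Λ.IsScalarOn x := by
  induction hx with
  | of hx => exact isScalarOn_word h𝒯 hψ hq hx
  | zero => exact isScalarOn_zero
  | add _ _ h h' => exact h.add h'
  | smul _ _ h => exact h.smul _

theorem IsPos.conjTranspose {x : Matrix Λ.VirtCfg Λ.VirtCfg ℂ} (hx : Λ.IsPos x) :
    Λ.IsPos x.conjTranspose := by
  induction hx with
  | of hx => exact .of (Λ.conjTranspose_mem_words hx)
  | zero => rw [Matrix.conjTranspose_zero]; exact .zero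
  | add _ _ h h' => rw [Matrix.conjTranspose_add]; exact h.add h'
  | @smul x c hc _ h =>
    rw [Matrix.conjTranspose_smul, show star (c : ℂ) = (c : ℂ) by simp]
    exact h.smul hc

/-! ### Properties of bounded combinations inherited from their terms -/

section CombBounds

variable {A : Set (Matrix Λ.VirtCfg Λ.VirtCfg ℂ)} {C : ℝ} {x : Matrix Λ.VirtCfg Λ.VirtCfg ℂ}

theorem comb_isScalarOn (h : Comb A C x) (hA : ∀ z ∈ A, Λ.IsScalarOn z) : Λ.IsScalarOn x := by
  induction h with
  | of h => exact hA _ h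
  | zero => exact isScalarOn_zero
  | add _ _ h h' => exact h.add h'
  | smul c _ h => exact h.smul c
  | mono _ _ h => exact h

theorem comb_actsOn (h : Comb A C x) {U : Finset Λ.S} (hA : ∀ z ∈ A, ActsOn z U) :
    ActsOn x U := by
  induction h with
  | of h => exact hA _ h
  | zero => exact ActsOn.of_zero U
  | add _ _ h h' => exact h.add h'
  | smul c _ h => exact h.smul _
  | mono _ _ h => exact h

theorem comb_linear_le (f : Matrix Λ.VirtCfg Λ.VirtCfg ℂ → ℝ) (hadd : ∀ x y, f (x + y) = f x + f y)
    (hsmul : ∀ (c : ℝ) x, f ((c : ℂ) • x) = c * f x) (h : Comb A C x) {K : ℝ} (hK : 0 ≤ K)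
    (hA : ∀ z ∈ A, |f z| ≤ K) : |f x| ≤ C * K := by
  induction h with
  | of h => rw [one_mul]; exact hA _ h
  | zero =>
    have := hsmul 0 0
    rw [smul_zero, zero_mul] at this
    rw [this]
    simp
  | add _ _ h h' =>
    rw [hadd, add_mul]
    exact (abs_add_le _ _).trans (add_le_add h h')
  | smul c _ h =>
    rw [hsmul, abs_mul, mul_assoc]
    exact mul_le_mul_of_nonneg_left h (abs_nonneg c)
  | mono _ hC h => exact h.trans (mul_le_mul_of_nonneg_right hC hK)

end CombBounds

theorem actsOn_posRes (U : Finset Λ.S) : ActsOn (Λ.posRes U) U :=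
  ActsOn.sum _ fun B hB =>
    ((Λ.actsOn_siteProj B).mono (Finset.mem_ssubsets.1 hB).subset).smul _

theorem actsOn_lead {U : Finset Λ.S} (j : ℕ) {F : Finset Λ.E} (hF : Λ.sitesOf F ⊆ U) :
    ActsOn (Λ.lead U j F) U := by
  induction j generalizing F with
  | zero =>
    simp only [lead]
    split_ifs
    · exact ActsOn.one U
    · exact ActsOn.of_zero U
  | succ j ih =>
    refine ActsOn.sum _ fun p hp => ?_
    rw [Finset.mem_filter, Finset.mem_product, Finset.mem_powerset, Finset.mem_powerset] at hp
    refine ActsOn.mul ?_ (ih ((Λ.sitesOf_mono hp.1.2).trans hF))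
    rw [leadLetter]
    split_ifs
    · refine ActsOn.sum _ fun e he => ?_
      refine ((Λ.actsOn_bondProj _).mono ?_).mul (actsOn_posRes U)
      exact (Λ.sitesOf_mono (Finset.singleton_subset_iff.2 (hp.1.1 he))).trans hF
    · exact ActsOn.of_zero U

theorem actsOn_leadSum (r : ℕ) (ε : ℝ) (F : Finset Λ.E) :
    ActsOn (Λ.leadSum r ε F) (Λ.sitesOf F) :=
  (ActsOn.sum _ fun j _ => (actsOn_lead j subset_rfl).smul _).smul _

variable (Λ)

open Classical in
/-- The connected clusters with at most `r` edges. -/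
noncomputable def clusters (r : ℕ) : Finset (Finset Λ.E) :=
  Finset.univ.filter fun F => Λ.EdgeConn F ∧ F.card ≤ r

variable {Λ}

theorem mem_clusters {r : ℕ} {F : Finset Λ.E} : F ∈ Λ.clusters r ↔ Λ.EdgeConn F ∧ F.card ≤ r := by
  simp [clusters]

theorem pert_isHermitian (F : Finset Λ.E) : (Λ.pert F).IsHermitian :=
  (isHermitian_sum _ fun _ _ => Λ.bondProj_isHermitian _).neg

theorem compress_Vcoeff_isHermitian (h𝒯 : 𝒯.IsIsometric) (F : Finset Λ.E) (j : ℕ) :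
    (Λ.P₀ * Vcoeff Λ.P₀ Λ.resolvent (Λ.pert F) j * Λ.P₀).IsHermitian := by
  have h := isHermitian_Vcoeff Λ.P₀_isHermitian
    (Λ.resolvent_eq_siteRes h𝒯 ▸ Λ.siteRes_isHermitian Finset.univ) (pert_isHermitian F) j
  rw [Matrix.IsHermitian, Matrix.conjTranspose_mul, Matrix.conjTranspose_mul, h.eq,
    Λ.P₀_isHermitian.eq, Matrix.mul_assoc]

/-- The effective interaction of a cluster is the negative of its leading part, up to a remainder
that is small compared to the leading parts of its subclusters. -/
theorem exists_cluster_hamiltonian (h𝒯 : 𝒯.IsIsometric) (r : ℕ) :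
    ∃ C : ℝ, 0 ≤ C ∧ ∀ Λ : PEPS 𝒯, Λ.codeState ≠ 0 → Λ.IsQuasiInjective → ∀ ε : ℝ, 0 < ε → ε ≤ 1 →
      ∃ T : Finset Λ.E → Matrix Λ.VirtCfg Λ.VirtCfg ℂ,
        Λ.Heff ε r = ∑ F ∈ Λ.clusters r, Λ.P₀ * (T F - Λ.leadSum r ε F) * Λ.P₀ ∧
        ∀ F ∈ Λ.clusters r, (Λ.P₀ * (T F - Λ.leadSum r ε F) * Λ.P₀).IsHermitian ∧
          ActsOn (T F) (Λ.sitesOf F) ∧ Λ.IsScalarOn (T F) ∧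
          (∀ φ, Λ.P₀.mulVec φ = φ → |Λ.defect (T F) φ| ≤
            C * ε * ∑ A ∈ Λ.subclusters F, Λ.defect (Λ.leadSum r ε A) φ) ∧
          |Λ.mean (T F)| ≤ C * ε ^ 2 := by
  have hC : ∀ j, ∃ C : ℝ, 1 ≤ j → ∀ (Λ : PEPS 𝒯) (U : Finset Λ.S), U.card ≤ 2 * r → U.Nonempty →
      ∃ c : Finset Λ.E → Matrix Λ.VirtCfg Λ.VirtCfg ℂ,
        (∀ F, Λ.P₀ * Vcoeff (Λ.siteProj U) (Λ.siteRes U) (Λ.pert F) j * Λ.P₀ =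
          ∑ F' ∈ F.powerset, Λ.P₀ * c F' * Λ.P₀) ∧
        ∀ F, Comb (Λ.thruMonos U j F) C
          (c F + (((Λ.weightSum U)⁻¹ : ℝ) : ℂ) • Λ.lead U j F) := by
    intro j
    by_cases hj : 1 ≤ j
    · obtain ⟨C, hC⟩ := exists_local_clusters h𝒯 (2 * r) hj
      exact ⟨C, fun _ => hC⟩
    · exact ⟨0, fun h => absurd h hj⟩
  choose C hC using hC
  set M : ℝ := monoConst r * 4 ^ (r + 1) with hM
  have hM0 : 0 < M := mul_pos (monoConst_pos r) (by positivity)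
  have hS0 : 0 ≤ ∑ j ∈ Finset.Icc 1 r, |C j| := Finset.sum_nonneg fun _ _ => abs_nonneg _
  refine ⟨(∑ j ∈ Finset.Icc 1 r, |C j|) * (M + 1), mul_nonneg hS0 (by linarith),
    fun Λ hψ hq ε hε hε1 => ?_⟩
  have hh : ∀ j, ∃ h : Finset Λ.E → Matrix Λ.VirtCfg Λ.VirtCfg ℂ, 1 ≤ j →
      (∀ F, Λ.P₀ * Vcoeff Λ.P₀ Λ.resolvent (Λ.pert F) j * Λ.P₀ = ∑ F' ∈ F.powerset, h F') ∧
      ∀ F, h F ≠ 0 → Λ.EdgeConn F ∧ F.card ≤ j := by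
    intro j
    by_cases hj : 1 ≤ j
    · obtain ⟨h, h'⟩ := exists_clusters h𝒯 Λ hj
      exact ⟨h, fun _ => h'⟩
    · exact ⟨0, fun h => absurd h hj⟩
  choose h hh using hh
  -- The global cluster coefficient of `F` and the one computed with the resolvent of the sites of
  -- `F` have equal sums over all subsets of `F`, so they coincide; the bounds of the latter are
  -- uniform in the size of the system.
  have hc : ∀ (F : Finset Λ.E) (j : ℕ), ∃ c : Matrix Λ.VirtCfg Λ.VirtCfg ℂ,
      1 ≤ j → F ∈ Λ.clusters r → h j F = Λ.P₀ * c * Λ.P₀ ∧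
        Comb (Λ.thruMonos (Λ.sitesOf F) j F) |C j|
          (c + (((Λ.weightSum (Λ.sitesOf F))⁻¹ : ℝ) : ℂ) • Λ.lead (Λ.sitesOf F) j F) := by
    intro F j
    by_cases hj : 1 ≤ j
    · by_cases hF : F ∈ Λ.clusters r
      · rw [mem_clusters] at hF
        obtain ⟨c, hc1, hc2⟩ := hC j hj Λ (Λ.sitesOf F)
          ((Λ.card_sitesOf_le F).trans (by omega)) (sitesOf_nonempty hF.1.1)
        refine ⟨c F, fun _ _ => ⟨?_, (hc2 F).mono (le_abs_self _)⟩⟩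
        refine cluster_unique (c := h j) (c' := fun F => Λ.P₀ * c F * Λ.P₀) F fun F' hF' => ?_
        rw [← (hh j hj).1, ← hc1, Vcoeff_pert_local h𝒯 (Λ.sitesOf_mono hF') hj]
      · exact ⟨0, fun _ h => absurd h hF⟩
    · exact ⟨0, fun h => absurd h hj⟩
  choose c hc using hc
  set t : ℕ → Finset Λ.E → Matrix Λ.VirtCfg Λ.VirtCfg ℂ := fun j F =>
    c F j + (((Λ.weightSum (Λ.sitesOf F))⁻¹ : ℝ) : ℂ) • Λ.lead (Λ.sitesOf F) j F with ht
  have hT : ∀ F ∈ Λ.clusters r,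
      Λ.P₀ * (∑ j ∈ Finset.Icc 1 r, ((ε ^ j : ℝ) : ℂ) • t j F - Λ.leadSum r ε F) * Λ.P₀ =
      ∑ j ∈ Finset.Icc 1 r, ((ε ^ j : ℝ) : ℂ) • h j F := by
    intro F hF
    have e : ∑ j ∈ Finset.Icc 1 r, ((ε ^ j : ℝ) : ℂ) • t j F - Λ.leadSum r ε F =
        ∑ j ∈ Finset.Icc 1 r, ((ε ^ j : ℝ) : ℂ) • c F j := by
      rw [leadSum, Finset.smul_sum, ← Finset.sum_sub_distrib]
      refine Finset.sum_congr rfl fun j _ => ?_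
      rw [ht, smul_add, smul_comm (((ε ^ j : ℝ) : ℂ)), add_sub_cancel_right]
    rw [e, Finset.mul_sum, Finset.sum_mul]
    refine Finset.sum_congr rfl fun j hj => ?_
    rw [(hc F j (Finset.mem_Icc.1 hj).1 hF).1, Matrix.mul_smul, Matrix.smul_mul]
  have hcomb : ∀ F ∈ Λ.clusters r, ∀ j ∈ Finset.Icc 1 r,
      Comb (Λ.thruMonos (Λ.sitesOf F) j F) |C j| (t j F) := fun F hF j hj =>
    (hc F j (Finset.mem_Icc.1 hj).1 hF).2
  refine ⟨fun F => ∑ j ∈ Finset.Icc 1 r, ((ε ^ j : ℝ) : ℂ) • t j F, ?_, fun F hF =>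
    ⟨?_, ?_, ?_, fun φ hφ => ?_, ?_⟩⟩
  · rw [Finset.sum_congr rfl hT, Finset.sum_comm, Heff, effectiveHamiltonian]
    have h0 : Λ.H₀ * Λ.P₀ = 0 := (Λ.siteRes_isResolvent h𝒯 Finset.univ).HP
    rw [Matrix.mul_assoc, h0, mul_zero, zero_add]
    refine Finset.sum_congr rfl fun j hj => ?_
    rw [Finset.mem_Icc] at hj
    rw [← Finset.smul_sum, ← pert_univ, (hh j hj.1).1, Complex.ofReal_pow]
    congr 1
    rw [Finset.powerset_univ]
    symm
    refine Finset.sum_subset (Finset.subset_univ _) fun F _ hF => ?_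
    by_contra hne
    have := (hh j hj.1).2 F hne
    exact hF (mem_clusters.2 ⟨this.1, this.2.trans hj.2⟩)
  · rw [hT F hF]
    refine isHermitian_sum _ fun j hj => ?_
    have hj1 := (Finset.mem_Icc.1 hj).1
    have : (h j F).IsHermitian := by
      refine cluster_unique (c := fun F => (h j F).conjTranspose) (c' := h j) F fun F' _ => ?_
      rw [← Matrix.conjTranspose_sum, ← (hh j hj1).1]
      exact compress_Vcoeff_isHermitian h𝒯 F' j
    rw [Matrix.IsHermitian, Matrix.conjTranspose_smul, this.eq]
    simp
  · exact ActsOn.sum _ fun j hj =>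
      (comb_actsOn (hcomb F hF j hj) fun z hz => thruMonos_actsOn hz).smul _
  · exact IsScalarOn.sum _ fun j hj => (comb_isScalarOn (hcomb F hF j hj) fun z hz =>
      isScalarOn_word h𝒯 hψ hq (thruMonos_mem_words hz)).smul _
  · rw [defect_sum]
    have hD0 := sum_defect_nonneg h𝒯 hψ hq (r := r) hε hφ F
    set D := ∑ A ∈ Λ.subclusters F, Λ.defect (Λ.leadSum r ε A) φ with hD
    calc |∑ j ∈ Finset.Icc 1 r, Λ.defect (((ε ^ j : ℝ) : ℂ) • t j F) φ|
        ≤ ∑ j ∈ Finset.Icc 1 r, |Λ.defect (((ε ^ j : ℝ) : ℂ) • t j F) φ| :=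
          Finset.abs_sum_le_sum_abs _ _
      _ ≤ ∑ j ∈ Finset.Icc 1 r, |C j| * (ε * M * D) := by
          refine Finset.sum_le_sum fun j hj => ?_
          refine comb_linear_le (fun x => Λ.defect (((ε ^ j : ℝ) : ℂ) • x) φ)
            (fun x y => by rw [smul_add, defect_add])
            (fun c x => by rw [smul_comm, defect_smul]) (hcomb F hF j hj)
            (mul_nonneg (mul_nonneg hε.le hM0.le) hD0) fun z hz => ?_
          have hz0 := defect_nonneg h𝒯 hψ hq (thruMonos_mem_words hz) hφ
          rw [defect_smul, abs_of_nonneg (mul_nonneg (pow_nonneg hε.le j) hz0)]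
          exact thru_defect_le h𝒯 hψ hq hε hε1 hφ (Finset.mem_Icc.1 hj).2 hz
      _ = (∑ j ∈ Finset.Icc 1 r, |C j|) * M * ε * D := by rw [← Finset.sum_mul]; ring
      _ ≤ (∑ j ∈ Finset.Icc 1 r, |C j|) * (M + 1) * ε * D := by
          refine mul_le_mul_of_nonneg_right (mul_le_mul_of_nonneg_right
            (mul_le_mul_of_nonneg_left (by linarith) hS0) hε.le) hD0
  · rw [mean_sum]
    calc |∑ j ∈ Finset.Icc 1 r, Λ.mean (((ε ^ j : ℝ) : ℂ) • t j F)|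
        ≤ ∑ j ∈ Finset.Icc 1 r, |Λ.mean (((ε ^ j : ℝ) : ℂ) • t j F)| :=
          Finset.abs_sum_le_sum_abs _ _
      _ ≤ ∑ j ∈ Finset.Icc 1 r, |C j| * ε ^ 2 := by
          refine Finset.sum_le_sum fun j hj => ?_
          refine comb_linear_le (fun x => Λ.mean (((ε ^ j : ℝ) : ℂ) • x))
            (fun x y => by rw [smul_add, mean_add])
            (fun c x => by rw [smul_comm, mean_smul]) (hcomb F hF j hj)
            (sq_nonneg ε) fun z hz => ?_
          have hz0 := mean_nonneg h𝒯 hψ hq (thruMonos_mem_words hz)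
          have hz1 := mean_le_one h𝒯 hψ (thruMonos_mem_words hz)
          rw [mean_smul, abs_of_nonneg (mul_nonneg (pow_nonneg hε.le j) hz0)]
          -- Both factors of a product through the code space contain a bond. Hence the mean of the
          -- remainder is O(ε²), against order ε for the leading parts.
          have h2 : 2 ≤ j := by
            obtain ⟨k, l, -, -, -, -, hk, hl, hkl, -⟩ := hz
            omega
          calc ε ^ j * Λ.mean z ≤ ε ^ j * 1 :=
                mul_le_mul_of_nonneg_left hz1 (pow_nonneg hε.le j)
            _ ≤ ε ^ 2 := by rw [mul_one]; exact pow_le_pow_of_le_one hε.le hε1 h2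
      _ = (∑ j ∈ Finset.Icc 1 r, |C j|) * ε ^ 2 := by rw [← Finset.sum_mul]
      _ ≤ (∑ j ∈ Finset.Icc 1 r, |C j|) * (M + 1) * ε ^ 2 := by
          refine mul_le_mul_of_nonneg_right ?_ (sq_nonneg ε)
          exact le_mul_of_one_le_right hS0 (by linarith)

end PEPS

/-! ### A frustration-free form of the effective Hamiltonian -/

namespace PEPS

open SchriefferWolff

variable {𝒯 : SiteTensors} {Λ : PEPS 𝒯}

variable (Λ)

/-- The Hermitian part of the leading part of the effective interaction of a cluster. -/
noncomputable def symLead (r : ℕ) (ε : ℝ) (F : Finset Λ.E) : Matrix Λ.VirtCfg Λ.VirtCfg ℂ :=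
  ((1 / 2 : ℝ) : ℂ) • (Λ.leadSum r ε F + (Λ.leadSum r ε F).conjTranspose)

open Classical in
/-- The number of clusters that contain a given cluster. -/
noncomputable def superCount (r : ℕ) (F : Finset Λ.E) : ℕ :=
  ((Λ.clusters r).filter fun F' => F ⊆ F').card

variable {Λ}

theorem isHermitian_real_smul {n : Type*} {A : Matrix n n ℂ} (hA : A.IsHermitian) (c : ℝ) :
    ((c : ℂ) • A).IsHermitian := by
  rw [Matrix.IsHermitian, Matrix.conjTranspose_smul, hA.eq]
  simp

theorem isHermitian_compress {x : Matrix Λ.VirtCfg Λ.VirtCfg ℂ} (hx : x.IsHermitian) :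
    (Λ.P₀ * x * Λ.P₀).IsHermitian := by
  rw [Matrix.IsHermitian, Matrix.conjTranspose_mul, Matrix.conjTranspose_mul, hx.eq,
    Λ.P₀_isHermitian.eq, Matrix.mul_assoc]

theorem symLead_isHermitian (r : ℕ) (ε : ℝ) (F : Finset Λ.E) : (Λ.symLead r ε F).IsHermitian :=
  isHermitian_real_smul (Matrix.isHermitian_add_transpose_self _) _

theorem defect_symLead (r : ℕ) (ε : ℝ) (F : Finset Λ.E) (φ : Λ.VirtCfg → ℂ) :
    Λ.defect (Λ.symLead r ε F) φ = Λ.defect (Λ.leadSum r ε F) φ := by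
  rw [symLead, defect_smul, defect_add, defect_conjTranspose]
  ring

theorem actsOn_symLead (r : ℕ) (ε : ℝ) (F : Finset Λ.E) :
    ActsOn (Λ.symLead r ε F) (Λ.sitesOf F) :=
  ((actsOn_leadSum r ε F).add (actsOn_leadSum r ε F).conjTranspose).smul _

theorem isScalarOn_symLead (h𝒯 : 𝒯.IsIsometric) (hψ : Λ.codeState ≠ 0) (hq : Λ.IsQuasiInjective)
    (r : ℕ) {ε : ℝ} (hε : 0 ≤ ε) (F : Finset Λ.E) : Λ.IsScalarOn (Λ.symLead r ε F) :=
  (((isPos_leadSum r hε F).isScalarOn h𝒯 hψ hq).add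
    ((isPos_leadSum r hε F).conjTranspose.isScalarOn h𝒯 hψ hq)).smul _

open Classical in
theorem superCount_le {r : ℕ} {F : Finset Λ.E} (hF : F.Nonempty) :
    Λ.superCount r F ≤ 𝒯.clusterBound r := by
  obtain ⟨e, he⟩ := hF
  refine le_trans (Finset.card_le_card fun F' hF' => ?_) (card_clusters_le e r)
  rw [Finset.mem_filter, mem_clusters] at hF'
  exact Finset.mem_filter.2 ⟨Finset.mem_univ _, hF'.1.1, hF'.1.2, hF'.2 he⟩

open Classical in
theorem card_clusters_le_mul (r : ℕ) :
    (Λ.clusters r).card ≤ Fintype.card Λ.E * 𝒯.clusterBound r := by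
  have h : Λ.clusters r ⊆ Finset.univ.biUnion fun e => Finset.univ.filter
      fun F : Finset Λ.E => Λ.EdgeConn F ∧ F.card ≤ r ∧ e ∈ F := by
    intro F hF
    rw [mem_clusters] at hF
    obtain ⟨e, he⟩ := hF.1.1
    exact Finset.mem_biUnion.2 ⟨e, Finset.mem_univ _,
      Finset.mem_filter.2 ⟨Finset.mem_univ _, hF.1, hF.2, he⟩⟩
  exact (Finset.card_le_card h).trans (Finset.card_biUnion_le_card_mul _ _ _ fun e _ =>
    card_clusters_le e r)

open Classical in
theorem sum_sum_subclusters {M : Type*} [AddCommMonoid M] (r : ℕ) (f : Finset Λ.E → M) :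
    ∑ F ∈ Λ.clusters r, ∑ A ∈ Λ.subclusters F, f A =
      ∑ A ∈ Λ.clusters r, Λ.superCount r A • f A := by
  have h : ∀ F ∈ Λ.clusters r, ∑ A ∈ Λ.subclusters F, f A =
      ∑ A ∈ (Λ.clusters r).filter (fun A => A ⊆ F), f A := by
    intro F hF
    refine Finset.sum_congr ?_ fun _ _ => rfl
    ext A
    rw [mem_clusters] at hF
    rw [mem_subclusters, Finset.mem_filter, mem_clusters]
    exact ⟨fun h => ⟨⟨h.2, (Finset.card_le_card h.1).trans hF.2⟩, h.1⟩, fun h => ⟨h.2, h.1.1⟩⟩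
  rw [Finset.sum_congr rfl h]
  simp only [Finset.sum_filter]
  rw [Finset.sum_comm]
  refine Finset.sum_congr rfl fun A _ => ?_
  rw [← Finset.sum_filter, Finset.sum_const, superCount]

/-- The effective Hamiltonian is a sum of local terms, each of which has the encoded PEPS as a
ground state. -/
theorem exists_frustrationFree (h𝒯 : 𝒯.IsIsometric) (r : ℕ) :
    ∃ C ε₁ : ℝ, 0 ≤ C ∧ 0 < ε₁ ∧ ε₁ ≤ 1 ∧
    ∀ Λ : PEPS 𝒯, Λ.codeState ≠ 0 → Λ.IsQuasiInjective → ∀ ε : ℝ, 0 < ε → ε ≤ ε₁ →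
      Λ.mean (Λ.Heff ε r) ≤
        C * ε ^ 2 * (Λ.clusters r).card - ∑ F ∈ Λ.clusters r, Λ.mean (Λ.leadSum r ε F) ∧
      ∃ X : Finset Λ.E → Matrix Λ.VirtCfg Λ.VirtCfg ℂ,
        Λ.Heff ε r = ∑ F ∈ Λ.clusters r, Λ.P₀ * X F * Λ.P₀ ∧
        ∀ F ∈ Λ.clusters r, (Λ.P₀ * X F * Λ.P₀).IsHermitian ∧
          ActsOn (X F) (Λ.sitesOf F) ∧ Λ.IsScalarOn (X F) ∧
          ∀ φ, Λ.P₀.mulVec φ = φ →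
            Λ.defect (Λ.leadSum r ε F) φ ≤ -2 * Λ.defect (X F) φ := by
  obtain ⟨C, hC, H⟩ := exists_cluster_hamiltonian h𝒯 r
  set K : ℝ := ((𝒯.clusterBound r : ℕ) : ℝ) with hK
  have hK0 : 0 ≤ K := Nat.cast_nonneg _
  have hKC : 0 ≤ K * C := mul_nonneg hK0 hC
  -- For ε below this threshold, `superCount` times C ε is at most 1/2, so the amount given back
  -- below costs at most half of the leading part.
  refine ⟨C, 1 / (2 * (K * C) + 1), hC, by positivity, ?_, fun Λ hψ hq ε hε hε₁ => ?_⟩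
  · rw [div_le_one (by positivity)]
    linarith
  rw [le_div_iff₀ (by positivity)] at hε₁
  have hε1 : ε ≤ 1 := by nlinarith
  have hKCε : K * (C * ε) ≤ 1 / 2 := by nlinarith
  obtain ⟨T, hT, hT'⟩ := H Λ hψ hq ε hε hε1
  -- Each cluster borrows C ε times the leading parts of its subclusters, enough to outweigh its
  -- remainder, and gives back C ε times its own leading part once for each cluster containing it.
  -- The sum is unchanged. The Hermitian parts are used so that the individual terms remain
  -- Hermitian; the defects do not change.
  refine ⟨?_, fun F => (T F - Λ.leadSum r ε F)
    + (((-(C * ε) : ℝ) : ℂ) • ∑ A ∈ Λ.subclusters F, Λ.symLead r ε A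
    + ((Λ.superCount r F * (C * ε) : ℝ) : ℂ) • Λ.symLead r ε F), ?_, fun F hF => ?_⟩
  · rw [hT, mean_sum]
    have h1 : ∀ F ∈ Λ.clusters r, Λ.mean (Λ.P₀ * (T F - Λ.leadSum r ε F) * Λ.P₀) ≤
        C * ε ^ 2 - Λ.mean (Λ.leadSum r ε F) := by
      intro F hF
      have h2 := (abs_le.1 (hT' F hF).2.2.2.2).2
      have h3 : Λ.mean (T F - Λ.leadSum r ε F) = Λ.mean (T F) - Λ.mean (Λ.leadSum r ε F) := by
        rw [mean, qform_sub, sub_div]; rfl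
      rw [mean_compress h𝒯, h3]
      linarith
    refine (Finset.sum_le_sum h1).trans (le_of_eq ?_)
    rw [Finset.sum_sub_distrib, Finset.sum_const, nsmul_eq_mul]
    ring
  · rw [hT]
    simp only [mul_add, add_mul, Finset.sum_add_distrib]
    rw [left_eq_add]
    simp only [Matrix.mul_smul, Matrix.smul_mul, Finset.mul_sum, Finset.sum_mul]
    rw [← Finset.smul_sum, sum_sum_subclusters, Finset.smul_sum, ← Finset.sum_add_distrib]
    refine Finset.sum_eq_zero fun A _ => ?_
    rw [← Nat.cast_smul_eq_nsmul ℂ, smul_smul, ← add_smul]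
    push_cast
    rw [show -((C : ℂ) * ε) * (Λ.superCount r A : ℂ) + (Λ.superCount r A : ℂ) * (C * ε) = 0 by ring,
      zero_smul]
  · obtain ⟨hh, ha, hs, hd, -⟩ := hT' F hF
    rw [mem_clusters] at hF
    refine ⟨?_, ?_, ?_, fun φ hφ => ?_⟩
    · rw [mul_add, add_mul]
      exact hh.add (isHermitian_compress ((isHermitian_real_smul
        (isHermitian_sum _ fun A _ => symLead_isHermitian r ε A) _).add
        (isHermitian_real_smul (symLead_isHermitian r ε F) _)))
    · beta_reduce
      rw [sub_eq_add_neg]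
      refine (ha.add (actsOn_leadSum r ε F).neg).add (((ActsOn.sum _ fun A hA => ?_).smul _).add
        ((actsOn_symLead r ε F).smul _))
      exact (actsOn_symLead r ε A).mono (Λ.sitesOf_mono (mem_subclusters.1 hA).1)
    · have hl := ((isPos_leadSum r hε.le F).isScalarOn h𝒯 hψ hq).smul (-1)
      have hl' : Λ.IsScalarOn (T F - Λ.leadSum r ε F) := by
        have := hs.add hl
        rwa [Complex.ofReal_neg, Complex.ofReal_one, neg_smul, one_smul, ← sub_eq_add_neg] at this
      exact hl'.add (((IsScalarOn.sum _ fun A _ => isScalarOn_symLead h𝒯 hψ hq r hε.le A).smul _).add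
        ((isScalarOn_symLead h𝒯 hψ hq r hε.le F).smul _))
    · have h1 := (abs_le.1 (hd φ hφ)).2
      have h0 := (isPos_leadSum r hε.le F).defect_nonneg h𝒯 hψ hq hφ
      have h2 : (Λ.superCount r F : ℝ) ≤ K := Nat.cast_le.2 (superCount_le hF.1.1)
      beta_reduce
      rw [sub_eq_add_neg, defect_add, defect_add, defect_add, defect_neg, defect_smul, defect_smul,
        defect_sum, defect_symLead]
      simp only [defect_symLead]
      generalize ∑ A ∈ Λ.subclusters F, Λ.defect (Λ.leadSum r ε A) φ = s at h1 ⊢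
      generalize Λ.defect (Λ.leadSum r ε F) φ = d at h0 ⊢
      generalize Λ.defect (T F) φ = t at h1 ⊢
      have h3 : (Λ.superCount r F : ℝ) * (C * ε) ≤ 1 / 2 :=
        (mul_le_mul_of_nonneg_right h2 (mul_nonneg hC hε.le)).trans hKCε
      have h4 := mul_le_mul_of_nonneg_right h3 h0
      linarith

/-- The bond projection itself is a good word of degree one, and all other words in the leading part
have nonnegative mean. -/
theorem mean_bondProj_le_mean_leadSum (h𝒯 : 𝒯.IsIsometric) (hψ : Λ.codeState ≠ 0)
    (hq : Λ.IsQuasiInjective) {r : ℕ} (hr : 1 ≤ r) {ε : ℝ} (hε : 0 < ε) (e : Λ.E) :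
    ε * Λ.mean (Λ.bondProj {e}) ≤ monoConst r * Λ.mean (Λ.leadSum r ε {e}) := by
  have hU := sitesOf_nonempty (Λ := Λ) (Finset.singleton_nonempty e)
  have hw := Λ.weightSum_pos hU
  have h : Λ.IsGood (Λ.sitesOf {e}) 1 {e} _ _ :=
    IsGood.cons e (Finset.empty_ssubset.2 hU) IsGood.one
  rw [siteProj_empty, mul_one, mul_one, mul_one] at h
  have h1 := h.isPos_sub.mean_nonneg h𝒯 hψ hq
  rw [mean, qform_sub, qform_smul, sub_div, mul_div_assoc] at h1
  have hm := mean_nonneg h𝒯 hψ hq (Λ.bondProj_mem_words {e})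
  have h2 : ε ^ 1 * Λ.mean (Λ.lead (Λ.sitesOf {e}) 1 {e}) ≤
      ∑ j ∈ Finset.Icc 1 r, ε ^ j * Λ.mean (Λ.lead (Λ.sitesOf {e}) j {e}) :=
    Finset.single_le_sum (f := fun j => ε ^ j * Λ.mean (Λ.lead (Λ.sitesOf {e}) j {e}))
      (fun j _ => mul_nonneg (pow_nonneg hε.le j) ((isPos_lead _ j {e}).mean_nonneg h𝒯 hψ hq))
      (Finset.mem_Icc.2 ⟨le_rfl, hr⟩)
  have hwg := h.weightSum_le h𝒯 hr
  change 0 ≤ Λ.mean (Λ.lead (Λ.sitesOf {e}) 1 {e}) - _ * Λ.mean (Λ.bondProj {e}) at h1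
  rw [mean_leadSum]
  generalize ∑ j ∈ Finset.Icc 1 r, ε ^ j * Λ.mean (Λ.lead (Λ.sitesOf {e}) j {e}) = L at h2 ⊢
  generalize Λ.mean (Λ.lead (Λ.sitesOf {e}) 1 {e}) = l at h1 h2
  generalize Λ.mean (Λ.bondProj {e}) = d at h1 hm ⊢
  generalize resWeight (Λ.sitesOf {e}).card (∅ : Finset Λ.S).card = g at h1 hwg
  generalize Λ.weightSum (Λ.sitesOf {e}) = w at hw hwg ⊢
  have hA := monoConst_pos r
  generalize monoConst r = A at hwg hA ⊢
  have hgl : g * d ≤ l := by linarith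
  have h3 : ε * (g * d) ≤ L :=
    (mul_le_mul_of_nonneg_left hgl hε.le).trans (by rwa [pow_one] at h2)
  have e2 : w * (ε * d) ≤ A * L :=
    calc w * (ε * d) ≤ A * g * (ε * d) := mul_le_mul_of_nonneg_right hwg (mul_nonneg hε.le hm)
      _ = A * (ε * (g * d)) := by ring
      _ ≤ A * L := mul_le_mul_of_nonneg_left h3 hA.le
  calc ε * d = w⁻¹ * (w * (ε * d)) := by field_simp
    _ ≤ w⁻¹ * (A * L) := mul_le_mul_of_nonneg_left e2 (inv_nonneg.2 hw.le)
    _ = A * (w⁻¹ * L) := by ring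

/-- The expectation value of the leading parts is at least of order `ε` per edge. -/
theorem sum_mean_leadSum_ge (h𝒯 : 𝒯.IsIsometric) (hψ : Λ.codeState ≠ 0)
    (hq : Λ.IsQuasiInjective) {r : ℕ} (hr : 1 ≤ r) {ε : ℝ} (hε : 0 < ε) {μ : ℝ}
    (hμ : ∀ e, μ ≤ Λ.mean (Λ.bondProj {e})) :
    Fintype.card Λ.E * (ε * μ) ≤
      monoConst r * ∑ F ∈ Λ.clusters r, Λ.mean (Λ.leadSum r ε F) := by
  have hinj : Function.Injective (fun e : Λ.E => ({e} : Finset Λ.E)) :=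
    fun _ _ h => Finset.singleton_injective h
  have hsub : Finset.univ.map ⟨_, hinj⟩ ⊆ Λ.clusters r := by
    intro F hF
    obtain ⟨e, -, rfl⟩ := Finset.mem_map.1 hF
    exact mem_clusters.2 ⟨edgeConn_singleton e, by simpa using hr⟩
  have h1 : ∑ e, Λ.mean (Λ.leadSum r ε {e}) ≤ ∑ F ∈ Λ.clusters r, Λ.mean (Λ.leadSum r ε F) := by
    refine le_trans (le_of_eq ?_) (Finset.sum_le_sum_of_subset_of_nonneg hsub fun F _ _ =>
      (isPos_leadSum r hε.le F).mean_nonneg h𝒯 hψ hq)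
    rw [Finset.sum_map]
    rfl
  calc Fintype.card Λ.E * (ε * μ) = ∑ e : Λ.E, ε * μ := by
        rw [Finset.sum_const, nsmul_eq_mul, Finset.card_univ]
    _ ≤ ∑ e, monoConst r * Λ.mean (Λ.leadSum r ε {e}) := Finset.sum_le_sum fun e _ =>
        (mul_le_mul_of_nonneg_left (hμ e) hε.le).trans
          (mean_bondProj_le_mean_leadSum h𝒯 hψ hq hr hε e)
    _ = monoConst r * ∑ e, Λ.mean (Λ.leadSum r ε {e}) := (Finset.mul_sum _ _ _).symm
    _ ≤ _ := mul_le_mul_of_nonneg_left h1 (monoConst_pos r).le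

/-- A product of bond projections is a good word. -/
theorem exists_isGood_bondProj {U : Finset Λ.S} (hU : U.Nonempty) (F : Finset Λ.E) :
    ∃ g, Λ.IsGood U F.card F (Λ.bondProj F) g := by
  induction F using Finset.induction_on with
  | empty => exact ⟨1, by rw [bondProj_empty]; exact .one⟩
  | insert e F he ih =>
    obtain ⟨g, hg⟩ := ih
    have := IsGood.cons e (Finset.empty_ssubset.2 hU) hg
    rw [siteProj_empty, mul_one, bondProj_mul, ← Finset.insert_eq] at this
    exact ⟨_, by rw [Finset.card_insert_of_notMem he]; exact this⟩

theorem bondProj_defect_le (h𝒯 : 𝒯.IsIsometric) (hψ : Λ.codeState ≠ 0) (hq : Λ.IsQuasiInjective)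
    {r : ℕ} {ε : ℝ} (hε : 0 < ε) (hε1 : ε ≤ 1) {F : Finset Λ.E} (hF : F.Nonempty) (hFr : F.card ≤ r)
    {φ : Λ.VirtCfg → ℂ} (hφ : Λ.P₀.mulVec φ = φ) :
    ε ^ r * Λ.defect (Λ.bondProj F) φ ≤ monoConst r * Λ.defect (Λ.leadSum r ε F) φ := by
  obtain ⟨g, hg⟩ := exists_isGood_bondProj (sitesOf_nonempty hF) F
  refine le_trans ?_ (good_defect_le h𝒯 hψ hq hε hφ hF (Finset.card_pos.2 hF) hFr hg)
  exact mul_le_mul_of_nonneg_right (pow_le_pow_of_le_one hε.le hε1 hFr)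
    (defect_nonneg h𝒯 hψ hq (Λ.bondProj_mem_words F) hφ)

end PEPS

/-! ### A uniform lower bound on the expectation values of bond projections -/

theorem exists_pos_le_of_finite {α : Type*} [Finite α] (f : α → ℝ) :
    ∃ μ : ℝ, 0 < μ ∧ ∀ a, 0 < f a → μ ≤ f a := by
  classical
  have := Fintype.ofFinite α
  by_cases h : (Finset.univ.filter fun a => 0 < f a).Nonempty
  · obtain ⟨a, ha, hmin⟩ := Finset.exists_min_image _ f h
    exact ⟨f a, (Finset.mem_filter.1 ha).2, fun b hb => hmin b (by simpa using hb)⟩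
  · refine ⟨1, one_pos, fun a ha => absurd ⟨a, by simpa using ha⟩ h⟩

namespace SiteTensors

variable (𝒯 : SiteTensors)

/-- The virtual qudits of finitely many sites of given types. -/
abbrev Leg {n : ℕ} (t : Fin n → 𝒯.T) : Type := Σ i, Fin (𝒯.deg (t i))

/-- The condition for a nonzero matrix element of the product of the bond projections on the pairs
of virtual qudits in `L`. -/
def BondCond {n : ℕ} (t : Fin n → 𝒯.T) (L : Set (𝒯.Leg t × 𝒯.Leg t))
    (x y : ∀ i, Fin (𝒯.deg (t i)) → Fin 𝒯.D) : Prop :=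
  (∀ p ∈ L, x p.1.1 p.1.2 = x p.2.1 p.2.2 ∧ y p.1.1 p.1.2 = y p.2.1 p.2.2) ∧
    ∀ l : 𝒯.Leg t, (∀ p ∈ L, p.1 ≠ l ∧ p.2 ≠ l) → x l.1 l.2 = y l.1 l.2

open Classical in
/-- A diagonal matrix element of the product of `k` bond projections, compressed to the code space,
in terms of the local data. -/
noncomputable def localElement {n : ℕ} (t : Fin n → 𝒯.T) (c : ∀ i, Fin (𝒯.d (t i)))
    (L : Set (𝒯.Leg t × 𝒯.Leg t)) (k : ℕ) : ℂ :=
  ∑ x : ∀ i, Fin (𝒯.deg (t i)) → Fin 𝒯.D, ∑ y : ∀ i, Fin (𝒯.deg (t i)) → Fin 𝒯.D,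
    (∏ i, 𝒯.map (t i) (c i) (x i) * star (𝒯.map (t i) (c i) (y i))) *
      (if 𝒯.BondCond t L x y then ((𝒯.D : ℂ)⁻¹) ^ k else 0)

/-- With boundedly many sites, finitely many types and labels, and finitely many ways to pair the
legs, only finitely many values occur; the bound is the smallest positive one. -/
theorem exists_pos_le_localElement (m : ℕ) : ∃ μ : ℝ, 0 < μ ∧
    ∀ (n : ℕ) (t : Fin n → 𝒯.T) (c : ∀ i, Fin (𝒯.d (t i))) (L : Set (𝒯.Leg t × 𝒯.Leg t)) (k : ℕ),
      n ≤ m → k ≤ m → 0 < (𝒯.localElement t c L k).re → μ ≤ (𝒯.localElement t c L k).re := by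
  have := 𝒯.fintypeT
  obtain ⟨μ, hμ, h⟩ := exists_pos_le_of_finite
    (fun p : Σ n : Fin (m + 1), Σ t : Fin n → 𝒯.T,
      (∀ i, Fin (𝒯.d (t i))) × Set (𝒯.Leg t × 𝒯.Leg t) × Fin (m + 1) =>
      (𝒯.localElement p.2.1 p.2.2.1 p.2.2.2.1 p.2.2.2.2).re)
  exact ⟨μ, hμ, fun n t c L k hn hk => h ⟨⟨n, by omega⟩, t, c, L, ⟨k, by omega⟩⟩⟩

end SiteTensors

namespace PEPS

variable {𝒯 : SiteTensors} {Λ : PEPS 𝒯}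

/-- The pairs of virtual qudits of enumerated sites that are connected by edges of `F`. -/
def localBonds {n : ℕ} (u : Fin n → Λ.S) (F : Finset Λ.E) :
    Set (𝒯.Leg (fun i => Λ.type (u i)) × 𝒯.Leg (fun i => Λ.type (u i))) :=
  {p | ∃ e ∈ F, Λ.ends (e, false) = ⟨u p.1.1, p.1.2⟩ ∧ Λ.ends (e, true) = ⟨u p.2.1, p.2.2⟩}

theorem exists_leg {n : ℕ} {u : Fin n → Λ.S} {U : Finset Λ.S} (hu : ∀ s ∈ U, ∃ i, u i = s)
    (g : Σ s, Fin (𝒯.deg (Λ.type s))) (hg : g.1 ∈ U) :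
    ∃ l : 𝒯.Leg (fun i => Λ.type (u i)), g = ⟨u l.1, l.2⟩ := by
  obtain ⟨s, m⟩ := g
  obtain ⟨i, rfl⟩ := hu s hg
  exact ⟨⟨i, m⟩, rfl⟩

theorem bondCond_iff {n : ℕ} {u : Fin n → Λ.S} (F : Finset Λ.E)
    (hu : ∀ s ∈ Λ.sitesOf F, ∃ i, u i = s) (hinj : Function.Injective u) (x y : Λ.VirtCfg) :
    ((∀ e ∈ F, Λ.endVal x e false = Λ.endVal x e true ∧ Λ.endVal y e false = Λ.endVal y e true) ∧
      ∀ e ∈ Fᶜ, Λ.endVal x e false = Λ.endVal y e false ∧ Λ.endVal x e true = Λ.endVal y e true) ↔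
    𝒯.BondCond _ (Λ.localBonds u F) (fun i => x (u i)) (fun i => y (u i)) ∧
      ∀ s, s ∉ Λ.sitesOf F → x s = y s := by
  have ev : ∀ (x : Λ.VirtCfg) {e i} {g : Σ s, Fin (𝒯.deg (Λ.type s))}, Λ.ends (e, i) = g →
      Λ.endVal x e i = x g.1 g.2 := by
    rintro x e i g rfl
    rfl
  have linj : ∀ l l' : 𝒯.Leg (fun i => Λ.type (u i)),
      (⟨u l.1, l.2⟩ : Σ s, Fin (𝒯.deg (Λ.type s))) = ⟨u l'.1, l'.2⟩ → l = l' := by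
    rintro ⟨i, m⟩ ⟨j, m'⟩ h
    have h1 : i = j := hinj (congrArg Sigma.fst h)
    subst h1
    simpa using h
  have hmem : ∀ {e : Λ.E} {i : Bool} {g : Σ s, Fin (𝒯.deg (Λ.type s))}, e ∈ F →
      Λ.ends (e, i) = g → g.1 ∈ Λ.sitesOf F := by
    rintro e i g he rfl
    exact Λ.endSite_mem_sitesOf he i
  constructor
  · rintro ⟨h1, h2⟩
    have h2' : ∀ {e : Λ.E} {i : Bool}, e ∉ F → Λ.endVal x e i = Λ.endVal y e i := by
      intro e i he
      have := h2 e (Finset.mem_compl.2 he)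
      cases i
      exacts [this.1, this.2]
    refine ⟨⟨?_, ?_⟩, ?_⟩
    · rintro p ⟨e, he, h0, h1'⟩
      have := h1 e he
      rwa [ev x h0, ev x h1', ev y h0, ev y h1'] at this
    · intro l hl
      obtain ⟨⟨e, i⟩, hei⟩ := Λ.ends.surjective ⟨u l.1, l.2⟩
      by_cases he : e ∈ F
      · exfalso
        obtain ⟨l', hl'⟩ := exists_leg hu (Λ.ends (e, !i)) (hmem he rfl)
        cases i
        · exact (hl (l, l') ⟨e, he, hei, hl'⟩).1 rfl
        · exact (hl (l', l) ⟨e, he, hl', hei⟩).2 rfl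
      · have := h2' (i := i) he
        rwa [ev x hei, ev y hei] at this
    · intro s hs
      ext1 m
      obtain ⟨⟨e, i⟩, hei⟩ := Λ.ends.surjective ⟨s, m⟩
      by_cases he : e ∈ F
      · exact absurd (hmem he hei) hs
      · have := h2' (i := i) he
        rwa [ev x hei, ev y hei] at this
  · rintro ⟨⟨h1, h2⟩, h3⟩
    refine ⟨fun e he => ?_, fun e he => ?_⟩
    · obtain ⟨l, hl⟩ := exists_leg hu (Λ.ends (e, false)) (hmem he rfl)
      obtain ⟨l', hl'⟩ := exists_leg hu (Λ.ends (e, true)) (hmem he rfl)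
      have := h1 (l, l') ⟨e, he, hl, hl'⟩
      rwa [ev x hl, ev x hl', ev y hl, ev y hl']
    · have key : ∀ i, Λ.endVal x e i = Λ.endVal y e i := by
        intro i
        by_cases hs : Λ.endSite e i ∈ Λ.sitesOf F
        · obtain ⟨l, hl⟩ := exists_leg hu (Λ.ends (e, i)) hs
          rw [ev x hl, ev y hl]
          refine h2 l fun p hp => ?_
          obtain ⟨e', he', h0, h1'⟩ := hp
          have hne : ∀ j, Λ.ends (e', j) ≠ Λ.ends (e, i) := fun j hj => by
            have : e' = e := congrArg Prod.fst (Λ.ends.injective hj)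
            exact Finset.mem_compl.1 he (this ▸ he')
          constructor
          · rintro rfl
            exact hne false (h0.trans hl.symm)
          · rintro rfl
            exact hne true (h1'.trans hl.symm)
        · exact congrFun (h3 _ hs) _
      exact ⟨key false, key true⟩

open Classical in
theorem bondProj_apply {n : ℕ} {u : Fin n → Λ.S} (F : Finset Λ.E)
    (hu : ∀ s ∈ Λ.sitesOf F, ∃ i, u i = s) (hinj : Function.Injective u) (x y : Λ.VirtCfg) :
    Λ.bondProj F x y =
      (if 𝒯.BondCond _ (Λ.localBonds u F) (fun i => x (u i)) (fun i => y (u i))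
        then ((𝒯.D : ℂ)⁻¹) ^ F.card else 0) *
      ∏ s : {s // s ∉ Λ.sitesOf F}, (1 : Matrix (Λ.SiteCfg s) (Λ.SiteCfg s) ℂ) (x s) (y s) := by
  have h := bondCond_iff F hu hinj x y
  rw [bondProj, Finset.prod_ite_zero, Finset.prod_ite_zero, Finset.prod_const, Finset.prod_const_one]
  have h1 : (∏ s : {s // s ∉ Λ.sitesOf F}, (1 : Matrix (Λ.SiteCfg s) (Λ.SiteCfg s) ℂ) (x s) (y s)) =
      if ∀ s, s ∉ Λ.sitesOf F → x s = y s then 1 else 0 := by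
    simp only [Matrix.one_apply, Finset.prod_ite_zero, Finset.prod_const_one, Finset.mem_univ,
      forall_true_left, Subtype.forall]
  rw [h1, ite_zero_mul_ite_zero, ite_zero_mul_ite_zero]
  split_ifs with h2 h3 h3
  · simp
  · exact absurd (h.1 h2) h3
  · exact absurd (h.2 h3) h2
  · rfl

-- The sum over configurations factors over the sites of F and the others. At each of the others the
-- projection map meets its adjoint and contributes 1 by isometry. What remains depends on the graph
-- only through the types of the sites of F and the pairing of their legs.
open Classical in
theorem compress_bondProj_diag (h𝒯 : 𝒯.IsIsometric) {n : ℕ} {F : Finset Λ.E}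
    (w : {s // s ∈ Λ.sitesOf F} ≃ Fin n) (c : Λ.CodeCfg) :
    (Λ.codeMap * Λ.bondProj F * Λ.codeMap.conjTranspose) c c =
      𝒯.localElement (fun i => Λ.type (w.symm i)) (fun i => c (w.symm i))
        (Λ.localBonds (fun i => ((w.symm i : {s // s ∈ Λ.sitesOf F}) : Λ.S)) F) F.card := by
  set u : Fin n → Λ.S := fun i => w.symm i with hu
  have hsurj : ∀ s ∈ Λ.sitesOf F, ∃ i, u i = s := fun s hs => ⟨w ⟨s, hs⟩, by simp [hu]⟩
  have hinj : Function.Injective u := Subtype.val_injective.comp w.symm.injective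
  let split : Λ.VirtCfg ≃ (∀ i, Λ.SiteCfg (u i)) × (∀ s : {s // s ∉ Λ.sitesOf F}, Λ.SiteCfg s) :=
    (Equiv.piEquivPiSubtypeProd (fun s => s ∈ Λ.sitesOf F) Λ.SiteCfg).trans
      (Equiv.prodCongr (Equiv.piCongrLeft' (fun s : {s // s ∈ Λ.sitesOf F} => Λ.SiteCfg s) w)
        (Equiv.refl _))
  have hone : ∑ a : ∀ s : {s // s ∉ Λ.sitesOf F}, Λ.SiteCfg s,
      ∑ b : ∀ s : {s // s ∉ Λ.sitesOf F}, Λ.SiteCfg s,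
      ∏ s : {s // s ∉ Λ.sitesOf F}, (𝒯.map (Λ.type s) (c s) (a s) *
        (1 : Matrix (Λ.SiteCfg s) (Λ.SiteCfg s) ℂ) (a s) (b s) *
        star (𝒯.map (Λ.type s) (c s) (b s))) = 1 := by
    have h0 : (piMap fun s : {s // s ∉ Λ.sitesOf F} => 𝒯.map (Λ.type s)) * (piMap fun
        s : {s // s ∉ Λ.sitesOf F} => (1 : Matrix (Λ.SiteCfg s) (Λ.SiteCfg s) ℂ)) *
        (piMap fun s : {s // s ∉ Λ.sitesOf F} => 𝒯.map (Λ.type s)).conjTranspose = 1 := by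
      rw [piMap_one, Matrix.mul_one, piMap_conjTranspose, piMap_mul, ← piMap_one]
      congr 1
      ext1 s
      exact h𝒯 _
    have h1 := congrFun (congrFun h0 (fun s => c s)) (fun s => c s)
    rw [Matrix.one_apply_eq, Matrix.mul_apply] at h1
    rw [← h1, Finset.sum_comm]
    refine Finset.sum_congr rfl fun b _ => ?_
    rw [Matrix.mul_apply, Finset.sum_mul]
    refine Finset.sum_congr rfl fun a _ => ?_
    simp only [piMap, Matrix.conjTranspose_apply, star_prod, Finset.prod_mul_distrib]
  have term : ∀ x y : Λ.VirtCfg, Λ.codeMap c x * Λ.bondProj F x y * star (Λ.codeMap c y) =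
      ((∏ i, 𝒯.map (Λ.type (u i)) (c (u i)) ((split x).1 i) *
          star (𝒯.map (Λ.type (u i)) (c (u i)) ((split y).1 i))) *
        (if 𝒯.BondCond _ (Λ.localBonds u F) (split x).1 (split y).1
          then ((𝒯.D : ℂ)⁻¹) ^ F.card else 0)) *
      ∏ s : {s // s ∉ Λ.sitesOf F}, (𝒯.map (Λ.type s) (c s) ((split x).2 s) *
        (1 : Matrix (Λ.SiteCfg s) (Λ.SiteCfg s) ℂ) ((split x).2 s) ((split y).2 s) *
        star (𝒯.map (Λ.type s) (c s) ((split y).2 s))) := by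
    intro x y
    have hp : ∀ x : Λ.VirtCfg, Λ.codeMap c x = (∏ i, 𝒯.map (Λ.type (u i)) (c (u i)) (x (u i))) *
        ∏ s : {s // s ∉ Λ.sitesOf F}, 𝒯.map (Λ.type s) (c s) (x s) := by
      intro x
      rw [codeMap, ← Fintype.prod_subtype_mul_prod_subtype (fun s => s ∈ Λ.sitesOf F)]
      congr 1
      convert (w.symm.prod_comp fun s : {s // s ∈ Λ.sitesOf F} => 𝒯.map (Λ.type s) (c s) (x s)).symm
    rw [hp x, hp y, bondProj_apply F hsurj hinj]
    simp only [star_mul', star_prod, Finset.prod_mul_distrib]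
    change _ = ((∏ i, 𝒯.map (Λ.type (u i)) (c (u i)) (x (u i))) *
      (∏ i, star (𝒯.map (Λ.type (u i)) (c (u i)) (y (u i)))) *
        (if 𝒯.BondCond _ (Λ.localBonds u F) (fun i => x (u i)) (fun i => y (u i))
          then ((𝒯.D : ℂ)⁻¹) ^ F.card else 0)) *
      ((∏ s : {s // s ∉ Λ.sitesOf F}, 𝒯.map (Λ.type s) (c s) (x s)) *
        (∏ s : {s // s ∉ Λ.sitesOf F}, (1 : Matrix (Λ.SiteCfg s) (Λ.SiteCfg s) ℂ) (x s) (y s)) *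
        ∏ s : {s // s ∉ Λ.sitesOf F}, star (𝒯.map (Λ.type s) (c s) (y s)))
    ring
  have expand : (Λ.codeMap * Λ.bondProj F * Λ.codeMap.conjTranspose) c c =
      ∑ x, ∑ y, Λ.codeMap c x * Λ.bondProj F x y * star (Λ.codeMap c y) := by
    rw [Matrix.mul_apply, Finset.sum_comm]
    refine Finset.sum_congr rfl fun y _ => ?_
    rw [Matrix.mul_apply, Finset.sum_mul]
    rfl
  rw [expand]
  simp only [term]
  generalize hf : (fun a b : ∀ i, Λ.SiteCfg (u i) =>
    (∏ i, 𝒯.map (Λ.type (u i)) (c (u i)) (a i) * star (𝒯.map (Λ.type (u i)) (c (u i)) (b i))) *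
        (if 𝒯.BondCond _ (Λ.localBonds u F) a b then ((𝒯.D : ℂ)⁻¹) ^ F.card else 0)) = f
  generalize hg : (fun a b : ∀ s : {s // s ∉ Λ.sitesOf F}, Λ.SiteCfg s =>
    ∏ s : {s // s ∉ Λ.sitesOf F}, (𝒯.map (Λ.type s) (c s) (a s) *
        (1 : Matrix (Λ.SiteCfg s) (Λ.SiteCfg s) ℂ) (a s) (b s) *
        star (𝒯.map (Λ.type s) (c s) (b s)))) = g at hone
  have hone' : ∑ a, ∑ b, g a b = 1 := by rw [← hone, ← hg]
  have hloc : 𝒯.localElement (fun i => Λ.type (u i)) (fun i => c (u i)) (Λ.localBonds u F) F.card =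
      ∑ a, ∑ b, f a b := by rw [← hf]; rfl
  rw [hloc]
  have hsum : ∑ x, ∑ y, f (split x).1 (split y).1 * g (split x).2 (split y).2 =
      (∑ a, ∑ b, f a b) * ∑ a, ∑ b, g a b := by
    have h1 : ∀ x, ∑ y, f (split x).1 (split y).1 * g (split x).2 (split y).2 =
        (∑ b, f (split x).1 b) * ∑ b, g (split x).2 b := by
      intro x
      rw [split.sum_comp fun q => f (split x).1 q.1 * g (split x).2 q.2, Fintype.sum_prod_type,
        Finset.sum_mul_sum]
    simp only [h1]
    rw [split.sum_comp fun q => (∑ b, f q.1 b) * ∑ b, g q.2 b, Fintype.sum_prod_type,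
      Finset.sum_mul_sum]
  rw [hone', mul_one] at hsum
  rw [← hsum, ← hf, ← hg]

/-- The expectation values of products of boundedly many bond projections are bounded below. -/
theorem exists_pos_le_mean_bondProj (h𝒯 : 𝒯.IsIsometric) (r : ℕ) :
    ∃ μ : ℝ, 0 < μ ∧ ∀ Λ : PEPS 𝒯, Λ.codeState ≠ 0 → Λ.IsQuasiInjective →
      ∀ F : Finset Λ.E, F.card ≤ r → μ ≤ Λ.mean (Λ.bondProj F) := by
  obtain ⟨μ, hμ, h⟩ := 𝒯.exists_pos_le_localElement (2 * r)
  refine ⟨μ, hμ, fun Λ hψ hq F hF => ?_⟩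
  -- The mean dominates the expectation value in every normalized vector of the code space, hence in
  -- the encoded basis vector of a label with nonzero amplitude in the PEPS.
  obtain ⟨c, hc⟩ := Function.ne_iff.1 hψ
  set δ : Λ.CodeCfg → ℂ := Pi.single c 1 with hδ
  set v := Λ.codeMap.conjTranspose.mulVec δ with hv
  have hv1 : nsq v = 1 := by
    rw [hv, nsq, star_mulVec_dotProduct, Matrix.conjTranspose_conjTranspose, Matrix.mulVec_mulVec,
      Λ.codeMap_mul_conjTranspose h𝒯, Matrix.one_mulVec, hδ]
    simp
  have hPv : Λ.P₀.mulVec v = v := by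
    rw [hv, Matrix.mulVec_mulVec, Λ.P₀_mul_codeMap_conjTranspose h𝒯]
  have hd := defect_nonneg h𝒯 hψ hq (Λ.bondProj_mem_words F) hPv
  rw [defect, hv1, mul_one] at hd
  have hel : qform (Λ.bondProj F) v =
      ((Λ.codeMap * Λ.bondProj F * Λ.codeMap.conjTranspose) c c).re := by
    rw [qform, hv, star_mulVec_dotProduct, Matrix.conjTranspose_conjTranspose, Matrix.mulVec_mulVec,
      Matrix.mulVec_mulVec, hδ, Matrix.mulVec_single_one]
    congr 1
    rw [← Pi.single_star, star_one, single_one_dotProduct]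
    rfl
  -- If the projection annihilated v, then v would be orthogonal to the bond state, which it fixes;
  -- but that inner product is the amplitude of c.
  have hpos : 0 < qform (Λ.bondProj F) v := by
    have h2 : Λ.bondProj F = (Λ.bondProj F).conjTranspose * Λ.bondProj F := by
      rw [(Λ.bondProj_isHermitian F).eq, bondProj_mul, Finset.union_self]
    rw [h2, ← nsq_mulVec]
    refine nsq_pos fun h0 => hc ?_
    have h3 : star v ⬝ᵥ Λ.bondState = 0 := by
      rw [← Λ.bondProj_mulVec_bondState F, ← (Λ.bondProj_isHermitian F).eq, ← star_mulVec_dotProduct,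
        h0]
      simp
    rw [hv, star_mulVec_dotProduct, Matrix.conjTranspose_conjTranspose, hδ, ← Pi.single_star,
      star_one, single_one_dotProduct] at h3
    exact h3
  rw [hel, compress_bondProj_diag h𝒯 (Λ.sitesOf F).equivFin c] at hpos hd
  have hcard := Λ.card_sitesOf_le F
  have := h _ _ _ _ _ (by omega) (by omega) hpos
  linarith

end PEPS

/-! ### Spectral gaps and supports -/

section SpectralGap

variable {n : Type} [Fintype n]

theorem qform_diagonal [DecidableEq n] (d : n → ℝ) (x : n → ℂ) :
    qform (Matrix.diagonal fun i => (d i : ℂ)) x = ∑ i, d i * ‖x i‖ ^ 2 := by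
  simp only [qform, Matrix.mulVec_diagonal, dotProduct, Complex.re_sum]
  refine Finset.sum_congr rfl fun i _ => ?_
  rw [Pi.star_apply, Complex.star_def, ← Complex.normSq_eq_norm_sq, Complex.normSq_apply]
  simp
  ring

/-- A vector orthogonal to the ground states has energy above the gap. -/
theorem le_qform_of_orthogonal [DecidableEq n] {A : Matrix n n ℂ} (hA : A.IsHermitian) {E γ : ℝ}
    (hgap : ∀ μ ∈ realEigenvalues A, μ ≠ E → E + γ ≤ μ) {φ : n → ℂ}
    (hφ : ∀ g, A.mulVec g = (E : ℂ) • g → star g ⬝ᵥ φ = 0) : (E + γ) * nsq φ ≤ qform A φ := by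
  set U : Matrix n n ℂ := (hA.eigenvectorUnitary).1 with hU
  have hspec : A = (star U).conjTranspose *
      (Matrix.diagonal fun i => (hA.eigenvalues i : ℂ)) * star U := by
    have := hA.spectral_theorem
    rw [Unitary.conjStarAlgAut_apply] at this
    rw [Matrix.star_eq_conjTranspose, Matrix.conjTranspose_conjTranspose]
    exact this
  have hn : nsq ((star U).mulVec φ) = nsq φ := by
    rw [nsq_mulVec, Matrix.star_eq_conjTranspose, Matrix.conjTranspose_conjTranspose,
      ← Matrix.star_eq_conjTranspose, Unitary.mul_star_self_of_mem hA.eigenvectorUnitary.2, qform,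
      Matrix.one_mulVec, nsq]
  have hq : qform A φ = ∑ i, hA.eigenvalues i * ‖(star U).mulVec φ i‖ ^ 2 := by
    conv_lhs => rw [hspec]
    rw [qform_mul_conjTranspose_mul, qform_diagonal]
  rw [hq, ← hn, nsq_eq_sum, Finset.mul_sum]
  refine Finset.sum_le_sum fun i _ => ?_
  have hv : A.mulVec (hA.eigenvectorBasis i).ofLp =
      ((hA.eigenvalues i : ℝ) : ℂ) • (hA.eigenvectorBasis i).ofLp := by
    rw [hA.mulVec_eigenvectorBasis i]
    ext
    simp
  by_cases hE : hA.eigenvalues i = E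
  · have h0 : (star U).mulVec φ i = 0 := by
      rw [hE] at hv
      rw [← hφ _ hv]
      rfl
    rw [h0]
    simp
  · refine mul_le_mul_of_nonneg_right (hgap _ ⟨_, ?_, hv⟩ hE) (by positivity)
    intro h0
    exact hA.eigenvectorBasis.orthonormal.ne_zero i (by ext j; exact congrFun h0 j)

theorem eigenvalue_ge_of_qform_ge {A : Matrix n n ℂ} {E : ℝ} (h : ∀ x, E * nsq x ≤ qform A x)
    {μ : ℝ} (hμ : μ ∈ realEigenvalues A) : E ≤ μ := by
  obtain ⟨x, hx, hAx⟩ := hμ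
  have := h x
  rw [qform_of_eigen hAx] at this
  exact le_of_mul_le_mul_right this (nsq_pos hx)

theorem isLeast_of_eigen {A : Matrix n n ℂ} {E : ℝ} (h : ∀ x, E * nsq x ≤ qform A x)
    {g : n → ℂ} (hg : g ≠ 0) (hAg : A.mulVec g = (E : ℂ) • g) : IsLeast (realEigenvalues A) E :=
  ⟨⟨g, hg, hAg⟩, fun _ => eigenvalue_ge_of_qform_ge h⟩

theorem isGroundState_iff {A : Matrix n n ℂ} {E : ℝ} (h : IsLeast (realEigenvalues A) E)
    {x : n → ℂ} : IsGroundState A x ↔ x ≠ 0 ∧ A.mulVec x = (E : ℂ) • x := by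
  constructor
  · rintro ⟨hx, E', hE', hx'⟩
    rw [h.unique hE']
    exact ⟨hx, hx'⟩
  · rintro ⟨hx, hx'⟩
    exact ⟨hx, E, h, hx'⟩

theorem orthogonal_of_eigen {A : Matrix n n ℂ} (hA : A.IsHermitian) {μ ν : ℝ} (hμν : μ ≠ ν)
    {x y : n → ℂ} (hx : A.mulVec x = (μ : ℂ) • x) (hy : A.mulVec y = (ν : ℂ) • y) :
    star x ⬝ᵥ y = 0 := by
  have h := star_mulVec_dotProduct A x y
  rw [hA.eq, hx, hy, star_smul, smul_dotProduct, dotProduct_smul, Complex.star_def,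
    Complex.conj_ofReal, ← sub_eq_zero, ← sub_smul, smul_eq_mul, mul_eq_zero] at h
  refine h.resolve_left ?_
  rw [← Complex.ofReal_sub]
  exact_mod_cast sub_ne_zero.2 hμν

theorem nsq_sub_mulVec_of_idempotent {P : Matrix n n ℂ} (hP : P.IsHermitian) (hPP : P * P = P)
    (x : n → ℂ) : nsq (x - P.mulVec x) = nsq x - qform P x := by
  rw [nsq_sub, nsq_mulVec, hP.eq, hPP, qform]
  ring

end SpectralGap

/-! ### The projection onto the range of a matrix -/

section Support

variable {n : Type} [Fintype n] [DecidableEq n]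

theorem supportProj_mul_self (A : Matrix n n ℂ) :
    supportProj A * supportProj A = supportProj A := by
  rw [supportProj, ← map_mul, (Submodule.isIdempotentElem_starProjection _).eq]

/-- The hypothesis says that `B` acts as the scalar `c` on the range of `A`. -/
theorem mul_supportProj {A B : Matrix n n ℂ} {c : ℂ} (h : B * A = c • A) :
    B * supportProj A = c • supportProj A := by
  apply EquivLike.injective (Matrix.toEuclideanCLM (n := n) (𝕜 := ℂ))
  rw [supportProj, map_mul, map_smul, StarAlgEquiv.apply_symm_apply]
  ext1 v
  obtain ⟨w, hw⟩ := Submodule.starProjection_apply_mem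
    (LinearMap.range (Matrix.toEuclideanCLM (n := n) (𝕜 := ℂ) A).toLinearMap) v
  rw [mul_apply_eq_comp, smul_apply, ← hw]
  have := congrArg (fun T => T w) (congrArg (Matrix.toEuclideanCLM (n := n) (𝕜 := ℂ)) h)
  rw [map_mul, map_smul] at this
  exact this

end Support

/-! ### Local operators and reduced states on a region -/

section Regions

open scoped Kronecker

variable {S : Type} [Fintype S] [DecidableEq S] {ι : S → Type} [∀ s, Fintype (ι s)]
  [∀ s, DecidableEq (ι s)]

/-- Splitting a configuration into its parts on a region and off it. -/
def splitRegion (ι : S → Type) (R : Finset S) :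
    (∀ s, ι s) ≃ (∀ s : R, ι s) × (∀ s : {s // s ∉ R}, ι s) :=
  Equiv.piEquivPiSubtypeProd (fun s => s ∈ R) ι

theorem extendOp_eq_submatrix (R : Finset S) (B : Matrix (∀ s : R, ι s) (∀ s : R, ι s) ℂ) :
    extendOp R B = (B ⊗ₖ (1 : Matrix (∀ s : {s // s ∉ R}, ι s) (∀ s : {s // s ∉ R}, ι s) ℂ)).submatrix
      (splitRegion ι R) (splitRegion ι R) := by
  ext x y
  rw [Matrix.submatrix_apply, Matrix.kroneckerMap_apply, Matrix.one_apply, extendOp]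
  have : (splitRegion ι R x).2 = (splitRegion ι R y).2 ↔ ∀ s, s ∉ R → x s = y s :=
    ⟨fun h s hs => congrFun h ⟨s, hs⟩, fun h => funext fun s => h s s.2⟩
  by_cases h : ∀ s, s ∉ R → x s = y s
  · rw [if_pos h, if_pos (this.2 h), mul_one]
    rfl
  · rw [if_neg h, if_neg fun h' => h (this.1 h'), mul_zero]

theorem extendOp_mul (R : Finset S) (B B' : Matrix (∀ s : R, ι s) (∀ s : R, ι s) ℂ) :
    extendOp R B * extendOp R B' = extendOp R (B * B') := by
  rw [extendOp_eq_submatrix, extendOp_eq_submatrix, extendOp_eq_submatrix,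
    Matrix.submatrix_mul_equiv, ← Matrix.mul_kronecker_mul, Matrix.one_mul]

theorem extendOp_smul (R : Finset S) (c : ℂ) (B : Matrix (∀ s : R, ι s) (∀ s : R, ι s) ℂ) :
    extendOp R (c • B) = c • extendOp R B := by
  ext x y
  simp only [extendOp, Matrix.smul_apply]
  split_ifs <;> simp

/-- A vector as a matrix between the complement of a region and the region. -/
def regionMatrix (ψ : (∀ s, ι s) → ℂ) (R : Finset S) :
    Matrix (∀ s : R, ι s) (∀ s : {s // s ∉ R}, ι s) ℂ :=
  fun a k => ψ ((splitRegion ι R).symm (a, k))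

theorem reducedState_eq (ψ : (∀ s, ι s) → ℂ) (R : Finset S) :
    reducedState ψ R = regionMatrix ψ R * (regionMatrix ψ R).conjTranspose := by
  ext a b
  have hx : ∀ x : ∀ s, ι s, ∀ a : ∀ s : R, ι s, (∀ s : R, x s = a s) ↔ (splitRegion ι R x).1 = a :=
    fun x a => ⟨fun h => funext h, fun h s => congrFun h s⟩
  have hxy : ∀ x y : ∀ s, ι s, (∀ s, s ∉ R → x s = y s) ↔
      (splitRegion ι R x).2 = (splitRegion ι R y).2 := fun x y =>
    ⟨fun h => funext fun s => h s s.2, fun h s hs => congrFun h ⟨s, hs⟩⟩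
  simp only [reducedState, hx, hxy]
  rw [← (splitRegion ι R).symm.sum_comp]
  simp only [← (splitRegion ι R).symm.sum_comp (fun y => ite _ _ _), Equiv.apply_symm_apply,
    Fintype.sum_prod_type]
  rw [Finset.sum_eq_single a, Matrix.mul_apply]
  · refine Finset.sum_congr rfl fun k _ => ?_
    rw [Finset.sum_eq_single b, Finset.sum_eq_single k]
    · simp [regionMatrix]
    · intro k' _ hk'
      rw [if_neg fun h => hk' h.2.2.symm]
    · simp
    · intro b' _ hb'
      exact Finset.sum_eq_zero fun k' _ => if_neg fun h => hb' h.2.1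
    · simp
  · intro a' _ ha'
    exact Finset.sum_eq_zero fun k _ => Finset.sum_eq_zero fun b' _ =>
      Finset.sum_eq_zero fun k' _ => if_neg fun h => ha' h.1
  · simp

theorem regionMatrix_extendOp_mulVec (ψ : (∀ s, ι s) → ℂ) (R : Finset S)
    (B : Matrix (∀ s : R, ι s) (∀ s : R, ι s) ℂ) :
    regionMatrix ((extendOp R B).mulVec ψ) R = B * regionMatrix ψ R := by
  ext a k
  rw [regionMatrix, extendOp_eq_submatrix, Matrix.submatrix_mulVec_equiv, Function.comp_apply,
    Equiv.apply_symm_apply, Matrix.mul_apply, Matrix.mulVec, dotProduct, Fintype.sum_prod_type]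
  refine Finset.sum_congr rfl fun b _ => ?_
  rw [Finset.sum_eq_single k]
  · simp [regionMatrix]
  · intro k' _ hk'
    rw [Matrix.kroneckerMap_apply, Matrix.one_apply_ne hk'.symm, mul_zero, zero_mul]
  · simp

/-- A local operator with eigenvector `ψ` is a scalar on the support of the reduced state. -/
theorem extendOp_mul_supportProj {ψ : (∀ s, ι s) → ℂ} {R : Finset S}
    {B : Matrix (∀ s : R, ι s) (∀ s : R, ι s) ℂ} {c : ℂ}
    (h : (extendOp R B).mulVec ψ = c • ψ) :
    extendOp R B * extendOp R (supportProj (reducedState ψ R)) =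
      c • extendOp R (supportProj (reducedState ψ R)) := by
  have h1 : B * regionMatrix ψ R = c • regionMatrix ψ R := by
    rw [← regionMatrix_extendOp_mulVec, h]
    rfl
  rw [extendOp_mul, mul_supportProj, extendOp_smul]
  rw [reducedState_eq, ← Matrix.mul_assoc, h1, Matrix.smul_mul]

end Regions

/-! ### Comparison with the canonical parent Hamiltonian -/

namespace PEPS

variable {𝒯 : SiteTensors} {Λ : PEPS 𝒯}

theorem codeMap_mulVec_codeMap_conjTranspose (h𝒯 : 𝒯.IsIsometric) (φ : Λ.CodeCfg → ℂ) :
    Λ.codeMap.mulVec (Λ.codeMap.conjTranspose.mulVec φ) = φ := by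
  rw [Matrix.mulVec_mulVec, Λ.codeMap_mul_conjTranspose h𝒯, Matrix.one_mulVec]

theorem codeMap_conjTranspose_mulVec_codeMap (x : Λ.VirtCfg → ℂ) :
    Λ.codeMap.conjTranspose.mulVec (Λ.codeMap.mulVec x) = Λ.P₀.mulVec x := by
  rw [Matrix.mulVec_mulVec, codeMap_conjTranspose_mul]

theorem P₀_mulVec_codeMap_conjTranspose (h𝒯 : 𝒯.IsIsometric) (φ : Λ.CodeCfg → ℂ) :
    Λ.P₀.mulVec (Λ.codeMap.conjTranspose.mulVec φ) = Λ.codeMap.conjTranspose.mulVec φ := by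
  rw [Matrix.mulVec_mulVec, Λ.P₀_mul_codeMap_conjTranspose h𝒯]

theorem nsq_codeMap_conjTranspose (h𝒯 : 𝒯.IsIsometric) (φ : Λ.CodeCfg → ℂ) :
    nsq (Λ.codeMap.conjTranspose.mulVec φ) = nsq φ := by
  rw [nsq_mulVec, Matrix.conjTranspose_conjTranspose, Λ.codeMap_mul_conjTranspose h𝒯, qform,
    Matrix.one_mulVec, nsq]

theorem qform_codeMap_conjTranspose (x : Matrix Λ.VirtCfg Λ.VirtCfg ℂ) (φ : Λ.CodeCfg → ℂ) :
    qform x (Λ.codeMap.conjTranspose.mulVec φ) =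
      qform (Λ.codeMap * x * Λ.codeMap.conjTranspose) φ := by
  rw [← qform_mul_conjTranspose_mul, Matrix.conjTranspose_conjTranspose]

theorem defect_codeMap_conjTranspose (h𝒯 : 𝒯.IsIsometric) (x : Matrix Λ.VirtCfg Λ.VirtCfg ℂ)
    (φ : Λ.CodeCfg → ℂ) : Λ.defect x (Λ.codeMap.conjTranspose.mulVec φ) =
      Λ.mean x * nsq φ - qform (Λ.codeMap * x * Λ.codeMap.conjTranspose) φ := by
  rw [defect, nsq_codeMap_conjTranspose h𝒯, qform_codeMap_conjTranspose]

theorem codeMap_mul_compress_mul (h𝒯 : 𝒯.IsIsometric) (x : Matrix Λ.VirtCfg Λ.VirtCfg ℂ) :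
    Λ.codeMap * (Λ.P₀ * x * Λ.P₀) * Λ.codeMap.conjTranspose =
      Λ.codeMap * x * Λ.codeMap.conjTranspose := by
  simp only [Matrix.mul_assoc]
  rw [Λ.P₀_mul_codeMap_conjTranspose h𝒯, ← Matrix.mul_assoc Λ.codeMap, Λ.codeMap_mul_P₀ h𝒯]

theorem IsScalarOn.mulVec_codeState (h𝒯 : 𝒯.IsIsometric) {x : Matrix Λ.VirtCfg Λ.VirtCfg ℂ}
    (hx : Λ.IsScalarOn x) : (Λ.codeMap * x * Λ.codeMap.conjTranspose).mulVec Λ.codeState =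
      (Λ.mean x : ℂ) • Λ.codeState := by
  rw [← codeMap_mul_compress_mul h𝒯, ← Matrix.mulVec_mulVec,
    codeMap_conjTranspose_mulVec_codeState, ← Matrix.mulVec_mulVec, hx, Matrix.mulVec_smul,
    Λ.codeMap_mulVec_virtState h𝒯]

theorem isHermitian_codeMap_mul {x : Matrix Λ.VirtCfg Λ.VirtCfg ℂ} (hx : x.IsHermitian) :
    (Λ.codeMap * x * Λ.codeMap.conjTranspose).IsHermitian := by
  rw [Matrix.IsHermitian, Matrix.conjTranspose_mul, Matrix.conjTranspose_mul, hx.eq,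
    Matrix.conjTranspose_conjTranspose, Matrix.mul_assoc]

theorem mean_bondProj_pos (h𝒯 : 𝒯.IsIsometric) (hψ : Λ.codeState ≠ 0) (hq : Λ.IsQuasiInjective)
    (F : Finset Λ.E) : 0 < Λ.mean (Λ.bondProj F) := by
  obtain ⟨μ, hμ, h⟩ := exists_pos_le_mean_bondProj h𝒯 F.card
  exact hμ.trans_le (h Λ hψ hq F le_rfl)

theorem regionProj_mul_self (R : Finset Λ.S) :
    Λ.regionProj R * Λ.regionProj R = Λ.regionProj R := by
  rw [regionProj, extendOp_mul, supportProj_mul_self]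

/-- A local operator with the PEPS as an eigenvector is a scalar on the support of its reduced
state. -/
theorem mulVec_of_regionProj {O : Matrix Λ.CodeCfg Λ.CodeCfg ℂ} {R : Finset Λ.S}
    (hO : ActsOn O R) {c : ℂ} (h : O.mulVec Λ.codeState = c • Λ.codeState) {φ : Λ.CodeCfg → ℂ}
    (hφ : (Λ.regionProj R).mulVec φ = φ) : O.mulVec φ = c • φ := by
  obtain ⟨B, rfl⟩ := hO.supportedOn
  rw [← hφ, Matrix.mulVec_mulVec, regionProj, extendOp_mul_supportProj h, Matrix.smul_mulVec]

/-! ### Energies of the canonical parent Hamiltonian -/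

section Canonical

variable {ℛ : Finset (Finset Λ.S)} {r : ℕ} {γ : ℝ}

/-- The normalization κ must be the mean: the PEPS is an eigenvector of the idempotent ϖ_R with
eigenvalue mean/κ, which is positive and therefore 1. -/
theorem IsGappedCanonical.regionProj_facts (hℛ : Λ.IsGappedCanonical ℛ r γ) (h𝒯 : 𝒯.IsIsometric)
    (hψ : Λ.codeState ≠ 0) (hq : Λ.IsQuasiInjective) {R : Finset Λ.S} (hR : R ∈ ℛ) :
    Λ.codeMap * Λ.bondProj (Λ.edgesIn R) * Λ.codeMap.conjTranspose =
        (Λ.mean (Λ.bondProj (Λ.edgesIn R)) : ℂ) • Λ.regionProj R ∧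
      (Λ.regionProj R).IsHermitian ∧ (Λ.regionProj R).mulVec Λ.codeState = Λ.codeState := by
  obtain ⟨κ, hκ, hform⟩ := hℛ.form R hR
  set m := Λ.mean (Λ.bondProj (Λ.edgesIn R)) with hm
  have hm0 : 0 < m := mean_bondProj_pos h𝒯 hψ hq _
  have hκ' : (κ : ℂ) ≠ 0 := by exact_mod_cast hκ.ne'
  have h1 := (isScalarOn_word h𝒯 hψ hq (Λ.bondProj_mem_words (Λ.edgesIn R))).mulVec_codeState h𝒯
  have hreg : Λ.regionProj R = ((κ⁻¹ : ℝ) : ℂ) •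
      (Λ.codeMap * Λ.bondProj (Λ.edgesIn R) * Λ.codeMap.conjTranspose) := by
    rw [hform, smul_smul, Complex.ofReal_inv, inv_mul_cancel₀ hκ', one_smul]
  have h2 : (Λ.regionProj R).mulVec Λ.codeState = ((κ⁻¹ * m : ℝ) : ℂ) • Λ.codeState := by
    rw [hreg, Matrix.smul_mulVec, h1, smul_smul, ← hm, Complex.ofReal_mul]
  have h3 : κ⁻¹ * m * (κ⁻¹ * m) = κ⁻¹ * m := by
    refine smul_right_cancel_real hψ ?_
    conv_rhs => rw [← h2, ← regionProj_mul_self, ← Matrix.mulVec_mulVec, h2, Matrix.mulVec_smul, h2]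
    rw [smul_smul, Complex.ofReal_mul]
  have h4 : κ⁻¹ * m = 1 := by
    have hpos : 0 < κ⁻¹ * m := by positivity
    exact (mul_eq_left₀ hpos.ne').1 h3
  have h5 : m = κ := by
    field_simp at h4
    exact h4
  refine ⟨by rw [h5, hform], ?_, ?_⟩
  · rw [hreg]
    exact isHermitian_real_smul (isHermitian_codeMap_mul (Λ.bondProj_isHermitian _)) _
  · rw [h2, h4, Complex.ofReal_one, one_smul]

theorem qform_canonical (φ : Λ.CodeCfg → ℂ) :
    qform (Λ.canonicalHamiltonian ℛ) φ + ℛ.card * nsq φ =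
      ∑ R ∈ ℛ, (nsq φ - qform (Λ.regionProj R) φ) := by
  rw [canonicalHamiltonian, qform_neg, qform_sum, Finset.sum_sub_distrib, Finset.sum_const,
    nsmul_eq_mul]
  ring

theorem IsGappedCanonical.energy_nonneg (hℛ : Λ.IsGappedCanonical ℛ r γ) (h𝒯 : 𝒯.IsIsometric)
    (hψ : Λ.codeState ≠ 0) (hq : Λ.IsQuasiInjective) {R : Finset Λ.S} (hR : R ∈ ℛ)
    (φ : Λ.CodeCfg → ℂ) : 0 ≤ nsq φ - qform (Λ.regionProj R) φ := by
  rw [← nsq_sub_mulVec_of_idempotent (hℛ.regionProj_facts h𝒯 hψ hq hR).2.1 (regionProj_mul_self R)]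
  exact nsq_nonneg _

theorem IsGappedCanonical.isHermitian (hℛ : Λ.IsGappedCanonical ℛ r γ) (h𝒯 : 𝒯.IsIsometric)
    (hψ : Λ.codeState ≠ 0) (hq : Λ.IsQuasiInjective) : (Λ.canonicalHamiltonian ℛ).IsHermitian :=
  (SchriefferWolff.isHermitian_sum _ fun _ hR => (hℛ.regionProj_facts h𝒯 hψ hq hR).2.1).neg

theorem canonical_mulVec {φ : Λ.CodeCfg → ℂ}
    (h : ∀ R ∈ ℛ, (Λ.regionProj R).mulVec φ = φ) :
    (Λ.canonicalHamiltonian ℛ).mulVec φ = ((-(ℛ.card : ℝ) : ℝ) : ℂ) • φ := by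
  rw [canonicalHamiltonian, Matrix.neg_mulVec, Matrix.sum_mulVec, Finset.sum_congr rfl h,
    Finset.sum_const, Complex.ofReal_neg, neg_smul, ← Nat.cast_smul_eq_nsmul ℂ]
  simp

theorem IsGappedCanonical.isLeast (hℛ : Λ.IsGappedCanonical ℛ r γ) (h𝒯 : 𝒯.IsIsometric)
    (hψ : Λ.codeState ≠ 0) (hq : Λ.IsQuasiInjective) :
    IsLeast (realEigenvalues (Λ.canonicalHamiltonian ℛ)) (-(ℛ.card : ℝ)) := by
  refine isLeast_of_eigen (fun φ => ?_) hψ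
    (canonical_mulVec fun R hR => (hℛ.regionProj_facts h𝒯 hψ hq hR).2.2)
  have h := qform_canonical (ℛ := ℛ) φ
  have h0 := Finset.sum_nonneg fun R hR => hℛ.energy_nonneg h𝒯 hψ hq hR φ
  linarith

theorem IsGappedCanonical.groundState_of_energy_le (hℛ : Λ.IsGappedCanonical ℛ r γ)
    (h𝒯 : 𝒯.IsIsometric) (hψ : Λ.codeState ≠ 0) (hq : Λ.IsQuasiInjective) {φ : Λ.CodeCfg → ℂ}
    (hφ : φ ≠ 0) (h : qform (Λ.canonicalHamiltonian ℛ) φ + ℛ.card * nsq φ ≤ 0) :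
    IsGroundState (Λ.canonicalHamiltonian ℛ) φ := by
  rw [isGroundState_iff (hℛ.isLeast h𝒯 hψ hq)]
  refine ⟨hφ, canonical_mulVec fun R hR => ?_⟩
  rw [qform_canonical] at h
  have h0 := (Finset.sum_eq_zero_iff_of_nonneg
    fun R hR => hℛ.energy_nonneg h𝒯 hψ hq hR φ).1 (le_antisymm h
    (Finset.sum_nonneg fun R hR => hℛ.energy_nonneg h𝒯 hψ hq hR φ)) R hR
  rw [← nsq_sub_mulVec_of_idempotent (hℛ.regionProj_facts h𝒯 hψ hq hR).2.1 (regionProj_mul_self R),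
    nsq_eq_zero, sub_eq_zero] at h0
  exact h0.symm

/-- The energy above the ground energy of the canonical Hamiltonian is controlled by the leading
parts of the effective interaction. -/
theorem IsGappedCanonical.energy_le (hℛ : Λ.IsGappedCanonical ℛ r γ) (h𝒯 : 𝒯.IsIsometric)
    (hψ : Λ.codeState ≠ 0) (hq : Λ.IsQuasiInjective) {ε : ℝ} (hε : 0 < ε) (hε1 : ε ≤ 1) {μ : ℝ}
    (hμ : ∀ F : Finset Λ.E, F.card ≤ r → μ ≤ Λ.mean (Λ.bondProj F)) (φ : Λ.CodeCfg → ℂ) :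
    μ * ε ^ r * (qform (Λ.canonicalHamiltonian ℛ) φ + ℛ.card * nsq φ) ≤
      monoConst r * ∑ F ∈ Λ.clusters r,
        Λ.defect (Λ.leadSum r ε F) (Λ.codeMap.conjTranspose.mulVec φ) := by
  classical
  set x := Λ.codeMap.conjTranspose.mulVec φ with hx
  have hPx : Λ.P₀.mulVec x = x := P₀_mulVec_codeMap_conjTranspose h𝒯 φ
  -- The defect of the bond projections of R is their mean times the energy of 1 - ϖ_R, and the mean
  -- is at least μ.
  have hterm : ∀ R ∈ ℛ, μ * (nsq φ - qform (Λ.regionProj R) φ) ≤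
      Λ.defect (Λ.bondProj (Λ.edgesIn R)) x := by
    intro R hR
    rw [hx, defect_codeMap_conjTranspose h𝒯, (hℛ.regionProj_facts h𝒯 hψ hq hR).1, qform_smul,
      ← mul_sub]
    exact mul_le_mul_of_nonneg_right (hμ _ (hℛ.card_le R hR)) (hℛ.energy_nonneg h𝒯 hψ hq hR φ)
  -- Regions without edges have zero defect. A connected region with an edge is recovered as the set
  -- of ends of its edges, so the others correspond to distinct connected clusters and no leading
  -- part is counted twice.
  set 𝒮 := ℛ.filter fun R => (Λ.edgesIn R).Nonempty with h𝒮
  have hempty : ∑ R ∈ ℛ, Λ.defect (Λ.bondProj (Λ.edgesIn R)) x =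
      ∑ R ∈ 𝒮, Λ.defect (Λ.bondProj (Λ.edgesIn R)) x := by
    symm
    refine Finset.sum_filter_of_ne fun R _ hne => ?_
    by_contra h0
    rw [Finset.not_nonempty_iff_eq_empty] at h0
    rw [h0, bondProj_empty, ← Λ.siteProj_empty] at hne
    exact hne (defect_siteProj h𝒯 hψ ∅ hPx)
  have hinj : Set.InjOn Λ.edgesIn (𝒮 : Set (Finset Λ.S)) := by
    intro R hR R' hR' hRR'
    rw [Finset.mem_coe, h𝒮, Finset.mem_filter] at hR hR'
    rw [← sitesOf_edgesIn (hℛ.connected R hR.1) hR.2, hRR',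
      sitesOf_edgesIn (hℛ.connected R' hR'.1) hR'.2]
  have hle : ∑ R ∈ 𝒮, Λ.defect (Λ.leadSum r ε (Λ.edgesIn R)) x ≤
      ∑ F ∈ Λ.clusters r, Λ.defect (Λ.leadSum r ε F) x := by
    rw [← Finset.sum_image (f := fun F => Λ.defect (Λ.leadSum r ε F) x) hinj]
    refine Finset.sum_le_sum_of_subset_of_nonneg (fun F hF => ?_) fun F _ _ =>
      (isPos_leadSum r hε.le F).defect_nonneg h𝒯 hψ hq hPx
    obtain ⟨R, hR, rfl⟩ := Finset.mem_image.1 hF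
    rw [h𝒮, Finset.mem_filter] at hR
    exact mem_clusters.2 ⟨edgeConn_edgesIn (hℛ.connected R hR.1) hR.2, hℛ.card_le R hR.1⟩
  have hword : ∑ R ∈ 𝒮, ε ^ r * Λ.defect (Λ.bondProj (Λ.edgesIn R)) x ≤
      ∑ R ∈ 𝒮, monoConst r * Λ.defect (Λ.leadSum r ε (Λ.edgesIn R)) x := by
    refine Finset.sum_le_sum fun R hR => ?_
    rw [h𝒮, Finset.mem_filter] at hR
    exact bondProj_defect_le h𝒯 hψ hq hε hε1 hR.2 (hℛ.card_le R hR.1) hPx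
  rw [← Finset.mul_sum, ← Finset.mul_sum, ← hempty] at hword
  rw [qform_canonical]
  have hsum := Finset.sum_le_sum hterm
  rw [← Finset.mul_sum] at hsum
  calc _ = ε ^ r * (μ * ∑ R ∈ ℛ, (nsq φ - qform (Λ.regionProj R) φ)) := by ring
    _ ≤ ε ^ r * ∑ R ∈ ℛ, Λ.defect (Λ.bondProj (Λ.edgesIn R)) x :=
        mul_le_mul_of_nonneg_left hsum (pow_nonneg hε.le r)
    _ ≤ _ := hword.trans (mul_le_mul_of_nonneg_left hle (monoConst_pos r).le)

end Canonical

/-- Without edges there are no virtual qudits, so the virtual space has dimension one and is spanned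
by the encoded PEPS. -/
theorem P₀_mulVec_of_isEmpty (h𝒯 : 𝒯.IsIsometric) (hψ : Λ.codeState ≠ 0) [IsEmpty Λ.E]
    (x : Λ.VirtCfg → ℂ) : Λ.P₀.mulVec x = x := by
  have hsub : Subsingleton Λ.VirtCfg := by
    refine ⟨fun a b => ?_⟩
    ext1 s
    ext1 m
    exact isEmptyElim (Λ.ends.symm ⟨s, m⟩).1
  obtain ⟨y, hy⟩ := Function.ne_iff.1 (Λ.virtState_ne_zero h𝒯 hψ)
  have hx : x = (x y / Λ.virtState y) • Λ.virtState := by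
    ext z
    rw [Subsingleton.elim z y, Pi.smul_apply, smul_eq_mul, div_mul_cancel₀ _ hy]
  rw [hx, Matrix.mulVec_smul, Λ.P₀_mulVec_virtState h𝒯]

end PEPS

/-! ### The effective Hamiltonian as a parent Hamiltonian -/

namespace PEPS

variable {𝒯 : SiteTensors} {Λ : PEPS 𝒯}

open Classical in
/-- The local terms on the code space, collected according to their supports. -/
noncomputable def regionTerm (Λ : PEPS 𝒯) (r : ℕ) (X : Finset Λ.E → Matrix Λ.VirtCfg Λ.VirtCfg ℂ)
    (R : Finset Λ.S) : Matrix Λ.CodeCfg Λ.CodeCfg ℂ :=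
  ∑ F ∈ (Λ.clusters r).filter (fun F => Λ.sitesOf F = R),
    Λ.codeMap * X F * Λ.codeMap.conjTranspose

theorem sum_regionTerm (r : ℕ) (X : Finset Λ.E → Matrix Λ.VirtCfg Λ.VirtCfg ℂ) :
    ∑ R, Λ.regionTerm r X R =
      ∑ F ∈ Λ.clusters r, Λ.codeMap * X F * Λ.codeMap.conjTranspose := by
  classical
  simp only [regionTerm]
  exact Finset.sum_fiberwise _ _ _

theorem regionTerm_ne_zero {r : ℕ} {X : Finset Λ.E → Matrix Λ.VirtCfg Λ.VirtCfg ℂ}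
    {R : Finset Λ.S} (h : Λ.regionTerm r X R ≠ 0) :
    Λ.IsConnectedRegion R ∧ R.card ≤ r + 1 := by
  classical
  obtain ⟨F, hF, -⟩ := Finset.exists_ne_zero_of_sum_ne_zero h
  obtain ⟨hFr, rfl⟩ := Finset.mem_filter.1 hF
  rw [mem_clusters] at hFr
  exact ⟨hFr.1.isConnectedRegion, hFr.1.card_sitesOf_le.trans (by omega)⟩

/-- A sum of local terms on the code space that are minimized by the PEPS, that are scalar on the
ground states of the canonical Hamiltonian, and whose energy dominates that of the canonical
Hamiltonian, is a gapped frustration-free parent Hamiltonian. -/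
theorem parent_of_local_terms (h𝒯 : 𝒯.IsIsometric) (hψ : Λ.codeState ≠ 0)
    (hq : Λ.IsQuasiInjective) {ℛ : Finset (Finset Λ.S)} {r : ℕ} {γ : ℝ}
    (hℛ : Λ.IsGappedCanonical ℛ r γ) {H : Matrix Λ.VirtCfg Λ.VirtCfg ℂ}
    {X : Finset Λ.E → Matrix Λ.VirtCfg Λ.VirtCfg ℂ}
    (hH : H = ∑ F ∈ Λ.clusters r, Λ.P₀ * X F * Λ.P₀)
    (hherm : ∀ F ∈ Λ.clusters r, (Λ.P₀ * X F * Λ.P₀).IsHermitian)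
    (hact : ∀ F ∈ Λ.clusters r, ActsOn (X F) (Λ.sitesOf F))
    (hscal : ∀ F ∈ Λ.clusters r, Λ.IsScalarOn (X F))
    (hdef : ∀ F ∈ Λ.clusters r, ∀ φ, Λ.P₀.mulVec φ = φ → Λ.defect (X F) φ ≤ 0)
    {c Δ : ℝ} (hc : 0 < c) (hΔ : Δ ≤ c * γ) (hΔ0 : 0 < Δ)
    (hen : ∀ φ : Λ.CodeCfg → ℂ, c * (qform (Λ.canonicalHamiltonian ℛ) φ + ℛ.card * nsq φ) ≤
      -∑ F ∈ Λ.clusters r, Λ.defect (X F) (Λ.codeMap.conjTranspose.mulVec φ))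
    (hE : Nonempty Λ.E → Λ.mean H ≤ -Δ) :
    H.IsHermitian ∧ IsGroundState H Λ.virtState ∧
      (∀ x, IsGroundState H x ↔ ∃ φ, IsGroundState (Λ.canonicalHamiltonian ℛ) φ ∧
        x = Λ.codeMap.conjTranspose.mulVec φ) ∧
      Λ.IsLocalFrustrationFree H (r + 1) ∧ HasGap H Δ := by
  classical
  set Y : Finset Λ.E → Matrix Λ.CodeCfg Λ.CodeCfg ℂ := fun F =>
    Λ.codeMap * X F * Λ.codeMap.conjTranspose with hY
  set K : Matrix Λ.CodeCfg Λ.CodeCfg ℂ := ∑ F ∈ Λ.clusters r, Y F with hK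
  have hHK : H = Λ.codeMap.conjTranspose * K * Λ.codeMap := by
    rw [hH, hK, Matrix.mul_sum, Matrix.sum_mul]
    refine Finset.sum_congr rfl fun F _ => ?_
    rw [hY, ← codeMap_conjTranspose_mul]
    simp only [Matrix.mul_assoc]
  have hYherm : ∀ F ∈ Λ.clusters r, (Y F).IsHermitian := by
    intro F hF
    have := isHermitian_codeMap_mul (hherm F hF)
    rwa [codeMap_mul_compress_mul h𝒯] at this
  have hHherm : H.IsHermitian := by
    rw [hH]
    exact SchriefferWolff.isHermitian_sum _ hherm
  have hKherm : K.IsHermitian := SchriefferWolff.isHermitian_sum _ hYherm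
  have hmean : Λ.mean H = ∑ F ∈ Λ.clusters r, Λ.mean (X F) := by
    rw [hH, mean_sum]
    exact Finset.sum_congr rfl fun F _ => mean_compress h𝒯 _
  set E := Λ.mean H with hEdef
  have hYq : ∀ F ∈ Λ.clusters r, ∀ φ, Λ.mean (X F) * nsq φ ≤ qform (Y F) φ := by
    intro F hF φ
    have := hdef F hF _ (P₀_mulVec_codeMap_conjTranspose h𝒯 φ)
    rw [defect_codeMap_conjTranspose h𝒯] at this
    linarith
  have hKq : ∀ φ, c * (qform (Λ.canonicalHamiltonian ℛ) φ + ℛ.card * nsq φ) ≤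
      qform K φ - E * nsq φ := by
    intro φ
    refine (hen φ).trans (le_of_eq ?_)
    rw [hmean, hK, qform_sum, Finset.sum_mul, ← Finset.sum_sub_distrib, ← Finset.sum_neg_distrib]
    refine Finset.sum_congr rfl fun F _ => ?_
    rw [defect_codeMap_conjTranspose h𝒯]
    ring
  have hcan0 : ∀ φ, 0 ≤ qform (Λ.canonicalHamiltonian ℛ) φ + ℛ.card * nsq φ := by
    intro φ
    rw [qform_canonical]
    exact Finset.sum_nonneg fun R hR => hℛ.energy_nonneg h𝒯 hψ hq hR φ
  -- A connected cluster of at most r edges has at most r + 1 sites, which is exactly the size up to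
  -- which saturation confines φ to the support of the reduced state; there the local term is a
  -- scalar.
  have hYgs : ∀ φ, IsGroundState (Λ.canonicalHamiltonian ℛ) φ → ∀ F ∈ Λ.clusters r,
      (Y F).mulVec φ = (Λ.mean (X F) : ℂ) • φ := by
    intro φ hφ F hF
    refine mulVec_of_regionProj (actsOn_codeMap_mul Λ h𝒯 (hact F hF))
      ((hscal F hF).mulVec_codeState h𝒯) ?_
    rw [mem_clusters] at hF
    exact hℛ.saturated φ hφ _ hF.1.isConnectedRegion (hF.1.card_sitesOf_le.trans (by omega))
  have hKgs : ∀ φ, IsGroundState (Λ.canonicalHamiltonian ℛ) φ → K.mulVec φ = (E : ℂ) • φ := by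
    intro φ hφ
    rw [hK, Matrix.sum_mulVec, Finset.sum_congr rfl (hYgs φ hφ), ← Finset.sum_smul, hmean,
      Complex.ofReal_sum]
  have hHgs : ∀ φ, IsGroundState (Λ.canonicalHamiltonian ℛ) φ →
      H.mulVec (Λ.codeMap.conjTranspose.mulVec φ) =
        (E : ℂ) • Λ.codeMap.conjTranspose.mulVec φ := by
    intro φ hφ
    rw [hHK, ← Matrix.mulVec_mulVec, codeMap_mulVec_codeMap_conjTranspose h𝒯,
      ← Matrix.mulVec_mulVec, hKgs φ hφ, Matrix.mulVec_smul]
  have hψgs : IsGroundState (Λ.canonicalHamiltonian ℛ) Λ.codeState :=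
    (isGroundState_iff (hℛ.isLeast h𝒯 hψ hq)).2
      ⟨hψ, canonical_mulVec fun R hR => (hℛ.regionProj_facts h𝒯 hψ hq hR).2.2⟩
  have hHψ : H.mulVec Λ.virtState = (E : ℂ) • Λ.virtState := by
    have := hHgs _ hψgs
    rwa [codeMap_conjTranspose_mulVec_codeState] at this
  -- an eigenvector lies in the code space, or it has eigenvalue zero
  have hdich : ∀ {x : Λ.VirtCfg → ℂ} {ν : ℝ}, H.mulVec x = (ν : ℂ) • x →
      Λ.P₀.mulVec x = x ∨ (ν = 0 ∧ E + Δ ≤ 0) := by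
    intro x ν hx
    rcases isEmpty_or_nonempty Λ.E with hem | hne
    · exact Or.inl (P₀_mulVec_of_isEmpty h𝒯 hψ x)
    by_cases hν : ν = 0
    · exact Or.inr ⟨hν, by linarith [hE hne]⟩
    · left
      have h1 : Λ.P₀.mulVec (H.mulVec x) = H.mulVec x := by
        rw [hHK, ← Matrix.mulVec_mulVec, ← Matrix.mulVec_mulVec,
          P₀_mulVec_codeMap_conjTranspose h𝒯]
      rw [hx, Matrix.mulVec_smul] at h1
      exact smul_right_injective _ (by exact_mod_cast hν : (ν : ℂ) ≠ 0) h1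
  have hcode : ∀ {x : Λ.VirtCfg → ℂ} {ν : ℝ}, H.mulVec x = (ν : ℂ) • x →
      K.mulVec (Λ.codeMap.mulVec x) = (ν : ℂ) • Λ.codeMap.mulVec x := by
    intro x ν hx
    rw [← Matrix.mulVec_smul, ← hx, hHK, ← Matrix.mulVec_mulVec, ← Matrix.mulVec_mulVec,
      codeMap_mulVec_codeMap_conjTranspose h𝒯]
  have hback : ∀ {x : Λ.VirtCfg → ℂ}, Λ.P₀.mulVec x = x →
      x = Λ.codeMap.conjTranspose.mulVec (Λ.codeMap.mulVec x) := by
    intro x hx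
    rw [codeMap_conjTranspose_mulVec_codeMap, hx]
  have hne : ∀ {x : Λ.VirtCfg → ℂ}, x ≠ 0 → Λ.P₀.mulVec x = x → Λ.codeMap.mulVec x ≠ 0 := by
    intro x hx0 hx h0
    apply hx0
    rw [hback hx, h0, Matrix.mulVec_zero]
  have hleast : IsLeast (realEigenvalues H) E := by
    refine ⟨⟨_, Λ.virtState_ne_zero h𝒯 hψ, hHψ⟩, ?_⟩
    rintro ν ⟨x, hx0, hx⟩
    rcases hdich hx with hP | ⟨rfl, h0⟩
    · have h1 := hKq (Λ.codeMap.mulVec x)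
      have h2 := mul_nonneg hc.le (hcan0 (Λ.codeMap.mulVec x))
      rw [qform_of_eigen (hcode hx)] at h1
      exact le_of_mul_le_mul_right (by linarith) (nsq_pos (hne hx0 hP))
    · linarith
  have hgs : ∀ {x}, IsGroundState H x → IsGroundState (Λ.canonicalHamiltonian ℛ)
      (Λ.codeMap.mulVec x) ∧ Λ.P₀.mulVec x = x := by
    intro x hx
    rw [isGroundState_iff hleast] at hx
    have hP : Λ.P₀.mulVec x = x := by
      rcases hdich hx.2 with hP | ⟨h0, h1⟩
      · exact hP
      · linarith
    refine ⟨hℛ.groundState_of_energy_le h𝒯 hψ hq (hne hx.1 hP) ?_, hP⟩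
    have h1 := hKq (Λ.codeMap.mulVec x)
    rw [qform_of_eigen (hcode hx.2), sub_self] at h1
    exact nonpos_of_mul_nonpos_right h1 hc
  refine ⟨hHherm, (isGroundState_iff hleast).2 ⟨Λ.virtState_ne_zero h𝒯 hψ, hHψ⟩, fun x => ⟨?_, ?_⟩,
    ⟨Λ.regionTerm r X, fun R => ⟨?_, ?_⟩, fun R hR => regionTerm_ne_zero hR, ?_, ?_⟩,
    E, hleast, ?_⟩
  · exact fun hx => ⟨_, (hgs hx).1, hback (hgs hx).2⟩
  · rintro ⟨φ, hφ, rfl⟩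
    refine (isGroundState_iff hleast).2 ⟨fun h0 => hφ.1 ?_, hHgs φ hφ⟩
    rw [← codeMap_mulVec_codeMap_conjTranspose h𝒯 φ, h0, Matrix.mulVec_zero]
  · exact SchriefferWolff.isHermitian_sum _ fun F hF => hYherm F (Finset.mem_filter.1 hF).1
  · refine (ActsOn.sum _ fun F hF => ?_).supportedOn
    obtain ⟨hFr, rfl⟩ := Finset.mem_filter.1 hF
    exact actsOn_codeMap_mul Λ h𝒯 (hact F hFr)
  · rw [sum_regionTerm, hHK]
  · intro x hx R
    have hφ := (hgs hx).1
    have heig : (Λ.regionTerm r X R).mulVec (Λ.codeMap.mulVec x) =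
        ((∑ F ∈ (Λ.clusters r).filter (fun F => Λ.sitesOf F = R), Λ.mean (X F) : ℝ) : ℂ) •
          Λ.codeMap.mulVec x := by
      rw [regionTerm, Matrix.sum_mulVec, Complex.ofReal_sum, Finset.sum_smul]
      exact Finset.sum_congr rfl fun F hF => hYgs _ hφ F (Finset.mem_filter.1 hF).1
    refine ⟨hφ.1, _, isLeast_of_eigen (fun φ => ?_) hφ.1 heig, heig⟩
    rw [regionTerm, qform_sum, Finset.sum_mul]
    exact Finset.sum_le_sum fun F hF => hYq F (Finset.mem_filter.1 hF).1 φ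
  · rintro ν ⟨x, hx0, hx⟩ hν
    rcases hdich hx with hP | ⟨rfl, h0⟩
    · obtain ⟨E', hE', hgap⟩ := hℛ.gap
      have hcan := hℛ.isLeast h𝒯 hψ hq
      rw [← hcan.unique hE'] at hgap
      -- All canonical ground states are eigenvectors of `K` for the eigenvalue `E`, so an
      -- eigenvector with another eigenvalue is orthogonal to them and has canonical energy above
      -- the gap.
      have h1 := le_qform_of_orthogonal (hℛ.isHermitian h𝒯 hψ hq) hgap
        (φ := Λ.codeMap.mulVec x) fun g hg => by
          by_cases hg0 : g = 0
          · simp [hg0]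
          · exact orthogonal_of_eigen hKherm hν.symm
              (hKgs g ((isGroundState_iff hcan).2 ⟨hg0, hg⟩)) (hcode hx)
      have h2 := hKq (Λ.codeMap.mulVec x)
      rw [qform_of_eigen (hcode hx)] at h2
      have hpos := nsq_pos (hne hx0 hP)
      have h3 : c * (γ * nsq (Λ.codeMap.mulVec x)) ≤
          c * (qform (Λ.canonicalHamiltonian ℛ) (Λ.codeMap.mulVec x) +
            ℛ.card * nsq (Λ.codeMap.mulVec x)) := mul_le_mul_of_nonneg_left (by linarith) hc.le
      have h4 := mul_le_mul_of_nonneg_right hΔ hpos.le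
      exact le_of_mul_le_mul_right (by linarith) hpos
    · exact h0

end PEPS

theorem theoremt (𝒯 : SiteTensors) (h𝒯 : 𝒯.IsIsometric) (r : ℕ) (hr : 1 ≤ r) (γ : ℝ) (hγ : 0 < γ) :
    ∃ (nstar ℓ : ℕ) (c ε₀ : ℝ), 0 < c ∧ 0 < ε₀ ∧
      ∀ Λ : PEPS 𝒯, Λ.codeState ≠ 0 → Λ.IsQuasiInjective →
      ∀ ℛ : Finset (Finset Λ.S), Λ.IsGappedCanonical ℛ r γ →
      ∀ ε : ℝ, 0 < ε → ε < ε₀ →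
        (Λ.Heff ε nstar).IsHermitian ∧
        IsGroundState (Λ.Heff ε nstar) Λ.virtState ∧
        (∀ x, IsGroundState (Λ.Heff ε nstar) x ↔
          ∃ φ, IsGroundState (Λ.canonicalHamiltonian ℛ) φ ∧
            x = Λ.codeMap.conjTranspose.mulVec φ) ∧
        Λ.IsLocalFrustrationFree (Λ.Heff ε nstar) ℓ ∧
        HasGap (Λ.Heff ε nstar) (c * ε ^ nstar) := by
  obtain ⟨C, ε₁, hC, hε₁, hε₁1, hff⟩ := PEPS.exists_frustrationFree h𝒯 r
  obtain ⟨μ, hμ, hmean⟩ := PEPS.exists_pos_le_mean_bondProj h𝒯 r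
  have hA := PEPS.monoConst_pos r
  set A := PEPS.monoConst r with hAdef
  set K : ℝ := ((𝒯.clusterBound r : ℕ) : ℝ) with hK
  have hK0 : 0 ≤ K := Nat.cast_nonneg _
  have hCK : 0 ≤ C * K := mul_nonneg hC hK0
  -- For the gap, the 2 accounts for the half of the leading defect lost in the redistribution. For
  -- the ground energy, it leaves half of the binding energy per edge to absorb the ε² remainder.
  set a : ℝ := μ / (2 * A) with ha
  have ha0 : 0 < a := by positivity
  have haA : A * (2 * a) = μ := by rw [ha]; field_simp
  -- Order r suffices because a product of at most r bond projections occurs at an order not above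
  -- r. The minimum with 1 makes the gap bound also hold towards the eigenvalue 0 off the code
  -- space; the second bound on ε keeps the O(ε²) remainder below the binding energy.
  refine ⟨r, r + 1, a * min 1 γ, min ε₁ (a / (C * K + 1)), mul_pos ha0 (lt_min one_pos hγ),
    lt_min hε₁ (by positivity), fun Λ hψ hq ℛ hℛ ε hε hεlt => ?_⟩
  have hε₂ : ε ≤ ε₁ := hεlt.le.trans (min_le_left _ _)
  have hε1 : ε ≤ 1 := hε₂.trans hε₁1
  have hεa : ε * (C * K + 1) ≤ a :=
    (le_div_iff₀ (by positivity)).1 (hεlt.le.trans (min_le_right _ _))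
  have hεr : 0 < ε ^ r := pow_pos hε r
  have hεrle : ε ^ r ≤ ε := by simpa using pow_le_pow_of_le_one hε.le hε1 hr
  obtain ⟨hm, X, hX, hXF⟩ := hff Λ hψ hq ε hε hε₂
  refine PEPS.parent_of_local_terms h𝒯 hψ hq hℛ hX (fun F hF => (hXF F hF).1)
    (fun F hF => (hXF F hF).2.1) (fun F hF => (hXF F hF).2.2.1) (fun F hF φ hφ => ?_)
    (c := a * ε ^ r) (mul_pos ha0 hεr) ?_ (mul_pos (mul_pos ha0 (lt_min one_pos hγ)) hεr)
    (fun φ => ?_) fun hne => ?_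
  · have h1 := (hXF F hF).2.2.2 φ hφ
    have h2 := (PEPS.isPos_leadSum r hε.le F).defect_nonneg h𝒯 hψ hq hφ
    linarith
  · rw [mul_right_comm]
    exact mul_le_mul_of_nonneg_left (min_le_right _ _) (mul_pos ha0 hεr).le
  · have h1 := hℛ.energy_le h𝒯 hψ hq hε hε1 (hmean Λ hψ hq) φ
    have h2 := Finset.sum_le_sum fun F hF => (hXF F hF).2.2.2 _
      (PEPS.P₀_mulVec_codeMap_conjTranspose h𝒯 φ)
    rw [← Finset.mul_sum] at h2
    generalize ∑ F ∈ Λ.clusters r,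
      Λ.defect (X F) (Λ.codeMap.conjTranspose.mulVec φ) = x at h2 ⊢
    have h3 := h1.trans (mul_le_mul_of_nonneg_left h2 hA.le)
    rw [← haA] at h3
    refine le_of_mul_le_mul_left ?_ (mul_pos hA two_pos)
    linarith
  -- With N ≥ 1 edges, the leading parts lower the energy of the PEPS by at least 2aεN, while the
  -- remainders, one per cluster and at most K clusters per edge, raise it by at most aεN. So it
  -- lies below zero by at least aε.
  · have h1 := PEPS.sum_mean_leadSum_ge h𝒯 hψ hq hr hε fun e =>
      hmean Λ hψ hq {e} (by simpa using hr)
    have h2 : ((Λ.clusters r).card : ℝ) ≤ Fintype.card Λ.E * K := by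
      rw [hK]
      exact_mod_cast PEPS.card_clusters_le_mul (Λ := Λ) r
    have hn : (1 : ℝ) ≤ Fintype.card Λ.E := by exact_mod_cast Fintype.card_pos
    generalize ((Fintype.card Λ.E : ℕ) : ℝ) = N at h1 h2 hn
    generalize ∑ F ∈ Λ.clusters r, Λ.mean (Λ.leadSum r ε F) = s at h1 hm
    generalize ((Λ.clusters r).card : ℝ) = k at h2 hm
    rw [← haA] at h1
    have h3 : N * (ε * (2 * a)) ≤ s := by
      refine le_of_mul_le_mul_left ?_ hA
      linarith
    have h4 : C * ε ^ 2 * k ≤ N * ε * (ε * (C * K)) := by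
      have := mul_le_mul_of_nonneg_left h2 (by positivity : 0 ≤ C * ε ^ 2)
      linarith
    have h5 : N * ε * (ε * (C * K)) ≤ N * ε * a :=
      mul_le_mul_of_nonneg_left (by linarith) (by positivity)
    have h6 : a * min 1 γ * ε ^ r ≤ N * ε * a :=
      calc a * min 1 γ * ε ^ r ≤ a * 1 * ε :=
            mul_le_mul (mul_le_mul_of_nonneg_left (min_le_left _ _) ha0.le) hεrle hεr.le
              (by positivity)
        _ = 1 * (ε * a) := by ring
        _ ≤ N * (ε * a) := mul_le_mul_of_nonneg_right hn (by positivity)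
        _ = N * ε * a := by ring
    linarith
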